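/- **Scattering diagram of $(\mathbb P^2,E)$.** Let $E\subset\mathbb P^2$ be a smooth cubic. Let $\Delta_\infty\subset\mathbb R^2$ be the unbounded convex polygon with vertices $v_n=(n,-\tfrac{3n(n-1)}{2})$, $n\in\mathbb Z$, and edges $e_n=[v_n,v_{n+1}]$ (the unfolding of the spanning polytope of $\mathbb P^2$), and on each $e_n$ choose an interior point $p_n=v_n+\tau_n(v_{n+1}-v_n)$, $0<\tau_n<1$, with $\tau_{n+3}=\tau_n$. The initial diagram $\mathscr S_0$ has for each $n$ the two rays $p_n+\mathbb R_{\ge0}m$, $m=\pm(1,-3n)$, with functions $1+tz^{m}$. Given $\mathscr S_k$, consistent to order $k$, the diagram $\mathscr S_{k+1}$ is obtained as follows: at each point $p\notin\{p_n\}$ localize at $p$, and form the path-ordered product $\theta$ around $p$ (counterclockwise) of the automorphisms $z^q\mapsto f_{\mathfrak d}^{\langle n_{\mathfrak d},q\rangle}z^q$, with $n_{\mathfrak d}$ the primitive normal positive on the loop; if $\theta(z^q)= z^q\bigl(1-\sum_i a_i\langle n_i,q\rangle t^{k+1}z^{m_i}\bigr)$ modulo $t^{k+2}$ (with $n_i$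 the primitive normal to $m_i$ positive on the loop), add the rays $p+\mathbb R_{\ge0}m_i$ with functions $1+a_it^{k+1}z^{m_i}$. Let $\mathscr S_\infty=\bigcup_k\mathscr S_k$, let $m_{\mathfrak d}$ be the primitive direction of a ray $\mathfrak d$, and let $$f_{\rm out}=\prod_{\mathfrak d:\,m_{\mathfrak d}=(0,1)}f_{\mathfrak d}|_{t=1}\in\mathbb C[\![y]\!],\qquad y=z^{(0,1)},$$ the product over the upward rays of $\mathscr S_\infty$ with base in a fundamental domain $[x_0,x_0+3)\times\mathbb R$ ($x_0\in\mathbb R$ arbitrary). **Tropical curves.** Let $B$ be the tropicalization of $(\mathbb P^2,E)$: the integral affine manifold with three singularities obtained by gluing the triangle $\Delta=\mathrm{Conv}\{(0,1),(1,0),(-1,-1)\}$ along its edges to the quotient of the closed region above $\Delta_\infty$ by the deck transformation $(x,y)\mapsto(x+3,y-9x-9)$, with the affine structure near the vertices given by the unfolding; the singularities are the images of the $p_n$. A tropical curve $h:\Gamma\to B$ here is an isomorphism class of balanced, integral affine maps from a weighted tree with at least one vertex and all vertices of valency $\ge3$, with exactly one unbounded leg, all other legs ending in affine singularities (and lying,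 near them, on the edge of $\Delta$ containing the singularity). Its multiplicity is $$\mathrm{Mult}(h)=\frac1{|\mathrm{Aut}(h)|}\prod_V m_V\prod_L\frac{(-1)^{w_L+1}}{w_L^2},$$ the second product over the bounded legs, with weights $w_L$. Here $m_V$ is the number of trivalent deformations of $h$ near $V$, for a generic parallel displacement of the edges at $V$ other than the one leading to the unbounded leg, each counted with the product of $|\det(u_1|u_2)|$ over its vertices, where $u_1,u_2$ are two weighted edge vectors at the vertex; so $m_V=|\det(u_1|u_2)|$ for trivalent $V$. Let $\mathcal H_d$ be the set of those $h$ whose unbounded leg goes off in the unbounded direction of $B$ (the image of $(0,1)$) and has weight $3d$. **Claim.** In each $y$-degree only finitely many rays contribute to $f_{\rm out}$, and each $\mathcal H_d$ contains only finitely many $h$ with $\mathrm{Mult}(h)\ne0$. With $t$ recording the order in $y$ (that is, with $y$ replaced by $ty$ in $f_{\rm out}$), $$\log f_{\rm out}=\sum_{d=1}^\infty\sum_{h\in\mathcal H_d}3d\cdot\mathrm{Mult}(h)\cdot t^{3d}y^{3d},$$ and hence also $\log f_{\rm out}=\sum_d\sum_{h\in\mathcal H_d}3d\,\mathrm{Mult}(h)\,y^{3d}$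 at $t=1$. More precisely, the rays correspond to tropical curves: for every point $p\notin\{p_n\}$ and every primitive $m\in\mathbb Z^2$, $$\log\prod_{\mathfrak d:\,b_{\mathfrak d}=p,\,m_{\mathfrak d}=m}f_{\mathfrak d}|_{t=1}=\sum_{w\ge1}\ \sum_{h}w\cdot\mathrm{Mult}(h)\cdot z^{wm},$$ where $b_{\mathfrak d}$ is the base of $\mathfrak d$ and the inner sum is over the tropical curves $h$ as above whose unbounded leg has weight $w$ and is the image in $B$ of the ray from $p$ in the direction $m$; again only finitely many rays and finitely many $h$ with $\mathrm{Mult}(h)\neq0$ contribute to each power of $z^m$. -/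

import Mathlib

open scoped Topology

namespace Scat

noncomputable section

/-! ## Plane vectors -/

/-- The determinant of two plane vectors. -/
def det2 {R : Type} [CommRing R] (u v : R × R) : R := u.1 * v.2 - u.2 * v.1

/-- An integral vector seen in the real plane. -/
def vecR (v : ℤ × ℤ) : ℝ × ℝ := ((v.1 : ℝ), (v.2 : ℝ))

/-- Primitive integral vectors. -/
def IsPrim (m : ℤ × ℤ) : Prop := Int.gcd m.1 m.2 = 1

/-! ## The unfolding of the spanning polytope of the projective plane

Its vertices are `vtx n` for integers `n`, with `vtx 0 = (0, 0)` and `vtx 1 = (1, 0)`. The edge from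
`vtx n` to `vtx (n + 1)` has primitive direction `(1, -3 n)`, hence affine length one, and the
two primitive edge directions `(1, -3 n)` and `(-1, 3 (n - 1))` at `vtx n` have determinant of
absolute value three, so that every kink is three. -/

/-- The vertices of the unfolding. -/
def vtx (n : ℤ) : ℝ × ℝ := ((n : ℝ), -(3 * (n : ℝ) * (n - 1) / 2))

/-- The line spanned by the edge from `vtx n` to `vtx (n + 1)`, as a function of the abscissa. -/
def edgeLine (n : ℤ) (x : ℝ) : ℝ := 3 * (n : ℝ) * (n + 1) / 2 - 3 * n * x

/-- The unfolding: the unbounded convex polygon below all the lines `edgeLine n`. -/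
def unfolding : Set (ℝ × ℝ) := {q | ∀ n : ℤ, q.2 ≤ edgeLine n q.1}

/-- The closed region on and above the boundary of the unfolding. -/
def outer : Set (ℝ × ℝ) := closure (unfoldingᶜ)

/-- The chosen interior point of the edge from `vtx n` to `vtx (n + 1)`. -/
def singPt (τ : ZMod 3 → ℝ) (n : ℤ) : ℝ × ℝ :=
  ((n : ℝ) + τ (n : ZMod 3), edgeLine n ((n : ℝ) + τ (n : ZMod 3)))

/-- The set of all the chosen points. -/
def singSet (τ : ZMod 3 → ℝ) : Set (ℝ × ℝ) := Set.range (singPt τ)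

/-! ## Scattering diagrams -/

/-- Laurent polynomials in two variables: `single m c` is `c z^m`. -/
abbrev Laurent : Type := AddMonoidAlgebra ℂ (ℤ × ℤ)

/-- A ray `base + ℝ≥0 dir` with the function `1 + coeff * t ^ ord * z ^ (wt • dir)`. -/
@[ext]
structure Ray where
  base : ℝ × ℝ
  dir : ℤ × ℤ
  wt : ℕ
  ord : ℕ
  coeff : ℂ

/-- The exponent of `z` in the function of a ray. -/
def Ray.expo (d : Ray) : ℤ × ℤ := (d.wt : ℤ) • d.dir

/-- The function of a ray, as a power series in `t` over the Laurent polynomials. -/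
def Ray.fn (d : Ray) : PowerSeries Laurent :=
  1 + PowerSeries.monomial d.ord (AddMonoidAlgebra.single d.expo d.coeff)

/-- The points on a ray. -/
def Ray.support (d : Ray) : Set (ℝ × ℝ) :=
  {p | ∃ s : ℝ, 0 ≤ s ∧ p = d.base + s • vecR d.dir}

/-- Integral powers of a power series with constant term one. -/
def intPow (f : PowerSeries Laurent) (n : ℤ) : PowerSeries Laurent :=
  if 0 ≤ n then f ^ n.toNat else (PowerSeries.invOfUnit f 1) ^ (-n).toNat

/-- The localization of a diagram at `p`: a ray through `p` gives the half-ray from `p` in its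
direction, marked `1`, and, unless `p` is its base, also the opposite one, marked `-1`; both keep
the function of the ray. -/
def halfRays (S : Set Ray) (p : ℝ × ℝ) : Set (Ray × ℤˣ) :=
  {x | x.1 ∈ S ∧ p ∈ x.1.support ∧ (x.2 = 1 ∨ (x.2 = -1 ∧ p ≠ x.1.base))}

/-- The direction of a half-ray, pointing away from the point at which we localize. -/
def halfDir (x : Ray × ℤˣ) : ℤ × ℤ := (x.2 : ℤ) • x.1.dir

/-- The wall-crossing automorphism `z ^ q ↦ f ^ ⟨n, q⟩ z ^ q`, linear over the power series
in `t`, for a half-ray crossed counterclockwise. The primitive normal covector that is positive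
on the tangent vector of a counterclockwise loop is `⟨n, q⟩ = det (direction, q)`. -/
def wallCross (x : Ray × ℤˣ) (g : PowerSeries Laurent) : PowerSeries Laurent :=
  PowerSeries.mk fun N => ∑ ij ∈ Finset.HasAntidiagonal.antidiagonal N,
    (PowerSeries.coeff ij.1 g).coeff.sum fun q c =>
      PowerSeries.coeff ij.2 (intPow x.1.fn (det2 (halfDir x) q)) * AddMonoidAlgebra.single q c

/-- The angle in `(-π, π]` of a direction. -/
def angle (m : ℤ × ℤ) : ℝ := Complex.arg ((m.1 : ℂ) + (m.2 : ℂ) * Complex.I)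

/-- The list `l` enumerates the half-rays at `p` in the order in which a counterclockwise simple
loop around `p` crosses them. -/
def IsLoopOrder (S : Set Ray) (p : ℝ × ℝ) (l : List (Ray × ℤˣ)) : Prop :=
  l.Nodup ∧ (∀ x, x ∈ l ↔ x ∈ halfRays S p) ∧
    l.Pairwise fun x y => angle (halfDir x) ≤ angle (halfDir y)

/-- The path-ordered product `θ_r ∘ ⋯ ∘ θ_1` of the wall-crossing automorphisms of a list. -/
def loopAut (l : List (Ray × ℤˣ)) (g : PowerSeries Laurent) : PowerSeries Laurent :=
  l.foldl (fun h x => wallCross x h) g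

/-- One step of the scattering algorithm, away from the points of `P`: if the path-ordered product
at `p` sends `z ^ q` to `z ^ q (1 - ∑ a ⟨n_v, q⟩ t ^ (k + 1) z ^ v)` modulo `t ^ (k + 2)`, then for
every term `a t ^ (k + 1) z ^ v` a ray with base `p` and function `1 + a t ^ (k + 1) z ^ v` is
added, in the direction of `v`. -/
def scatterStep (P : Set (ℝ × ℝ)) (k : ℕ) (S : Set Ray) : Set Ray :=
  S ∪ {d | d.base ∉ P ∧ IsPrim d.dir ∧ 0 < d.wt ∧ d.ord = k + 1 ∧ d.coeff ≠ 0 ∧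
    ∃ l, IsLoopOrder S d.base l ∧ ∀ q : ℤ × ℤ,
      (PowerSeries.coeff (k + 1)
        (loopAut l (PowerSeries.monomial 0 (AddMonoidAlgebra.single q 1)))).coeff (q + d.expo)
      = -((det2 d.dir q : ℤ) : ℂ) * d.coeff}

/-- The initial diagram: for each edge of the unfolding the two rays from the chosen interior point
along the edge, with functions `1 + t z ^ m` for the two primitive directions `m`. -/
def initialDiagram (τ : ZMod 3 → ℝ) : Set Ray :=
  {d | ∃ n : ℤ, d.base = singPt τ n ∧ (d.dir = (1, -3 * n) ∨ d.dir = (-1, 3 * n)) ∧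
    d.wt = 1 ∧ d.ord = 1 ∧ d.coeff = 1}

/-- The diagram consistent to order `k` that the scattering algorithm produces. -/
def diagram (τ : ZMod 3 → ℝ) : ℕ → Set Ray
  | 0 => initialDiagram τ
  | k + 1 => scatterStep (singSet τ) k (diagram τ k)

/-- The limit of the scattering algorithm. -/
def diagramInfty (τ : ZMod 3 → ℝ) : Set Ray := ⋃ k, diagram τ k

/-- The product over the rays of `S` of their functions at `t = 1`, for rays of one common direction
`m`, in the variable `y = z ^ m`. The coefficient of `y ^ n` only involves rays of weight at
most `n`. -/
def rayProd (S : Set Ray) : PowerSeries ℂ :=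
  PowerSeries.mk fun n => PowerSeries.coeff n
    (∏ᶠ d ∈ {d | d ∈ S ∧ d.wt ≤ n}, (1 + PowerSeries.C d.coeff * PowerSeries.X ^ d.wt))

/-- The rays going upwards whose base lies in the fundamental domain `[x₀, x₀ + 3) × ℝ`. -/
def upwardRays (τ : ZMod 3 → ℝ) (x₀ : ℝ) : Set Ray :=
  {d | d ∈ diagramInfty τ ∧ d.dir = (0, 1) ∧ d.base.1 ∈ Set.Ico x₀ (x₀ + 3)}

/-- The rays with given base and direction. -/
def raysAt (τ : ZMod 3 → ℝ) (p : ℝ × ℝ) (m : ℤ × ℤ) : Set Ray :=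
  {d | d ∈ diagramInfty τ ∧ d.base = p ∧ d.dir = m}

/-- The function `f_out` at `t = 1`, in the variable `y = z ^ (0, 1)`. -/
def fOut (τ : ZMod 3 → ℝ) (x₀ : ℝ) : PowerSeries ℂ := rayProd (upwardRays τ x₀)

/-! ## The tropicalization of the plane with a smooth cubic -/

/-- The vertices `(0, 1), (1, 0), (-1, -1)` of the spanning polytope of the projective plane. -/
def triVtx (i : ZMod 3) : ℝ × ℝ :=
  if i = 0 then (0, 1) else if i = 1 then (1, 0) else (-1, -1)

/-- The generator of the deck transformations of the unfolding: the shear mapping `vtx n` to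
`vtx (n + 3)`. -/
def deck (q : ℝ × ℝ) : ℝ × ℝ := (q.1 + 3, q.2 - 9 * q.1 - 9)

/-- Barycentric coordinates of the point at parameter `r` of the edge from the vertex `i` to the
vertex `i + 1` of the triangle. -/
def edgeBary (i : ZMod 3) (r : ℝ) : ZMod 3 → ℝ := Pi.single i (1 - r) + Pi.single (i + 1) r

/-- The gluing of the unbounded cells, which form the quotient of `outer` by the deck
transformations, with the bounded cell, the triangle in barycentric coordinates, along their
edges. -/
inductive Glue : outer ⊕ stdSimplex ℝ (ZMod 3) → outer ⊕ stdSimplex ℝ (ZMod 3) → Prop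
  | shift (q r : outer) (h : r.1 = deck q.1) : Glue (Sum.inl q) (Sum.inl r)
  | edge (n : ℤ) (s : ℝ) (hs : s ∈ Set.Icc (0 : ℝ) 1) (q : outer) (l : stdSimplex ℝ (ZMod 3))
      (hq : q.1 = (1 - s) • vtx n + s • vtx (n + 1)) (hl : l.1 = edgeBary (n : ZMod 3) s) :
      Glue (Sum.inl q) (Sum.inr l)

/-- The points of the affine manifold with singularities `B`. -/
def B : Type := Quot Glue

/-- The projection from the region above the unfolding to `B`. -/
def ofOuter (q : outer) : B := Quot.mk _ (Sum.inl q)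

/-- The inclusion of the bounded cell in `B`. -/
def ofTri (l : stdSimplex ℝ (ZMod 3)) : B := Quot.mk _ (Sum.inr l)

/-- The integral affine parametrization of the interiors of the unbounded cells and of the unbounded
edges. Charts are given as sets of pairs of a point of the plane and the corresponding
point of `B`. -/
def outerChart : Set ((ℝ × ℝ) × B) :=
  {x | ∃ h : x.1 ∈ outer, x.1 ∈ interior outer ∧ x.2 = ofOuter ⟨x.1, h⟩}

/-- The integral affine parametrization of the interior of the bounded cell. -/
def triChart : Set ((ℝ × ℝ) × B) :=
  {x | ∃ l : stdSimplex ℝ (ZMod 3), (∀ i, 0 < l.1 i) ∧ x.1 = ∑ i, l.1 i • triVtx i ∧ x.2 = ofTri l}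

/-- The integral affine parametrization of a neighbourhood of the `n`-th vertex. It contains the
adjacent edges up to the affine singularities, and extends the unfolding to the bounded cell by the
affine map that sends the vertices of the triangle to `vtx (n - 1)`, `vtx n`, `vtx (n + 1)`. -/
def starChart (τ : ZMod 3 → ℝ) (n : ℤ) : Set ((ℝ × ℝ) × B) :=
  {x | (∃ h : x.1 ∈ outer, (singPt τ (n - 1)).1 < x.1.1 ∧ x.1.1 < (singPt τ n).1 ∧
        x.2 = ofOuter ⟨x.1, h⟩) ∨
      ∃ l : stdSimplex ℝ (ZMod 3), (∀ i, 0 < l.1 i) ∧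
        x.1 = l.1 ((n - 1 : ℤ) : ZMod 3) • vtx (n - 1) + l.1 ((n : ℤ) : ZMod 3) • vtx n
          + l.1 ((n + 1 : ℤ) : ZMod 3) • vtx (n + 1) ∧
        x.2 = ofTri l}

/-- The integral affine atlas of `B` away from the affine singularities. -/
def charts (τ : ZMod 3 → ℝ) : Set (Set ((ℝ × ℝ) × B)) :=
  {outerChart, triChart} ∪ Set.range (starChart τ)

/-! ## Vertex multiplicities -/

/-- Combinatorial types of trivalent rational tropical curves in the plane with incoming legs
labelled by `ι` and one outgoing leg. -/
inductive CTree (ι : Type) : Type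
  | leaf : ι → CTree ι
  | node : CTree ι → CTree ι → CTree ι

variable {ι : Type}

/-- The labels of the incoming legs. -/
def CTree.leaves : CTree ι → List ι
  | .leaf i => [i]
  | .node l r => l.leaves ++ r.leaves

/-- The weighted direction of the outgoing edge, by balancing, when the incoming legs
have weighted directions `u`. -/
def CTree.vec (u : ι → ℤ × ℤ) : CTree ι → ℤ × ℤ
  | .leaf i => u i
  | .node l r => l.vec u + r.vec u

/-- The product of the multiplicities `|det|` of the trivalent vertices. -/
def CTree.mult (u : ι → ℤ × ℤ) : CTree ι → ℕ
  | .leaf _ => 1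
  | .node l r => l.mult u * r.mult u * (det2 (l.vec u) (r.vec u)).natAbs

/-- The tree is realized by a tropical curve whose incoming leg `i` lies on the line
`det (u i, ·) = c i` and whose outgoing edge contains `P` in its interior. The two incoming edges of
a vertex are listed so that their determinant is positive, so every curve is counted once. -/
def CTree.Through (u : ι → ℤ × ℤ) (c : ι → ℝ) : CTree ι → ℝ × ℝ → Prop
  | .leaf i, P => det2 (vecR (u i)) P = c i
  | .node l r, P => 0 < det2 (l.vec u) (r.vec u) ∧ ∃ (Q : ℝ × ℝ) (s : ℝ),
      l.Through u c Q ∧ r.Through u c Q ∧ 0 < s ∧ P = Q + s • vecR (l.vec u + r.vec u)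

/-- The number, counted with multiplicity, of trivalent rational tropical curves in the plane
whose incoming legs are labelled by `I`, have weighted directions `u` and lie on the lines
`det (u i, ·) = c i`. -/
def curveCount (I : Finset ι) (u : ι → ℤ × ℤ) (c : ι → ℝ) : ℕ :=
  ∑ᶠ T ∈ {T : CTree ι | T.leaves.Nodup ∧ (∀ i, i ∈ T.leaves ↔ i ∈ I) ∧ ∃ P, T.Through u c P},
    T.mult u

/-- The displacement `c` of the incoming legs is generic: no three edges carrying disjoint sets of
incoming legs, two of which are transversal, can ever meet in one point. -/
def GenericDispl (I : Finset ι) (u : ι → ℤ × ℤ) (c : ι → ℝ) : Prop :=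
  ∀ J K L : Finset ι, J ⊆ I → K ⊆ I → L ⊆ I → J.Nonempty → K.Nonempty → L.Nonempty →
    Disjoint J K → Disjoint J L → Disjoint K L → det2 (∑ i ∈ J, u i) (∑ i ∈ K, u i) ≠ 0 →
    ∀ P : ℝ × ℝ, det2 (vecR (∑ i ∈ J, u i)) P = ∑ i ∈ J, c i →
      det2 (vecR (∑ i ∈ K, u i)) P = ∑ i ∈ K, c i →
      det2 (vecR (∑ i ∈ L, u i)) P ≠ ∑ i ∈ L, c i

/-! ## Tropical curves -/

/-- The data of a rational tropical curve with one unbounded leg. All edges are oriented towards the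
unbounded leg. The tail of an edge is `none` when the edge is a bounded leg, and its head is `none`
when it is the unbounded leg. An edge is mapped to `B` by its parametrization
`path`, on the interval `dom`. -/
structure CurveData where
  nV : ℕ
  nE : ℕ
  tail : Fin nE → Option (Fin nV)
  head : Fin nE → Option (Fin nV)
  wt : Fin nE → ℕ
  len : Fin nE → ℝ
  path : Fin nE → ℝ → B

namespace CurveData

variable (C : CurveData)

/-- The parameter interval of an edge. -/
def dom (e : Fin C.nE) : Set ℝ := if C.head e = none then Set.Ici 0 else Set.Icc 0 (C.len e)

/-- The edges coming into a vertex. -/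
def inE (v : Fin C.nV) : Finset (Fin C.nE) := Finset.univ.filter fun e => C.head e = some v

/-- The edges going out of a vertex. -/
def outE (v : Fin C.nV) : Finset (Fin C.nE) := Finset.univ.filter fun e => C.tail e = some v

/-- In the chart `κ`, the vertex `v` is mapped to the point `q`, the edges at `v` are affine with the
primitive integral velocities `vel`, in the direction of the unbounded leg, and the balancing
condition holds. -/
def IsFrame (τ : ZMod 3 → ℝ) (v : Fin C.nV) (κ : Set ((ℝ × ℝ) × B)) (q : ℝ × ℝ)
    (vel : Fin C.nE → ℤ × ℤ) : Prop :=
  κ ∈ charts τ ∧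
  (∀ e ∈ C.outE v, IsPrim (vel e) ∧
    ∀ᶠ s in 𝓝[≥] (0 : ℝ), (q + s • vecR (vel e), C.path e s) ∈ κ) ∧
  (∀ e ∈ C.inE v, IsPrim (vel e) ∧
    ∀ᶠ s in 𝓝[≤] (C.len e), (q + (s - C.len e) • vecR (vel e), C.path e s) ∈ κ) ∧
  ∑ e ∈ C.inE v, (C.wt e : ℤ) • vel e = ∑ e ∈ C.outE v, (C.wt e : ℤ) • vel e

/-- The multiplicity of a vertex: the number, counted with multiplicity, of trivalent deformations
of the curve near the vertex for a generic displacement of the incoming edges. (It does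
not depend on the displacement or on the chart, so that the set has one element. At a trivalent
vertex it is the absolute value of the determinant of the two incoming vectors.) -/
def vertexMult (τ : ZMod 3 → ℝ) (v : Fin C.nV) : ℕ :=
  sInf {N | ∃ κ q vel, C.IsFrame τ v κ q vel ∧ ∃ c : Fin C.nE → ℝ,
    GenericDispl (C.inE v) (fun e => (C.wt e : ℤ) • vel e) c ∧
    N = curveCount (C.inE v) (fun e => (C.wt e : ℤ) • vel e) c}

/-- The automorphisms of the curve: automorphisms of the weighted graph that commute with the map
to `B`. -/
def autSet : Set (Equiv.Perm (Fin C.nV) × Equiv.Perm (Fin C.nE)) :=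
  {g | ∀ e, C.tail (g.2 e) = (C.tail e).map g.1 ∧ C.head (g.2 e) = (C.head e).map g.1 ∧
    C.wt (g.2 e) = C.wt e ∧ C.dom (g.2 e) = C.dom e ∧ Set.EqOn (C.path (g.2 e)) (C.path e) (C.dom e)}

/-- The multiplicity of a tropical curve. -/
def mult (τ : ZMod 3 → ℝ) : ℚ :=
  1 / (Nat.card C.autSet : ℚ) * (∏ v, (C.vertexMult τ v : ℚ)) *
    ∏ e ∈ Finset.univ.filter (fun e => C.tail e = none), (-1) ^ (C.wt e + 1) / (C.wt e : ℚ) ^ 2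

end CurveData

/-- A tropical curve in `B`, of genus zero and with one unbounded leg, all of whose other legs end
in affine singularities. -/
structure TropicalCurve (τ : ZMod 3 → ℝ) extends CurveData where
  nV_pos : 0 < nV
  wt_pos : ∀ e, 0 < wt e
  len_pos : ∀ e, 0 < len e
  /-- There is one unbounded leg. -/
  root : ∃! e, head e = none
  /-- Exactly one edge at each vertex leads towards the unbounded leg. -/
  tail_unique : ∀ v, ∃! e, tail e = some v
  /-- The graph has no oriented cycles; with the previous two fields it is a tree. -/
  acyclic : ∃ rk : Fin nV → ℕ, ∀ e v w, tail e = some v → head e = some w → rk v < rk w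
  /-- All vertices have valency at least three. -/
  valency : ∀ v, 2 ≤ (toCurveData.inE v).card
  /-- Bounded legs start at an affine singularity, along the edge that contains it. -/
  start : ∀ e, tail e = none → ∃ (i : ZMod 3) (ε : ℤˣ), ∀ᶠ s in 𝓝[≥] (0 : ℝ),
    ∃ l : stdSimplex ℝ (ZMod 3), l.1 = edgeBary i (τ i + ((ε : ℤ) : ℝ) * s) ∧ path e s = ofTri l
  /-- Edges are affine in the charts of `B`, with primitive integral velocity. -/
  affine : ∀ e, ∀ s, 0 < s → (head e = none ∨ s < len e) →
    ∃ κ ∈ charts τ, ∃ (q : ℝ × ℝ) (m : ℤ × ℤ), IsPrim m ∧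
      ∀ᶠ r in 𝓝 s, (q + (r - s) • vecR m, path e r) ∈ κ
  /-- The edges at a vertex meet in a regular point and are balanced. -/
  balanced : ∀ v, ∃ κ q vel, toCurveData.IsFrame τ v κ q vel

/-- Isomorphisms of tropical curves. -/
def CurveData.Iso (C D : CurveData) : Prop :=
  ∃ (f : Fin C.nV ≃ Fin D.nV) (g : Fin C.nE ≃ Fin D.nE),
    ∀ e, D.tail (g e) = (C.tail e).map f ∧ D.head (g e) = (C.head e).map f ∧
      D.wt (g e) = C.wt e ∧ D.dom (g e) = C.dom e ∧ Set.EqOn (D.path (g e)) (C.path e) (C.dom e)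

theorem CurveData.Iso.refl (C : CurveData) : C.Iso C :=
  ⟨Equiv.refl _, Equiv.refl _, fun e => by simp [Set.eqOn_refl]⟩

theorem CurveData.Iso.symm {C D : CurveData} (h : C.Iso D) : D.Iso C := by
  obtain ⟨f, g, h⟩ := h
  refine ⟨f.symm, g.symm, fun e => ?_⟩
  obtain ⟨h1, h2, h3, h4, h5⟩ := h (g.symm e)
  simp only [Equiv.apply_symm_apply] at h1 h2 h3 h4 h5
  refine ⟨?_, ?_, h3.symm, h4.symm, ?_⟩
  · simp [h1, Function.comp_def]
  · simp [h2, Function.comp_def]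
  · rw [h4]
    exact h5.symm

theorem CurveData.Iso.trans {C D E : CurveData} (h : C.Iso D) (k : D.Iso E) : C.Iso E := by
  obtain ⟨f, g, h⟩ := h
  obtain ⟨f₂, g₂, k⟩ := k
  refine ⟨f.trans f₂, g.trans g₂, fun e => ?_⟩
  obtain ⟨h1, h2, h3, h4, h5⟩ := h e
  obtain ⟨k1, k2, k3, k4, k5⟩ := k (g e)
  refine ⟨?_, ?_, k3.trans h3, k4.trans h4, ?_⟩
  · simp [k1, h1, Function.comp_def]
  · simp [k2, h2, Function.comp_def]
  · rw [h4] at k5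
    exact k5.trans h5

/-- Isomorphism of tropical curves as an equivalence relation. -/
def curveSetoid (τ : ZMod 3 → ℝ) : Setoid (TropicalCurve τ) where
  r C D := C.toCurveData.Iso D.toCurveData
  iseqv := ⟨fun C => CurveData.Iso.refl C.toCurveData, fun h => h.symm, fun h k => h.trans k⟩

/-- Isomorphism classes of tropical curves. -/
def CurveClass (τ : ZMod 3 → ℝ) : Type := Quotient (curveSetoid τ)

/-- The class of a tropical curve. -/
def TropicalCurve.cls {τ : ZMod 3 → ℝ} (C : TropicalCurve τ) : CurveClass τ :=
  Quotient.mk (curveSetoid τ) C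

/-- The multiplicity of a tropical curve, which only depends on its isomorphism class. -/
def CurveClass.mult {τ : ZMod 3 → ℝ} (c : CurveClass τ) : ℚ := (Quotient.out c).toCurveData.mult τ

/-- The tropical curves of degree `d`: the unbounded leg has weight `3 d` and goes off in
the unbounded direction of `B`. -/
def tropCurves (τ : ZMod 3 → ℝ) (d : ℕ) : Set (CurveClass τ) :=
  {c | ∃ C : TropicalCurve τ, C.cls = c ∧ ∃ e, C.head e = none ∧ C.wt e = 3 * d ∧
    ∃ q : ℝ × ℝ, ∀ᶠ s in Filter.atTop, ∃ h : q + (0, s) ∈ outer, C.path e s = ofOuter ⟨_, h⟩}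

/-- The tropical curves whose unbounded leg has weight `w` and is the image in `B` of the ray from
`p` in the direction `m`. -/
def tropCurvesAt (τ : ZMod 3 → ℝ) (p : ℝ × ℝ) (m : ℤ × ℤ) (w : ℕ) : Set (CurveClass τ) :=
  {c | ∃ C : TropicalCurve τ, C.cls = c ∧ ∃ e, C.head e = none ∧ C.wt e = w ∧
    ∀ᶠ s in 𝓝[≥] (0 : ℝ), ∃ h : p + s • vecR m ∈ outer, C.path e s = ofOuter ⟨_, h⟩}

end

end Scat

open Scat

open scoped Topology

set_option linter.unusedSectionVars false
set_option linter.style.haveILetI false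

namespace Scat

noncomputable section

section

notation "ℤ²" => ℤ × ℤ
notation "ℝ²" => ℝ × ℝ
notation "σ(" u "," K ")" => ∑ i ∈ K, u i

/-- The marked points lie in the interiors of the edges. -/
abbrev Interior (τ : ZMod 3 → ℝ) : Prop := ∀ i, τ i ∈ Set.Ioo (0 : ℝ) 1
open List

section Ordered

variable {α β R : Type}

lemma prod_eq_of_perm_of_pairwise [Monoid R] {r r' : α → α → Prop} (F : α → R) :
    ∀ {l l' : List α}, l.Perm l' → l.Pairwise r → l'.Pairwise r' →
      (∀ x ∈ l, ∀ y ∈ l, r x y → r' y x → Commute (F x) (F y)) →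
      (l.map F).prod = (l'.map F).prod
  | [], l', hp, _, _, _ => by simp [hp.nil_eq.symm]
  | x :: t, l', hp, h, h', hc => by
    obtain ⟨A, B, rfl⟩ := append_of_mem (hp.subset (mem_cons_self))
    have hp' : t.Perm (A ++ B) := perm_cons x |>.1 (hp.trans perm_middle)
    rw [pairwise_cons] at h
    rw [pairwise_append, pairwise_cons] at h'
    have ih := prod_eq_of_perm_of_pairwise (r' := r') F hp' h.2
      (pairwise_append.2 ⟨h'.1, h'.2.1.2, fun a ha b hb => h'.2.2 a ha b (.tail _ hb)⟩)
      (fun a ha b hb => hc a (.tail _ ha) b (.tail _ hb))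
    have hcomm : Commute (F x) (A.map F).prod := by
      refine Commute.list_prod_right _ _ fun y hy => ?_
      obtain ⟨z, hz, rfl⟩ := mem_map.1 hy
      have hzt : z ∈ t := hp'.mem_iff.2 (mem_append_left _ hz)
      exact hc x (.head _) z (.tail _ hzt) (h.1 z hzt)
        (h'.2.2 z hz x (.head _))
    rw [map_cons, prod_cons, ih, map_append, prod_append, map_append,
      prod_append, map_cons, prod_cons, ← mul_assoc, hcomm.eq, mul_assoc]

lemma pairwise_or {r : α → α → Prop} : ∀ {l : List α}, l.Pairwise r → ∀ {x y}, x ∈ l → y ∈ l →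
    x ≠ y → r x y ∨ r y x
  | a :: t, h, x, y, hx, hy, hxy => by
    rw [pairwise_cons] at h
    rcases mem_cons.1 hx with rfl | hx' <;> rcases mem_cons.1 hy with rfl | hy'
    · exact absurd rfl hxy
    · exact .inl (h.1 _ hy')
    · exact .inr (h.1 _ hx')
    · exact pairwise_or h.2 hx' hy' hxy

/-- A list sorted by a key. -/
def sortBy [LinearOrder β] (k : α → β) (l : List α) : List α :=
  l.insertionSort fun a b => k a ≤ k b

lemma sortBy_perm [LinearOrder β] (k : α → β) (l : List α) : (sortBy k l).Perm l :=
  perm_insertionSort _ _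

lemma sortBy_pairwise [LinearOrder β] (k : α → β) (l : List α) :
    (sortBy k l).Pairwise fun a b => k a ≤ k b := by
  have : Std.Total fun a b => k a ≤ k b := ⟨fun a b => le_total _ _⟩
  have : IsTrans α fun a b => k a ≤ k b := ⟨fun a b c h1 h2 => le_trans h1 h2⟩
  exact pairwise_insertionSort _ _

variable [Ring R] (a : α → R)

lemma mul_prod_one_add_of_annihilates (x : R) :
    ∀ l : List α, (∀ y ∈ l, x * a y = 0) → x * (l.map fun y => 1 + a y).prod = x
  | [], _ => by simp
  | y :: t, h => by
    rw [map_cons, prod_cons, ← mul_assoc, mul_add, mul_one, h y mem_cons_self,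
      add_zero]
    exact mul_prod_one_add_of_annihilates x t fun z hz => h z (.tail _ hz)

lemma mul_prod_one_add_eq (x : R) :
    ∀ l : List α, (∀ y ∈ l, ∀ z ∈ l, (x * a y - a y * x) * a z = 0) →
      (∀ y ∈ l, ∀ z ∈ l, a z * (x * a y - a y * x) = 0) →
      x * (l.map fun y => 1 + a y).prod =
        (l.map fun y => 1 + a y).prod * x + (l.map fun y => x * a y - a y * x).sum
  | [], _, _ => by simp
  | y :: t, h, h' => by
    have ih := mul_prod_one_add_eq x t
      (fun y hy z hz => h y (.tail _ hy) z (.tail _ hz))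
      (fun y hy z hz => h' y (.tail _ hy) z (.tail _ hz))
    have h1 : (x * a y - a y * x) * (t.map fun y => 1 + a y).prod = x * a y - a y * x :=
      mul_prod_one_add_of_annihilates a _ t fun z hz => h y (.head _) z
        (.tail _ hz)
    have h2 : a y * (t.map fun y => x * a y - a y * x).sum = 0 := by
      rw [← sum_map_mul_left]
      refine sum_eq_zero fun w hw => ?_
      obtain ⟨z, hz, rfl⟩ := mem_map.1 hw
      exact h' z (.tail _ hz) y mem_cons_self
    rw [map_cons, prod_cons, map_cons, sum_cons]
    calc x * ((1 + a y) * (t.map fun y => 1 + a y).prod)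
        = (x * a y - a y * x) * (t.map fun y => 1 + a y).prod
          + (1 + a y) * (x * (t.map fun y => 1 + a y).prod) := by noncomm_ring
      _ = _ := by rw [h1, ih, mul_add, one_add_mul (a y) (sum _), h2]; noncomm_ring

/-- Reversing a product of factors `1 + a x` all of whose double commutators vanish. -/
lemma prod_one_add_reverse {r : α → α → Prop} (g : α → α → R) :
    ∀ l : List α, l.Pairwise r → (∀ x ∈ l, g x x = 0) →
      (∀ x ∈ l, ∀ y ∈ l, r x y → g x y = a x * a y - a y * a x ∧ g y x = 0) →
      (∀ x ∈ l, ∀ y ∈ l, ∀ z ∈ l, (a x * a y - a y * a x) * a z = 0 ∧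
        a z * (a x * a y - a y * a x) = 0) →
      (l.map fun y => 1 + a y).prod =
        (l.reverse.map fun y => 1 + a y).prod + (l.map fun x => (l.map fun y => g x y).sum).sum
  | [], _, _, _, _ => by simp
  | x :: t, h, h0, hg, hz => by
    rw [pairwise_cons] at h
    have ih := prod_one_add_reverse g t h.2 (fun y hy => h0 y (.tail _ hy))
      (fun y hy z hz => hg y (.tail _ hy) z (.tail _ hz))
      (fun y hy z hz' w hw => hz y (.tail _ hy) z (.tail _ hz')
        w (.tail _ hw))
    have e1 : (t.map fun y => g x y).sum = (t.map fun y => a x * a y - a y * a x).sum := by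
      congr 1
      exact map_congr_left fun y hy =>
        (hg x (.head _) y (.tail _ hy) (h.1 y hy)).1
    have e2 : (t.map fun y => g y x).sum = 0 := by
      refine sum_eq_zero fun w hw => ?_
      obtain ⟨y, hy, rfl⟩ := mem_map.1 hw
      exact (hg x (.head _) y (.tail _ hy) (h.1 y hy)).2
    have e5 := mul_prod_one_add_eq a (a x) t.reverse
      (fun y hy z hz' => (hz x (.head _) y (.tail _ (mem_reverse.1 hy)) z
        (.tail _ (mem_reverse.1 hz'))).1)
      (fun y hy z hz' => (hz x (.head _) y (.tail _ (mem_reverse.1 hy)) z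
        (.tail _ (mem_reverse.1 hz'))).2)
    rw [map_reverse, map_reverse, sum_reverse, ← map_reverse] at e5
    have e4 : a x * (t.map fun x => (t.map fun y => g x y).sum).sum = 0 := by
      rw [← sum_map_mul_left]
      refine sum_eq_zero fun w hw => ?_
      obtain ⟨y, hy, rfl⟩ := mem_map.1 hw
      rw [← sum_map_mul_left]
      refine sum_eq_zero fun w hw => ?_
      obtain ⟨z, hz', rfl⟩ := mem_map.1 hw
      have hy' := mem_cons_of_mem x hy
      have hz'' := mem_cons_of_mem x hz'
      have key : g y z = a y * a z - a z * a y ∨ g y z = 0 := by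
        by_cases hyz : y = z
        · right; rw [hyz]; exact h0 z hz''
        · have : r y z ∨ r z y := by exact pairwise_or h.2 hy hz' hyz
          rcases this with h1 | h1
          · exact .inl (hg y hy' z hz'' h1).1
          · exact .inr (hg z hz'' y hy' h1).2
      rcases key with h1 | h1
      · simp only [h1]; exact (hz y hy' z hz'' x (.head _)).2
      · simp only [h1, mul_zero]
    simp only [map_cons, prod_cons, sum_cons, reverse_cons, map_append,
      prod_append, map_nil, prod_nil, mul_one, sum_map_add, e1, e2]
    rw [h0 x mem_cons_self, ih, mul_add, one_add_mul (a x) (sum _), e4, one_add_mul, e5]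
    noncomm_ring

lemma prod_one_add_add (b : α → R) :
    ∀ l : List α, (∀ x ∈ l, ∀ y ∈ l, a x * b y = 0 ∧ b x * a y = 0 ∧ b x * b y = 0) →
      (l.map fun y => 1 + (a y + b y)).prod =
        (l.map fun y => 1 + a y).prod + (l.map b).sum
  | [], _ => by simp
  | x :: t, h => by
    have ih := prod_one_add_add b t
      (fun y hy z hz => h y (.tail _ hy) z (.tail _ hz))
    have h1 : b x * (t.map fun y => 1 + a y).prod = b x :=
      mul_prod_one_add_of_annihilates a _ t fun z hz =>
        (h x (.head _) z (.tail _ hz)).2.1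
    have h2 : (a x + b x) * (t.map b).sum = 0 := by
      rw [← sum_map_mul_left]
      refine sum_eq_zero fun w hw => ?_
      obtain ⟨z, hz, rfl⟩ := mem_map.1 hw
      have := h x (.head _) z (.tail _ hz)
      rw [add_mul, this.1, this.2.2, add_zero]
    rw [map_cons, prod_cons, ih, mul_add, one_add_mul _ (sum _), h2, one_add_mul,
      add_mul, h1, map_cons, prod_cons, map_cons, sum_cons]
    noncomm_ring

end Ordered

end

section

open Finset

section SweepGeometry

/-- The time at which the sweep line passes, extended to integral vectors. -/
def alpha (α : ℝ²) (v : ℤ²) : ℝ := α.1 * v.1 + α.2 * v.2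

/-- The coordinate along the sweep line, on integral vectors. -/
def chi (α : ℝ²) (v : ℤ²) : ℝ := α.1 * v.2 - α.2 * v.1

def slope (α : ℝ²) (v : ℤ²) : ℝ := chi α v / alpha α v

/-- The position at time `s` on the sweep line of the line `det (v, ·) = c`. -/
def sweepPos (α : ℝ²) (v : ℤ²) (c s : ℝ) : ℝ :=
  ((α.1 ^ 2 + α.2 ^ 2) * c + chi α v * s) / alpha α v

/-- The time at which two lines cross. -/
def crossTime (α : ℝ²) (v w : ℤ²) (c d : ℝ) : ℝ :=
  ((α.1 ^ 2 + α.2 ^ 2) * c / alpha α v - (α.1 ^ 2 + α.2 ^ 2) * d / alpha α w) /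
    (slope α w - slope α v)

/-- The point of the sweep line at time `s` and position `x`. -/
def sweepPt (α : ℝ²) (s x : ℝ) : ℝ² :=
  ((α.1 * s - α.2 * x) / (α.1 ^ 2 + α.2 ^ 2), (α.2 * s + α.1 * x) / (α.1 ^ 2 + α.2 ^ 2))

variable {α : ℝ²} {v w : ℤ²} {c d s : ℝ}

lemma alpha_add : alpha α (v + w) = alpha α v + alpha α w := by
  simp only [alpha, Prod.fst_add, Prod.snd_add, Int.cast_add]; ring

lemma chi_add : chi α (v + w) = chi α v + chi α w := by
  simp only [chi, Prod.fst_add, Prod.snd_add, Int.cast_add]; ring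

lemma norm_pos_of_alpha (hv : 0 < alpha α v) : 0 < α.1 ^ 2 + α.2 ^ 2 := by
  rcases eq_or_ne α.1 0 with h | h
  · rcases eq_or_ne α.2 0 with h' | h'
    · simp [alpha, h, h'] at hv
    · positivity
  · positivity

lemma alpha_mul_chi : alpha α v * chi α w - chi α v * alpha α w =
    (α.1 ^ 2 + α.2 ^ 2) * (det2 v w : ℤ) := by simp only [alpha, chi, det2]; push_cast; ring

lemma slope_lt_iff (hv : 0 < alpha α v) (hw : 0 < alpha α w) :
    slope α v < slope α w ↔ 0 < det2 v w := by
  have hD := norm_pos_of_alpha hv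
  have h := alpha_mul_chi (α := α) (v := v) (w := w)
  rw [slope, slope, div_lt_div_iff₀ hv hw]
  constructor
  · intro h1
    have : 0 < (α.1 ^ 2 + α.2 ^ 2) * ((det2 v w : ℤ) : ℝ) := by rw [← h]; linarith
    exact_mod_cast pos_of_mul_pos_right this hD.le
  · intro h1
    have : 0 < (α.1 ^ 2 + α.2 ^ 2) * ((det2 v w : ℤ) : ℝ) := mul_pos hD (mod_cast h1)
    rw [← h] at this; linarith

lemma det2_swap {R : Type} [CommRing R] (v w : R × R) : det2 v w = -det2 w v := by
  simp only [det2]; ring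

lemma slope_le_iff (hv : 0 < alpha α v) (hw : 0 < alpha α w) :
    slope α v ≤ slope α w ↔ 0 ≤ det2 v w := by rw [← not_lt, slope_lt_iff hw hv, det2_swap]; simp

lemma slope_eq_iff (hv : 0 < alpha α v) (hw : 0 < alpha α w) :
    slope α v = slope α w ↔ det2 v w = 0 := by
  rw [le_antisymm_iff, slope_le_iff hv hw, slope_le_iff hw hv, det2_swap w v]
  constructor
  · rintro ⟨h1, h2⟩; omega
  · intro h; omega

lemma sweepPos_eq : sweepPos α v c s =
    (α.1 ^ 2 + α.2 ^ 2) * c / alpha α v + slope α v * s := by rw [sweepPos, slope]; ring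

lemma sweepPos_eq_iff (h : slope α v ≠ slope α w) :
    sweepPos α v c s = sweepPos α w d s ↔ crossTime α v w c d = s := by
  have : slope α w - slope α v ≠ 0 := sub_ne_zero.2 h.symm
  rw [sweepPos_eq, sweepPos_eq, crossTime, div_eq_iff this]
  constructor <;> intro h <;> linarith

lemma sweepPos_add (hv : 0 < alpha α v) (hw : 0 < alpha α w)
    (h : sweepPos α v c s = sweepPos α w d s) :
    sweepPos α (v + w) (c + d) s = sweepPos α v c s := by
  have h1 : sweepPos α v c s * alpha α v = (α.1 ^ 2 + α.2 ^ 2) * c + chi α v * s :=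
    div_mul_cancel₀ _ hv.ne'
  have h2 : sweepPos α w d s * alpha α w = (α.1 ^ 2 + α.2 ^ 2) * d + chi α w * s :=
    div_mul_cancel₀ _ hw.ne'
  rw [← h] at h2
  rw [sweepPos, alpha_add, chi_add, div_eq_iff (by linarith)]
  linarith

lemma continuous_sweepPos : Continuous (sweepPos α v c) := by unfold sweepPos; fun_prop

end SweepGeometry

section Sweep

variable {ι : Type} [Fintype ι] [DecidableEq ι] {R : Type} [Ring R]

/-- The number, with multiplicities, of ways in which an edge carrying the legs `J` has been created
before time `s` satisfies the recursion over the last vertex. -/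
def IsBirthCount (α : ℝ²) (u : ι → ℤ²) (c : ι → ℝ) (f : Finset ι → ℝ → ℕ) : Prop :=
  ∀ J : Finset ι, ∀ s, J.Nonempty → f J s = (if J.card = 1 then 1 else 0) +
    ∑ K ∈ J.powerset with K.Nonempty ∧ (J \ K).Nonempty ∧
      0 < det2 σ(u,K) σ(u,J \ K) ∧
      crossTime α σ(u,K) σ(u,J \ K) σ(c,K) σ(c,J \ K) < s,
      (det2 σ(u,K) σ(u,J \ K)).natAbs *
        f K (crossTime α σ(u,K) σ(u,J \ K) σ(c,K) σ(c,J \ K)) *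
        f (J \ K)
          (crossTime α σ(u,K) σ(u,J \ K) σ(c,K) σ(c,J \ K))

variable (α : ℝ²) (u : ι → ℤ²) (c : ι → ℝ) (f : Finset ι → ℝ → ℕ)
  (A : Finset ι → R)

/-- The position of the edge carrying the legs `J`. -/
def legPos (J : Finset ι) (s : ℝ) : ℝ := sweepPos α σ(u,J) σ(c,J) s

/-- The order of the edges along the sweep line, from large to small positions. -/
def legKey (s : ℝ) (J : Finset ι) : ℝ ×ₗ ℝ :=
  toLex (-legPos α u c J s, slope α σ(u,J))

/-- The nonempty sets of legs. -/
def legSets (ι : Type) [Fintype ι] [DecidableEq ι] : List (Finset ι) :=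
  (univ.filter fun J : Finset ι => J.Nonempty).toList

lemma mem_legSets {J : Finset ι} : J ∈ legSets ι ↔ J.Nonempty := by simp [legSets]

lemma nodup_legSets : (legSets ι).Nodup := nodup_toList _

/-- The ordered product over the edges met by the sweep line. -/
def sweepProd (s : ℝ) : R :=
  ((sortBy (legKey α u c s) (legSets ι)).map fun J => 1 + f J s • A J).prod

variable {α u c f A}

/-- The multiplication of the elements attached to sets of legs. -/
structure IsLegSystem (u : ι → ℤ²) (A : Finset ι → R) : Prop where
  bracket : ∀ J K, Disjoint J K →
    A J * A K - A K * A J = det2 σ(u,J) σ(u,K) • A (J ∪ K)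
  mul_eq_zero : ∀ J K, ¬ Disjoint J K → A J * A K = 0

lemma IsLegSystem.commute (hA : IsLegSystem u A) {J K : Finset ι}
    (h : det2 σ(u,J) σ(u,K) = 0) : Commute (A J) (A K) := by
  by_cases hd : Disjoint J K
  · have := hA.bracket J K hd
    rw [h, zero_smul, sub_eq_zero] at this
    exact this
  · exact (hA.mul_eq_zero J K hd).trans (hA.mul_eq_zero K J fun h => hd h.symm).symm

lemma alpha_sum_pos (hα : ∀ i, 0 < alpha α (u i)) {J : Finset ι} (hJ : J.Nonempty) :
    0 < alpha α σ(u,J) := by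
  have : alpha α σ(u,J) = ∑ i ∈ J, alpha α (u i) := by
    induction J using cons_induction with
    | empty => simp [alpha]
    | cons a s ha ih =>
      rw [sum_cons, sum_cons, alpha_add]
      rcases s.eq_empty_or_nonempty with rfl | hs
      · simp [alpha]
      · rw [ih hs]
  rw [this]
  exact sum_pos (fun i _ => hα i) hJ

lemma commute_factor (hα : ∀ i, 0 < alpha α (u i)) (hA : IsLegSystem u A) {J K : Finset ι}
    (hJ : J.Nonempty) (hK : K.Nonempty)
    (h : slope α σ(u,J) = slope α σ(u,K)) (m n : ℕ) :
    Commute (1 + m • A J) (1 + n • A K) := by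
  rw [slope_eq_iff (alpha_sum_pos hα hJ) (alpha_sum_pos hα hK)] at h
  exact ((Commute.one_left _).add_left
    ((Commute.one_right _).add_right (((hA.commute h).smul_left m).smul_right n)))

lemma legKey_le_iff {s : ℝ} {J K : Finset ι} : legKey α u c s J ≤ legKey α u c s K ↔
    legPos α u c K s < legPos α u c J s ∨ (legPos α u c J s = legPos α u c K s ∧
      slope α σ(u,J) ≤ slope α σ(u,K)) := by simp [legKey, Prod.Lex.le_iff]

lemma legPos_sub (J K : Finset ι) (s s₀ : ℝ) (h : legPos α u c J s₀ = legPos α u c K s₀) :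
    legPos α u c J s - legPos α u c K s =
      (slope α σ(u,J) - slope α σ(u,K)) * (s - s₀) := by
  simp only [legPos, sweepPos_eq] at h ⊢
  linear_combination h

lemma eventually_legPos_lt (s₀ : ℝ) : ∀ᶠ s in 𝓝 s₀, ∀ J K : Finset ι,
    legPos α u c J s₀ < legPos α u c K s₀ → legPos α u c J s < legPos α u c K s := by
  rw [Filter.eventually_all]; intro J
  rw [Filter.eventually_all]; intro K
  by_cases h : legPos α u c J s₀ < legPos α u c K s₀
  · have := (continuous_sweepPos.continuousAt (x := s₀)).eventually_lt
      (continuous_sweepPos.continuousAt (x := s₀)) h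
    filter_upwards [this] with s hs _ using hs
  · exact .of_forall fun s hs => absurd hs h

lemma sweepProd_left (hα : ∀ i, 0 < alpha α (u i)) (hA : IsLegSystem u A)
    (hf : IsBirthCount α u c f) (s₀ : ℝ) :
    ∀ᶠ s in 𝓝[<] s₀, sweepProd α u c f A s = sweepProd α u c f A s₀ := by
  have h1 : ∀ᶠ s in 𝓝[<] s₀, ∀ J K : Finset ι,
      (crossTime α σ(u,K) σ(u,J \ K) σ(c,K) σ(c,J \ K) < s ↔
      crossTime α σ(u,K) σ(u,J \ K) σ(c,K) σ(c,J \ K) < s₀) := by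
    rw [Filter.eventually_all]; intro J
    rw [Filter.eventually_all]; intro K
    generalize crossTime α σ(u,K) σ(u,J \ K) σ(c,K) σ(c,J \ K) = x
    by_cases hx : x < s₀
    · filter_upwards [Ioo_mem_nhdsLT hx] with s hs
      exact ⟨fun _ => hx, fun _ => hs.1⟩
    · filter_upwards [self_mem_nhdsWithin] with s hs
      exact ⟨fun h => h.trans hs, fun h => absurd h hx⟩
  filter_upwards [h1, (eventually_legPos_lt (α := α) (u := u) (c := c) s₀).filter_mono nhdsWithin_le_nhds,
    self_mem_nhdsWithin] with s hs hp hlt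
  have hlt : s < s₀ := hlt
  have hfs : ∀ J : Finset ι, J.Nonempty → f J s = f J s₀ := by
    intro J hJ
    rw [hf J s hJ, hf J s₀ hJ]
    simp only [hs]
  unfold sweepProd
  have e1 : ((sortBy (legKey α u c s) (legSets ι)).map fun J => 1 + f J s • A J) =
      ((sortBy (legKey α u c s) (legSets ι)).map fun J => 1 + f J s₀ • A J) := by
    refine List.map_congr_left fun J hJ => ?_
    rw [(sortBy_perm _ _).mem_iff, mem_legSets] at hJ
    rw [hfs J hJ]
  rw [e1]
  refine prod_eq_of_perm_of_pairwise _ ((sortBy_perm (legKey α u c s) (legSets ι)).trans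
    (sortBy_perm (legKey α u c s₀) (legSets ι)).symm)
    (sortBy_pairwise _ _) (sortBy_pairwise _ _) fun J hJ K hK h h' => ?_
  rw [(sortBy_perm _ _).mem_iff, mem_legSets] at hJ hK
  refine commute_factor hα hA hJ hK ?_ _ _
  rw [legKey_le_iff] at h h'
  rcases h' with h' | ⟨h', h''⟩
  · have h2 := hp J K
    rcases h with h | ⟨h, -⟩ <;> specialize h2 h' <;> linarith
  · have h3 := legPos_sub (α := α) (u := u) (c := c) J K s s₀ h'.symm
    have h4 : 0 ≤ legPos α u c J s - legPos α u c K s := by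
      rcases h with h | ⟨h, -⟩ <;> linarith
    rw [h3] at h4
    have : slope α σ(u,J) - slope α σ(u,K) ≤ 0 := by
      by_contra! hcon
      nlinarith
    linarith

end Sweep

end

section

open Finset
section Sweep

variable {ι : Type} [Fintype ι] [DecidableEq ι] {R : Type} [Ring R]
variable {α : ℝ²} {u : ι → ℤ²} {c : ι → ℝ} {f : Finset ι → ℝ → ℕ}
  {A : Finset ι → R}

/-- The edges created at time `s` from two edges with legs `K` and `J \ K`. -/
def birthSplits (α : ℝ²) (u : ι → ℤ²) (c : ι → ℝ) (J : Finset ι) (s : ℝ) :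
    Finset (Finset ι) :=
  J.powerset.filter fun K => K.Nonempty ∧ (J \ K).Nonempty ∧
      0 < det2 σ(u,K) σ(u,J \ K) ∧
      crossTime α σ(u,K) σ(u,J \ K) σ(c,K) σ(c,J \ K) = s

def birthJump (α : ℝ²) (u : ι → ℤ²) (c : ι → ℝ) (f : Finset ι → ℝ → ℕ) (J : Finset ι)
    (s : ℝ) : ℕ :=
  ∑ K ∈ birthSplits α u c J s,
      (det2 σ(u,K) σ(u,J \ K)).natAbs * f K s * f (J \ K) s

lemma eventually_birthCount (hf : IsBirthCount α u c f) (s₀ : ℝ) :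
    ∀ᶠ s in 𝓝[>] s₀, ∀ J : Finset ι, J.Nonempty → f J s = f J s₀ + birthJump α u c f J s₀ := by
  have h1 : ∀ᶠ s in 𝓝[>] s₀, ∀ J K : Finset ι,
      (crossTime α σ(u,K) σ(u,J \ K) σ(c,K) σ(c,J \ K) < s ↔
      crossTime α σ(u,K) σ(u,J \ K) σ(c,K) σ(c,J \ K) ≤ s₀) := by
    rw [Filter.eventually_all]; intro J
    rw [Filter.eventually_all]; intro K
    generalize crossTime α σ(u,K) σ(u,J \ K) σ(c,K) σ(c,J \ K) = x
    by_cases hx : x ≤ s₀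
    · filter_upwards [self_mem_nhdsWithin] with s hs
      exact ⟨fun _ => hx, fun h => lt_of_le_of_lt h hs⟩
    · filter_upwards [Ioo_mem_nhdsGT (not_le.1 hx)] with s hs
      exact ⟨fun h => absurd h (not_lt.2 hs.2.le), fun h => absurd h hx⟩
  filter_upwards [h1] with s hs J hJ
  rw [hf J s hJ, hf J s₀ hJ, add_assoc]
  congr 1
  simp only [hs]
  rw [birthJump, birthSplits, sum_filter, sum_filter, sum_filter,
    ← sum_add_distrib]
  refine sum_congr rfl fun K _ => ?_
  rcases lt_trichotomy
    (crossTime α σ(u,K) σ(u,J \ K) σ(c,K) σ(c,J \ K)) s₀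
    with h | h | h
  · simp [h, h.le, h.ne]
  · simp [h]
  · simp [h.not_gt, h.not_ge, h.ne']

/-- Three edges with disjoint legs, two of which are transversal, never meet. -/
def NoTriplePoint (α : ℝ²) (u : ι → ℤ²) (c : ι → ℝ) : Prop :=
  ∀ J K L : Finset ι, J.Nonempty → K.Nonempty → L.Nonempty → Disjoint J K → Disjoint J L →
    Disjoint K L → det2 σ(u,J) σ(u,K) ≠ 0 →
    ∀ s, legPos α u c J s = legPos α u c K s → legPos α u c L s ≠ legPos α u c J s

lemma IsLegSystem.mul_eq_zero_of_not_disjoint (hA : IsLegSystem u A) {J K L : Finset ι}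
    (hJK : Disjoint J K) (h : ¬ (Disjoint J L ∧ Disjoint K L)) :
    (A J * A K - A K * A J) * A L = 0 ∧ A L * (A J * A K - A K * A J) = 0 := by
  rw [hA.bracket J K hJK, smul_mul_assoc, mul_smul_comm,
    hA.mul_eq_zero (J ∪ K) L (by rwa [disjoint_union_left]),
    hA.mul_eq_zero L (J ∪ K) (by rwa [disjoint_comm, disjoint_union_left])]
  simp

lemma annihilate_of_meet (hA : IsLegSystem u A) (hg : NoTriplePoint α u c) {s x : ℝ}
    {J K L : Finset ι} (hJ : J.Nonempty ∧ legPos α u c J s = x)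
    (hK : K.Nonempty ∧ legPos α u c K s = x) (hL : L.Nonempty ∧ legPos α u c L s = x) :
    (A J * A K - A K * A J) * A L = 0 ∧ A L * (A J * A K - A K * A J) = 0 := by
  by_cases hJK : Disjoint J K
  · by_cases h : Disjoint J L ∧ Disjoint K L
    · by_cases hd : det2 σ(u,J) σ(u,K) = 0
      · rw [hA.bracket J K hJK, hd]; simp
      · exact absurd (hL.2.trans hJ.2.symm)
          (hg J K L hJ.1 hK.1 hL.1 hJK h.1 h.2 hd s (hJ.2.trans hK.2.symm))
    · exact hA.mul_eq_zero_of_not_disjoint hJK h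
  · rw [hA.mul_eq_zero J K hJK, hA.mul_eq_zero K J fun h => hJK h.symm]; simp

/-- The edges created at a point from pairs of edges meeting there. -/
lemma sum_birthJump (hα : ∀ i, 0 < alpha α (u i)) (hA : IsLegSystem u A) (s x : ℝ) :
    ∑ J ∈ univ.filter (fun J : Finset ι => J.Nonempty ∧ legPos α u c J s = x),
        birthJump α u c f J s • A J =
      ∑ K ∈ univ.filter (fun J : Finset ι => J.Nonempty ∧ legPos α u c J s = x),
        ∑ L ∈ univ.filter (fun J : Finset ι => J.Nonempty ∧ legPos α u c J s = x),
          if 0 < det2 σ(u,K) σ(u,L) then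
            (f K s • A K) * (f L s • A L) - (f L s • A L) * (f K s • A K) else 0 := by
  classical
  have hbr : ∀ K L : Finset ι, 0 < det2 σ(u,K) σ(u,L) →
      (f K s • A K) * (f L s • A L) - (f L s • A L) * (f K s • A K) = if Disjoint K L then
        ((det2 σ(u,K) σ(u,L)).natAbs * f K s * f L s) • A (K ∪ L) else 0 := by
    intro K L hpos
    rw [smul_mul_smul_comm, smul_mul_smul_comm, mul_comm (f L s), ← smul_sub]
    split_ifs with h
    · rw [hA.bracket K L h]
      conv_lhs => rw [← Int.natAbs_of_nonneg hpos.le, natCast_zsmul, smul_smul]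
      congr 1; ring
    · rw [hA.mul_eq_zero K L h, hA.mul_eq_zero L K fun h' => h h'.symm]; simp
  have hpos : ∀ K L : Finset ι, K.Nonempty → L.Nonempty → Disjoint K L →
      legPos α u c K s = legPos α u c L s → legPos α u c (K ∪ L) s = legPos α u c K s := by
    intro K L hK hL hd h
    rw [legPos, sum_union hd, sum_union hd]
    exact sweepPos_add (alpha_sum_pos hα hK) (alpha_sum_pos hα hL) h
  have hcross : ∀ K L : Finset ι, K.Nonempty → L.Nonempty →
      0 < det2 σ(u,K) σ(u,L) → (legPos α u c K s = legPos α u c L s ↔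
      crossTime α σ(u,K) σ(u,L) σ(c,K) σ(c,L) = s) := by
    intro K L hK hL h
    exact sweepPos_eq_iff fun he => h.ne'
      ((slope_eq_iff (alpha_sum_pos hα hK) (alpha_sum_pos hα hL)).1 he)
  simp only [birthJump, sum_smul]
  rw [← sum_product', sum_sigma']
  symm
  rw [← sum_filter_ne_zero]
  have hmem : ∀ p ∈ ((univ.filter (fun J : Finset ι => J.Nonempty ∧ legPos α u c J s = x)) ×ˢ
      (univ.filter (fun J : Finset ι => J.Nonempty ∧ legPos α u c J s = x))).filter
      (fun p => (if 0 < det2 σ(u,p.1) σ(u,p.2) then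
            (f p.1 s • A p.1) * (f p.2 s • A p.2) - (f p.2 s • A p.2) * (f p.1 s • A p.1) else 0)
              ≠ 0),
      (p.1.Nonempty ∧ legPos α u c p.1 s = x) ∧ (p.2.Nonempty ∧ legPos α u c p.2 s = x) ∧
      0 < det2 σ(u,p.1) σ(u,p.2) ∧ Disjoint p.1 p.2 := by
    intro p hp
    simp only [mem_filter, mem_product, mem_univ, true_and] at hp
    obtain ⟨⟨h1, h2⟩, h3⟩ := hp
    have h4 : 0 < det2 σ(u,p.1) σ(u,p.2) := by by_contra hcon; rw [if_neg hcon] at h3; exact h3 rfl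
    rw [if_pos h4, hbr _ _ h4] at h3
    have h5 : Disjoint p.1 p.2 := by by_contra hcon; rw [if_neg hcon] at h3; exact h3 rfl
    exact ⟨h1, h2, h4, h5⟩
  refine sum_of_injOn (fun p => ⟨p.1 ∪ p.2, p.1⟩) ?_ ?_ ?_ ?_
  · intro p hp q hq hpq
    have hp' := (hmem p hp).2.2.2
    have hq' := (hmem q hq).2.2.2
    simp only [Sigma.mk.injEq, heq_eq_eq] at hpq
    refine Prod.ext hpq.2 ?_
    rw [← union_sdiff_cancel_left hp', ← union_sdiff_cancel_left hq', hpq.1, hpq.2]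
  · intro p hp
    obtain ⟨h1, h2, h3, h4⟩ := hmem p hp
    simp only [coe_sigma, Set.mem_sigma_iff, mem_coe, mem_filter,
      mem_univ, true_and, birthSplits, mem_powerset,
      union_sdiff_cancel_left h4]
    exact ⟨⟨h1.1.mono subset_union_left,
      (hpos _ _ h1.1 h2.1 h4 (h1.2.trans h2.2.symm)).trans h1.2⟩, subset_union_left, h1.1,
      h2.1, h3, (hcross _ _ h1.1 h2.1 h3).1 (h1.2.trans h2.2.symm)⟩
  · rintro ⟨J, K⟩ hJK hn
    simp only [mem_sigma, mem_filter,
      mem_univ, true_and, birthSplits, mem_powerset] at hJK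
    obtain ⟨⟨hJ, hx⟩, hKJ, hK, hL, hd, ht⟩ := hJK
    by_contra hne
    refine hn ⟨(K, J \ K), ?_, by simp [union_sdiff_of_subset hKJ]⟩
    have hdis : Disjoint K (J \ K) := disjoint_sdiff
    have he := (hcross _ _ hK hL hd).2 ht
    have hKx : legPos α u c K s = x := by
      rw [← hpos _ _ hK hL hdis he, union_sdiff_of_subset hKJ, hx]
    simp only [coe_filter, mem_product, mem_filter,
      mem_univ, true_and]
    refine ⟨⟨⟨hK, hKx⟩, hL, he.symm.trans hKx⟩, ?_⟩
    rw [if_pos hd, hbr _ _ hd, if_pos hdis, union_sdiff_of_subset hKJ]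
    exact hne
  · intro p hp
    obtain ⟨h1, h2, h3, h4⟩ := hmem p hp
    rw [if_pos h3, hbr _ _ h3, if_pos h4]
    simp only [union_sdiff_cancel_left h4]

lemma sweepProd_right (hα : ∀ i, 0 < alpha α (u i)) (hA : IsLegSystem u A)
    (hf : IsBirthCount α u c f) (hg : NoTriplePoint α u c) (s₀ : ℝ) :
    ∀ᶠ s in 𝓝[>] s₀, sweepProd α u c f A s = sweepProd α u c f A s₀ := by
  filter_upwards [eventually_birthCount hf s₀,
    (eventually_legPos_lt (α := α) (u := u) (c := c) s₀).filter_mono nhdsWithin_le_nhds,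
    self_mem_nhdsWithin] with s hs hp hlt
  have hlt : s₀ < s := hlt
  let X : ℝ → Finset (Finset ι) := fun y =>
    univ.filter fun J : Finset ι => J.Nonempty ∧ legPos α u c J s₀ = -y
  let cl : ℝ → List (Finset ι) := fun y => sortBy (fun J => slope α σ(u,J)) (X y).toList
  let xs : List ℝ := ((univ.filter fun J : Finset ι => J.Nonempty).image
    fun J => -legPos α u c J s₀).sort (· ≤ ·)
  have hcl : ∀ y J, J ∈ cl y ↔ J.Nonempty ∧ legPos α u c J s₀ = -y := by
    intro y J
    rw [(sortBy_perm _ _).mem_iff]; simp [X]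
  have hclnd : ∀ y, (cl y).Nodup := fun y => (sortBy_perm _ _).nodup_iff.2 (nodup_toList _)
  have hxs : xs.Pairwise (· < ·) := (sortedLT_sort _).pairwise
  have hdisj : ∀ y z : ℝ, y < z → ∀ J, J ∈ cl y → J ∉ cl z := by
    intro y z hyz J h1 h2
    rw [hcl] at h1 h2; linarith [h1.2, h2.2]
  have hmem : ∀ J : Finset ι, J.Nonempty ↔ ∃ y ∈ xs, J ∈ cl y := by
    intro J
    constructor
    · intro hJ
      exact ⟨-legPos α u c J s₀, by simp only [xs, mem_sort, mem_image]; exact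
        ⟨J, by simp [hJ], rfl⟩, by rw [hcl]; exact ⟨hJ, by ring⟩⟩
    · rintro ⟨y, -, h⟩; exact ((hcl y J).1 h).1
  have perm0 : (sortBy (legKey α u c s₀) (legSets ι)).Perm (xs.flatMap cl) := by
    refine (sortBy_perm _ _).trans ((List.perm_ext_iff_of_nodup nodup_legSets ?_).2 fun J => ?_)
    · refine List.nodup_flatMap.2 ⟨fun y _ => hclnd y, hxs.imp fun {y z} h J h1 h2 => ?_⟩
      exact hdisj y z h J h1 h2
    · rw [mem_legSets, List.mem_flatMap, hmem]
  have perm1 : (sortBy (legKey α u c s) (legSets ι)).Perm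
      (xs.flatMap fun y => (cl y).reverse) := by
    refine (sortBy_perm _ _).trans ((List.perm_ext_iff_of_nodup nodup_legSets ?_).2 fun J => ?_)
    · refine List.nodup_flatMap.2 ⟨fun y _ => List.nodup_reverse.2 (hclnd y),
        hxs.imp fun {y z} h J h1 h2 => ?_⟩
      exact hdisj y z h J (List.mem_reverse.1 h1) (List.mem_reverse.1 h2)
    · rw [mem_legSets, List.mem_flatMap, hmem]; simp only [List.mem_reverse]
  have comm : ∀ (s' : ℝ), ∀ J K : Finset ι, J.Nonempty → K.Nonempty →
      legKey α u c s' J ≤ legKey α u c s' K → legKey α u c s' K ≤ legKey α u c s' J →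
      ∀ m n : ℕ, Commute (1 + m • A J) (1 + n • A K) := by
    intro s' J K hJ hK h h'
    refine commute_factor hα hA hJ hK ?_
    have := le_antisymm h h'
    exact congrArg (fun p => (ofLex p).2) this
  have e0 : sweepProd α u c f A s₀ =
      ((xs.flatMap cl).map fun J => 1 + f J s₀ • A J).prod := by
    refine prod_eq_of_perm_of_pairwise (r' := fun J K => legKey α u c s₀ J ≤ legKey α u c s₀ K)
      _ perm0 (sortBy_pairwise _ _) ?_ fun J hJ K hK h h' => ?_
    · refine List.pairwise_flatMap.2 ⟨fun y _ => ?_, hxs.imp fun {y z} h J h1 K h2 => ?_⟩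
      · refine (sortBy_pairwise _ _).imp_of_mem fun {J K} hJ hK h => ?_
        have hJ := (hcl y J).1 hJ
        have hK := (hcl y K).1 hK
        exact legKey_le_iff.2 (.inr ⟨hJ.2.trans hK.2.symm, h⟩)
      · rw [hcl] at h1 h2
        exact legKey_le_iff.2 (.inl (by rw [h1.2, h2.2]; linarith))
    · rw [(sortBy_perm _ _).mem_iff, mem_legSets] at hJ hK
      exact comm s₀ J K hJ hK h h' _ _
  have e1 : sweepProd α u c f A s =
      ((xs.flatMap fun y => (cl y).reverse).map fun J => 1 + f J s • A J).prod := by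
    refine prod_eq_of_perm_of_pairwise (r' := fun J K => legKey α u c s J ≤ legKey α u c s K)
      _ perm1 (sortBy_pairwise _ _) ?_ fun J hJ K hK h h' => ?_
    · refine List.pairwise_flatMap.2 ⟨fun y _ => ?_, hxs.imp fun {y z} h J h1 K h2 => ?_⟩
      · rw [List.pairwise_reverse]
        refine (sortBy_pairwise _ _).imp_of_mem fun {J K} hJ hK h => ?_
        have hJ := (hcl y J).1 hJ
        have hK := (hcl y K).1 hK
        have h3 := legPos_sub K J s s₀ (hK.2.trans hJ.2.symm)
        rw [legKey_le_iff]
        rcases h.lt_or_eq with h | h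
        · left
          have : 0 < legPos α u c K s - legPos α u c J s := by
            rw [h3]; exact mul_pos (by linarith) (by linarith)
          linarith
        · right
          rw [h, sub_self, zero_mul] at h3
          exact ⟨by linarith, h.ge⟩
      · rw [List.mem_reverse, hcl] at h1 h2
        exact legKey_le_iff.2 (.inl (hp _ _ (by rw [h1.2, h2.2]; linarith)))
    · rw [(sortBy_perm _ _).mem_iff, mem_legSets] at hJ hK
      exact comm s J K hJ hK h h' _ _
  rw [e0, e1, List.map_flatMap, List.map_flatMap, List.flatMap_def, List.flatMap_def,
    List.prod_flatten, List.prod_flatten, List.map_map, List.map_map]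
  congr 1
  refine List.map_congr_left fun y _ => ?_
  simp only [Function.comp_apply]
  set a : Finset ι → R := fun J => f J s₀ • A J with ha
  set b : Finset ι → R := fun J => birthJump α u c f J s₀ • A J with hb
  have hgood : ∀ J ∈ cl y, J.Nonempty ∧ legPos α u c J s₀ = -y := fun J hJ => (hcl y J).1 hJ
  have hann : ∀ J ∈ cl y, ∀ K ∈ cl y, ∀ L ∈ cl y, (a J * a K - a K * a J) * a L = 0 ∧
      a L * (a J * a K - a K * a J) = 0 := by
    intro J hJ K hK L hL
    obtain ⟨h1, h2⟩ := annihilate_of_meet hA hg (hgood J hJ) (hgood K hK) (hgood L hL)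
    simp only [ha]
    rw [smul_mul_smul_comm, smul_mul_smul_comm, mul_comm (f K s₀), ← smul_sub, smul_mul_smul_comm,
      smul_mul_smul_comm, h1, h2]
    simp
  have hbA : ∀ J ∈ cl y, ∀ K ∈ cl y, A K * b J = 0 ∧ b J * A K = 0 := by
    intro J hJ K hK
    have hz : ∀ S ∈ birthSplits α u c J s₀, A K * A J = 0 ∧ A J * A K = 0 := by
      intro S hS
      simp only [birthSplits, mem_filter, mem_powerset] at hS
      obtain ⟨hSJ, hS1, hS2, hd, ht⟩ := hS
      by_cases hJK : Disjoint J K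
      · have hdis : Disjoint S (J \ S) := disjoint_sdiff
        have hu := union_sdiff_of_subset hSJ
        have he : legPos α u c S s₀ = legPos α u c (J \ S) s₀ :=
          (sweepPos_eq_iff fun he => hd.ne'
            ((slope_eq_iff (alpha_sum_pos hα hS1) (alpha_sum_pos hα hS2)).1 he)).2 ht
        have hSx : legPos α u c S s₀ = -y := by
          have : legPos α u c (S ∪ (J \ S)) s₀ = legPos α u c S s₀ := by
            rw [legPos, sum_union hdis, sum_union hdis]
            exact sweepPos_add (alpha_sum_pos hα hS1) (alpha_sum_pos hα hS2) he
          rw [← this, hu]; exact (hgood J hJ).2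
        refine absurd ((hgood K hK).2.trans hSx.symm) (hg S (J \ S) K hS1 hS2 (hgood K hK).1 hdis
          (hJK.mono_left hSJ) (hJK.mono_left sdiff_subset) hd.ne' s₀ he)
      · exact ⟨hA.mul_eq_zero K J fun h => hJK h.symm, hA.mul_eq_zero J K hJK⟩
    simp only [hb, birthJump]
    rw [sum_smul, mul_sum, sum_mul]
    constructor
    · refine sum_eq_zero fun S hS => ?_
      rw [mul_smul_comm, (hz S hS).1, smul_zero]
    · refine sum_eq_zero fun S hS => ?_
      rw [smul_mul_assoc, (hz S hS).2, smul_zero]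
  have hab : ∀ J ∈ (cl y).reverse, ∀ K ∈ (cl y).reverse,
      a J * b K = 0 ∧ b J * a K = 0 ∧ b J * b K = 0 := by
    intro J hJ K hK
    rw [List.mem_reverse] at hJ hK
    refine ⟨?_, ?_, ?_⟩
    · rw [ha]; simp only; rw [smul_mul_assoc, (hbA K hK J hJ).1, smul_zero]
    · rw [ha]; simp only; rw [mul_smul_comm, (hbA J hJ K hK).2, smul_zero]
    · rw [hb]; simp only; rw [smul_mul_assoc, (hbA K hK J hJ).1, smul_zero]
  have hfs : ((cl y).reverse.map fun J => 1 + f J s • A J) =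
      ((cl y).reverse.map fun J => 1 + (a J + b J)) := by
    refine List.map_congr_left fun J hJ => ?_
    rw [hs J (hgood J (List.mem_reverse.1 hJ)).1, add_smul]
  have hsum : ∀ g : Finset ι → R, ((cl y).map g).sum = ∑ J ∈ X y, g J := by
    intro g
    rw [← sum_map_toList]
    exact ((sortBy_perm _ _).map g).sum_eq
  rw [hfs, prod_one_add_add a b _ hab, prod_one_add_reverse a
    (fun K L => if 0 < det2 σ(u,K) σ(u,L) then a K * a L - a L * a K else 0)
    (cl y) (sortBy_pairwise _ _) ?_ ?_ hann]
  · congr 1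
    rw [List.map_reverse, List.sum_reverse, hsum, hsum]
    simp only [hsum]
    exact sum_birthJump hα hA s₀ (-y)
  · intro J _; simp
  · intro J hJ K hK h
    have h1 := alpha_sum_pos hα (hgood J hJ).1
    have h2 := alpha_sum_pos hα (hgood K hK).1
    rcases h.lt_or_eq with h | h
    · have h3 := (slope_lt_iff h1 h2).1 h
      have h4 : ¬ 0 < det2 σ(u,K) σ(u,J) := by rw [det2_swap]; omega
      exact ⟨if_pos h3, if_neg h4⟩
    · have h3 := (slope_eq_iff h1 h2).1 h
      have h4 : ¬ 0 < det2 σ(u,K) σ(u,J) := by rw [det2_swap]; omega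
      rw [if_neg h3.not_gt, if_neg h4]
      refine ⟨?_, rfl⟩
      rw [eq_comm, sub_eq_zero]
      exact ((hA.commute h3).smul_left _).smul_right _

/-- The ordered product along the sweep line does not depend on time. -/
lemma sweepProd_eq (hα : ∀ i, 0 < alpha α (u i)) (hA : IsLegSystem u A)
    (hf : IsBirthCount α u c f) (hg : NoTriplePoint α u c) (s s' : ℝ) :
    sweepProd α u c f A s = sweepProd α u c f A s' := by
  have : IsLocallyConstant (sweepProd α u c f A) := by
    rw [IsLocallyConstant.iff_eventually_eq]
    intro s₀
    rw [← nhdsNE_sup_pure, ← nhdsLT_sup_nhdsGT, Filter.eventually_sup, Filter.eventually_sup]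
    exact ⟨⟨sweepProd_left hα hA hf s₀, sweepProd_right hα hA hf hg s₀⟩, by simp⟩
  exact this.apply_eq_of_isPreconnected isPreconnected_univ (Set.mem_univ _) (Set.mem_univ _)

end Sweep

end

section

open Finset CTree Prod

section TreeCount

variable {ι : Type} {u : ι → ℤ²} {c : ι → ℝ}

/-- The trees with the set of labels `J`. -/
def treeSet (J : Finset ι) : Set (CTree ι) := {T | T.leaves.Nodup ∧ ∀ i, i ∈ T.leaves ↔ i ∈ J}

lemma CTree.leaves_ne_nil : ∀ T : CTree ι, T.leaves ≠ []
  | .leaf i => by simp [leaves]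
  | .node l r => by simp [leaves, l.leaves_ne_nil]

lemma CTree.vec_eq : ∀ T : CTree ι, T.vec u = (T.leaves.map u).sum
  | .leaf i => by simp [leaves, vec]
  | .node l r => by simp [leaves, vec, l.vec_eq, r.vec_eq]

lemma vecR_add (v w : ℤ²) : vecR (v + w) = vecR v + vecR w := by simp [vecR]

lemma CTree.Through.det2_eq : ∀ {T : CTree ι} {P : ℝ²}, T.Through u c P →
    det2 (vecR (T.vec u)) P = (T.leaves.map c).sum
  | .leaf i, P, h => by simpa [leaves, vec, Through] using h
  | .node l r, P, ⟨_, Q, s, hl, hr, _, hP⟩ => by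
    simp only [leaves, vec, List.map_append, List.sum_append, ← hl.det2_eq,
      ← hr.det2_eq, hP, vecR_add]
    simp only [det2, fst_add, snd_add, smul_fst, smul_snd, smul_eq_mul]
    ring

variable [DecidableEq ι]

lemma sum_leaves {M : Type} [AddCommMonoid M] {J : Finset ι} {T : CTree ι} (hT : T ∈ treeSet J)
    (g : ι → M) : (T.leaves.map g).sum = ∑ i ∈ J, g i := by
  rw [← List.sum_toFinset _ hT.1]
  refine sum_congr ?_ fun _ _ => rfl
  ext i; simp [hT.2 i]

lemma node_mem_treeSet {J : Finset ι} {l r : CTree ι} :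
    node l r ∈ treeSet J ↔ ∃ K ⊆ J, K.Nonempty ∧ (J \ K).Nonempty ∧ l ∈ treeSet K ∧
      r ∈ treeSet (J \ K) := by
  constructor
  · rintro ⟨h1, h2⟩
    simp only [leaves, List.nodup_append, List.mem_append] at h1 h2
    refine ⟨l.leaves.toFinset, fun i hi => (h2 i).1 (.inl (List.mem_toFinset.1 hi)), ?_, ?_,
      ⟨h1.1, by simp⟩, h1.2.1, fun i => ?_⟩
    · obtain ⟨i, hi⟩ := List.exists_mem_of_ne_nil _ l.leaves_ne_nil
      exact ⟨i, List.mem_toFinset.2 hi⟩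
    · obtain ⟨i, hi⟩ := List.exists_mem_of_ne_nil _ r.leaves_ne_nil
      refine ⟨i, mem_sdiff.2 ⟨(h2 i).1 (.inr hi), fun h => ?_⟩⟩
      exact h1.2.2 i (List.mem_toFinset.1 h) i hi rfl
    · rw [mem_sdiff, List.mem_toFinset, ← h2 i]
      constructor
      · exact fun hi => ⟨.inr hi, fun h => h1.2.2 i h i hi rfl⟩
      · rintro ⟨h | h, h'⟩
        · exact absurd h h'
        · exact h
  · rintro ⟨K, hKJ, -, -, hl, hr⟩
    refine ⟨?_, fun i => ?_⟩
    · simp only [leaves, List.nodup_append]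
      refine ⟨hl.1, hr.1, fun i hi j hj hij => ?_⟩
      rw [hl.2] at hi; rw [hr.2, mem_sdiff] at hj
      exact hj.2 (hij ▸ hi)
    · simp only [leaves, List.mem_append, hl.2, hr.2, mem_sdiff]
      constructor
      · rintro (h | h)
        · exact hKJ h
        · exact h.1
      · intro h
        by_cases h' : i ∈ K
        · exact .inl h'
        · exact .inr ⟨h, h'⟩

lemma leaf_mem_treeSet {J : Finset ι} {i : ι} : leaf i ∈ treeSet J ↔ J = {i} := by
  simp only [treeSet, leaves, Set.mem_ofPred_eq, List.nodup_singleton, List.mem_singleton,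
    true_and]
  constructor
  · intro h; ext j; rw [← h, mem_singleton]
  · rintro rfl j; simp

lemma treeSet_finite (J : Finset ι) : (treeSet J).Finite := by
  induction J using strongInduction with
  | H J ih =>
    have h1 : (⋃ K ∈ {K | K ∈ J.powerset ∧ K.Nonempty ∧ (J \ K).Nonempty},
        Set.image2 node (treeSet K) (treeSet (J \ K))).Finite := by
      refine Set.Finite.biUnion (J.powerset.finite_toSet.subset fun K hK => hK.1) ?_
      rintro K ⟨hK, hK1, hK2⟩
      rw [mem_powerset] at hK
      refine Set.Finite.image2 _ (ih K ?_) (ih _ ?_)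
      · refine Finset.ssubset_iff_subset_ne.2 ⟨hK, fun h => ?_⟩
        rw [h, Finset.sdiff_self] at hK2; simp at hK2
      · exact sdiff_ssubset hK hK1
    refine ((J.finite_toSet.image leaf).union h1).subset fun T hT => ?_
    cases T with
    | leaf i =>
      left
      exact ⟨i, by rw [leaf_mem_treeSet.1 hT]; simp, rfl⟩
    | node l r =>
      right
      obtain ⟨K, h1, h2, h3, h4, h5⟩ := node_mem_treeSet.1 hT
      exact Set.mem_biUnion (x := K) ⟨mem_powerset.2 h1, h2, h3⟩
        ⟨l, h4, r, h5, rfl⟩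

/-- The finite set of trees with the set of labels `J`. -/
def trees (J : Finset ι) : Finset (CTree ι) := (treeSet_finite J).toFinset

lemma mem_trees {J : Finset ι} {T : CTree ι} : T ∈ trees J ↔ T ∈ treeSet J :=
  (treeSet_finite J).mem_toFinset

/-- The sum over trees, split according to the last vertex. -/
lemma sum_trees (J : Finset ι) (g : CTree ι → ℕ) :
    σ(g,trees J) = ∑ i ∈ J with J = {i}, g (.leaf i) +
      ∑ K ∈ J.powerset with K.Nonempty ∧ (J \ K).Nonempty,
        ∑ l ∈ trees K, ∑ r ∈ trees (J \ K), g (.node l r) := by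
  classical
  have hinj : Set.InjOn (fun x : (Σ _ : Finset ι, CTree ι × CTree ι) => node x.2.1 x.2.2)
      ((J.powerset.filter fun K => K.Nonempty ∧ (J \ K).Nonempty).sigma fun K =>
        trees K ×ˢ trees (J \ K) : Finset _) := by
    rintro ⟨K, l, r⟩ h ⟨K', l', r'⟩ h' he
    simp only [node.injEq] at he
    obtain ⟨rfl, rfl⟩ := he
    simp only [coe_sigma, Set.mem_sigma_iff, mem_coe, mem_product,
      mem_trees] at h h'
    have : K = K' := by ext i; rw [← h.2.1.2, h'.2.1.2]
    subst this; rfl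
  have hsplit : trees J = (J.filter fun i => J = {i}).image leaf ∪
      ((J.powerset.filter fun K => K.Nonempty ∧ (J \ K).Nonempty).sigma fun K =>
        trees K ×ˢ trees (J \ K)).image fun x => node x.2.1 x.2.2 := by
    ext T
    rw [mem_trees, mem_union]
    cases T with
    | leaf i =>
      rw [leaf_mem_treeSet]
      simp only [mem_image, mem_filter, leaf.injEq, exists_eq_right, reduceCtorEq,
        and_false, exists_false, or_false]
      exact ⟨fun h => ⟨by rw [h]; simp, h⟩, fun h => h.2⟩
    | node l r =>
      rw [node_mem_treeSet]
      simp only [mem_image, mem_filter, reduceCtorEq, and_false, exists_false,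
        false_or, mem_sigma, mem_product, mem_trees, mem_powerset,
        node.injEq, Sigma.exists, Prod.exists]
      constructor
      · rintro ⟨K, h1, h2, h3, h4, h5⟩
        exact ⟨K, l, r, ⟨⟨h1, h2, h3⟩, h4, h5⟩, rfl, rfl⟩
      · rintro ⟨K, l', r', ⟨⟨h1, h2, h3⟩, h4, h5⟩, rfl, rfl⟩
        exact ⟨K, h1, h2, h3, h4, h5⟩
  rw [hsplit, sum_union, sum_image (fun _ _ _ _ h => leaf.inj h),
    sum_image hinj, sum_sigma]
  · simp only [sum_product]
  · rw [disjoint_left]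
    simp only [mem_image]
    rintro _ ⟨i, -, rfl⟩ ⟨x, -, h⟩
    exact CTree.noConfusion rfl (heq_of_eq h)

open Classical in
lemma curveCount_eq (J : Finset ι) :
    curveCount J u c = ∑ T ∈ trees J, if ∃ P, T.Through u c P then T.mult u else 0 := by
  rw [curveCount, ← sum_filter, ← finsum_mem_coe_finset]
  refine finsum_mem_congr ?_ fun _ _ => rfl
  ext T
  simp only [coe_filter, mem_trees, treeSet, Set.mem_ofPred_eq, and_assoc]

open Classical in
/-- The number of trees whose outgoing edge contains `P`. -/
def throughCount (u : ι → ℤ²) (c : ι → ℝ) (J : Finset ι) (P : ℝ²) : ℕ :=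
  ∑ T ∈ trees J, if T.Through u c P then T.mult u else 0

end TreeCount

section SweepTrees

variable {ι : Type} [Fintype ι] [DecidableEq ι] {u : ι → ℤ²} {c : ι → ℝ} {α : ℝ²}

lemma sweepPt_time (hα : 0 < α.1 ^ 2 + α.2 ^ 2) (s x : ℝ) :
    α.1 * (sweepPt α s x).1 + α.2 * (sweepPt α s x).2 = s := by
  simp only [sweepPt]; field_simp; ring

lemma eq_sweepPt (hα : 0 < α.1 ^ 2 + α.2 ^ 2) (P : ℝ²) :
    P = sweepPt α (α.1 * P.1 + α.2 * P.2) (α.1 * P.2 - α.2 * P.1) := by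
  ext <;> simp only [sweepPt] <;> field_simp <;> ring

lemma det2_sweepPt {v : ℤ²} (hv : 0 < alpha α v) (d s : ℝ) :
    det2 (vecR v) (sweepPt α s (sweepPos α v d s)) = d := by
  have hD := norm_pos_of_alpha hv
  have h2 : sweepPos α v d s * alpha α v = (α.1 ^ 2 + α.2 ^ 2) * d + chi α v * s :=
    div_mul_cancel₀ _ hv.ne'
  simp only [alpha, chi] at h2
  simp only [det2, vecR, sweepPt]
  field_simp
  linear_combination h2

lemma eq_sweepPt_of_det2 {v : ℤ²} (hv : 0 < alpha α v) {d : ℝ} {P : ℝ²}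
    (h : det2 (vecR v) P = d) :
    P = sweepPt α (α.1 * P.1 + α.2 * P.2) (sweepPos α v d (α.1 * P.1 + α.2 * P.2)) ∧
    sweepPos α v d (α.1 * P.1 + α.2 * P.2) = α.1 * P.2 - α.2 * P.1 := by
  have hD := norm_pos_of_alpha hv
  have : sweepPos α v d (α.1 * P.1 + α.2 * P.2) = α.1 * P.2 - α.2 * P.1 := by
    rw [sweepPos, div_eq_iff hv.ne', ← h]
    simp only [det2, vecR, alpha, chi]; ring
  rw [this]
  exact ⟨eq_sweepPt hD P, rfl⟩

lemma sweepPt_add {v : ℤ²} (hv : 0 < alpha α v) (d s t : ℝ) :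
    sweepPt α s (sweepPos α v d s) =
      sweepPt α t (sweepPos α v d t) + ((s - t) / alpha α v) • vecR v := by
  have hD := norm_pos_of_alpha hv
  have hv' := hv.ne'
  have e1 : α.1 * v.1 + α.2 * v.2 = alpha α v := rfl
  ext
  · simp only [sweepPt, sweepPos, vecR, fst_add, smul_fst, smul_eq_mul]
    field_simp
    simp only [alpha, chi]; ring
  · simp only [sweepPt, sweepPos, vecR, snd_add, smul_snd, smul_eq_mul]
    field_simp
    simp only [alpha, chi]; ring

/-- The point at time `s` of the edge carrying the legs `J`. -/
def legPt (α : ℝ²) (u : ι → ℤ²) (c : ι → ℝ) (J : Finset ι) (s : ℝ) : ℝ² :=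
  sweepPt α s (legPos α u c J s)

lemma through_node_iff (hα : ∀ i, 0 < alpha α (u i)) {J K : Finset ι} (hKJ : K ⊆ J)
    (hK : K.Nonempty) (hL : (J \ K).Nonempty) {l r : CTree ι} (hl : l ∈ treeSet K)
    (hr : r ∈ treeSet (J \ K)) (s : ℝ) :
    (node l r).Through u c (legPt α u c J s) ↔
      0 < det2 σ(u,K) σ(u,J \ K) ∧
      crossTime α σ(u,K) σ(u,J \ K) σ(c,K) σ(c,J \ K) < s ∧
      l.Through u c (legPt α u c K
        (crossTime α σ(u,K) σ(u,J \ K) σ(c,K) σ(c,J \ K))) ∧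
      r.Through u c (legPt α u c (J \ K)
        (crossTime α σ(u,K) σ(u,J \ K) σ(c,K) σ(c,J \ K))) := by
  have hKp := alpha_sum_pos hα hK
  have hLp := alpha_sum_pos hα hL
  have hJp := alpha_sum_pos hα (hK.mono hKJ)
  have hD := norm_pos_of_alpha hKp
  have hdis : Disjoint K (J \ K) := disjoint_sdiff
  have hu := union_sdiff_of_subset hKJ
  have huJ : σ(u,K) + σ(u,J \ K) = ∑ i ∈ J, u i := by rw [← sum_union hdis, hu]
  have hcJ : σ(c,K) + σ(c,J \ K) = ∑ i ∈ J, c i := by rw [← sum_union hdis, hu]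
  simp only [Through, vec_eq, sum_leaves hl, sum_leaves hr, huJ]
  refine and_congr_right fun hdet => ?_
  have hne : slope α σ(u,K) ≠ slope α σ(u,J \ K) := fun he => hdet.ne'
    ((slope_eq_iff hKp hLp).1 he)
  generalize ht : crossTime α σ(u,K) σ(u,J \ K) σ(c,K)
    σ(c,J \ K) = t
  have hpos := (sweepPos_eq_iff hne).2 ht
  have hposJ := sweepPos_add hKp hLp hpos
  rw [huJ, hcJ] at hposJ
  have e1 : legPt α u c (J \ K) t = legPt α u c K t := by simp only [legPt, legPos]; rw [← hpos]
  have e2 : legPt α u c J t = legPt α u c K t := by simp only [legPt, legPos]; rw [hposJ]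
  rw [e1]
  constructor
  · rintro ⟨Q, s', h1, h2, hs', hP⟩
    have d1 := h1.det2_eq
    have d2 := h2.det2_eq
    rw [vec_eq, sum_leaves hl, sum_leaves hl] at d1
    rw [vec_eq, sum_leaves hr, sum_leaves hr] at d2
    obtain ⟨g1, g2⟩ := eq_sweepPt_of_det2 hKp d1
    obtain ⟨g3, g4⟩ := eq_sweepPt_of_det2 hLp d2
    have ht' : t = α.1 * Q.1 + α.2 * Q.2 := by
      rw [← ht]; exact (sweepPos_eq_iff hne).1 (g2.trans g4.symm)
    have hQ : Q = legPt α u c K t := by rw [ht']; exact g1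
    refine ⟨?_, hQ ▸ h1, hQ ▸ h2⟩
    have h3 : α.1 * (legPt α u c J s).1 + α.2 * (legPt α u c J s).2 = s := sweepPt_time hD _ _
    rw [hP] at h3
    have h4 : s = t + s' * alpha α σ(u,J) := by
      rw [← h3, ht']
      simp only [alpha, vecR, fst_add, snd_add, smul_fst, smul_snd, smul_eq_mul]
      ring
    rw [h4]
    have := mul_pos hs' hJp
    linarith
  · rintro ⟨hlt, h1, h2⟩
    refine ⟨_, (s - t) / alpha α σ(u,J), h1, h2, div_pos (by linarith) hJp, ?_⟩
    rw [← e2]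
    exact sweepPt_add hJp _ _ _

lemma isBirthCount_throughCount (hα : ∀ i, 0 < alpha α (u i)) :
    IsBirthCount α u c fun J s => throughCount u c J (legPt α u c J s) := by
  classical
  intro J s hJ
  simp only
  rw [throughCount, sum_trees]
  congr 1
  · by_cases h : J.card = 1
    · obtain ⟨i, rfl⟩ := card_eq_one.1 h
      have : (filter (fun j => ({i} : Finset ι) = {j}) {i}) = {i} := by ext j; simp [eq_comm]
      have hT : (leaf i).Through u c (legPt α u c {i} s) := by
        simpa [Through, legPt, legPos] using det2_sweepPt (hα i) (c i) s
      rw [this, sum_singleton, if_pos hT, if_pos h, mult]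
    · rw [if_neg h]
      refine sum_eq_zero fun i hi => ?_
      rw [(mem_filter.1 hi).2] at h; simp at h
  · rw [sum_filter, sum_filter]
    refine sum_congr rfl fun K hK => ?_
    rw [mem_powerset] at hK
    by_cases h : K.Nonempty ∧ (J \ K).Nonempty
    · rw [if_pos h]
      have hiff : ∀ l ∈ trees K, ∀ r ∈ trees (J \ K), _ := fun l hl r hr =>
        through_node_iff (c := c) hα hK h.1 h.2 (mem_trees.1 hl) (mem_trees.1 hr) s
      generalize crossTime α σ(u,K) σ(u,J \ K) σ(c,K)
        σ(c,J \ K) = t at *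
      by_cases h' : 0 < det2 σ(u,K) σ(u,J \ K) ∧ t < s
      · rw [if_pos ⟨h.1, h.2, h'⟩, throughCount, throughCount, mul_assoc, sum_mul_sum,
          mul_sum]
        refine sum_congr rfl fun l hl => ?_
        rw [mul_sum]
        refine sum_congr rfl fun r hr => ?_
        simp only [hiff l hl r hr, h'.1, h'.2, true_and]
        simp only [mult, vec_eq, sum_leaves (mem_trees.1 hl), sum_leaves (mem_trees.1 hr)]
        split_ifs <;> simp_all
        ring
      · rw [if_neg (by tauto)]
        refine sum_eq_zero fun l hl => sum_eq_zero fun r hr => ?_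
        rw [if_neg]
        rw [hiff l hl r hr]; tauto
    · rw [if_neg h, if_neg (by tauto)]

end SweepTrees

end

section

open Finset List Filter

section VertexTheorem

variable {ι : Type} [Fintype ι] [DecidableEq ι] {u : ι → ℤ²} {c : ι → ℝ} {α : ℝ²}
  {R : Type} [Ring R] {A : Finset ι → R}

lemma noTriplePoint_of_generic (hα : ∀ i, 0 < alpha α (u i))
    (hc : GenericDispl univ u c) : NoTriplePoint α u c := by
  intro J K L hJ hK hL hJK hJL hKL hd s h1 h2
  have e : ∀ M : Finset ι, M.Nonempty → legPos α u c M s = legPos α u c J s →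
      det2 (vecR σ(u,M)) (legPt α u c J s) = ∑ i ∈ M, c i := by
    intro M hM h
    rw [legPt, ← h]
    exact det2_sweepPt (alpha_sum_pos hα hM) _ _
  exact hc J K L (subset_univ _) (subset_univ _) (subset_univ _) hJ hK hL hJK
    hJL hKL hd _ (e J hJ rfl) (e K hK h1.symm) (e L hL h2)

lemma eventually_atTop_throughCount (hα : ∀ i, 0 < alpha α (u i)) :
    ∀ᶠ s in atTop, ∀ J : Finset ι, J.Nonempty →
      throughCount u c J (legPt α u c J s) = curveCount J u c := by
  classical
  rw [eventually_all]; intro J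
  by_cases hJ : J.Nonempty
  swap
  · exact .of_forall fun s h => absurd h hJ
  have key : ∀ T ∈ trees J, ∀ᶠ s in atTop,
      (T.Through u c (legPt α u c J s) ↔ ∃ P, T.Through u c P) := by
    intro T hT
    by_cases hP : ∃ P, T.Through u c P
    · obtain ⟨P, hP⟩ := hP
      have hline := hP.det2_eq
      rw [CTree.vec_eq, sum_leaves (mem_trees.1 hT), sum_leaves (mem_trees.1 hT)] at hline
      obtain ⟨g1, -⟩ := eq_sweepPt_of_det2 (alpha_sum_pos hα hJ) hline
      have hP' : T.Through u c (legPt α u c J (α.1 * P.1 + α.2 * P.2)) := by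
        have : P = legPt α u c J (α.1 * P.1 + α.2 * P.2) := g1
        rwa [← this]
      filter_upwards [eventually_ge_atTop (α.1 * P.1 + α.2 * P.2)] with s hs
      refine ⟨fun h => ⟨_, h⟩, fun _ => ?_⟩
      cases T with
      | leaf i =>
        obtain rfl := leaf_mem_treeSet.1 (mem_trees.1 hT)
        simpa [CTree.Through, legPt, legPos] using det2_sweepPt (hα i) (c i) s
      | node l r =>
        obtain ⟨K, h1, h2, h3, h4, h5⟩ := node_mem_treeSet.1 (mem_trees.1 hT)
        rw [through_node_iff hα h1 h2 h3 h4 h5] at hP' ⊢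
        exact ⟨hP'.1, hP'.2.1.trans_le hs, hP'.2.2⟩
    · exact .of_forall fun s => ⟨fun h => ⟨_, h⟩, fun h => absurd h hP⟩
  filter_upwards [(eventually_all_finset _).2 key] with s hs _
  rw [throughCount, curveCount_eq]
  refine sum_congr rfl fun T hT => ?_
  simp only [hs T hT]

lemma eventually_atTop_legPos (α : ℝ²) (u : ι → ℤ²) (c : ι → ℝ) :
    ∀ᶠ s in atTop, ∀ J K : Finset ι,
      slope α σ(u,J) < slope α σ(u,K) → legPos α u c J s < legPos α u c K s := by
  rw [eventually_all]; intro J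
  rw [eventually_all]; intro K
  by_cases h : slope α σ(u,J) < slope α σ(u,K)
  · have h' := sub_pos.2 h
    filter_upwards [eventually_gt_atTop
      (((α.1 ^ 2 + α.2 ^ 2) * σ(c,J) / alpha α σ(u,J) -
        (α.1 ^ 2 + α.2 ^ 2) * σ(c,K) / alpha α σ(u,K)) /
        (slope α σ(u,K) - slope α σ(u,J)))] with s hs _
    rw [div_lt_iff₀ h'] at hs
    simp only [legPos, sweepPos_eq]
    linarith
  · exact .of_forall fun s hs => absurd hs h

lemma eventually_atBot_legPos (α : ℝ²) (u : ι → ℤ²) (c : ι → ℝ) :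
    ∀ᶠ s in atBot, ∀ J K : Finset ι,
      slope α σ(u,J) < slope α σ(u,K) → legPos α u c K s < legPos α u c J s := by
  rw [eventually_all]; intro J
  rw [eventually_all]; intro K
  by_cases h : slope α σ(u,J) < slope α σ(u,K)
  · have h' := sub_pos.2 h
    filter_upwards [eventually_lt_atBot
      (((α.1 ^ 2 + α.2 ^ 2) * σ(c,J) / alpha α σ(u,J) -
        (α.1 ^ 2 + α.2 ^ 2) * σ(c,K) / alpha α σ(u,K)) /
        (slope α σ(u,K) - slope α σ(u,J)))] with s hs _
    rw [lt_div_iff₀ h'] at hs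
    simp only [legPos, sweepPos_eq]
    linarith
  · exact .of_forall fun s hs => absurd hs h

lemma eventually_atBot_birthCount {f : Finset ι → ℝ → ℕ} (hf : IsBirthCount α u c f) :
    ∀ᶠ s in atBot, ∀ J : Finset ι, J.Nonempty → f J s = if J.card = 1 then 1 else 0 := by
  have h1 : ∀ᶠ s in atBot, ∀ J K : Finset ι, s <
      crossTime α σ(u,K) σ(u,J \ K) σ(c,K) σ(c,J \ K) := by
    rw [eventually_all]; intro J
    rw [eventually_all]; intro K
    exact eventually_lt_atBot _
  filter_upwards [h1] with s hs J hJ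
  rw [hf J s hJ]
  refine (add_eq_left (a := if J.card = 1 then 1 else 0)).2 (sum_eq_zero fun K hK => ?_)
  exact absurd (mem_filter.1 hK).2.2.2.2 (hs J K).not_gt

lemma prod_map_filter_of_eq_one {β : Type} {M : Type} [Monoid M] (F : β → M) (p : β → Prop)
    [DecidablePred p] : ∀ l : List β, (∀ x ∈ l, ¬ p x → F x = 1) →
      (l.map F).prod = ((l.filter p).map F).prod
  | [], _ => by simp
  | x :: t, h => by
    have ih := prod_map_filter_of_eq_one F p t fun y hy => h y (.tail _ hy)
    by_cases hx : p x
    · rw [List.filter_cons_of_pos (by simpa using hx)]; simp [ih]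
    · rw [List.filter_cons_of_neg (by simpa using hx)]
      simp [ih, h x (.head _) hx]

/-- The product of the incoming elements in one order equals the product, in the opposite order, of
the outgoing elements, which are weighted by counts of trivalent trees. -/
lemma vertex_factorization (hα : ∀ i, 0 < alpha α (u i)) (hA : IsLegSystem u A)
    (hc : GenericDispl univ u c) {l : List ι} (hl : l.Perm univ.toList)
    (hls : l.Pairwise fun i j => 0 ≤ det2 (u i) (u j)) {l' : List (Finset ι)}
    (hl' : l'.Perm (legSets ι))
    (hls' : l'.Pairwise fun J K => det2 σ(u,J) σ(u,K) ≤ 0) :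
    (l.map fun i => 1 + A {i}).prod = (l'.map fun J => 1 + curveCount J u c • A J).prod := by
  have hf := isBirthCount_throughCount (u := u) (c := c) hα
  have hcst := sweepProd_eq hα hA hf (noTriplePoint_of_generic hα hc)
  obtain ⟨s, hs1, hs2⟩ := ((eventually_atBot_birthCount hf).and
    (eventually_atBot_legPos α u c)).exists
  obtain ⟨t, ht1, ht2⟩ := ((eventually_atTop_throughCount (c := c) hα).and
    (eventually_atTop_legPos α u c)).exists
  have e1 : sweepProd α u c (fun J s => throughCount u c J (legPt α u c J s)) A t =
      (l'.map fun J => 1 + curveCount J u c • A J).prod := by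
    unfold sweepProd
    have : ((sortBy (legKey α u c t) (legSets ι)).map fun J =>
        1 + throughCount u c J (legPt α u c J t) • A J) =
        ((sortBy (legKey α u c t) (legSets ι)).map fun J => 1 + curveCount J u c • A J) := by
      refine map_congr_left fun J hJ => ?_
      rw [(sortBy_perm _ _).mem_iff, mem_legSets] at hJ
      rw [ht1 J hJ]
    rw [this]
    refine prod_eq_of_perm_of_pairwise _ ((sortBy_perm _ _).trans hl'.symm) (sortBy_pairwise _ _)
      hls' fun J hJ K hK h h' => ?_
    rw [(sortBy_perm _ _).mem_iff, mem_legSets] at hJ hK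
    refine commute_factor hα hA hJ hK ?_ _ _
    have h1 : slope α σ(u,J) ≤ slope α σ(u,K) := by
      rw [slope_le_iff (alpha_sum_pos hα hJ) (alpha_sum_pos hα hK), det2_swap]; omega
    refine h1.antisymm ?_
    by_contra! hlt
    have := ht2 J K hlt
    rcases legKey_le_iff.1 h with h2 | ⟨h2, -⟩ <;> linarith
  have e2 : sweepProd α u c (fun J s => throughCount u c J (legPt α u c J s)) A s =
      (l.map fun i => 1 + A {i}).prod := by
    unfold sweepProd
    rw [prod_map_filter_of_eq_one _ (fun J : Finset ι => J.card = 1)]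
    · have e3 : (l.map fun i => 1 + A {i}) =
          ((l.map fun i => ({i} : Finset ι)).map fun J => 1 + A J) := by rw [List.map_map]; rfl
      have e4 : (((sortBy (legKey α u c s) (legSets ι)).filter fun J => J.card = 1).map fun J =>
          1 + throughCount u c J (legPt α u c J s) • A J) =
          ((sortBy (legKey α u c s) (legSets ι)).filter fun J => J.card = 1).map fun J =>
            1 + A J := by
        refine map_congr_left fun J hJ => ?_
        rw [List.mem_filter] at hJ
        have hJ' : J.card = 1 := by simpa using hJ.2
        have := hs1 J (card_pos.1 (by omega))
        rw [this, if_pos hJ', one_smul]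
      rw [e3, e4]
      refine prod_eq_of_perm_of_pairwise (r := fun J K => legKey α u c s J ≤ legKey α u c s K)
        (r' := fun J K => 0 ≤ det2 σ(u,J) σ(u,K)) _ ?_
        ((sortBy_pairwise _ _).filter _) ?_ ?_
      · refine ((sortBy_perm _ _).filter _).trans
          ((perm_ext_iff_of_nodup (nodup_legSets.filter _) ?_).2 fun J => ?_)
        · exact (hl.nodup_iff.2 (nodup_toList _)).map singleton_injective
        · simp only [List.mem_filter, mem_legSets, decide_eq_true_eq, List.mem_map, hl.mem_iff,
            mem_toList, mem_univ, true_and, card_eq_one]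
          constructor
          · rintro ⟨-, i, rfl⟩; exact ⟨i, rfl⟩
          · rintro ⟨i, rfl⟩; exact ⟨singleton_nonempty i, i, rfl⟩
      · rw [pairwise_map]
        simpa using hls
      · intro J hJ K hK h h'
        simp only [List.mem_filter, (sortBy_perm _ _).mem_iff, mem_legSets] at hJ hK
        have := commute_factor hα hA hJ.1 hK.1 ?_ 1 1
        · simpa using this
        rw [← slope_le_iff (alpha_sum_pos hα hK.1) (alpha_sum_pos hα hJ.1)] at h'
        refine le_antisymm ?_ h'
        by_contra! hlt
        have := hs2 K J hlt
        rcases legKey_le_iff.1 h with h2 | ⟨h2, -⟩ <;> linarith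
    · intro J hJ hJ1
      rw [(sortBy_perm _ _).mem_iff, mem_legSets] at hJ
      have := hs1 J hJ
      beta_reduce
      rw [this, if_neg hJ1, zero_smul, add_zero]
  rw [← e1, ← e2]
  exact hcst _ _

end VertexTheorem

end

section

open Finset AddMonoidAlgebra

/-- Square-free polynomials in variables indexed by `ι` whose squares are zero, with coefficients in
a ring that need not be commutative. The value at `A` is the coefficient of the monomial `A`. -/
structure SF (ι R : Type) : Type where
  coeff : Finset ι → R

namespace SF

variable {ι R : Type} [DecidableEq ι] [Ring R]

lemma ext {f g : SF ι R} (h : ∀ A, f.coeff A = g.coeff A) : f = g := by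
  cases f; cases g; congr; exact funext h

/-- Square-free polynomials as families of coefficients. -/
def equivFun : SF ι R ≃ (Finset ι → R) := ⟨coeff, mk, fun _ => rfl, fun _ => rfl⟩

instance : AddCommGroup (SF ι R) := equivFun.addCommGroup

instance {S : Type} [Field S] [Module S R] : SMul S (SF ι R) := ⟨fun s f => ⟨s • f.coeff⟩⟩

@[simp] lemma add_coeff (f g : SF ι R) (A : Finset ι) : (f + g).coeff A = f.coeff A + g.coeff A :=
  rfl
@[simp] lemma neg_coeff (f : SF ι R) (A : Finset ι) : (-f).coeff A = -f.coeff A := rfl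
@[simp] lemma zero_coeff (A : Finset ι) : (0 : SF ι R).coeff A = 0 := rfl
@[simp] lemma smul_coeff {S : Type} [Field S] [Module S R] (s : S) (f : SF ι R)
    (A : Finset ι) : (s • f).coeff A = s • f.coeff A := rfl

lemma sum_coeff {κ : Type} (s : Finset κ) (f : κ → SF ι R) (A : Finset ι) :
    σ(f,s).coeff A = ∑ i ∈ s, (f i).coeff A :=
  map_sum (⟨⟨fun f : SF ι R => f.coeff A, rfl⟩, fun _ _ => rfl⟩ : SF ι R →+ R) f s

lemma nsmul_coeff (n : ℕ) (f : SF ι R) (A : Finset ι) : (n • f).coeff A = n • f.coeff A :=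
  map_nsmul (⟨⟨fun f : SF ι R => f.coeff A, rfl⟩, fun _ _ => rfl⟩ : SF ι R →+ R) n f

instance : Mul (SF ι R) := ⟨fun f g => ⟨fun A => ∑ B ∈ A.powerset, f.coeff B * g.coeff (A \ B)⟩⟩

lemma mul_coeff (f g : SF ι R) (A : Finset ι) :
    (f * g).coeff A = ∑ B ∈ A.powerset, f.coeff B * g.coeff (A \ B) := rfl

instance : One (SF ι R) := ⟨⟨fun A => if A = ∅ then 1 else 0⟩⟩

lemma one_coeff (A : Finset ι) : (1 : SF ι R).coeff A = if A = ∅ then 1 else 0 := rfl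

lemma mul_assoc' (f g h : SF ι R) : f * g * h = f * (g * h) := by
  refine ext fun A => ?_
  simp only [mul_coeff, sum_mul, mul_sum]
  rw [sum_sigma', sum_sigma']
  refine sum_bij' (fun x _ => ⟨x.2, x.1 \ x.2⟩) (fun x _ => ⟨x.1 ∪ x.2, x.1⟩) ?_ ?_ ?_ ?_ ?_
  · rintro ⟨B, C⟩ hx
    simp only [mem_sigma, mem_powerset] at hx ⊢
    exact ⟨hx.2.trans hx.1, sdiff_subset_sdiff hx.1 le_rfl⟩
  · rintro ⟨C, D⟩ hx
    simp only [mem_sigma, mem_powerset] at hx ⊢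
    exact ⟨union_subset hx.1 (hx.2.trans sdiff_subset), subset_union_left⟩
  · rintro ⟨B, C⟩ hx
    simp only [mem_sigma, mem_powerset] at hx
    simp [union_sdiff_of_subset hx.2]
  · rintro ⟨C, D⟩ hx
    simp only [mem_sigma, mem_powerset] at hx
    have : Disjoint C D := (disjoint_sdiff.mono_right hx.2)
    simp [union_sdiff_cancel_left this]
  · rintro ⟨B, C⟩ hx
    simp only [mem_sigma, mem_powerset] at hx
    simp only
    have : (A \ C) \ (B \ C) = A \ B := by
      ext i
      simp only [mem_sdiff]
      have := @hx.2 i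
      tauto
    rw [this, mul_assoc]

instance : Ring (SF ι R) :=
  { (inferInstance : AddCommGroup (SF ι R)), (inferInstance : Mul (SF ι R)),
    (inferInstance : One (SF ι R)) with
    mul_assoc := mul_assoc'
    one_mul := fun f => by
      refine ext fun A => ?_
      rw [mul_coeff, sum_eq_single ∅]
      · simp [one_coeff]
      · intro B _ hB; simp [one_coeff, hB]
      · simp
    mul_one := fun f => by
      refine ext fun A => ?_
      rw [mul_coeff, sum_eq_single A]
      · simp [one_coeff]
      · intro B hB hne
        rw [mem_powerset] at hB
        rw [one_coeff, if_neg, mul_zero]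
        rw [sdiff_eq_empty_iff_subset]
        exact fun h => hne (hB.antisymm h)
      · simp
    left_distrib := fun f g h => by
      refine ext fun A => ?_; simp [mul_coeff, mul_add, sum_add_distrib]
    right_distrib := fun f g h => by
      refine ext fun A => ?_; simp [mul_coeff, add_mul, sum_add_distrib]
    zero_mul := fun f => by refine ext fun A => ?_; simp [mul_coeff]
    mul_zero := fun f => by refine ext fun A => ?_; simp [mul_coeff] }

lemma sum_powerset_compl {M : Type} [AddCommMonoid M] (A : Finset ι)
    (f : Finset ι → Finset ι → M) :
    ∑ B ∈ A.powerset, f B (A \ B) = ∑ B ∈ A.powerset, f (A \ B) B := by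
  refine sum_bij' (fun B _ => A \ B) (fun B _ => A \ B) ?_ ?_ ?_ ?_ ?_ <;>
    simp +contextual [mem_powerset]

instance {S : Type} [CommRing S] : CommRing (SF ι S) :=
  { (inferInstance : Ring (SF ι S)) with
    mul_comm := fun f g => by
      refine ext fun A => ?_
      rw [mul_coeff, mul_coeff, sum_powerset_compl A fun B D => f.coeff B * g.coeff D]
      exact sum_congr rfl fun B _ => mul_comm _ _ }

lemma mul_empty (f g : SF ι R) : (f * g).coeff ∅ = f.coeff ∅ * g.coeff ∅ := by simp [mul_coeff]

/-- The monomial `A` with a coefficient. -/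
def single (A : Finset ι) (r : R) : SF ι R := ⟨fun B => if B = A then r else 0⟩

lemma single_coeff (A B : Finset ι) (r : R) : (single A r).coeff B = if B = A then r else 0 := rfl

lemma single_mul_single (A B : Finset ι) (r s : R) :
    single A r * single B s = if Disjoint A B then single (A ∪ B) (r * s) else 0 := by
  refine ext fun C => ?_
  rw [mul_coeff]
  split_ifs with h
  · rw [single_coeff]
    split_ifs with hC
    · subst hC
      rw [sum_eq_single A]
      · simp [single_coeff, union_sdiff_cancel_left h]
      · intro D _ hD; simp [single_coeff, hD]
      · intro hA; exact absurd (mem_powerset.2 subset_union_left) hA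
    · refine sum_eq_zero fun D hD => ?_
      rw [mem_powerset] at hD
      rw [single_coeff, single_coeff]
      split_ifs with h1 h2 <;> try simp
      subst h1
      exact absurd (by rw [← h2, union_sdiff_of_subset hD]) hC
  · refine sum_eq_zero fun D hD => ?_
    rw [mem_powerset] at hD
    rw [single_coeff, single_coeff]
    split_ifs with h1 h2 <;> try simp
    subst h1 h2
    exact absurd disjoint_sdiff h

/-- Constants. -/
def C : R →+* SF ι R where
  toFun r := single ∅ r
  map_one' := rfl
  map_mul' r s := by rw [single_mul_single]; simp
  map_zero' := by refine ext fun A => ?_; simp [single_coeff]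
  map_add' r s := by
    refine ext fun A => ?_
    simp only [single_coeff, add_coeff]
    split_ifs <;> simp

lemma C_apply (r : R) : (C r : SF ι R) = single ∅ r := rfl

lemma single_mul_C (A : Finset ι) (r s : R) : single A r * C s = single A (r * s) := by
  rw [C_apply, single_mul_single]; simp

/-- Change of coefficients. -/
def map {S : Type} [Ring S] (φ : S →+* R) : SF ι S →+* SF ι R where
  toFun f := ⟨fun A => φ (f.coeff A)⟩
  map_one' := by refine ext fun A => ?_; simp only [one_coeff]; split_ifs <;> simp
  map_mul' f g := by refine ext fun A => ?_; simp [mul_coeff]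
  map_zero' := by refine ext fun A => ?_; simp
  map_add' f g := by refine ext fun A => ?_; simp

lemma map_coeff {S : Type} [Ring S] (φ : S →+* R) (f : SF ι S) (A : Finset ι) :
    (map φ f).coeff A = φ (f.coeff A) := rfl

lemma map_single {S : Type} [Ring S] (φ : S →+* R) (A : Finset ι) (s : S) :
    map φ (single A s) = single A (φ s) := by
  refine ext fun B => ?_; simp only [map_coeff, single_coeff]; split_ifs <;> simp

lemma commute_map {S : Type} [CommRing S] [Algebra S R] (f : SF ι S) (g : SF ι R) :
    Commute (map (algebraMap S R) f) g := by
  refine ext fun A => ?_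
  rw [mul_coeff, mul_coeff, sum_powerset_compl A fun B D => (map (algebraMap S R) f).coeff B * g.coeff D]
  exact sum_congr rfl fun B _ => by rw [map_coeff]; exact Algebra.commutes _ _

lemma prod_single {κ S : Type} [DecidableEq κ] [CommRing S] (J : Finset κ) (a : κ → Finset ι)
    (x : κ → S) (h : (J : Set κ).PairwiseDisjoint a) :
    ∏ i ∈ J, single (a i) (x i) = single (J.biUnion a) (∏ i ∈ J, x i) := by
  induction J using Finset.induction_on with
  | empty => rfl
  | insert i s hi ih =>
    rw [prod_insert hi, ih (h.subset (by simp)), single_mul_single, if_pos,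
      biUnion_insert, prod_insert hi]
    rw [disjoint_biUnion_right]
    intro j hj
    exact h (by simp) (by simp [hj]) (fun hij => hi (hij ▸ hj))

end SF

lemma isLegSystem_of_square_zero {ι R Q : Type} [DecidableEq ι] [Ring R] [CommRing Q]
    {u : ι → ℤ²} (E : ℤ² → R)
    (hE : ∀ v w, E v * E w - E w * E v = det2 v w • E (v + w)) (κ : Q →+* R)
    (hκ : ∀ q r, Commute (κ q) r) (η : ι → Q) (hη : ∀ i, η i * η i = 0) :
    IsLegSystem u fun J => κ (∏ i ∈ J, η i) * E σ(u,J) where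
  bracket J K h := by
    rw [prod_union h, sum_union h, map_mul, ← mul_smul_comm, ← hE]
    have h1 := (hκ (∏ i ∈ J, η i) (E σ(u,K))).eq
    have h2 := (hκ (∏ i ∈ K, η i) (E σ(u,J))).eq
    have h3 := (hκ (∏ i ∈ J, η i) (κ (∏ i ∈ K, η i))).eq
    rw [mul_sub]
    congr 1
    · rw [mul_assoc, ← mul_assoc (E _) (κ _), ← h2]; noncomm_ring
    · rw [mul_assoc, ← mul_assoc (E _) (κ _), ← h1, h3]; noncomm_ring
  mul_eq_zero J K h := by
    rw [not_disjoint_iff] at h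
    obtain ⟨i, hJ, hK⟩ := h
    have h2 := (hκ (∏ i ∈ K, η i) (E σ(u,J))).eq
    have h3 : (∏ i ∈ J, η i) * ∏ i ∈ K, η i = 0 := by
      rw [← mul_prod_erase _ _ hJ, ← mul_prod_erase _ _ hK, mul_mul_mul_comm, hη,
        zero_mul]
    calc κ (∏ i ∈ J, η i) * E σ(u,J) * (κ (∏ i ∈ K, η i) * E σ(u,K))
        = κ (∏ i ∈ J, η i) * (E σ(u,J) * κ (∏ i ∈ K, η i)) * E σ(u,K) := by noncomm_ring
      _ = κ ((∏ i ∈ J, η i) * ∏ i ∈ K, η i) * (E σ(u,J) * E σ(u,K)) := by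
          rw [← h2, map_mul]; noncomm_ring
      _ = 0 := by rw [h3, map_zero, zero_mul]

/-- The linear operator `z ^ q ↦ φ q * z ^ q`. -/
def mulOp (φ : ℤ² → Laurent) : Module.End ℂ Laurent :=
  (Finsupp.lsum ℂ fun q => (LinearMap.mulLeft ℂ (φ q)).comp
    (lsingle (R := ℂ) q)).comp
    (coeffLinearEquiv ℂ).toLinearMap

lemma mulOp_apply (φ : ℤ² → Laurent) (g : Laurent) :
    mulOp φ g = g.coeff.sum fun q c => φ q * single q c := rfl

lemma mulOp_single (φ : ℤ² → Laurent) (q : ℤ²) (c : ℂ) :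
    mulOp φ (single q c) = φ q * single q c := by
  rw [mulOp_apply, coeff_single, Finsupp.sum_single_index]
  simp

lemma end_ext {f g : Module.End ℂ Laurent}
    (h : ∀ q, f (single q 1) = g (single q 1)) : f = g := by
  refine lhom_ext' fun q => LinearMap.ext_ring ?_
  exact h q

/-- The derivation `z ^ q ↦ det (v, q) z ^ (q + v)`. -/
def derOp (v : ℤ²) : Module.End ℂ Laurent :=
  mulOp fun q => single v ((det2 v q : ℤ) : ℂ)

lemma derOp_single (v q : ℤ²) (c : ℂ) : derOp v (single q c) =
    single (v + q) (((det2 v q : ℤ) : ℂ) * c) := by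
  rw [derOp, mulOp_single, single_mul_single]

lemma derOp_bracket (v w : ℤ²) :
    derOp v * derOp w - derOp w * derOp v = det2 v w • derOp (v + w) := by
  refine end_ext fun q => ?_
  rw [LinearMap.sub_apply, Module.End.mul_apply, Module.End.mul_apply, LinearMap.smul_apply,
    derOp_single, derOp_single, derOp_single, derOp_single, derOp_single, ← add_assoc, ← add_assoc,
    add_comm w v]
  refine ext (Finsupp.ext fun r => ?_)
  rw [coeff_sub, coeff_smul, Finsupp.sub_apply,
    Finsupp.smul_apply]
  simp only [coeff_single, Finsupp.single_apply]
  split_ifs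
  · simp only [det2, zsmul_eq_mul, Prod.fst_add, Prod.snd_add]
    push_cast
    ring
  · simp

lemma derOp_ne_zero {v : ℤ²} (hv : v ≠ 0) : derOp v ≠ 0 := by
  intro h
  have : ∃ q, det2 v q ≠ 0 := by
    by_contra! hcon
    have h1 := hcon (0, 1)
    have h2 := hcon (1, 0)
    simp only [det2, mul_one, mul_zero, sub_zero, zero_sub, neg_eq_zero] at h1 h2
    exact hv (Prod.ext h1 h2)
  obtain ⟨q, hq⟩ := this
  have h1 := congrArg (fun f => f (single q 1)) h
  simp only [derOp_single, mul_one, LinearMap.zero_apply, single_eq_zero] at h1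
  exact hq (mod_cast h1)

end

section

open Finset CTree SF Subtype

section Relabel

variable {ι κ : Type} {u : κ → ℤ²} {c : κ → ℝ}

/-- Relabelling of the incoming legs. -/
def CTree.map (f : ι → κ) : CTree ι → CTree κ
  | .leaf i => .leaf (f i)
  | .node l r => .node (l.map f) (r.map f)

lemma CTree.leaves_map (f : ι → κ) : ∀ T : CTree ι, (T.map f).leaves = T.leaves.map f
  | .leaf i => rfl
  | .node l r => by simp [map, leaves, l.leaves_map f, r.leaves_map f]

lemma CTree.vec_map (f : ι → κ) : ∀ T : CTree ι, (T.map f).vec u = T.vec (u ∘ f)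
  | .leaf i => rfl
  | .node l r => by simp [map, vec, l.vec_map f, r.vec_map f]

lemma CTree.mult_map (f : ι → κ) : ∀ T : CTree ι, (T.map f).mult u = T.mult (u ∘ f)
  | .leaf i => rfl
  | .node l r => by simp [map, mult, l.mult_map f, r.mult_map f, vec_map]

lemma CTree.through_map (f : ι → κ) : ∀ (T : CTree ι) (P : ℝ²),
    (T.map f).Through u c P ↔ T.Through (u ∘ f) (c ∘ f) P
  | .leaf i, P => Iff.rfl
  | .node l r, P => by
    simp [map, Through, l.through_map f, r.through_map f, vec_map]

lemma CTree.map_injOn {f : ι → κ} {s : Set ι} (hf : s.InjOn f) : ∀ T T' : CTree ι,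
    (∀ i ∈ T.leaves, i ∈ s) → (∀ i ∈ T'.leaves, i ∈ s) → T.map f = T'.map f → T = T'
  | .leaf i, .leaf j, h, h', he => by
    simp only [leaves, List.mem_singleton, forall_eq] at h h'
    simp only [map, leaf.injEq] at he
    rw [hf h h' he]
  | .leaf i, .node _ _, _, _, he => by simp [map] at he
  | .node _ _, .leaf _, _, _, he => by simp [map] at he
  | .node l r, .node l' r', h, h', he => by
    simp only [leaves, List.mem_append] at h h'
    simp only [map, node.injEq] at he
    rw [map_injOn hf l l' (fun i hi => h i (.inl hi)) (fun i hi => h' i (.inl hi)) he.1,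
      map_injOn hf r r' (fun i hi => h i (.inr hi)) (fun i hi => h' i (.inr hi)) he.2]

lemma CTree.exists_map_eq {f : ι → κ} {s : Set ι} : ∀ T : CTree κ,
    (∀ i ∈ T.leaves, i ∈ f '' s) → ∃ T' : CTree ι, (∀ i ∈ T'.leaves, i ∈ s) ∧ T'.map f = T
  | .leaf i, h => by
    obtain ⟨j, hj, rfl⟩ := h i (by simp [leaves])
    exact ⟨.leaf j, by simpa [leaves] using hj, rfl⟩
  | .node l r, h => by
    simp only [leaves, List.mem_append] at h
    obtain ⟨l', h1, rfl⟩ := exists_map_eq l fun i hi => h i (.inl hi)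
    obtain ⟨r', h2, rfl⟩ := exists_map_eq r fun i hi => h i (.inr hi)
    refine ⟨.node l' r', fun i hi => ?_, rfl⟩
    simp only [leaves, List.mem_append] at hi
    exact hi.elim (h1 i) (h2 i)

variable [DecidableEq ι] [DecidableEq κ]

lemma curveCount_image {f : ι → κ} {I : Finset ι} (hf : Set.InjOn f I) :
    curveCount (I.image f) u c = curveCount I (u ∘ f) (c ∘ f) := by
  rw [curveCount, curveCount]
  symm
  refine finsum_mem_eq_of_bijOn (map f) ⟨?_, ?_, ?_⟩ fun T _ => (T.mult_map f).symm
  · rintro T ⟨h1, h2, P, hP⟩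
    refine ⟨?_, fun i => ?_, P, (T.through_map f P).2 hP⟩
    · rw [leaves_map]
      exact h1.map_on fun i hi j hj => hf ((h2 i).1 hi) ((h2 j).1 hj)
    · simp [leaves_map, h2]
  · rintro T ⟨-, h2, -⟩ T' ⟨-, h2', -⟩ he
    exact map_injOn hf T T' (fun i hi => (h2 i).1 hi) (fun i hi => (h2' i).1 hi) he
  · rintro T ⟨h1, h2, P, hP⟩
    obtain ⟨T', h3, rfl⟩ := exists_map_eq (f := f) (s := I) T fun i hi => by
      simpa using (h2 i).1 hi
    refine ⟨T', ⟨?_, fun i => ⟨h3 i, fun hi => ?_⟩, P, (T'.through_map f P).1 hP⟩, rfl⟩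
    · rw [leaves_map] at h1
      exact h1.of_map
    · have : f i ∈ (T'.map f).leaves := (h2 _).2 (mem_image_of_mem f hi)
      rw [leaves_map, List.mem_map] at this
      obtain ⟨j, hj, hji⟩ := this
      rwa [← hf (h3 j hj) hi hji]

lemma GenericDispl.comp {f : ι → κ} {I : Finset ι} (hf : Set.InjOn f I)
    (h : GenericDispl (I.image f) u c) : GenericDispl I (u ∘ f) (c ∘ f) := by
  have hs : ∀ {M : Type} [AddCommMonoid M] (g : κ → M) {J : Finset ι}, J ⊆ I →
      ∑ i ∈ J, (g ∘ f) i = ∑ i ∈ J.image f, g i := fun g J hJ =>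
    (sum_image (hf.mono (mod_cast hJ))).symm
  have hd : ∀ {J K : Finset ι}, J ⊆ I → K ⊆ I → Disjoint J K →
      Disjoint (J.image f) (K.image f) := by
    intro J K hJ hK hd
    rw [disjoint_left] at hd ⊢
    simp only [mem_image]
    rintro _ ⟨i, hi, rfl⟩ ⟨j, hj, hij⟩
    exact hd hi (hf (hK hj) (hJ hi) hij ▸ hj)
  intro J K L hJ hK hL hJ0 hK0 hL0 hJK hJL hKL
  rw [hs u hJ, hs u hK, hs u hL, hs c hJ, hs c hK, hs c hL]
  exact h _ _ _ (image_subset_image hJ) (image_subset_image hK)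
    (image_subset_image hL) (hJ0.image f) (hK0.image f) (hL0.image f) (hd hJ hK hJK)
    (hd hJ hL hJL) (hd hK hL hKL)

end Relabel

lemma exists_linearIndependent_real (ι : Type) [Finite ι] :
    ∃ c : ι → ℝ, LinearIndependent ℚ c := by
  have h : Cardinal.lift.{0} (Cardinal.mk ι) ≤ Cardinal.lift.{0} (Module.rank ℚ ℝ) := by
    rw [Real.rank_rat_real, Cardinal.lift_id, Cardinal.lift_id]
    exact (Cardinal.lt_aleph0_of_finite ι).le.trans Cardinal.aleph0_le_continuum
  rw [Cardinal.lift_id, Cardinal.lift_id] at h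
  obtain ⟨s, hs, hli⟩ := le_rank_iff_exists_linearIndependent.1 h
  obtain ⟨e⟩ := Cardinal.eq.1 hs
  exact ⟨fun i => (e.symm i : ℝ), hli.comp _ e.symm.injective⟩

lemma exists_genericDispl {ι : Type} [DecidableEq ι] (I : Finset ι) (u : ι → ℤ²) :
    ∃ c, GenericDispl I u c := by
  obtain ⟨c₀, hc₀⟩ := exists_linearIndependent_real I
  refine ⟨fun i => if h : i ∈ I then c₀ ⟨i, h⟩ else 0, ?_⟩
  set c : ι → ℝ := fun i => if h : i ∈ I then c₀ ⟨i, h⟩ else 0 with hc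
  have hrel : ∀ g : ι → ℚ, ∑ i ∈ I, (g i : ℝ) * c i = 0 → ∀ i ∈ I, g i = 0 := by
    intro g hg i hi
    rw [Fintype.linearIndependent_iff] at hc₀
    refine hc₀ (fun i => g i) ?_ ⟨i, hi⟩
    rw [← hg, ← sum_coe_sort I]
    exact sum_congr rfl fun i _ => by simp [hc, Rat.smul_def]
  intro J K L hJ hK hL hJ0 hK0 hL0 hJK hJL hKL hd P h1 h2 h3
  set uJ := σ(u,J)
  set uK := σ(u,K)
  set uL := σ(u,L)
  have hrel' : ((det2 uJ uK : ℤ) : ℝ) * σ(c,L) = ((det2 uL uK : ℤ) : ℝ) * σ(c,J) +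
      ((det2 uJ uL : ℤ) : ℝ) * ∑ i ∈ K, c i := by
    rw [← h1, ← h2, ← h3]
    simp only [det2, vecR]
    push_cast
    ring
  obtain ⟨i, hi⟩ := hL0
  have hsum : ∀ M : Finset ι, M ⊆ I → σ(c,M) = ∑ i ∈ I, (if i ∈ M then c i else 0) :=
    fun M hM => by rw [← sum_filter, filter_mem_eq_inter,
      inter_eq_right.2 hM]
  have := hrel (fun i => ((det2 uJ uK : ℤ) : ℚ) * (if i ∈ L then 1 else 0) -
    ((det2 uL uK : ℤ) : ℚ) * (if i ∈ J then 1 else 0) - ((det2 uJ uL : ℤ) : ℚ) * (if i ∈ K then 1 else 0)) (by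
      rw [hsum J hJ, hsum K hK, hsum L hL, mul_sum, mul_sum, mul_sum,
        ← sub_eq_zero, ← sub_sub, ← sum_sub_distrib, ← sum_sub_distrib] at hrel'
      rw [← hrel']
      refine sum_congr rfl fun i _ => ?_
      push_cast
      split_ifs <;> simp <;> ring) i (hL hi)
  have hiJ : i ∉ J := fun h => disjoint_left.1 hJL h hi
  have hiK : i ∉ K := fun h => disjoint_left.1 hKL h hi
  simp only [hi, hiJ, hiK, if_true, if_false, mul_one, mul_zero, sub_zero, Int.cast_eq_zero]
    at this
  exact hd this

namespace SF

variable {ι R : Type} [DecidableEq ι] [Ring R]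

lemma single_mul_coeff (K A : Finset ι) (r : R) (f : SF ι R) :
    (single K r * f).coeff A = if K ⊆ A then r * f.coeff (A \ K) else 0 := by
  rw [mul_coeff]
  split_ifs with h
  · rw [sum_eq_single K]
    · simp [single_coeff]
    · intro B _ hB; simp [single_coeff, hB]
    · intro hK; exact absurd (mem_powerset.2 h) hK
  · refine sum_eq_zero fun B hB => ?_
    rw [single_coeff, if_neg, zero_mul]
    rintro rfl
    exact h (mem_powerset.1 hB)

lemma coeff_prod_cons (K A : Finset ι) (r : R) (f : SF ι R) :
    ((1 + single K r) * f).coeff A = f.coeff A + if K ⊆ A then r * f.coeff (A \ K) else 0 := by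
  rw [add_mul, one_mul, add_coeff, single_mul_coeff]

lemma coeff_prod_congr {y y' : Finset ι → R} : ∀ (l : List (Finset ι)) (A : Finset ι),
    (∀ K ∈ l, K ⊆ A → y K = y' K) → ((l.map fun K => 1 + single K (y K)).prod).coeff A =
      ((l.map fun K => 1 + single K (y' K)).prod).coeff A
  | [], _, _ => rfl
  | K :: l, A, h => by
    rw [List.map_cons, List.prod_cons, List.map_cons, List.prod_cons, coeff_prod_cons,
      coeff_prod_cons, coeff_prod_congr l A fun L hL => h L (.tail _ hL)]
    split_ifs with hK
    · rw [h K (.head _) hK, coeff_prod_congr l (A \ K) fun L hL hLA =>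
        h L (.tail _ hL) (hLA.trans sdiff_subset)]
    · rfl

lemma prod_coeff_empty {y : Finset ι → R} : ∀ (l : List (Finset ι)),
    (∀ K ∈ l, K.Nonempty) → ((l.map fun K => 1 + single K (y K)).prod).coeff ∅ = 1
  | [], _ => by simp [one_coeff]
  | K :: l, h => by
    rw [List.map_cons, List.prod_cons, coeff_prod_cons, if_neg, add_zero,
      prod_coeff_empty l fun L hL => h L (.tail _ hL)]
    rw [subset_empty]
    exact (h K (.head _)).ne_empty

lemma coeff_prod_eq {y y' : Finset ι → R} {J : Finset ι} (hy : ∀ K, K ⊂ J → y K = y' K) :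
    ∀ l : List (Finset ι), (∀ K ∈ l, K.Nonempty) →
      ((l.map fun K => 1 + single K (y K)).prod).coeff J =
        ((l.map fun K => 1 + single K (y' K)).prod).coeff J + l.count J • (y J - y' J)
  | [], _ => by simp
  | K :: l, h => by
    have hl : ∀ K ∈ l, K.Nonempty := fun L hL => h L (.tail _ hL)
    have hK0 := h K List.mem_cons_self
    rw [List.map_cons, List.prod_cons, List.map_cons, List.prod_cons, coeff_prod_cons,
      coeff_prod_cons, coeff_prod_eq hy l hl]
    by_cases hKJ : K = J
    · subst hKJ
      rw [List.count_cons_self, if_pos subset_rfl, if_pos subset_rfl, Finset.sdiff_self,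
        prod_coeff_empty l hl, prod_coeff_empty l hl, add_smul, one_smul, mul_one, mul_one]
      abel
    · rw [List.count_cons_of_ne hKJ]
      split_ifs with hs
      · rw [hy K (hs.ssubset_of_ne hKJ), coeff_prod_congr (y := y) (y' := y') l (J \ K)
          fun L _ hL => hy L (lt_of_le_of_lt hL (sdiff_ssubset hs hK0))]
        abel
      · abel

end SF

section Independence

variable {ι : Type} [DecidableEq ι] {u : ι → ℤ²} {α : ℝ²}

lemma ne_zero_of_alpha_pos {v : ℤ²} (h : 0 < alpha α v) : v ≠ 0 := by
  rintro rfl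
  simp [alpha] at h

lemma curveCount_eq_of_generic [Fintype ι] (hα : ∀ i, 0 < alpha α (u i)) {c c' : ι → ℝ}
    (hc : GenericDispl univ u c) (hc' : GenericDispl univ u c') (J : Finset ι)
    (hJ : J.Nonempty) : curveCount J u c = curveCount J u c' := by
  set κ : SF ι ℂ →+* SF ι (Module.End ℂ Laurent) := map (algebraMap ℂ _)
  set A : Finset ι → SF ι (Module.End ℂ Laurent) := fun J =>
    κ (∏ i ∈ J, single {i} 1) * C (derOp σ(u,J))
  have hA : IsLegSystem u A := isLegSystem_of_square_zero (fun v => C (derOp v))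
    (fun v w => by rw [← map_mul, ← map_mul, ← map_sub, derOp_bracket, map_zsmul]) κ
    (fun q r => commute_map q r) _ fun i => by simp [single_mul_single]
  have hAs : ∀ J, A J = single J (derOp σ(u,J)) := by
    intro J
    simp only [A, κ]
    rw [prod_single _ _ _ (by
      intro i _ j _ hij; simpa [Function.onFun] using hij), map_single, single_mul_C]
    simp
  set l := sortBy (fun i => slope α (u i)) (univ : Finset ι).toList
  set l' := sortBy (fun J : Finset ι => -slope α σ(u,J)) (legSets ι)
  have hls : l.Pairwise fun i j => 0 ≤ det2 (u i) (u j) :=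
    (sortBy_pairwise _ _).imp fun {i j} h => (slope_le_iff (hα i) (hα j)).1 h
  have hmem : ∀ J ∈ l', J.Nonempty := fun J hJ => mem_legSets.1 ((sortBy_perm _ _).mem_iff.1 hJ)
  have hls' : l'.Pairwise fun J K => det2 σ(u,J) σ(u,K) ≤ 0 := by
    refine (List.Pairwise.and_mem.1 (sortBy_pairwise _ _)).imp fun {J K} h => ?_
    have h1 := (slope_le_iff (alpha_sum_pos hα (hmem K h.2.1)) (alpha_sum_pos hα (hmem J h.1))).1
      (neg_le_neg_iff.1 h.2.2)
    rw [det2_swap]; linarith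
  have h1 := vertex_factorization hα hA hc (sortBy_perm _ _) hls (sortBy_perm _ _) hls'
  have h2 := vertex_factorization hα hA hc' (sortBy_perm _ _) hls (sortBy_perm _ _) hls'
  rw [h1] at h2
  have hf : ∀ c : ι → ℝ, (fun J : Finset ι => 1 + curveCount J u c • A J) = fun J => 1 +
      single J (curveCount J u c • derOp σ(u,J)) := fun c => funext fun J => by
    rw [hAs]; congr 1
    refine ext fun B => ?_
    simp only [single_coeff, nsmul_coeff]
    split_ifs <;> simp
  rw [hf, hf] at h2
  induction J using strongInduction with
  | H J ih =>
    have h3 := congrArg (fun f => coeff f J) h2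
    beta_reduce at h3
    rw [coeff_prod_eq (y := fun J => curveCount J u c • derOp σ(u,J))
      (y' := fun J => curveCount J u c' • derOp σ(u,J)) (J := J) ?_ l' hmem] at h3
    · have hcount : l'.count J = 1 :=
        List.count_eq_one_of_mem ((sortBy_perm _ _).nodup_iff.2 nodup_legSets)
          ((sortBy_perm _ _).mem_iff.2 (mem_legSets.2 hJ))
      rw [hcount, one_smul, add_eq_left, sub_eq_zero] at h3
      have hd : derOp σ(u,J) ≠ 0 :=
        derOp_ne_zero (ne_zero_of_alpha_pos (alpha_sum_pos hα hJ))
      rw [← Nat.cast_smul_eq_nsmul ℂ, ← Nat.cast_smul_eq_nsmul ℂ] at h3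
      exact_mod_cast smul_left_injective ℂ hd h3
    · intro K hK
      rcases K.eq_empty_or_nonempty with rfl | hK0
      · have : derOp 0 = 0 := end_ext fun q => by rw [derOp_single]; simp [det2]
        simp [this]
      · simp only [ih K hK hK0]

/-- The number of trivalent rational tropical curves with incoming legs of weighted
directions `u`, for a generic displacement of the legs. -/
def Nm (I : Finset ι) (u : ι → ℤ²) : ℕ :=
  sInf {N | ∃ c, GenericDispl I u c ∧ N = curveCount I u c}

lemma curveCount_eq_curveCount {I : Finset ι} (hα : ∀ i ∈ I, 0 < alpha α (u i)) {c c' : ι → ℝ}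
    (hc : GenericDispl I u c) (hc' : GenericDispl I u c') :
    curveCount I u c = curveCount I u c' := by
  have hI : I = (univ : Finset I).image Subtype.val := by simp
  rw [hI] at hc hc' ⊢
  rw [curveCount_image Subtype.val_injective.injOn, curveCount_image Subtype.val_injective.injOn]
  rcases I.eq_empty_or_nonempty with rfl | h0
  · have : ∀ c : (∅ : Finset ι) → ℝ, curveCount univ (u ∘ val) c = 0 := by
      intro c
      rw [curveCount_eq]
      refine sum_eq_zero fun T hT => ?_
      have := T.leaves_ne_nil
      obtain ⟨i, hi⟩ := List.exists_mem_of_ne_nil _ this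
      exact absurd i.2 (notMem_empty _)
    rw [this, this]
  · have : Nonempty I := h0.to_subtype
    exact curveCount_eq_of_generic (ι := I) (α := α) (fun i => hα i i.2)
      (hc.comp val_injective.injOn) (hc'.comp val_injective.injOn) _
      univ_nonempty

lemma curveCount_eq_Nm {I : Finset ι} (hα : ∀ i ∈ I, 0 < alpha α (u i)) {c : ι → ℝ}
    (hc : GenericDispl I u c) : curveCount I u c = Nm I u := by
  have : {N | ∃ c, GenericDispl I u c ∧ N = curveCount I u c} = {curveCount I u c} := by
    ext N
    simp only [Set.mem_singleton_iff]
    constructor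
    · rintro ⟨c', h, rfl⟩; exact curveCount_eq_curveCount hα h hc
    · rintro rfl; exact ⟨c, hc, rfl⟩
  rw [Nm, this, csInf_singleton]

lemma Nm_image {κ : Type} [DecidableEq κ] {u : κ → ℤ²} {f : ι → κ} {I : Finset ι}
    (hf : Set.InjOn f I) (hα : ∀ i ∈ I, 0 < alpha α (u (f i))) :
    Nm (I.image f) u = Nm I (u ∘ f) := by
  obtain ⟨c, hc⟩ := exists_genericDispl (I.image f) u
  rw [← curveCount_eq_Nm (α := α) (by simpa using hα) hc, curveCount_image hf,
    curveCount_eq_Nm (α := α) (by simpa using hα) (hc.comp hf)]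

lemma Nm_congr {I : Finset ι} {u' : ι → ℤ²} (hα : ∀ i ∈ I, 0 < alpha α (u i))
    (h : ∀ i ∈ I, u i = u' i) : Nm I u = Nm I u' := by
  have hI : I = (univ : Finset I).image Subtype.val := by simp
  rw [hI, Nm_image (α := α) Subtype.val_injective.injOn (fun i _ => hα i i.2),
    Nm_image (α := α) Subtype.val_injective.injOn (fun i _ => h i i.2 ▸ hα i i.2)]
  congr 1
  exact funext fun i => h i i.2

open Classical in
lemma Nm_singleton {i : ι} (hi : u i ≠ 0) : Nm {i} u = 1 := by
  have hc : ∀ c : ι → ℝ, curveCount {i} u c = if ∃ P, det2 (vecR (u i)) P = c i then 1 else 0 := by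
    intro c
    rw [curveCount_eq, sum_eq_single (leaf i)]
    · rfl
    · intro T hT hne
      rw [mem_trees] at hT
      cases T with
      | leaf j => rw [leaf_mem_treeSet] at hT; simp_all
      | node l r =>
        obtain ⟨K, h1, h2, h3, -⟩ := node_mem_treeSet.1 hT
        rcases subset_singleton_iff.1 h1 with rfl | rfl <;> simp_all
    · intro h; exact absurd (mem_trees.2 (leaf_mem_treeSet.2 rfl)) h
  have hc1 : ∀ c : ι → ℝ, curveCount {i} u c = 1 := by
    intro c
    rw [hc, if_pos]
    have hpos : ((u i).1 : ℝ) ^ 2 + ((u i).2 : ℝ) ^ 2 ≠ 0 := by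
      intro h0
      have h1 : ((u i).1 : ℝ) = 0 := by nlinarith [sq_nonneg ((u i).1 : ℝ), sq_nonneg ((u i).2 : ℝ)]
      have h2 : ((u i).2 : ℝ) = 0 := by nlinarith [sq_nonneg ((u i).1 : ℝ), sq_nonneg ((u i).2 : ℝ)]
      exact hi (Prod.ext (mod_cast h1) (mod_cast h2))
    refine ⟨(-((u i).2 : ℝ) * c i / (((u i).1 : ℝ) ^ 2 + ((u i).2 : ℝ) ^ 2),
      ((u i).1 : ℝ) * c i / (((u i).1 : ℝ) ^ 2 + ((u i).2 : ℝ) ^ 2)), ?_⟩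
    simp only [det2, vecR]
    field_simp
    ring
  obtain ⟨c, hg⟩ := exists_genericDispl {i} u
  have : {N | ∃ c, GenericDispl {i} u c ∧ N = curveCount {i} u c} = {1} := by
    ext N
    simp only [Set.mem_singleton_iff, hc1]
    exact ⟨fun h => h.choose_spec.2, fun h => ⟨c, hg, h⟩⟩
  rw [Nm, this, csInf_singleton]

lemma curveCount_eq_zero {I : Finset ι} (h2 : 2 ≤ I.card)
    (h : ∀ i ∈ I, ∀ j ∈ I, det2 (u i) (u j) = 0) (c : ι → ℝ) : curveCount I u c = 0 := by
  rw [curveCount_eq]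
  refine sum_eq_zero fun T hT => if_neg ?_
  rw [mem_trees] at hT
  rintro ⟨P, hP⟩
  cases T with
  | leaf i => rw [leaf_mem_treeSet] at hT; simp [hT] at h2
  | node l r =>
    obtain ⟨K, h1, -, -, h4, h5⟩ := node_mem_treeSet.1 hT
    have h6 : det2 (l.vec u) (r.vec u) = 0 := by
      rw [vec_eq, vec_eq, sum_leaves h4, sum_leaves h5]
      have : ∀ (K L : Finset ι), det2 σ(u,K) σ(u,L) =
          ∑ i ∈ K, ∑ j ∈ L, det2 (u i) (u j) := by
        intro K L
        simp only [det2, Prod.fst_sum, Prod.snd_sum, sum_mul_sum, sum_sub_distrib]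
      rw [this]
      exact sum_eq_zero fun i hi => sum_eq_zero fun j hj =>
        h i (h1 hi) j (sdiff_subset hj)
    exact hP.1.ne' h6

lemma Nm_eq_zero {I : Finset ι} (h2 : 2 ≤ I.card) (h : ∀ i ∈ I, ∀ j ∈ I, det2 (u i) (u j) = 0) :
    Nm I u = 0 := by
  obtain ⟨c, hc⟩ := exists_genericDispl I u
  exact Nat.sInf_eq_zero.2 (.inl ⟨c, hc, (curveCount_eq_zero h2 h c).symm⟩)

end Independence

end

section

open Finset PowerSeries

namespace SF

variable {ι R : Type} [DecidableEq ι] [Ring R] [Algebra ℂ R]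

/-- The derivation multiplying a monomial by its degree. -/
def deg (f : SF ι R) : SF ι R := ⟨fun A => (A.card : ℂ) • f.coeff A⟩

lemma deg_coeff (f : SF ι R) (A : Finset ι) : (deg f).coeff A = (A.card : ℂ) • f.coeff A := rfl

lemma deg_add (f g : SF ι R) : deg (f + g) = deg f + deg g :=
  ext fun A => by simp [deg_coeff, smul_add]

lemma deg_mul (f g : SF ι R) : deg (f * g) = deg f * g + f * deg g := by
  refine ext fun A => ?_
  rw [deg_coeff, add_coeff, mul_coeff, mul_coeff, mul_coeff, smul_sum,
    ← sum_add_distrib]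
  refine sum_congr rfl fun B hB => ?_
  have h : A.card = B.card + (A \ B).card := by
    rw [add_comm, card_sdiff_add_card_eq_card (mem_powerset.1 hB)]
  rw [deg_coeff, deg_coeff, h, smul_mul_assoc, mul_smul_comm, ← add_smul]
  push_cast; rfl

lemma deg_one : deg (1 : SF ι R) = 0 := by
  refine ext fun A => ?_
  rw [deg_coeff, one_coeff]
  split_ifs with h
  · simp [h]
  · simp

lemma deg_single (A : Finset ι) (r : R) : deg (single A r) = (A.card : ℂ) • single A r := by
  refine ext fun B => ?_
  rw [deg_coeff, smul_coeff, single_coeff]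
  split_ifs with h
  · rw [h]
  · simp

lemma deg_zero : deg (0 : SF ι R) = 0 := ext fun A => by simp [deg_coeff]

lemma commute_of_coeff {f g : SF ι R} (h : ∀ A B, Commute (f.coeff A) (g.coeff B)) :
    Commute f g := by
  refine ext fun A => ?_
  rw [mul_coeff, mul_coeff, sum_powerset_compl A fun B D => f.coeff B * g.coeff D]
  exact sum_congr rfl fun B _ => h _ _

/-- `Y` is the exponential of `X`, up to the constant term of `X`. -/
structure IsExp (X Y : SF ι R) : Prop where
  coeff_empty : Y.coeff ∅ = 1
  deg_eq : deg Y = deg X * Y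

namespace IsExp

variable {X X' Y Y' : SF ι R}

lemma card_smul_coeff (h : IsExp X Y) (A : Finset ι) : (A.card : ℂ) • Y.coeff A =
    ∑ B ∈ A.powerset.erase ∅, ((B.card : ℂ) • X.coeff B) * Y.coeff (A \ B) := by
  rw [← deg_coeff, h.deg_eq, mul_coeff, ← add_sum_erase _ _ (empty_mem_powerset A)]
  simp [deg_coeff]

lemma unique (h : IsExp X Y) (h' : IsExp X' Y') (hX : ∀ A, A ≠ ∅ → X.coeff A = X'.coeff A) :
    Y = Y' := by
  refine ext fun A => ?_
  induction A using strongInduction with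
  | H A ih =>
    rcases eq_or_ne A ∅ with rfl | hA
    · rw [h.coeff_empty, h'.coeff_empty]
    · have hc : (A.card : ℂ) ≠ 0 := by simpa using hA
      refine smul_right_injective R hc ?_
      beta_reduce
      rw [h.card_smul_coeff, h'.card_smul_coeff]
      refine sum_congr rfl fun B hB => ?_
      rw [mem_erase, mem_powerset] at hB
      rw [hX B hB.1, ih _ (sdiff_ssubset hB.2 (nonempty_iff_ne_empty.2 hB.1))]

lemma commute_coeff (h : IsExp X Y) {z : R} (hz : ∀ A, Commute z (X.coeff A)) (A : Finset ι) :
    Commute z (Y.coeff A) := by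
  induction A using strongInduction with
  | H A ih =>
    rcases eq_or_ne A ∅ with rfl | hA
    · rw [h.coeff_empty]; exact Commute.one_right z
    · have hc : (A.card : ℂ) ≠ 0 := by simpa using hA
      have : Commute z ((A.card : ℂ) • Y.coeff A) := by
        rw [h.card_smul_coeff]
        refine Commute.sum_right _ _ _ fun B hB => ?_
        rw [mem_erase, mem_powerset] at hB
        exact ((hz B).smul_right _).mul_right
          (ih _ (sdiff_ssubset hB.2 (nonempty_iff_ne_empty.2 hB.1)))
      have h2 := this.smul_right ((A.card : ℂ)⁻¹)
      rwa [smul_smul, inv_mul_cancel₀ hc, one_smul] at h2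

lemma one : IsExp (0 : SF ι R) 1 :=
  ⟨by simp [one_coeff], by rw [deg_one, deg_zero, zero_mul]⟩

lemma mul (h : IsExp X Y) (h' : IsExp X' Y')
    (hc : ∀ A B, Commute (X'.coeff A) (X.coeff B)) : IsExp (X + X') (Y * Y') := by
  refine ⟨by rw [mul_empty, h.coeff_empty, h'.coeff_empty, mul_one], ?_⟩
  have : Commute (deg X') Y := commute_of_coeff fun A B =>
    h.commute_coeff (fun C => (hc A C).smul_left _) B
  rw [deg_mul, h.deg_eq, h'.deg_eq, deg_add, add_mul, ← mul_assoc, ← mul_assoc, ← mul_assoc,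
    this.eq]

lemma list_prod {β : Type} {x y : β → SF ι R} : ∀ l : List β, (∀ b ∈ l, IsExp (x b) (y b)) →
    (∀ b ∈ l, ∀ b' ∈ l, ∀ A B, Commute ((x b).coeff A) ((x b').coeff B)) →
    IsExp (l.map x).sum (l.map y).prod
  | [], _, _ => one
  | b :: l, h, hc => by
    rw [List.map_cons, List.map_cons, List.sum_cons, List.prod_cons]
    refine (h b (.head _)).mul (list_prod l (fun b' hb => h b' (.tail _ hb))
      fun b hb b' hb' => hc b (.tail _ hb) b' (.tail _ hb')) ?_
    intro A B
    have : ∀ l' : List β, (∀ b' ∈ l', b' ∈ l) → Commute ((l'.map x).sum.coeff A) ((x b).coeff B) := by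
      intro l' hl'
      induction l' with
      | nil => simp
      | cons b' t ih =>
        rw [List.map_cons, List.sum_cons, add_coeff]
        exact (hc b' (.tail _ (hl' b' (.head _))) b List.mem_cons_self
          A B).add_left (ih fun c hc => hl' c (.tail _ hc))
    exact this l fun _ h => h

lemma one_add_single {A : Finset ι} (hA : A.Nonempty) (r : R) :
    IsExp (single A r) (1 + single A r) := by
  have h : ¬ Disjoint A A := fun h => hA.ne_empty (disjoint_self.1 h)
  refine ⟨?_, ?_⟩
  · rw [add_coeff, single_coeff, if_neg hA.ne_empty.symm, one_coeff, if_pos rfl, add_zero]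
  · rw [deg_add, deg_one, deg_single, mul_add, mul_one]
    have : (A.card : ℂ) • single A r * single A r = 0 := by
      refine ext fun B => ?_
      rw [mul_coeff]
      have h2 := congrArg (fun f => f.coeff B) (single_mul_single A A r r)
      simp only [if_neg h, mul_coeff, zero_coeff] at h2
      simp only [smul_coeff, smul_mul_assoc, ← smul_sum, h2, smul_zero, zero_coeff]
    rw [this, add_zero, zero_add]

end IsExp

/-- Elements that only involve the monomial of top degree. -/
def IsTop [Fintype ι] (T : SF ι R) : Prop := ∀ A, A ≠ univ → T.coeff A = 0

section Top

variable [Fintype ι] {X Y T T' : SF ι R}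

lemma IsTop.mul_right (hT : IsTop T) (f : SF ι R) (hf : f.coeff ∅ = 1) : T * f = T := by
  refine ext fun A => ?_
  rw [mul_coeff]
  rcases eq_or_ne A univ with rfl | hA
  · rw [sum_eq_single univ]
    · simp [hf]
    · intro B _ hB; rw [hT B hB, zero_mul]
    · simp
  · rw [hT A hA]
    refine sum_eq_zero fun B hB => ?_
    rw [hT B, zero_mul]
    rintro rfl
    exact hA (univ_subset_iff.1 (mem_powerset.1 hB))

lemma IsTop.mul_left (hT : IsTop T) (f : SF ι R) (hf : f.coeff ∅ = 1) : f * T = T := by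
  refine ext fun A => ?_
  rw [mul_coeff, sum_powerset_compl A fun B D => f.coeff B * T.coeff D]
  rcases eq_or_ne A univ with rfl | hA
  · rw [sum_eq_single univ]
    · simp [hf]
    · intro B _ hB; rw [hT B hB, mul_zero]
    · simp
  · rw [hT A hA]
    refine sum_eq_zero fun B hB => ?_
    rw [hT B, mul_zero]
    rintro rfl
    exact hA (univ_subset_iff.1 (mem_powerset.1 hB))

lemma IsTop.add (hT : IsTop T) (hT' : IsTop T') : IsTop (T + T') := fun A hA => by
  rw [add_coeff, hT A hA, hT' A hA, add_zero]

lemma isTop_zero : IsTop (0 : SF ι R) := fun _ _ => rfl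

lemma IsTop.deg (hT : IsTop T) : IsTop (deg T) := fun A hA => by rw [deg_coeff, hT A hA, smul_zero]

lemma IsTop.list_sum {β : Type} {t : β → SF ι R} : ∀ l : List β, (∀ b ∈ l, IsTop (t b)) →
    IsTop (l.map t).sum
  | [], _ => isTop_zero
  | b :: l, h => (h b (.head _)).add (list_sum l fun c hc => h c (.tail _ hc))

lemma IsTop.coeff_empty [Nonempty ι] (hT : IsTop T) : T.coeff ∅ = 0 :=
  hT ∅ univ_nonempty.ne_empty.symm

lemma IsExp.add_top [Nonempty ι] (h : IsExp X Y) (hT : IsTop T) : IsExp (X + T) (Y + T) := by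
  refine ⟨by rw [add_coeff, h.coeff_empty, hT.coeff_empty, add_zero], ?_⟩
  have h1 : SF.deg X * T = 0 := by
    have := hT.mul_left (1 + SF.deg X) (by simp [deg_coeff, one_coeff])
    rwa [add_mul, one_mul, add_eq_left] at this
  rw [deg_add, deg_add, mul_add, add_mul, add_mul, h.deg_eq, h1,
    hT.deg.mul_right Y h.coeff_empty]
  have h2 : SF.deg T * T = 0 := by
    have := hT.deg.mul_right (1 + T) (by simp [hT.coeff_empty, one_coeff])
    rwa [mul_add, mul_one, add_eq_left] at this
  rw [h2, zero_add, add_zero]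

lemma prod_coeff_empty_eq_one {β : Type} {P : β → SF ι R} : ∀ l : List β,
    (∀ b ∈ l, (P b).coeff ∅ = 1) → (l.map P).prod.coeff ∅ = 1
  | [], _ => by simp [one_coeff]
  | b :: l, h => by
    rw [List.map_cons, List.prod_cons, mul_empty, h b List.mem_cons_self, one_mul,
      prod_coeff_empty_eq_one l fun c hc => h c (.tail _ hc)]

lemma prod_add_top [Nonempty ι] {β : Type} {P t : β → SF ι R} : ∀ l : List β,
    (∀ b ∈ l, (P b).coeff ∅ = 1) → (∀ b ∈ l, IsTop (t b)) →
    (l.map fun b => P b + t b).prod = (l.map P).prod + (l.map t).sum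
  | [], _, _ => by simp
  | b :: l, h, ht => by
    have h' : ∀ c ∈ l, (P c).coeff ∅ = 1 := fun c hc => h c (.tail _ hc)
    have ht' : ∀ c ∈ l, IsTop (t c) := fun c hc => ht c (.tail _ hc)
    rw [List.map_cons, List.prod_cons, prod_add_top l h' ht', List.map_cons, List.prod_cons,
      List.map_cons, List.sum_cons, mul_add,
      (IsTop.list_sum l ht').mul_left (P b + t b) (by
        rw [add_coeff, h b List.mem_cons_self, (ht b (.head _)).coeff_empty, add_zero]),
      add_mul, (ht b (.head _)).mul_right _ (prod_coeff_empty_eq_one l h'), add_assoc]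

end Top

end SF

lemma eq_flatten_filter {β : Type} (key : β → ℝ) : ∀ (S : List ℝ) (l : List β),
    S.Pairwise (· < ·) → l.Pairwise (fun a b => key a ≤ key b) → (∀ b ∈ l, key b ∈ S) →
    l = (S.map fun s => l.filter fun b => key b = s).flatten
  | [], l, _, _, h => by
    cases l with
    | nil => rfl
    | cons b l => exact absurd (h b (.head _)) List.not_mem_nil
  | s :: S, l, hS, hl, h => by
    rw [List.pairwise_cons] at hS
    have hsplit : ∀ l : List β, l.Pairwise (fun a b => key a ≤ key b) → (∀ b ∈ l, s ≤ key b) →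
        l = l.filter (fun b => key b = s) ++ l.filter fun b => key b ≠ s := by
      intro l hl hs
      induction l with
      | nil => rfl
      | cons b l ih =>
        rw [List.pairwise_cons] at hl
        by_cases hb : key b = s
        · simp only [List.filter_cons, hb, decide_true, if_true, ne_eq, not_true_eq_false,
            decide_false, Bool.false_eq_true, if_false, List.cons_append]
          congr 1
          exact ih hl.2 fun c hc => hs c (.tail _ hc)
        · have h1 : ∀ c ∈ b :: l, key c ≠ s := by
            intro c hc hcs
            have hbs := lt_of_le_of_ne (hs b (.head _)) (Ne.symm hb)
            rcases List.mem_cons.1 hc with rfl | hc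
            · exact hb hcs
            · have := hl.1 c hc
              linarith
          rw [List.filter_eq_nil_iff.2 (by simpa using h1), List.filter_eq_self.2 (by simpa using h1),
            List.nil_append]
    have hge : ∀ b ∈ l, s ≤ key b := fun b hb => by
      rcases List.mem_cons.1 (h b hb) with h1 | h1
      · exact h1.ge
      · exact (hS.1 _ h1).le
    conv_lhs => rw [hsplit l hl hge]
    rw [List.map_cons, List.flatten_cons]
    congr 1
    rw [eq_flatten_filter key S (l.filter fun b => key b ≠ s) hS.2 (hl.filter _) ?_]
    · congr 1
      refine List.map_congr_left fun s' hs' => ?_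
      rw [List.filter_filter]
      refine List.filter_congr fun b _ => ?_
      have := (hS.1 s' hs').ne'
      by_cases hb : key b = s' <;> simp [hb, this]
    · intro b hb
      simp only [List.mem_filter, ne_eq, decide_not, Bool.not_eq_eq_eq_not, Bool.not_true,
        decide_eq_false_iff_not] at hb
      exact (List.mem_cons.1 (h b hb.1)).resolve_left hb.2

lemma prod_eq_prod_filter {β R : Type} [Monoid R] (key : β → ℝ) (S : List ℝ) (l : List β)
    (hS : S.Pairwise (· < ·)) (hl : l.Pairwise (fun a b => key a ≤ key b))
    (h : ∀ b ∈ l, key b ∈ S) (y : β → R) :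
    (l.map y).prod = (S.map fun s => ((l.filter fun b => key b = s).map y).prod).prod := by
  conv_lhs => rw [eq_flatten_filter key S l hS hl h]
  rw [List.map_flatten, List.prod_flatten, List.map_map, List.map_map]
  rfl

namespace SF

variable {ι R : Type} [DecidableEq ι] [Ring R] [Algebra ℂ R] [Fintype ι] [Nonempty ι]

/-- Two sorted products of exponentials whose logarithms agree for every key, up to terms of top
degree. -/
lemma prod_eq_prod_add_top {β β' : Type} {x y : β → SF ι R} {x' y' : β' → SF ι R}
    {key : β → ℝ} {key' : β' → ℝ} {S : List ℝ} {l : List β} {l' : List β'} {t : ℝ → SF ι R}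
    (hS : S.Pairwise (· < ·)) (hl : l.Pairwise (fun a b => key a ≤ key b))
    (hl' : l'.Pairwise (fun a b => key' a ≤ key' b)) (h : ∀ b ∈ l, key b ∈ S)
    (h' : ∀ b ∈ l', key' b ∈ S) (hy : ∀ b ∈ l, IsExp (x b) (y b))
    (hy' : ∀ b ∈ l', IsExp (x' b) (y' b))
    (hc : ∀ b ∈ l, ∀ b' ∈ l, key b = key b' → ∀ A B, Commute ((x b).coeff A) ((x b').coeff B))
    (hc' : ∀ b ∈ l', ∀ b' ∈ l', key' b = key' b' →
      ∀ A B, Commute ((x' b).coeff A) ((x' b').coeff B))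
    (ht : ∀ s, IsTop (t s))
    (hx : ∀ s ∈ S, ∀ A, A ≠ ∅ → (((l'.filter fun b => key' b = s).map x').sum).coeff A =
      (((l.filter fun b => key b = s).map x).sum + t s).coeff A) :
    (l'.map y').prod = (l.map y).prod + (S.map t).sum := by
  have e : ∀ s ∈ S, IsExp ((l.filter fun b => key b = s).map x).sum
      ((l.filter fun b => key b = s).map y).prod := fun s _ => by
    refine IsExp.list_prod _ (fun b hb => hy b (List.mem_of_mem_filter hb)) ?_
    intro b hb b' hb'
    simp only [List.mem_filter, decide_eq_true_eq] at hb hb'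
    exact hc b hb.1 b' hb'.1 (hb.2.trans hb'.2.symm)
  have e' : ∀ s ∈ S, IsExp ((l'.filter fun b => key' b = s).map x').sum
      ((l'.filter fun b => key' b = s).map y').prod := fun s _ => by
    refine IsExp.list_prod _ (fun b hb => hy' b (List.mem_of_mem_filter hb)) ?_
    intro b hb b' hb'
    simp only [List.mem_filter, decide_eq_true_eq] at hb hb'
    exact hc' b hb.1 b' hb'.1 (hb.2.trans hb'.2.symm)
  rw [prod_eq_prod_filter key S l hS hl h, prod_eq_prod_filter key' S l' hS hl' h',
    ← prod_add_top S (fun s hs => (e s hs).coeff_empty) fun s _ => ht s]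
  congr 1
  refine List.map_congr_left fun s hs => ?_
  exact (e' s hs).unique ((e s hs).add_top (ht s)) (hx s hs)

end SF

section ToSF

variable {ι R : Type} [DecidableEq ι] [Ring R]

/-- The homomorphism that sends the variable to the sum of all the variables. -/
def toSF (ι : Type) [DecidableEq ι] {R : Type} [Ring R] : PowerSeries R →+* SF ι R where
  toFun f := ⟨fun A => A.card.factorial • coeff A.card f⟩
  map_one' := by
    refine SF.ext fun A => ?_
    change A.card.factorial • coeff A.card 1 = _
    rw [SF.one_coeff, coeff_one]
    by_cases h : A = ∅ <;> simp [h]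
  map_zero' := SF.ext fun A => by simp
  map_add' f g := SF.ext fun A => by simp
  map_mul' f g := by
    refine SF.ext fun A => ?_
    rw [SF.mul_coeff]
    change A.card.factorial • coeff A.card (f * g) = _
    rw [coeff_mul, Nat.sum_antidiagonal_eq_sum_range_succ
      (fun i j => coeff i f * coeff j g)]
    have : ∀ B ∈ A.powerset, (B.card.factorial • coeff B.card f) *
        ((A \ B).card.factorial • coeff (A \ B).card g) =
        (fun i => (i.factorial * (A.card - i).factorial) • (coeff i f *
          coeff (A.card - i) g)) B.card := fun B hB => by
      rw [card_sdiff_of_subset (mem_powerset.1 hB)]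
      simp only [nsmul_eq_mul, Nat.cast_mul]
      rw [mul_assoc, mul_assoc, ← mul_assoc (coeff _ f),
        ← (Nat.cast_commute _ (coeff _ f)).eq, mul_assoc]
    rw [sum_congr rfl this]
    refine Eq.trans ?_ (sum_powerset_apply_card (fun i => (i.factorial *
      (A.card - i).factorial) • (coeff i f * coeff (A.card - i) g))).symm
    rw [smul_sum]
    refine sum_congr rfl fun i hi => ?_
    rw [smul_smul, ← mul_assoc, Nat.choose_mul_factorial_mul_factorial
      (Nat.lt_succ_iff.1 (mem_range.1 hi))]

lemma toSF_coeff (f : PowerSeries R) (A : Finset ι) :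
    (toSF ι f).coeff A = A.card.factorial • coeff A.card f := rfl

end ToSF

end

section

open Finset PowerSeries

section Theta

variable {A A' : Type} [CommRing A] [CommRing A']

/-- The derivation `t d/dt`. -/
def theta (A : Type) [CommRing A] : Derivation A (PowerSeries A) (PowerSeries A) :=
  (X : PowerSeries A) • derivative A

lemma coeff_theta (f : PowerSeries A) (n : ℕ) :
    coeff n (theta A f) = n * coeff n f := by
  rw [theta, Derivation.smul_apply, smul_eq_mul]
  cases n with
  | zero => simp
  | succ n => rw [coeff_succ_X_mul, coeff_derivative]; push_cast; ring

lemma theta_map (φ : A →+* A') (f : PowerSeries A) :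
    theta A' (map φ f) = map φ (theta A f) := by
  ext n
  rw [coeff_theta, coeff_map, coeff_map, coeff_theta, map_mul, map_natCast]

lemma theta_zpow (u : (PowerSeries A)ˣ) {g : PowerSeries A} (hg : u * g = theta A u) (n : ℤ) :
    theta A (u ^ n : (PowerSeries A)ˣ) = n * g * (u ^ n : (PowerSeries A)ˣ) := by
  induction n using Int.induction_on with
  | zero => simp
  | succ n ih =>
    rw [zpow_add_one, Units.val_mul, Derivation.leibniz, ih, ← hg]
    simp only [smul_eq_mul]
    push_cast
    ring
  | pred n ih =>
    have h : (u ^ (-(n : ℤ)) : (PowerSeries A)ˣ) = u ^ (-(n : ℤ) - 1) * u := by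
      rw [← zpow_add_one]; congr 1; ring
    rw [h, Units.val_mul, Derivation.leibniz, ← hg] at ih
    simp only [smul_eq_mul] at ih
    refine (Units.mul_right_inj u).1 ?_
    push_cast at ih ⊢
    linear_combination ih

variable [Algebra ℂ A]

/-- The logarithm of `1 + c t ^ o`. -/
def logMono (o : ℕ) (c : A) : PowerSeries A :=
  mk fun N => if o ∣ N then ((-1) ^ (N / o + 1) / ((N / o : ℕ) : ℂ) : ℂ) • c ^ (N / o) else 0

lemma mul_theta_logMono {o : ℕ} (ho : 0 < o) (c : A) :
    (1 + monomial o c) * theta A (logMono o c) =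
      theta A (1 + monomial o c) := by
  have hθ : ∀ N, coeff N (theta A (logMono o c)) =
      if o ∣ N ∧ N ≠ 0 then (o : A) * (-1) ^ (N / o + 1) * c ^ (N / o) else 0 := by
    intro N
    rw [coeff_theta, logMono, coeff_mk]
    by_cases h : o ∣ N
    · obtain ⟨j, rfl⟩ := h
      rw [Nat.mul_div_cancel_left j ho]
      rcases Nat.eq_zero_or_pos j with rfl | hj
      · simp
      · have hj' : (j : ℂ) ≠ 0 := mod_cast hj.ne'
        rw [if_pos (dvd_mul_right _ _), if_pos ⟨dvd_mul_right _ _, by positivity⟩,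
          Algebra.smul_def, ← map_natCast (algebraMap ℂ A), ← mul_assoc, ← map_mul,
          ← map_natCast (algebraMap ℂ A) o]
        congr 1
        rw [show (-1 : A) = algebraMap ℂ A (-1) by simp, ← map_pow, ← map_mul]
        congr 1
        push_cast
        field_simp
    · simp [h]
  ext N
  have hm : monomial o c = C c * X ^ o := by ext1 N; rw [coeff_C_mul_X_pow, coeff_monomial]
  rw [add_mul, one_mul, map_add, show coeff N (monomial o c *
    theta A (logMono o c)) = c * if o ≤ N then coeff (N - o) (theta A (logMono o c))
      else 0 by rw [hm, mul_assoc, coeff_C_mul, coeff_X_pow_mul'], hθ, hθ, coeff_theta, map_add,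
    coeff_one, coeff_monomial]
  by_cases hoN : o ∣ N
  · obtain ⟨j, rfl⟩ := hoN
    rcases j with _ | _ | j
    · simp [ho.ne']
    · simp [ho.ne', ho]
    · have e1 : o * (j + 1 + 1) - o = o * (j + 1) := by rw [Nat.mul_succ]; omega
      have e2 : o ≤ o * (j + 1 + 1) := Nat.le_mul_of_pos_right _ (by omega)
      have e3 : o * (j + 1 + 1) ≠ o := by nlinarith
      rw [if_pos ⟨dvd_mul_right _ _, by positivity⟩, if_pos e2, e1,
        if_pos ⟨dvd_mul_right _ _, by positivity⟩, if_neg (by positivity), if_neg e3,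
        Nat.mul_div_cancel_left _ ho, Nat.mul_div_cancel_left _ ho]
      ring
  · have e1 : N ≠ o := by rintro rfl; exact hoN dvd_rfl
    have e2 : o ≤ N → ¬ o ∣ N - o := fun h h' => hoN ((Nat.dvd_sub_iff_left h dvd_rfl).1 h')
    have e3 : N ≠ 0 := by rintro rfl; exact hoN (dvd_zero _)
    simp only [hoN, false_and, if_false, e1, e3, add_zero, mul_zero, zero_add]
    split_ifs with h1 h2
    · exact absurd h2.1 (e2 h1)
    · rw [mul_zero]
    · rw [mul_zero]

end Theta

/-- The homomorphism `y ↦ z ^ m`. -/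
def dirHom (m : ℤ²) : Polynomial ℂ →ₐ[ℂ] Laurent := Polynomial.aeval (AddMonoidAlgebra.single m 1)

lemma dirHom_monomial (m : ℤ²) (k : ℕ) (b : ℂ) :
    dirHom m (Polynomial.monomial k b) = AddMonoidAlgebra.single (k • m) b := by
  rw [dirHom, Polynomial.aeval_monomial, AddMonoidAlgebra.single_pow, one_pow,
    ← Algebra.smul_def]
  refine AddMonoidAlgebra.ext (Finsupp.ext fun q => ?_)
  rw [AddMonoidAlgebra.coeff_smul, Finsupp.smul_apply, AddMonoidAlgebra.coeff_single,
    AddMonoidAlgebra.coeff_single, Finsupp.single_apply, Finsupp.single_apply]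
  split_ifs <;> simp

/-- The operators `z ^ q ↦ g (det (m, q)) z ^ q` for functions `g` with values in the polynomials
in `z ^ m`. -/
def dirOp (m : ℤ²) (g : ℤ → Polynomial ℂ) : Module.End ℂ Laurent :=
  mulOp fun q => dirHom m (g (det2 m q))

lemma dirOp_mul_single (m : ℤ²) (g : ℤ → Polynomial ℂ) (p : Polynomial ℂ) (q : ℤ²) (c : ℂ) :
    dirOp m g (dirHom m p * AddMonoidAlgebra.single q c) =
      dirHom m (g (det2 m q)) * (dirHom m p * AddMonoidAlgebra.single q c) := by
  induction p using Polynomial.induction_on' with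
  | add p p' hp hp' => rw [map_add, add_mul, map_add, hp, hp', mul_add]
  | monomial k b =>
    have h : det2 m (k • m + q) = det2 m q := by
      simp only [det2, Prod.fst_add, Prod.snd_add, Prod.smul_fst, Prod.smul_snd]
      simp only [nsmul_eq_mul]
      ring
    rw [dirHom_monomial, AddMonoidAlgebra.single_mul_single, dirOp, mulOp_single, h]

/-- `dirOp` as a ring homomorphism. -/
def dirOpHom (m : ℤ²) : (ℤ → Polynomial ℂ) →+* Module.End ℂ Laurent where
  toFun := dirOp m
  map_one' := end_ext fun q => by rw [dirOp, mulOp_single]; simp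
  map_mul' g g' := end_ext fun q => by
    have h : ∀ g, dirOp m g (AddMonoidAlgebra.single q 1) =
        dirHom m (g (det2 m q)) * AddMonoidAlgebra.single q 1 := fun g => by
      rw [dirOp, mulOp_single]
    rw [Module.End.mul_apply, h, h, dirOp_mul_single, Pi.mul_apply, map_mul, mul_assoc]
  map_zero' := end_ext fun q => by rw [dirOp, mulOp_single]; simp
  map_add' g g' := end_ext fun q => by
    rw [LinearMap.add_apply, dirOp, dirOp, dirOp, mulOp_single, mulOp_single, mulOp_single,
      Pi.add_apply, map_add, add_mul]

lemma dirOpHom_single (m : ℤ²) (g : ℤ → Polynomial ℂ) (q : ℤ²) (c : ℂ) :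
    dirOpHom m g (AddMonoidAlgebra.single q c) =
      dirHom m (g (det2 m q)) * AddMonoidAlgebra.single q c := mulOp_single _ _ _

namespace Ray

variable (d : Ray)

/-- The function of a ray as a series over the polynomials in `z ^ m`. -/
def polyFn : PowerSeries (Polynomial ℂ) :=
  1 + monomial d.ord (Polynomial.monomial d.wt d.coeff)

lemma map_polyFn : map (dirHom d.dir : Polynomial ℂ →+* Laurent) d.polyFn = d.fn := by
  rw [polyFn, map_add, map_one, fn]
  congr 1
  ext1 N
  rw [coeff_map, coeff_monomial, coeff_monomial]
  split_ifs
  · have := dirHom_monomial d.dir d.wt d.coeff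
    rw [expo, natCast_zsmul]
    exact this
  · simp

/-- The coefficient of the logarithm of the function of a ray, divided by the index. -/
def logCoeff (N : ℕ) : ℂ :=
  if d.ord ∣ N then (-1) ^ (N / d.ord + 1) * d.coeff ^ (N / d.ord) /
    (((N / d.ord : ℕ) : ℂ) * ((d.wt * (N / d.ord) : ℕ) : ℂ)) else 0

/-- The vector that goes with `logCoeff`. -/
def logVec (N : ℕ) : ℤ² := (d.wt * (N / d.ord)) • d.dir

end Ray

/-- The wall-crossing automorphism as a power series of operators. -/
def crossSeries (x : Ray × ℤˣ) : PowerSeries (Module.End ℂ Laurent) :=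
  mk fun N => mulOp fun q =>
    coeff N (intPow x.1.fn (det2 (halfDir x) q))

/-- The logarithm of `crossSeries`. -/
def crossLog (x : Ray × ℤˣ) : PowerSeries (Module.End ℂ Laurent) :=
  mk fun N => (((x.2 : ℤ) : ℂ) * x.1.logCoeff N) • derOp (x.1.logVec N)

lemma intPow_map {m : ℤ²} (u : (PowerSeries (Polynomial ℂ))ˣ)
    (hu : constantCoeff (u : PowerSeries (Polynomial ℂ)) = 1) (n : ℤ) :
    intPow (map (dirHom m : Polynomial ℂ →+* Laurent) u) n =
      map (dirHom m : Polynomial ℂ →+* Laurent) (u ^ n : (PowerSeries (Polynomial ℂ))ˣ) := by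
  have hinv : invOfUnit (map (dirHom m : Polynomial ℂ →+* Laurent) u) 1 =
      map (dirHom m : Polynomial ℂ →+* Laurent) (u⁻¹ : (PowerSeries (Polynomial ℂ))ˣ) := by
    have h1 := mul_invOfUnit
      (map (dirHom m : Polynomial ℂ →+* Laurent) u) 1 (by
        rw [← coeff_zero_eq_constantCoeff_apply, coeff_map,
          coeff_zero_eq_constantCoeff_apply, hu, map_one, Units.val_one])
    have h2 : map (dirHom m : Polynomial ℂ →+* Laurent) (u⁻¹ : (PowerSeries (Polynomial ℂ))ˣ) *
        map (dirHom m : Polynomial ℂ →+* Laurent) u = 1 := by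
      rw [← map_mul, ← Units.val_mul, inv_mul_cancel, Units.val_one, map_one]
    exact (left_inv_eq_right_inv h2 h1).symm
  rw [intPow]
  split_ifs with h
  · obtain ⟨k, rfl⟩ := Int.eq_ofNat_of_zero_le h
    simp
  · obtain ⟨k, hk⟩ := Int.eq_ofNat_of_zero_le (by omega : 0 ≤ -n)
    have : n = -(k : ℤ) := by omega
    subst this
    simp [hinv]

section Pi

/-- A series of functions from a function with values in series. -/
def piSeries (F : ℤ → PowerSeries (Polynomial ℂ)) : PowerSeries (ℤ → Polynomial ℂ) :=
  mk fun N n => coeff N (F n)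

lemma piSeries_mul (F G : ℤ → PowerSeries (Polynomial ℂ)) :
    piSeries F * piSeries G = piSeries fun n => F n * G n := by
  ext N n
  simp [piSeries, coeff_mul]

end Pi

variable (x : Ray × ℤˣ)

lemma exists_unit_polyFn (d : Ray) (ho : 0 < d.ord) :
    ∃ u : (PowerSeries (Polynomial ℂ))ˣ, (u : PowerSeries (Polynomial ℂ)) = d.polyFn ∧
      constantCoeff (u : PowerSeries (Polynomial ℂ)) = 1 := by
  have h : constantCoeff d.polyFn = 1 := by
    rw [← coeff_zero_eq_constantCoeff_apply, Ray.polyFn, map_add,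
      coeff_monomial, if_neg ho.ne]
    simp
  have hu : IsUnit d.polyFn := isUnit_iff_constantCoeff.2 (by rw [h]; exact isUnit_one)
  exact ⟨hu.unit, rfl, h⟩

lemma det2_halfDir (q : ℤ²) : det2 (halfDir x) q = (x.2 : ℤ) * det2 x.1.dir q := by
  simp only [halfDir, det2, Prod.smul_fst, Prod.smul_snd, smul_eq_mul]; ring

lemma crossSeries_eq (u : (PowerSeries (Polynomial ℂ))ˣ) (hu : (u : PowerSeries _) = x.1.polyFn)
    (hu' : constantCoeff (u : PowerSeries (Polynomial ℂ)) = 1) :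
    crossSeries x = map (dirOpHom x.1.dir) (piSeries fun n =>
      (u ^ ((x.2 : ℤ) * n) : (PowerSeries (Polynomial ℂ))ˣ)) := by
  ext1 N
  rw [coeff_map, crossSeries, piSeries, coeff_mk, coeff_mk]
  refine end_ext fun q => ?_
  rw [mulOp_single, dirOpHom_single, ← x.1.map_polyFn, ← hu, intPow_map u hu', det2_halfDir,
    coeff_map]
  rfl

lemma crossLog_eq (hw : 0 < x.1.wt) :
    crossLog x = map (dirOpHom x.1.dir) (piSeries fun n =>
      (((x.2 : ℤ) * n : ℤ) : PowerSeries (Polynomial ℂ)) *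
        logMono x.1.ord (Polynomial.monomial x.1.wt x.1.coeff)) := by
  ext1 N
  rw [coeff_map, crossLog, piSeries, coeff_mk, coeff_mk]
  refine end_ext fun q => ?_
  rw [LinearMap.smul_apply, derOp_single, dirOpHom_single, ← zsmul_eq_mul (logMono _ _), map_zsmul,
    map_zsmul, logMono, coeff_mk, Ray.logCoeff, Ray.logVec]
  by_cases h : x.1.ord ∣ N
  · rw [if_pos h, if_pos h, Polynomial.monomial_pow, Polynomial.smul_monomial, dirHom_monomial,
      smul_mul_assoc, AddMonoidAlgebra.single_mul_single]
    refine AddMonoidAlgebra.ext (Finsupp.ext fun r => ?_)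
    rw [AddMonoidAlgebra.coeff_smul, AddMonoidAlgebra.coeff_smul, Finsupp.smul_apply,
      Finsupp.smul_apply, AddMonoidAlgebra.coeff_single, AddMonoidAlgebra.coeff_single,
      Finsupp.single_apply, Finsupp.single_apply]
    split_ifs
    · rcases Nat.eq_zero_or_pos (N / x.1.ord) with h0 | h0
      · simp [h0]
      · have h1 : ((N / x.1.ord : ℕ) : ℂ) ≠ 0 := mod_cast h0.ne'
        have h2 : (x.1.wt : ℂ) ≠ 0 := mod_cast hw.ne'
        simp only [det2, Prod.smul_fst, Prod.smul_snd]
        simp only [nsmul_eq_mul, zsmul_eq_mul, smul_eq_mul]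
        generalize N / x.1.ord = j at *
        push_cast
        field_simp
    · simp
  · simp [h]

lemma isExp_toSF_cross {ι : Type} [DecidableEq ι] (ho : 0 < x.1.ord) (hw : 0 < x.1.wt) :
    SF.IsExp (toSF ι (crossLog x)) (toSF ι (crossSeries x)) := by
  obtain ⟨u, hu, hu'⟩ := exists_unit_polyFn x.1 ho
  have hdeg : ∀ F : ℤ → PowerSeries (Polynomial ℂ),
      SF.deg (toSF ι (map (dirOpHom x.1.dir) (piSeries F))) =
        toSF ι (map (dirOpHom x.1.dir) (piSeries fun n => theta _ (F n))) := by
    intro F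
    refine SF.ext fun A => ?_
    rw [SF.deg_coeff, toSF_coeff, toSF_coeff, coeff_map, coeff_map,
      ← Nat.cast_smul_eq_nsmul ℂ, ← Nat.cast_smul_eq_nsmul ℂ, smul_comm]
    congr 1
    rw [Nat.cast_smul_eq_nsmul, ← map_nsmul]
    congr 1
    funext n
    simp only [piSeries, coeff_mk, coeff_theta, Pi.smul_apply, nsmul_eq_mul]
  constructor
  · rw [toSF_coeff, crossSeries_eq x u hu hu', card_empty, Nat.factorial_zero, one_smul,
      coeff_map, piSeries, coeff_mk, ← map_one (dirOpHom x.1.dir)]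
    congr 1
    funext n
    rw [coeff_zero_eq_constantCoeff_apply]
    have : Units.map (constantCoeff (R := Polynomial ℂ)).toMonoidHom u = 1 :=
      Units.ext hu'
    have h2 := congrArg (fun v => ((v ^ ((x.2 : ℤ) * n) : (Polynomial ℂ)ˣ) : Polynomial ℂ)) this
    rw [one_zpow, ← map_zpow] at h2
    exact h2
  · rw [crossLog_eq x hw, crossSeries_eq x u hu hu', hdeg, hdeg, ← map_mul, ← map_mul,
      piSeries_mul]
    have key : ∀ n : ℤ, theta _ ((u ^ ((x.2 : ℤ) * n) : (PowerSeries (Polynomial ℂ))ˣ) :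
        PowerSeries (Polynomial ℂ)) = theta _ ((((x.2 : ℤ) * n : ℤ) : PowerSeries (Polynomial ℂ)) *
        logMono x.1.ord (Polynomial.monomial x.1.wt x.1.coeff)) *
          (u ^ ((x.2 : ℤ) * n) : (PowerSeries (Polynomial ℂ))ˣ) := by
      intro n
      rw [theta_zpow u (g := theta _ (logMono x.1.ord (Polynomial.monomial x.1.wt x.1.coeff))) (by
        rw [hu, Ray.polyFn, mul_theta_logMono ho])]
      congr 1
      rw [← zsmul_eq_mul, ← zsmul_eq_mul, map_zsmul]
    rw [funext key]

/-- The action of a series of operators on a series. -/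
def actSeries (W : PowerSeries (Module.End ℂ Laurent)) (g : PowerSeries Laurent) :
    PowerSeries Laurent :=
  mk fun N => ∑ ij ∈ HasAntidiagonal.antidiagonal N,
    coeff ij.1 W (coeff ij.2 g)

lemma actSeries_mul (W W' : PowerSeries (Module.End ℂ Laurent)) (g : PowerSeries Laurent) :
    actSeries (W * W') g = actSeries W (actSeries W' g) := by
  ext1 N
  simp only [actSeries, coeff_mk, coeff_mul, LinearMap.sum_apply, map_sum,
    Module.End.mul_apply]
  rw [sum_sigma', sum_sigma']
  refine sum_nbij' (fun ⟨⟨_i, j⟩, ⟨k, l⟩⟩ ↦ ⟨(k, l + j), (l, j)⟩)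
    (fun ⟨⟨i, _j⟩, ⟨k, l⟩⟩ ↦ ⟨(i + k, l), (i, k)⟩) ?_ ?_ ?_ ?_ ?_ <;>
    rintro ⟨⟨i, j⟩, ⟨k, l⟩⟩ h <;>
    simp only [mem_sigma, HasAntidiagonal.mem_antidiagonal] at h ⊢
  · exact ⟨by change k + (l + j) = N; omega, trivial⟩
  · exact ⟨by change i + k + l = N; omega, trivial⟩
  · obtain ⟨-, rfl⟩ := h; rfl
  · obtain ⟨-, rfl⟩ := h; rfl

lemma wallCross_eq (g : PowerSeries Laurent) : wallCross x g = actSeries (crossSeries x) g := by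
  ext1 N
  rw [wallCross, actSeries, coeff_mk, coeff_mk,
    ← Nat.sum_antidiagonal_swap]
  refine sum_congr rfl fun ij _ => ?_
  rw [crossSeries, coeff_mk, mulOp_apply]
  rfl

lemma loopAut_eq (l : List (Ray × ℤˣ)) (g : PowerSeries Laurent) :
    loopAut l g = actSeries (l.map crossSeries).reverse.prod g := by
  induction l generalizing g with
  | nil =>
    ext1 N
    rw [List.map_nil, List.reverse_nil, List.prod_nil, actSeries, coeff_mk,
      sum_eq_single (0, N)]
    · simp [loopAut]
    · rintro ⟨i, j⟩ hij hne
      rw [HasAntidiagonal.mem_antidiagonal] at hij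
      have : i ≠ 0 := by rintro rfl; simp_all
      rw [coeff_one, if_neg this, LinearMap.zero_apply]
    · simp [HasAntidiagonal.mem_antidiagonal]
  | cons x l ih =>
    have h : loopAut (x :: l) g = loopAut l (wallCross x g) := rfl
    rw [h, wallCross_eq, ih, List.map_cons, List.reverse_cons, List.prod_append, List.prod_singleton, actSeries_mul]

lemma coeff_loopAut (l : List (Ray × ℤˣ)) (g : Laurent) (N : ℕ) :
    coeff N (loopAut l (monomial 0 g)) =
      coeff N (l.map crossSeries).reverse.prod g := by
  rw [loopAut_eq, actSeries, coeff_mk, sum_eq_single (N, 0)]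
  · simp
  · rintro ⟨i, j⟩ hij hne
    rw [HasAntidiagonal.mem_antidiagonal] at hij
    have : j ≠ 0 := by rintro rfl; simp_all
    rw [coeff_monomial, if_neg this, map_zero]
  · simp

end

section

open Finset List Real

section Angles

lemma exists_polar (m : ℤ²) : ∃ r : ℝ, 0 ≤ r ∧ (m.1 : ℝ) = r * cos (angle m) ∧
    (m.2 : ℝ) = r * sin (angle m) := by
  refine ⟨‖(m.1 : ℂ) + (m.2 : ℂ) * Complex.I‖, norm_nonneg _, ?_, ?_⟩
  · rw [angle, Complex.norm_mul_cos_arg]; simp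
  · rw [angle, Complex.norm_mul_sin_arg]; simp

lemma exists_polar_real (α : ℝ²) : ∃ r θ : ℝ, 0 ≤ r ∧ θ ∈ Set.Ioc (-Real.pi) Real.pi ∧
    α.1 = r * cos θ ∧ α.2 = r * sin θ := by
  refine ⟨‖(α.1 : ℂ) + (α.2 : ℂ) * Complex.I‖, Complex.arg ((α.1 : ℂ) + (α.2 : ℂ) * Complex.I),
    norm_nonneg _, ⟨Complex.neg_pi_lt_arg _, Complex.arg_le_pi _⟩, ?_, ?_⟩
  · rw [Complex.norm_mul_cos_arg]; simp
  · rw [Complex.norm_mul_sin_arg]; simp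

lemma angle_mem (m : ℤ²) : angle m ∈ Set.Ioc (-Real.pi) Real.pi :=
  ⟨Complex.neg_pi_lt_arg _, Complex.arg_le_pi _⟩

lemma det2_nonneg_of_sin {m m' : ℤ²} (h : 0 ≤ sin (angle m' - angle m)) :
    0 ≤ det2 m m' := by
  obtain ⟨r, hr, h1, h2⟩ := exists_polar m
  obtain ⟨r', hr', h1', h2'⟩ := exists_polar m'
  have : ((det2 m m' : ℤ) : ℝ) = r * r' * sin (angle m' - angle m) := by
    rw [sin_sub]
    simp only [det2]
    push_cast
    rw [h1, h2, h1', h2']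
    ring
  have h3 : (0 : ℝ) ≤ ((det2 m m' : ℤ) : ℝ) := by rw [this]; positivity
  exact_mod_cast h3

lemma exists_sine_phase (α : ℝ²) : ∃ (σ θ : ℝ), (σ = 1 ∨ σ = -1) ∧ θ ∈ Set.Ioc (-Real.pi) 0 ∧
    ∀ m : ℤ², ∃ r : ℝ, 0 ≤ r ∧ alpha α m = σ * r * sin (angle m - θ) := by
  obtain ⟨ρ, θ, hρ, hθ, h1, h2⟩ := exists_polar_real α
  have key : ∀ m : ℤ², ∃ r : ℝ, 0 ≤ r ∧ alpha α m = r * cos (angle m - θ) := by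
    intro m
    obtain ⟨r, hr, h3, h4⟩ := exists_polar m
    refine ⟨ρ * r, mul_nonneg hρ hr, ?_⟩
    rw [alpha, h1, h2, h3, h4, cos_sub]; ring
  have hpi := pi_pos
  rcases le_or_gt θ (-(Real.pi / 2)) with h | h
  · refine ⟨-1, θ + Real.pi / 2, .inr rfl, ⟨by linarith [hθ.1], by linarith⟩, fun m => ?_⟩
    obtain ⟨r, hr, h3⟩ := key m
    refine ⟨r, hr, ?_⟩
    rw [h3, ← sub_sub, sin_sub_pi_div_two]; ring
  rcases le_or_gt θ (Real.pi / 2) with h' | h'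
  · refine ⟨1, θ - Real.pi / 2, .inl rfl, ⟨by linarith, by linarith⟩, fun m => ?_⟩
    obtain ⟨r, hr, h3⟩ := key m
    refine ⟨r, hr, ?_⟩
    rw [h3, ← sub_add, sin_add_pi_div_two]; ring
  · refine ⟨-1, θ - Real.pi / 2 - Real.pi, .inr rfl, ⟨by linarith, by linarith [hθ.2]⟩, fun m => ?_⟩
    obtain ⟨r, hr, h3⟩ := key m
    refine ⟨r, hr, ?_⟩
    rw [h3, show angle m - (θ - Real.pi / 2 - Real.pi) = angle m - θ + Real.pi / 2 + Real.pi by ring,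
      sin_add_pi, sin_add_pi_div_two]
    ring

variable {β : Type}

lemma eq_filter_append_filter (ψ : β → ℝ) (θ : ℝ) : ∀ l : List β,
    l.Pairwise (fun x y => ψ x ≤ ψ y) →
    l = l.filter (fun x => ψ x ≤ θ) ++ l.filter fun x => θ < ψ x
  | [], _ => rfl
  | x :: l, h => by
    rw [List.pairwise_cons] at h
    by_cases hx : ψ x ≤ θ
    · have h1 : ¬ θ < ψ x := not_lt.2 hx
      simp only [List.filter_cons, hx, h1, decide_true, decide_false, if_true, Bool.false_eq_true,
        if_false, cons_append]
      congr 1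
      exact eq_filter_append_filter ψ θ l h.2
    · have hx' : θ < ψ x := not_le.1 hx
      have h1 : ∀ y ∈ x :: l, θ < ψ y := by
        intro y hy
        rcases mem_cons.1 hy with rfl | hy
        · exact hx'
        · exact hx'.trans_le (h.1 y hy)
      rw [List.filter_eq_nil_iff.2 (by simpa using h1), List.filter_eq_self.2 (by simpa using h1),
        nil_append]

/-- A list sorted by angles can be rotated so that it runs counterclockwise through the positive and
then the negative half-plane of a functional. -/
lemma exists_isRotated (α : ℝ²) (f : β → ℤ²) (l : List β)
    (hl : l.Pairwise fun x y => angle (f x) ≤ angle (f y)) (hα : ∀ x ∈ l, alpha α (f x) ≠ 0) :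
    ∃ a b : List β, l.IsRotated (a ++ b) ∧ (∀ x ∈ a, 0 < alpha α (f x)) ∧
      (∀ x ∈ b, alpha α (f x) < 0) ∧ a.Pairwise (fun x y => 0 ≤ det2 (f x) (f y)) ∧
      b.Pairwise (fun x y => 0 ≤ det2 (f x) (f y)) := by
  obtain ⟨σ, θ, hσ, hθ, hsin⟩ := exists_sine_phase α
  have hpi := pi_pos
  set ψ : β → ℝ := fun x => angle (f x) with hψ
  have hψm : ∀ x, ψ x ∈ Set.Ioc (-Real.pi) Real.pi := fun x => angle_mem _
  set l₁ := l.filter fun x => ψ x ≤ θ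
  set r := l.filter fun x => θ < ψ x
  set l₂ := r.filter fun x => ψ x ≤ θ + Real.pi
  set l₃ := r.filter fun x => θ + Real.pi < ψ x
  have e1 : l = l₁ ++ (l₂ ++ l₃) := by
    rw [← eq_filter_append_filter ψ (θ + Real.pi) r (hl.filter _)]
    exact eq_filter_append_filter ψ θ l hl
  have m1 : ∀ x ∈ l₁, x ∈ l ∧ ψ x ≤ θ := fun x hx => by simpa [l₁] using hx
  have m2 : ∀ x ∈ l₂, x ∈ l ∧ θ < ψ x ∧ ψ x ≤ θ + Real.pi := fun x hx => by
    have : x ∈ l ∧ ψ x ≤ θ + Real.pi ∧ θ < ψ x := by simpa [l₂, r, and_assoc] using hx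
    exact ⟨this.1, this.2.2, this.2.1⟩
  have m3 : ∀ x ∈ l₃, x ∈ l ∧ θ + Real.pi < ψ x := fun x hx => by
    have : x ∈ l ∧ θ + Real.pi < ψ x ∧ θ < ψ x := by simpa [l₃, r] using hx
    exact ⟨this.1, this.2.1⟩
  have p1 : l₁.Pairwise fun x y => ψ x ≤ ψ y := hl.filter _
  have p2 : l₂.Pairwise fun x y => ψ x ≤ ψ y := (hl.filter _).filter _
  have p3 : l₃.Pairwise fun x y => ψ x ≤ ψ y := (hl.filter _).filter _
  have d2 : l₂.Pairwise fun x y => 0 ≤ det2 (f x) (f y) := by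
    refine (Pairwise.and_mem.1 p2).imp fun {x y} h => det2_nonneg_of_sin ?_
    have hx := m2 x h.1
    have hy := m2 y h.2.1
    exact Real.sin_nonneg_of_nonneg_of_le_pi (sub_nonneg.2 h.2.2) (by
      change ψ y - ψ x ≤ _; linarith [hx.2.1, hy.2.2])
  have d31 : (l₃ ++ l₁).Pairwise fun x y => 0 ≤ det2 (f x) (f y) := by
    rw [pairwise_append]
    refine ⟨?_, ?_, ?_⟩
    · refine (Pairwise.and_mem.1 p3).imp fun {x y} h => det2_nonneg_of_sin ?_
      have hx := m3 x h.1
      exact Real.sin_nonneg_of_nonneg_of_le_pi (sub_nonneg.2 h.2.2) (by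
        change ψ y - ψ x ≤ _; linarith [hx.2, (hψm y).2, hθ.1])
    · refine (Pairwise.and_mem.1 p1).imp fun {x y} h => det2_nonneg_of_sin ?_
      have hy := m1 y h.2.1
      exact sin_nonneg_of_nonneg_of_le_pi (sub_nonneg.2 h.2.2) (by
        change ψ y - ψ x ≤ _; linarith [hy.2, (hψm x).1, hθ.2])
    · intro x hx y hy
      refine det2_nonneg_of_sin ?_
      rw [← sin_add_two_pi]
      have hx := m3 x hx
      have hy := m1 y hy
      have hx' := hψm x
      have hy' := hψm y
      exact sin_nonneg_of_nonneg_of_le_pi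
        (by change 0 ≤ ψ y - ψ x + _; linarith [hx'.2, hy'.1])
        (by change ψ y - ψ x + _ ≤ _; linarith [hx.2, hy.2])
  have s2 : ∀ x ∈ l₂, 0 ≤ Real.sin (ψ x - θ) := fun x hx =>
    Real.sin_nonneg_of_nonneg_of_le_pi (by linarith [(m2 x hx).2.1]) (by linarith [(m2 x hx).2.2])
  have s31 : ∀ x ∈ l₃ ++ l₁, sin (ψ x - θ) ≤ 0 := by
    intro x hx
    rcases mem_append.1 hx with hx | hx
    · rw [← sin_sub_two_pi]
      exact Real.sin_nonpos_of_nonpos_of_neg_pi_le (by linarith [(hψm x).2, hθ.1])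
        (by linarith [(m3 x hx).2])
    · exact Real.sin_nonpos_of_nonpos_of_neg_pi_le (by linarith [(m1 x hx).2])
        (by linarith [(hψm x).1, hθ.2])
  have mem31 : ∀ x ∈ l₃ ++ l₁, x ∈ l := fun x hx => by
    rcases mem_append.1 hx with hx | hx
    · exact (m3 x hx).1
    · exact (m1 x hx).1
  rcases hσ with rfl | rfl
  · refine ⟨l₂, l₃ ++ l₁, ?_, ?_, ?_, d2, d31⟩
    · rw [← append_assoc]
      conv_lhs => rw [e1]
      exact isRotated_append
    · intro x hx
      obtain ⟨ρ, hρ, h⟩ := hsin (f x)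
      refine lt_of_le_of_ne ?_ (hα x (m2 x hx).1).symm
      rw [h, one_mul]
      exact mul_nonneg hρ (s2 x hx)
    · intro x hx
      obtain ⟨ρ, hρ, h⟩ := hsin (f x)
      refine lt_of_le_of_ne ?_ (hα x (mem31 x hx))
      rw [h, one_mul]
      exact mul_nonpos_of_nonneg_of_nonpos hρ (s31 x hx)
  · refine ⟨l₃ ++ l₁, l₂, ?_, ?_, ?_, d31, d2⟩
    · rw [append_assoc]
      conv_lhs => rw [e1, ← append_assoc]
      exact isRotated_append
    · intro x hx
      obtain ⟨ρ, hρ, h⟩ := hsin (f x)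
      refine lt_of_le_of_ne ?_ (hα x (mem31 x hx)).symm
      rw [h]
      nlinarith [mul_nonpos_of_nonneg_of_nonpos hρ (s31 x hx)]
    · intro x hx
      obtain ⟨ρ, hρ, h⟩ := hsin (f x)
      refine lt_of_le_of_ne ?_ (hα x (m2 x hx).1)
      rw [h]
      nlinarith [mul_nonneg hρ (s2 x hx)]

end Angles

namespace SF

variable {ι R : Type} [DecidableEq ι] [Ring R]

lemma eq_zero_of_mul_eq_zero {f g : SF ι R} (hf : f.coeff ∅ = 1) (h : f * g = 0) : g = 0 := by
  refine ext fun A => ?_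
  induction A using strongInduction with
  | H A ih =>
    have h1 := congrArg (fun f => f.coeff A) h
    beta_reduce at h1
    rw [mul_coeff, sum_eq_single ∅] at h1
    · simpa [hf] using h1
    · intro B hB hne
      rw [ih _ (sdiff_ssubset (mem_powerset.1 hB) (nonempty_iff_ne_empty.2 hne)),
        zero_coeff, mul_zero]
    · simp

variable [Fintype ι] [Algebra ℂ R]

lemma prod_eq_of_isRotated {β : Type} {Y : β → SF ι R} {T : SF ι R} {l l' : List β}
    (h : l.IsRotated l') (hY : ∀ b ∈ l, (Y b).coeff ∅ = 1) (hT : IsTop T)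
    (hl : (l'.map Y).prod = 1 + T) : (l.map Y).prod = 1 + T := by
  obtain ⟨n, hn, rfl⟩ := isRotated_iff_mod.1 h
  rw [rotate_eq_drop_append_take hn, map_append, prod_append] at hl
  conv_lhs => rw [← take_append_drop n l, map_append, prod_append]
  have h1 : ((l.take n).map Y).prod.coeff ∅ = 1 :=
    prod_coeff_empty_eq_one _ fun b hb => hY b (mem_of_mem_take hb)
  have h2 : ((l.drop n).map Y).prod.coeff ∅ = 1 :=
    prod_coeff_empty_eq_one _ fun b hb => hY b (mem_of_mem_drop hb)
  rw [← sub_eq_zero]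
  refine eq_zero_of_mul_eq_zero h2 ?_
  rw [mul_sub, ← mul_assoc, hl, mul_add, mul_one, add_mul, one_mul, hT.mul_right _ h2,
    hT.mul_left _ h2, sub_self]

end SF

end

section

open Finset PowerSeries SF

/-- The derivation attached to a formal combination of exponents. -/
def opOf : (ℤ² →₀ ℂ) →ₗ[ℂ] Module.End ℂ Laurent := Finsupp.linearCombination ℂ derOp

lemma opOf_single (v : ℤ²) (c : ℂ) : opOf (Finsupp.single v c) = c • derOp v :=
  Finsupp.linearCombination_single ℂ c v

lemma commute_derOp {v w : ℤ²} (h : det2 v w = 0) : Commute (derOp v) (derOp w) := by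
  have := derOp_bracket v w
  rw [h, zero_smul, sub_eq_zero] at this
  exact this

lemma commute_opOf {f g : ℤ² →₀ ℂ} (h : ∀ v ∈ f.support, ∀ w ∈ g.support, det2 v w = 0) :
    Commute (opOf f) (opOf g) := by
  rw [opOf, Finsupp.linearCombination_apply, Finsupp.linearCombination_apply]
  exact Commute.sum_left _ _ _ fun v hv => Commute.sum_right _ _ _ fun w hw =>
    ((commute_derOp (h v hv w hw)).smul_right _).smul_left _

/-- The part of a formal combination of exponents with a given key. -/
def keyPart (K : ℤ² → ℝ) (s : ℝ) : (ℤ² →₀ ℂ) →+ (ℤ² →₀ ℂ) :=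
  Finsupp.filterAddHom fun v => K v = s

lemma keyPart_eq_self {K : ℤ² → ℝ} {s : ℝ} {f : ℤ² →₀ ℂ} (h : ∀ v ∈ f.support, K v = s) :
    keyPart K s f = f := by
  change Finsupp.filter _ f = f
  rw [Finsupp.filter_eq_self_iff]
  exact fun v hv => h v (Finsupp.mem_support_iff.2 hv)

lemma keyPart_eq_zero {K : ℤ² → ℝ} {s : ℝ} {f : ℤ² →₀ ℂ} (h : ∀ v ∈ f.support, K v ≠ s) :
    keyPart K s f = 0 := by
  change Finsupp.filter _ f = 0
  rw [Finsupp.filter_eq_zero_iff]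
  intro v hv
  by_contra h0
  exact h v (Finsupp.mem_support_iff.2 h0) hv

lemma sum_keyPart {K : ℤ² → ℝ} {f : ℤ² →₀ ℂ} (S : List ℝ) (hS : S.Pairwise (· < ·))
    (h : ∀ v ∈ f.support, K v ∈ S) : (S.map fun s => keyPart K s f).sum = f := by
  have h1 : ∀ s, keyPart K s f = ∑ v ∈ f.support, if K v = s then Finsupp.single v (f v) else 0 := by
    intro s
    conv_lhs => rw [← Finsupp.sum_single f, Finsupp.sum, map_sum]
    refine sum_congr rfl fun v hv => ?_
    split_ifs with h2
    · refine keyPart_eq_self fun w hw => ?_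
      rw [mem_singleton.1 (Finsupp.support_single_subset hw), h2]
    · refine keyPart_eq_zero fun w hw => ?_
      rwa [mem_singleton.1 (Finsupp.support_single_subset hw)]
  have hnd : S.Nodup := hS.imp fun h => h.ne
  rw [← List.sum_toFinset _ hnd]
  simp only [h1]
  rw [sum_comm]
  conv_rhs => rw [← Finsupp.sum_single f, Finsupp.sum]
  refine sum_congr rfl fun v hv => ?_
  rw [sum_ite_eq, if_pos (by simpa using h v hv)]

section Local

variable {κ : Type} [Fintype κ] [DecidableEq κ] (vec : κ → ℤ²) (lw : κ → ℕ) (w : κ → ℂ)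

/-- The logarithm of the incoming product, in a given degree. -/
def inSum (j : ℕ) : ℤ² →₀ ℂ := ∑ T, if lw T = j then Finsupp.single (vec T) (w T) else 0

/-- The part of the logarithm of the outgoing product that comes from vertices with `n` incoming
edges. -/
def outTerm (n j : ℕ) : ℤ² →₀ ℂ :=
  ((n.factorial : ℂ)⁻¹) • ∑ ts : Fin n → κ, if ∑ i, lw (ts i) = j then
    Finsupp.single (∑ i, vec (ts i)) ((Nm univ (vec ∘ ts) : ℂ) * ∏ i, w (ts i)) else 0

/-- The logarithm of the outgoing product, in a given degree. -/
def outSum (M j : ℕ) : ℤ² →₀ ℂ := ∑ n ∈ Icc 1 M, outTerm vec lw w n j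

variable (M : ℕ)

/-- The nilpotent variables attached to the incoming edges. -/
def legVar (x : κ × Finset (Fin M)) : SF (Fin M) ℂ :=
  if x.2.card = lw x.1 then single x.2 ((x.2.card.factorial : ℂ) * w x.1) else 0

/-- The elements attached to sets of incoming legs. -/
def legElt (J : Finset (κ × Finset (Fin M))) : SF (Fin M) (Module.End ℂ Laurent) :=
  SF.map (algebraMap ℂ _) (∏ x ∈ J, legVar lw w M x) * SF.C (derOp (∑ x ∈ J, vec x.1))

variable {vec lw w M}

lemma prod_legVar [NeZero M] (hlw : ∀ T, 0 < lw T) {J : Finset (κ × Finset (Fin M))}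
    (hJ : J.Nonempty) : ∃ (S : Finset (Fin M)) (c : ℂ), S.Nonempty ∧
      ∏ x ∈ J, legVar lw w M x = single S c := by
  have h0 : ∀ S, single S (0 : ℂ) = (0 : SF (Fin M) ℂ) := fun S => ext fun A => by
    rw [single_coeff]; simp
  have hu : (univ : Finset (Fin M)).Nonempty := univ_nonempty
  have h1 : ∀ x, ∃ (S : Finset (Fin M)) (c : ℂ), S.Nonempty ∧
      legVar lw w M x = single S c := by
    intro x
    rw [legVar]
    split_ifs with h
    · exact ⟨_, _, card_pos.1 (h ▸ hlw _), rfl⟩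
    · exact ⟨_, 0, hu, (h0 _).symm⟩
  induction hJ using Nonempty.cons_induction with
  | singleton x => simpa using h1 x
  | cons x s hx hs ih =>
    obtain ⟨S, c, hS, h2⟩ := h1 x
    obtain ⟨S', c', hS', h3⟩ := ih
    rw [prod_cons, h2, h3, single_mul_single]
    split_ifs
    · exact ⟨_, _, hS.mono subset_union_left, rfl⟩
    · exact ⟨_, 0, hu, (h0 _).symm⟩

lemma legVar_sq [NeZero M] (hlw : ∀ T, 0 < lw T) (x : κ × Finset (Fin M)) :
    legVar lw w M x * legVar lw w M x = 0 := by
  obtain ⟨S, c, hS, h⟩ := prod_legVar (w := w) hlw (singleton_nonempty x)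
  rw [prod_singleton] at h
  rw [h, single_mul_single, if_neg]
  exact fun h => hS.ne_empty (disjoint_self.1 h)

lemma SF.mul_C_coeff {ι R : Type} [DecidableEq ι] [Ring R] (f : SF ι R) (r : R) (A : Finset ι) :
    (f * C r).coeff A = f.coeff A * r := by
  rw [mul_coeff, sum_eq_single A]
  · simp [C_apply, single_coeff]
  · intro B hB hne
    have : A \ B ≠ ∅ := fun h => hne
      ((mem_powerset.1 hB).antisymm (sdiff_eq_empty_iff_subset.1 h))
    simp [C_apply, single_coeff, this]
  · simp

lemma legElt_coeff (J : Finset (κ × Finset (Fin M))) (A : Finset (Fin M)) :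
    (legElt vec lw w M J).coeff A =
      opOf (Finsupp.single (∑ x ∈ J, vec x.1) ((∏ x ∈ J, legVar lw w M x).coeff A)) := by
  rw [legElt, mul_C_coeff, map_coeff, opOf_single, Algebra.smul_def]

lemma isExp_legElt [NeZero M] (hlw : ∀ T, 0 < lw T) {J : Finset (κ × Finset (Fin M))}
    (hJ : J.Nonempty) (c : ℂ) : SF.IsExp (c • legElt vec lw w M J) (1 + c • legElt vec lw w M J) := by
  obtain ⟨S, a, hS, h⟩ := prod_legVar (w := w) hlw hJ
  have : c • legElt vec lw w M J = single S (c • (algebraMap ℂ (Module.End ℂ Laurent) a *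
      derOp (∑ x ∈ J, vec x.1))) := by
    rw [legElt, h, map_single, single_mul_C]
    refine ext fun A => ?_
    rw [smul_coeff, single_coeff, single_coeff]
    split_ifs <;> simp
  rw [this]
  exact IsExp.one_add_single hS _

lemma isLegSystem_legElt [NeZero M] (hlw : ∀ T, 0 < lw T) :
    IsLegSystem (fun x : κ × Finset (Fin M) => vec x.1) (legElt vec lw w M) :=
  isLegSystem_of_square_zero (fun v => SF.C (derOp v))
    (fun v w => by rw [← map_mul, ← map_mul, ← map_sub, derOp_bracket, map_zsmul]) _
    (fun q r => commute_map q r) _ (legVar_sq hlw)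

lemma sum_legVar_single (A : Finset (Fin M)) :
    ∑ x : κ × Finset (Fin M), Finsupp.single (vec x.1) ((legVar lw w M x).coeff A) =
      (A.card.factorial : ℂ) • inSum vec lw w A.card := by
  rw [Fintype.sum_prod_type, inSum, smul_sum]
  refine sum_congr rfl fun T _ => ?_
  rw [sum_eq_single A]
  · simp only [legVar]
    by_cases h : A.card = lw T
    · rw [if_pos h, if_pos h.symm, single_coeff, if_pos rfl, Finsupp.smul_single, smul_eq_mul]
    · rw [if_neg h, if_neg (Ne.symm h)]; simp
  · intro B _ hB
    simp only [legVar]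
    split_ifs
    · rw [single_coeff, if_neg hB.symm, Finsupp.single_zero]
    · simp
  · simp

/-- Sums over subsets as sums over injective maps. -/
lemma sum_powersetCard_eq {L V : Type} [Fintype L] [DecidableEq L] [AddCommGroup V] [Module ℂ V]
    (n : ℕ) (F : Finset L → V) : σ(F,powersetCard n univ) =
      ((n.factorial : ℂ)⁻¹) • ∑ a : Fin n → L with Function.Injective a,
        F (univ.image a) := by
  have h : ∑ a : Fin n → L with Function.Injective a, F (univ.image a) =
      (n.factorial : ℂ) • ∑ J ∈ powersetCard n univ, F J := by
    rw [← sum_fiberwise_of_maps_to (t := powersetCard n univ)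
      (g := fun a : Fin n → L => univ.image a)]
    · rw [smul_sum]
      refine sum_congr rfl fun J hJ => ?_
      rw [mem_powersetCard] at hJ
      rw [sum_congr rfl (g := fun _ => F J) (by
        intro a ha; rw [(mem_filter.1 ha).2]), sum_const, Nat.cast_smul_eq_nsmul]
      congr 1
      rw [show n.factorial = (univ : Finset (Fin n ≃ J)).card by
        rw [card_univ, Fintype.card_equiv (Fintype.equivOfCardEq (by simp [hJ.2])),
          Fintype.card_fin]]
      symm
      refine card_bij (fun e _ i => (e i : L)) ?_ ?_ ?_
      · intro e _
        simp only [mem_filter, mem_univ, true_and]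
        refine ⟨Subtype.val_injective.comp e.injective, ?_⟩
        ext x
        simp only [mem_image, mem_univ, true_and]
        constructor
        · rintro ⟨i, rfl⟩; exact (e i).2
        · intro hx; exact ⟨e.symm ⟨x, hx⟩, by simp⟩
      · intro e _ e' _ hee
        ext i
        exact congrFun hee i
      · intro a ha
        simp only [mem_filter, mem_univ, true_and] at ha
        have hmem : ∀ i, a i ∈ J := fun i => ha.2 ▸ mem_image_of_mem a (mem_univ i)
        refine ⟨Equiv.ofBijective (fun i => (⟨a i, hmem i⟩ : J)) ⟨?_, ?_⟩, mem_univ _, ?_⟩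
        · intro i j hij
          exact ha.1 (Subtype.ext_iff.1 hij)
        · rintro ⟨x, hx⟩
          rw [← ha.2] at hx
          obtain ⟨i, -, rfl⟩ := mem_image.1 hx
          exact ⟨i, rfl⟩
        · rfl
    · intro a ha
      rw [mem_powersetCard]
      refine ⟨subset_univ _, ?_⟩
      rw [card_image_of_injective _ (mem_filter.1 ha).2, card_univ,
        Fintype.card_fin]
  rw [h, smul_smul, inv_mul_cancel₀ (mod_cast n.factorial_ne_zero), one_smul]

lemma sum_legVar (T : κ) : ∑ A : Finset (Fin M), legVar lw w M (T, A) =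
    toSF (Fin M) (monomial (lw T) (w T)) := by
  refine ext fun A => ?_
  rw [sum_coeff, toSF_coeff, sum_eq_single A, coeff_monomial]
  · simp only [legVar]
    split_ifs
    · rw [single_coeff, if_pos rfl, nsmul_eq_mul]
    · simp
  · intro B _ hB
    simp only [legVar]
    split_ifs
    · rw [single_coeff, if_neg hB.symm]
    · simp
  · simp

lemma prod_monomial {n : ℕ} (o : Fin n → ℕ) (c : Fin n → ℂ) :
    ∏ i, monomial (o i) (c i) = monomial (∑ i, o i) (∏ i, c i) := by
  have h : ∀ (o : ℕ) (c : ℂ), monomial o c = C c * X ^ o := by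
    intro o c; ext1 N; rw [coeff_C_mul_X_pow, coeff_monomial]
  simp only [h, prod_mul_distrib, map_prod, prod_pow_eq_pow_sum]

variable {α : ℝ²}

lemma sum_legSets_single [NeZero M] (hlw : ∀ T, 0 < lw T) (hα : ∀ T, 0 < alpha α (vec T))
    (A : Finset (Fin M)) : ∑ J : Finset (κ × Finset (Fin M)) with J.Nonempty,
      Finsupp.single (∑ x ∈ J, vec x.1)
        ((Nm J (fun x => vec x.1) : ℂ) * (∏ x ∈ J, legVar lw w M x).coeff A) =
      (A.card.factorial : ℂ) • outSum vec lw w M A.card := by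
  set F : Finset (κ × Finset (Fin M)) → ℤ² →₀ ℂ := fun J =>
    Finsupp.single (∑ x ∈ J, vec x.1)
        ((Nm J (fun x => vec x.1) : ℂ) * (∏ x ∈ J, legVar lw w M x).coeff A) with hF
  have key : ∀ n, σ(F,powersetCard n univ) =
      (A.card.factorial : ℂ) • outTerm vec lw w n A.card := by
    intro n
    rw [sum_powersetCard_eq, outTerm, smul_comm (A.card.factorial : ℂ)]
    congr 1
    have h1 : ∑ a : Fin n → κ × Finset (Fin M) with Function.Injective a,
        F (univ.image a) = ∑ a : Fin n → κ × Finset (Fin M),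
          Finsupp.single (∑ i, vec (a i).1) ((Nm univ (fun i => vec (a i).1) : ℂ) *
            (∏ i, legVar lw w M (a i)).coeff A) := by
      rw [sum_filter]
      refine sum_congr rfl fun a _ => ?_
      split_ifs with ha
      · simp only [hF]
        rw [sum_image (fun i _ j _ h => ha h), prod_image (fun i _ j _ h => ha h),
          Nm_image (α := α) ha.injOn (fun i _ => hα _)]
        rfl
      · simp only [Function.Injective, not_forall] at ha
        obtain ⟨i, j, hij, hne⟩ := ha
        have : ∏ i, legVar lw w M (a i) = 0 := by
          rw [← mul_prod_erase _ _ (mem_univ i), ← mul_prod_erase _ _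
            (mem_erase.2 ⟨Ne.symm hne, mem_univ j⟩), ← mul_assoc, hij,
            legVar_sq hlw, zero_mul]
        rw [this]; simp
    rw [h1, ← (Equiv.arrowProdEquivProdArrow (Fin n) (fun _ => κ) fun _ => Finset (Fin M)).symm.sum_comp,
      Fintype.sum_prod_type, smul_sum]
    refine sum_congr rfl fun ts _ => ?_
    have h2 : ∑ B : Fin n → Finset (Fin M), (∏ i, legVar lw w M (ts i, B i)).coeff A =
        if ∑ i, lw (ts i) = A.card then (A.card.factorial : ℂ) * ∏ i, w (ts i) else 0 := by
      rw [← sum_coeff, ← Fintype.piFinset_univ,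
        ← prod_univ_sum (fun _ => univ) fun i B => legVar lw w M (ts i, B)]
      simp only [sum_legVar]
      rw [← map_prod, prod_monomial, toSF_coeff, coeff_monomial]
      split_ifs with h h' h'
      · rw [nsmul_eq_mul]
      · exact absurd h.symm h'
      · exact absurd h'.symm h
      · simp
    simp only [Equiv.arrowProdEquivProdArrow, Equiv.coe_fn_symm_mk]
    refine (map_sum (Finsupp.singleAddHom (∑ i, vec (ts i))) (fun y : Fin n → Finset (Fin M) =>
      (Nm univ (fun i => vec (ts i)) : ℂ) *
        (∏ i, legVar lw w M (ts i, y i)).coeff A) univ).symm.trans ?_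
    rw [← mul_sum, h2, Finsupp.singleAddHom_apply]
    split_ifs
    · rw [Finsupp.smul_single, smul_eq_mul]
      congr 1
      rw [mul_left_comm]
      rfl
    · simp
  have hsplit : ∑ J : Finset (κ × Finset (Fin M)) with J.Nonempty, F J =
      ∑ n ∈ Icc 1 (max M (Fintype.card (κ × Finset (Fin M)))),
        ∑ J ∈ powersetCard n univ, F J := by
    rw [← sum_fiberwise_of_maps_to (g := card)
      (t := Icc 1 (max M (Fintype.card (κ × Finset (Fin M)))))]
    · refine sum_congr rfl fun n hn => sum_congr ?_ fun _ _ => rfl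
      ext J
      simp only [mem_filter, mem_univ, true_and, mem_powersetCard,
        subset_univ]
      constructor
      · exact fun h => h.2
      · intro h
        refine ⟨card_pos.1 ?_, h⟩
        rw [h]; exact (mem_Icc.1 hn).1
    · intro J hJ
      rw [mem_Icc]
      exact ⟨card_pos.2 (mem_filter.1 hJ).2,
        (card_le_univ J).trans (le_max_right _ _)⟩
  rw [hsplit, outSum, smul_sum]
  simp only [key]
  symm
  refine sum_subset (Icc_subset_Icc_right (le_max_left _ _)) fun n hn hn' => ?_
  rw [mem_Icc] at hn hn'
  have hA : A.card ≤ M := by simpa using card_le_univ A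
  rw [outTerm, sum_eq_zero, smul_zero, smul_zero]
  intro ts _
  rw [if_neg]
  have : ∑ i : Fin n, 1 ≤ ∑ i, lw (ts i) := sum_le_sum fun i _ => hlw _
  simp only [sum_const, card_univ, Fintype.card_fin, smul_eq_mul, mul_one] at this
  omega

end Local

end

section

open Finset PowerSeries Finsupp SF

lemma prod_one_sub_reverse_mul {R β : Type} [Ring R] (a : β → R) : ∀ l : List β,
    (∀ b ∈ l, a b * a b = 0) →
    (l.reverse.map fun b => 1 + -a b).prod * (l.map fun b => 1 + a b).prod = 1
  | [], _ => by simp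
  | b :: l, h => by
    have ih := prod_one_sub_reverse_mul a l fun c hc => h c (.tail _ hc)
    have hb : (1 + -a b) * (1 + a b) = 1 := by
      have := h b List.mem_cons_self
      rw [add_mul, one_mul, mul_add, mul_one, neg_mul, this]; abel
    rw [List.reverse_cons, List.map_append, List.prod_append, List.map_singleton,
      List.prod_singleton, List.map_cons, List.prod_cons, mul_assoc, ← mul_assoc (1 + -a b), hb, one_mul, ih]

lemma coeff_sum_filter {ι β : Type} [DecidableEq ι] {K : ℤ² → ℝ} {key : β → ℝ}
    {x : β → SF ι (Module.End ℂ Laurent)} {F : β → ℤ² →₀ ℂ} {A : Finset ι} (s : ℝ) :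
    ∀ l : List β, (∀ b ∈ l, (x b).coeff A = opOf (F b)) →
      (∀ b ∈ l, ∀ v ∈ (F b).support, K v = key b) →
      (((l.filter fun b => key b = s).map x).sum).coeff A = opOf (keyPart K s (l.map F).sum)
  | [], _, _ => by simp
  | b :: l, hF, hK => by
    have ih := coeff_sum_filter s l (fun c hc => hF c (.tail _ hc))
      fun c hc => hK c (.tail _ hc)
    rw [List.map_cons, List.sum_cons, map_add, map_add, ← ih, List.filter_cons]
    by_cases hb : key b = s
    · rw [if_pos (by simpa using hb), List.map_cons, List.sum_cons, add_coeff,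
        hF b List.mem_cons_self, keyPart_eq_self]
      intro v hv
      rw [hK b (.head _) v hv, hb]
    · rw [if_neg (by simpa using hb), keyPart_eq_zero, map_zero, zero_add]
      intro v hv
      rwa [hK b (.head _) v hv]

lemma SF.commute_coeff_of_key {ι β : Type} [DecidableEq ι] {α : ℝ²}
    {x : β → SF ι (Module.End ℂ Laurent)} {F : β → Finset ι → ℤ² →₀ ℂ} {b b' : β} {k : ℝ}
    (hx : ∀ A, (x b).coeff A = opOf (F b A)) (hx' : ∀ A, (x b').coeff A = opOf (F b' A))
    (h : ∀ A, ∀ v ∈ (F b A).support, 0 < alpha α v ∧ -slope α v = k)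
    (h' : ∀ A, ∀ v ∈ (F b' A).support, 0 < alpha α v ∧ -slope α v = k) (A B : Finset ι) :
    Commute ((x b).coeff A) ((x b').coeff B) := by
  rw [hx, hx']
  refine commute_opOf fun v hv w hw => ?_
  have h1 := h A v hv
  have h2 := h' B w hw
  rw [← slope_eq_iff h1.1 h2.1]
  linarith [h1.2, h2.2]

/-- The logarithm of a half-ray, in a given degree. -/
def rayLog (x : Ray × ℤˣ) (j : ℕ) : ℤ² →₀ ℂ :=
  single (x.1.logVec j) (((x.2 : ℤ) : ℂ) * x.1.logCoeff j)

lemma crossLog_coeff {M : ℕ} (x : Ray × ℤˣ) (A : Finset (Fin M)) :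
    (toSF (Fin M) (crossLog x)).coeff A = opOf ((A.card.factorial : ℂ) • rayLog x A.card) := by
  rw [toSF_coeff, crossLog, coeff_mk, map_smul, rayLog, opOf_single,
    Nat.cast_smul_eq_nsmul]

section Loop

variable {κ : Type} [Fintype κ] [DecidableEq κ] {vec : κ → ℤ²} {lw : κ → ℕ} {w : κ → ℂ}
  {M : ℕ} {α : ℝ²}

lemma rayLog_support {x : Ray × ℤˣ} {c : ℂ} {j : ℕ} (hw : 0 < x.1.wt) (h : 0 < alpha α x.1.dir)
    {v : ℤ²} (hv : v ∈ (c • rayLog x j).support) :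
    0 < alpha α v ∧ slope α v = slope α x.1.dir := by
  rw [rayLog, smul_single] at hv
  have hv1 := mem_singleton.1 (support_single_subset hv)
  have hc : x.1.logCoeff j ≠ 0 := by
    intro h0
    rw [h0] at hv
    simp at hv
  have hj : 0 < j / x.1.ord := by
    rw [Nat.pos_iff_ne_zero]
    intro h0
    rw [Ray.logCoeff] at hc
    simp [h0] at hc
  subst hv1
  have hk : 0 < x.1.wt * (j / x.1.ord) := Nat.mul_pos hw hj
  rw [Ray.logVec]
  generalize x.1.wt * (j / x.1.ord) = k at hk
  have ha : 0 < alpha α (k • x.1.dir) := by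
    have : alpha α (k • x.1.dir) = k * alpha α x.1.dir := by
      simp only [alpha, Prod.smul_fst, Prod.smul_snd]; simp only [nsmul_eq_mul]; push_cast; ring
    rw [this]; positivity
  refine ⟨ha, (slope_eq_iff ha h).2 ?_⟩
  simp only [det2, Prod.smul_fst, Prod.smul_snd]; simp only [nsmul_eq_mul]; ring

/-- Around a point, the path-ordered product is determined, in the first degree in which the
incoming and outgoing logarithms may differ from those prescribed by the vertex theorem, by
these differences. -/
lemma coeff_loop_eq [NeZero M] (hlw : ∀ T, 0 < lw T) (hα : ∀ T, 0 < alpha α (vec T))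
    {l : List (Ray × ℤˣ)} (hl : l.Pairwise fun x y => angle (halfDir x) ≤ angle (halfDir y))
    (hord : ∀ x ∈ l, 0 < x.1.ord) (hwt : ∀ x ∈ l, 0 < x.1.wt)
    (hdir : ∀ x ∈ l, 0 < alpha α x.1.dir)
    (hin : ∀ j < M, ((l.filter fun x => x.2 = -1).map fun x => rayLog x j).sum = -inSum vec lw w j)
    (hout : ∀ j < M, ((l.filter fun x => x.2 = 1).map fun x => rayLog x j).sum =
      outSum vec lw w M j) :
    coeff M (l.map crossSeries).reverse.prod =
      opOf ((l.map fun x => rayLog x M).sum + inSum vec lw w M - outSum vec lw w M M) := by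
  set K : ℤ² → ℝ := fun v => -slope α v with hK
  have hsgn : ∀ x ∈ l, alpha α (halfDir x) = (x.2 : ℤ) * alpha α x.1.dir := by
    intro x _
    simp only [alpha, halfDir, Prod.smul_fst, Prod.smul_snd, smul_eq_mul]; push_cast; ring
  obtain ⟨a, b, hrot, ha, hb, hda, hdb⟩ := exists_isRotated α halfDir l hl (by
    intro x hx
    rw [hsgn x hx]
    have := hdir x hx
    rcases Int.units_eq_one_or x.2 with h | h <;> simp [h, this.ne'])
  have hperm := hrot.perm
  have hal : ∀ x ∈ a, x ∈ l := fun x hx => hperm.mem_iff.2 (List.mem_append_left _ hx)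
  have hbl : ∀ x ∈ b, x ∈ l := fun x hx => hperm.mem_iff.2 (List.mem_append_right _ hx)
  have ha1 : ∀ x ∈ a, x.2 = 1 := by
    intro x hx
    have h1 := ha x hx
    rw [hsgn x (hal x hx)] at h1
    rcases Int.units_eq_one_or x.2 with h | h
    · exact h
    · have := hdir x (hal x hx)
      rw [h] at h1; simp at h1; linarith
  have hb1 : ∀ x ∈ b, x.2 = -1 := by
    intro x hx
    have h1 := hb x hx
    rw [hsgn x (hbl x hx)] at h1
    rcases Int.units_eq_one_or x.2 with h | h
    · have := hdir x (hbl x hx)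
      rw [h] at h1; simp at h1; linarith
    · exact h
  have hfa : ∀ g : Ray × ℤˣ → ℤ² →₀ ℂ, ((l.filter fun x => x.2 = 1).map g).sum =
      (a.map g).sum := by
    intro g
    have h1 := ((hperm.filter fun x => x.2 = 1).map g).sum_eq
    rw [h1, List.filter_append, List.filter_eq_self.2 (by simpa using ha1),
      List.filter_eq_nil_iff.2 (by intro x hx; simp [hb1 x hx]), List.append_nil]
  have hfb : ∀ g : Ray × ℤˣ → ℤ² →₀ ℂ, ((l.filter fun x => x.2 = -1).map g).sum =
      (b.map g).sum := by
    intro g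
    have h1 := ((hperm.filter fun x => x.2 = -1).map g).sum_eq
    have h2 : (a.filter fun x => x.2 = -1) = [] :=
      List.filter_eq_nil_iff.2 (by intro x hx; simp [ha1 x hx])
    rw [h1, List.filter_append, h2, List.filter_eq_self.2 (by simpa using hb1), List.nil_append]
  have hfl : ∀ g : Ray × ℤˣ → ℤ² →₀ ℂ, (l.map g).sum = (a.map g).sum + (b.map g).sum := by
    intro g
    rw [(hperm.map g).sum_eq, List.map_append, List.sum_append]
  simp only [hfa] at hout
  simp only [hfb] at hin
  -- the model
  set u : κ × Finset (Fin M) → ℤ² := fun x => vec x.1 with hu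
  have hαu : ∀ i, 0 < alpha α (u i) := fun i => hα i.1
  obtain ⟨c, hc⟩ := exists_genericDispl univ u
  set lab := sortBy (fun i => slope α (u i)) (univ : Finset (κ × Finset (Fin M))).toList
  set sets := sortBy (fun J : Finset (κ × Finset (Fin M)) => K σ(u,J))
    (legSets (κ × Finset (Fin M)))
  have hmem : ∀ J ∈ sets, J.Nonempty := fun J hJ => mem_legSets.1 ((sortBy_perm _ _).mem_iff.1 hJ)
  have hvert := vertex_factorization hαu (isLegSystem_legElt (vec := vec) (w := w) (M := M) hlw) hc
    (l := lab) (sortBy_perm _ _)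
    ((sortBy_pairwise _ _).imp fun {i j} h => (slope_le_iff (hαu i) (hαu j)).1 h)
    (l' := sets) (sortBy_perm _ _) (by
      refine (List.Pairwise.and_mem.1 (sortBy_pairwise _ _)).imp fun {J L} h => ?_
      have h1 := (slope_le_iff (alpha_sum_pos hαu (hmem L h.2.1))
        (alpha_sum_pos hαu (hmem J h.1))).1 (neg_le_neg_iff.1 h.2.2)
      rw [det2_swap]; linarith)
  set e₁ : κ × Finset (Fin M) → SF (Fin M) (Module.End ℂ Laurent) := fun i =>
    legElt vec lw w M {i} with he₁
  set e₂ : Finset (κ × Finset (Fin M)) → SF (Fin M) (Module.End ℂ Laurent) := fun J =>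
    (Nm J u : ℂ) • legElt vec lw w M J with he₂
  have hvert' : (lab.map fun i => 1 + e₁ i).prod = (sets.map fun J => 1 + e₂ J).prod := by
    rw [hvert]
    congr 1
    refine List.map_congr_left fun J hJ => ?_
    have hcJ : GenericDispl J u c := fun J' K' L' hJ' hK' hL' => hc J' K' L'
      (subset_univ _) (subset_univ _) (subset_univ _)
    rw [curveCount_eq_Nm (fun i _ => hαu i) hcJ]
    congr 1
    refine ext fun A => ?_
    rw [he₂, nsmul_coeff, smul_coeff, Nat.cast_smul_eq_nsmul]
  -- formal logarithms of the model
  set F₁ : κ × Finset (Fin M) → Finset (Fin M) → ℤ² →₀ ℂ := fun i A =>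
    -single (u i) ((legVar lw w M i).coeff A) with hF₁
  set F₂ : Finset (κ × Finset (Fin M)) → Finset (Fin M) → ℤ² →₀ ℂ := fun J A =>
    single σ(u,J) ((Nm J u : ℂ) * (∏ x ∈ J, legVar lw w M x).coeff A) with hF₂
  have hx₁ : ∀ i A, (-e₁ i).coeff A = opOf (F₁ i A) := by
    intro i A
    rw [neg_coeff, he₁, legElt_coeff, hF₁, map_neg, sum_singleton, prod_singleton]
  have hx₂ : ∀ J A, (e₂ J).coeff A = opOf (F₂ J A) := by
    intro J A
    rw [he₂, smul_coeff, legElt_coeff, hF₂, ← map_smul, smul_single, smul_eq_mul]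
  have hs₁ : ∀ i A, ∀ v ∈ (F₁ i A).support, 0 < alpha α v ∧ K v = K (u i) := by
    intro i A v hv
    rw [hF₁, support_neg] at hv
    rw [mem_singleton.1 (support_single_subset hv)]
    exact ⟨hαu i, rfl⟩
  have hs₂ : ∀ J, J.Nonempty → ∀ A, ∀ v ∈ (F₂ J A).support,
      0 < alpha α v ∧ K v = K σ(u,J) := by
    intro J hJ A v hv
    rw [mem_singleton.1 (support_single_subset hv)]
    exact ⟨alpha_sum_pos hαu hJ, rfl⟩
  have hsum₁ : ∀ A : Finset (Fin M), (lab.reverse.map fun i => F₁ i A).sum =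
      -((A.card.factorial : ℂ) • inSum vec lw w A.card) := by
    intro A
    rw [← sum_legVar_single, ← sum_neg_distrib,
      (((List.reverse_perm lab).trans (sortBy_perm _ _)).map fun i => F₁ i A).sum_eq,
      sum_map_toList]
  have hsum₂ : ∀ A : Finset (Fin M), (sets.map fun J => F₂ J A).sum =
      (A.card.factorial : ℂ) • outSum vec lw w M A.card := by
    intro A
    rw [← sum_legSets_single (α := α) hlw hα, ((sortBy_perm _ _).map fun J => F₂ J A).sum_eq,
      legSets, sum_map_toList]
  -- formal logarithms of the rays
  set FR : Ray × ℤˣ → Finset (Fin M) → ℤ² →₀ ℂ := fun x A =>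
    (A.card.factorial : ℂ) • rayLog x A.card with hFR
  have hsR : ∀ x ∈ l, ∀ A, ∀ v ∈ (FR x A).support, 0 < alpha α v ∧ K v = K x.1.dir := by
    intro x hx A v hv
    have := rayLog_support (hwt x hx) (hdir x hx) hv
    exact ⟨this.1, congrArg Neg.neg this.2⟩
  have hsumR : ∀ (l' : List (Ray × ℤˣ)) A, (l'.map fun x => FR x A).sum =
      (A.card.factorial : ℂ) • (l'.map fun x => rayLog x A.card).sum := by
    intro l' A
    rw [List.smul_sum, List.map_map]; rfl
  have hsorted : ∀ l' : List (Ray × ℤˣ), (∀ x ∈ l', x ∈ l) → (∀ x ∈ l', ∀ y ∈ l', x.2 = y.2) →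
      l'.Pairwise (fun x y => 0 ≤ det2 (halfDir x) (halfDir y)) →
      l'.reverse.Pairwise fun x y => K x.1.dir ≤ K y.1.dir := by
    intro l' hl' h2 h
    rw [List.pairwise_reverse]
    refine (List.Pairwise.and_mem.1 h).imp fun {x y} hxy => neg_le_neg ?_
    rw [slope_le_iff (hdir x (hl' x hxy.1)) (hdir y (hl' y hxy.2.1))]
    have h3 := hxy.2.2
    have h4 : det2 (halfDir x) (halfDir y) = det2 x.1.dir y.1.dir := by
      rw [det2_halfDir, halfDir, ← h2 x hxy.1 y hxy.2.1]
      simp only [det2, Prod.smul_fst, Prod.smul_snd, smul_eq_mul]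
      rcases Int.units_eq_one_or x.2 with h | h <;> rw [h] <;> simp <;> ring
    rwa [h4] at h3
  -- all the slopes
  obtain ⟨S, hS, hSl, hSlab, hSsets, hSv⟩ : ∃ S : List ℝ, S.Pairwise (· < ·) ∧
      (∀ x ∈ l, K x.1.dir ∈ S) ∧ (∀ i, K (u i) ∈ S) ∧ (∀ J, K σ(u,J) ∈ S) ∧
      ∀ v ∈ ((l.map fun x => rayLog x M).sum + inSum vec lw w M -
        outSum vec lw w M M).support ∪ ((b.map fun x => rayLog x M).sum + inSum vec lw w M).support ∪
        ((a.map fun x => rayLog x M).sum - outSum vec lw w M M).support, K v ∈ S := by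
    refine ⟨(((l.map fun x => K x.1.dir).toFinset ∪ univ.image fun i => K (u i)) ∪
      (univ.image fun J : Finset (κ × Finset (Fin M)) => K σ(u,J)) ∪ image K
      (((l.map fun x => rayLog x M).sum + inSum vec lw w M -
        outSum vec lw w M M).support ∪ ((b.map fun x => rayLog x M).sum + inSum vec lw w M).support ∪
        ((a.map fun x => rayLog x M).sum - outSum vec lw w M M).support)).sort (· ≤ ·),
      (sortedLT_sort _).pairwise, ?_, ?_, ?_, ?_⟩
    · intro x hx
      rw [mem_sort]
      exact mem_union_left _ (mem_union_left _ (mem_union_left _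
        (List.mem_toFinset.2 (List.mem_map_of_mem hx))))
    · intro i
      rw [mem_sort]
      exact mem_union_left _ (mem_union_left _ (mem_union_right _
        (mem_image_of_mem (fun i => K (u i)) (mem_univ i))))
    · intro J
      rw [mem_sort]
      exact mem_union_left _ (mem_union_right _
        (mem_image_of_mem (fun J => K σ(u,J)) (mem_univ J)))
    · intro v hv
      rw [mem_sort]
      exact mem_union_right _ (mem_image_of_mem K hv)
  -- comparison
  set top : (ℤ² →₀ ℂ) → SF (Fin M) (Module.End ℂ Laurent) := fun f =>
    single univ (opOf ((M.factorial : ℂ) • f)) with htop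
  have htopT : ∀ f, IsTop (top f) := fun f A hA => by rw [htop, single_coeff, if_neg hA]
  have htop_sum : ∀ f : ℤ² →₀ ℂ, (∀ v ∈ f.support, K v ∈ S) →
      (S.map fun s => top (keyPart K s f)).sum = top f := by
    intro f hf
    have hadd : ∀ f g, top (f + g) = top f + top g := fun f g => by
      refine ext fun A => ?_
      simp only [htop, single_coeff, add_coeff, smul_add, map_add]
      split_ifs <;> simp
    have hzero : top 0 = 0 := by
      refine ext fun A => ?_
      simp [htop, single_coeff]
    have := map_list_sum (⟨⟨top, hzero⟩, hadd⟩ : (ℤ² →₀ ℂ) →+ _) (S.map fun s => keyPart K s f)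
    rw [sum_keyPart S hS hf, List.map_map] at this
    exact this.symm
  have hcase : ∀ (A : Finset (Fin M)) (f g : ℕ → ℤ² →₀ ℂ) (s : ℝ), (∀ j < M, f j = g j) →
      opOf (keyPart K s ((A.card.factorial : ℂ) • f A.card)) =
        opOf (keyPart K s ((A.card.factorial : ℂ) • g A.card)) +
          (top (keyPart K s (f M - g M))).coeff A := by
    intro A f g s hfg
    have hsm : ∀ (c : ℂ) (f : ℤ² →₀ ℂ), keyPart K s (c • f) = c • keyPart K s f :=
      fun c f => filter_smul
    rw [htop, single_coeff]
    rcases eq_or_ne A univ with rfl | hA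
    · rw [if_pos rfl, card_univ, Fintype.card_fin, ← map_add, hsm, hsm, ← smul_add,
        ← map_add, add_sub_cancel]
    · have : A.card < M := by
        have := card_lt_card (ssubset_univ_iff.2 hA)
        simpa using this
      rw [if_neg hA, add_zero, hfg _ this]
  have cmpa := prod_eq_prod_add_top (l := sets) (x := e₂) (y := fun J => 1 + e₂ J)
    (key := fun J => K σ(u,J)) (l' := a.reverse) (x' := fun x => toSF (Fin M) (crossLog x))
    (y' := fun x => toSF (Fin M) (crossSeries x)) (key' := fun x => K x.1.dir)
    (t := fun s => top (keyPart K s ((a.map fun x => rayLog x M).sum - outSum vec lw w M M)))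
    hS (sortBy_pairwise _ _)
    (hsorted a hal (fun x hx y hy => (ha1 x hx).trans (ha1 y hy).symm) hda)
    (fun J _ => hSsets J) (fun x hx => hSl x (hal x (List.mem_reverse.1 hx)))
    (fun J hJ => isExp_legElt hlw (hmem J hJ) _)
    (fun x hx => isExp_toSF_cross x (hord x (hal x (List.mem_reverse.1 hx)))
      (hwt x (hal x (List.mem_reverse.1 hx))))
    (fun J hJ J' hJ' h => commute_coeff_of_key (α := α) (hx₂ J) (hx₂ J')
      (hs₂ J (hmem J hJ)) fun A v hv => by rw [h]; exact hs₂ J' (hmem J' hJ') A v hv)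
    (fun x hx y hy h => commute_coeff_of_key (α := α)
      (x := fun x => toSF (Fin M) (crossLog x)) (F := FR) (crossLog_coeff x)
      (crossLog_coeff y) (hsR x (hal x (List.mem_reverse.1 hx))) fun A v hv => by
        rw [h]; exact hsR y (hal y (List.mem_reverse.1 hy)) A v hv)
    (fun s => htopT _) (by
      intro s _ A _
      rw [add_coeff, coeff_sum_filter (K := K) (F := fun x => FR x A) s a.reverse
        (fun x _ => crossLog_coeff x A)
        (fun x hx v hv => (hsR x (hal x (List.mem_reverse.1 hx)) A v hv).2),
        coeff_sum_filter (K := K) (F := fun J => F₂ J A) s sets (fun J _ => hx₂ J A)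
        (fun J hJ v hv => (hs₂ J (hmem J hJ) A v hv).2), hsum₂, List.map_reverse, List.sum_reverse,
        hsumR]
      exact hcase A (fun j => (a.map fun x => rayLog x j).sum) (outSum vec lw w M) s hout)
  have cmpb := prod_eq_prod_add_top (l := lab.reverse) (x := fun i => -e₁ i)
    (y := fun i => 1 + -e₁ i) (key := fun i => K (u i)) (l' := b.reverse)
    (x' := fun x => toSF (Fin M) (crossLog x))
    (y' := fun x => toSF (Fin M) (crossSeries x)) (key' := fun x => K x.1.dir)
    (t := fun s => top (keyPart K s ((b.map fun x => rayLog x M).sum - -inSum vec lw w M)))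
    hS (by
      rw [List.pairwise_reverse]
      exact (sortBy_pairwise _ _).imp fun {i j} h => neg_le_neg h)
    (hsorted b hbl (fun x hx y hy => (hb1 x hx).trans (hb1 y hy).symm) hdb)
    (fun i _ => hSlab i) (fun x hx => hSl x (hbl x (List.mem_reverse.1 hx)))
    (fun i _ => by
      have := isExp_legElt (vec := vec) (w := w) hlw (singleton_nonempty i) (-1 : ℂ)
      have h2 : (-1 : ℂ) • legElt vec lw w M {i} = -e₁ i := by
        refine ext fun A => ?_
        rw [smul_coeff, neg_coeff, neg_one_smul]
      rwa [h2] at this)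
    (fun x hx => isExp_toSF_cross x (hord x (hbl x (List.mem_reverse.1 hx)))
      (hwt x (hbl x (List.mem_reverse.1 hx))))
    (fun i _ i' _ h => commute_coeff_of_key (α := α) (x := fun i => -e₁ i) (F := F₁) (hx₁ i) (hx₁ i')
      (hs₁ i) fun A v hv => by rw [h]; exact hs₁ i' A v hv)
    (fun x hx y hy h => commute_coeff_of_key (α := α)
      (x := fun x => toSF (Fin M) (crossLog x)) (F := FR) (crossLog_coeff x)
      (crossLog_coeff y) (hsR x (hbl x (List.mem_reverse.1 hx))) fun A v hv => by
        rw [h]; exact hsR y (hbl y (List.mem_reverse.1 hy)) A v hv)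
    (fun s => htopT _) (by
      intro s _ A _
      rw [add_coeff, coeff_sum_filter (K := K) (F := fun x => FR x A) s b.reverse
        (fun x _ => crossLog_coeff x A)
        (fun x hx v hv => (hsR x (hbl x (List.mem_reverse.1 hx)) A v hv).2),
        coeff_sum_filter (K := K) (F := fun i => F₁ i A) s lab.reverse (fun i _ => hx₁ i A)
        (fun i _ v hv => (hs₁ i A v hv).2), hsum₁, List.map_reverse, List.sum_reverse, hsumR,
        ← smul_neg]
      exact hcase A (fun j => (b.map fun x => rayLog x j).sum) (fun j => -inSum vec lw w j) s hin)
  have hinv := prod_one_sub_reverse_mul e₁ lab fun i _ =>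
    (isLegSystem_legElt (vec := vec) (w := w) (M := M) hlw).mul_eq_zero _ _ (by simp)
  rw [htop_sum _ fun v hv => hSv v (mem_union_right _ hv)] at cmpa
  rw [htop_sum _ fun v hv => hSv v (mem_union_left _ (mem_union_right _ (by
    rwa [sub_neg_eq_add] at hv)))] at cmpb
  have hY : ∀ x ∈ l, (toSF (Fin M) (crossSeries x)).coeff ∅ = 1 := fun x hx =>
    (isExp_toSF_cross x (hord x hx) (hwt x hx)).coeff_empty
  have hPa : ((a.reverse.map fun x => toSF (Fin M) (crossSeries x)).prod).coeff ∅ = 1 :=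
    prod_coeff_empty_eq_one _ fun x hx => hY x (hal x (List.mem_reverse.1 hx))
  have hVb : ((lab.reverse.map fun i => 1 + -e₁ i).prod).coeff ∅ = 1 := by
    have h1 := prod_coeff_empty_eq_one (b.reverse) (P := fun x => toSF (Fin M) (crossSeries x))
      fun x hx => hY x (hbl x (List.mem_reverse.1 hx))
    rwa [cmpb, add_coeff, (htopT _).coeff_empty, add_zero] at h1
  set f := (l.map fun x => rayLog x M).sum + inSum vec lw w M - outSum vec lw w M M with hf
  have hfsum : top f = top ((a.map fun x => rayLog x M).sum - outSum vec lw w M M) +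
      top ((b.map fun x => rayLog x M).sum - -inSum vec lw w M) := by
    have : f = ((a.map fun x => rayLog x M).sum - outSum vec lw w M M) +
        ((b.map fun x => rayLog x M).sum - -inSum vec lw w M) := by rw [hf, hfl]; abel
    rw [this]
    refine ext fun A => ?_
    simp only [htop, single_coeff, add_coeff]
    split_ifs
    · rw [smul_add, map_add]
    · simp
  have hmain : (l.reverse.map fun x => toSF (Fin M) (crossSeries x)).prod = 1 + top f := by
    refine prod_eq_of_isRotated hrot.reverse (fun x hx => hY x (List.mem_reverse.1 hx))
      (htopT f) ?_
    rw [List.reverse_append, List.map_append, List.prod_append, cmpb, add_mul,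
      (htopT _).mul_right _ hPa, cmpa, mul_add, ← hvert', hinv, (htopT _).mul_left _ hVb, hfsum,
      add_assoc]
  have h1 : toSF (Fin M) (l.map crossSeries).reverse.prod = 1 + top f := by
    rw [← hmain, map_list_prod, ← List.map_reverse, List.map_map]; rfl
  have h2 := congrArg (fun g => g.coeff univ) h1
  beta_reduce at h2
  rw [toSF_coeff, add_coeff, one_coeff, if_neg univ_nonempty.ne_empty, zero_add,
    htop, single_coeff, if_pos rfl, map_smul, card_univ, Fintype.card_fin,
    ← Nat.cast_smul_eq_nsmul ℂ] at h2
  exact smul_right_injective _ (mod_cast M.factorial_ne_zero) h2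

end Loop

end

section

open Finset Prod Set

/-- Combinatorial types of tropical curves in the unfolding: a leg starts at the `n`-th singularity,
in one of two directions, with some weight. -/
inductive PTree : Type
  | leg : ℤ → ℤˣ → ℕ → PTree
  | node : (k : ℕ) → (Fin k → PTree) → PTree

namespace PTree

/-- The weighted direction of the outgoing edge. -/
def vec : PTree → ℤ²
  | leg n ε w => ((w : ℤ) * ε) • (1, -3 * n)
  | node _ ts => ∑ i, (ts i).vec

/-- The total weight of the legs. -/
def lw : PTree → ℕ
  | leg _ _ w => w
  | node _ ts => ∑ i, (ts i).lw

/-- The singularities at which the legs start. -/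
def legs : PTree → Set ℤ
  | leg n _ _ => {n}
  | node _ ts => ⋃ i, (ts i).legs

/-- The contribution of a tree to the multiplicity of the corresponding tropical curve. -/
def wtT : PTree → ℚ
  | leg _ _ w => (-1) ^ (w + 1) / (w : ℚ) ^ 2
  | node k ts => (Nm univ fun i => (ts i).vec : ℚ) / (k.factorial : ℚ) * ∏ i, (ts i).wtT

/-- The tree is realized in the plane, and its outgoing edge starts at `p`. -/
def At (τ : ZMod 3 → ℝ) : PTree → ℝ² → Prop
  | leg n _ w, p => p = singPt τ n ∧ 0 < w
  | node k ts, p => 2 ≤ k ∧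
      (∀ i, ∃ (q : ℝ²) (s : ℝ), 0 < s ∧ (ts i).At τ q ∧ p = q + s • vecR (ts i).vec) ∧
      ∃ i j, det2 (ts i).vec (ts j).vec ≠ 0

/-- The tree is realized in the plane, and its outgoing edge has `p` in its interior. -/
def Thru (τ : ZMod 3 → ℝ) (T : PTree) (p : ℝ²) : Prop :=
  ∃ (q : ℝ²) (s : ℝ), 0 < s ∧ T.At τ q ∧ p = q + s • vecR T.vec

variable {τ : ZMod 3 → ℝ}

lemma at_node {k : ℕ} {ts : Fin k → PTree} {p : ℝ²} : (node k ts).At τ p ↔ 2 ≤ k ∧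
    (∀ i, (ts i).Thru τ p) ∧ ∃ i j, det2 (ts i).vec (ts j).vec ≠ 0 := Iff.rfl

lemma At.lw_pos : ∀ {T : PTree} {p : ℝ²}, T.At τ p → 0 < T.lw
  | leg _ _ _, _, h => h.2
  | node k ts, p, h => by
    obtain ⟨hk, h1, -⟩ := h
    have i : Fin k := ⟨0, by omega⟩
    obtain ⟨q, s, -, hq, -⟩ := h1 i
    exact sum_pos' (fun i _ => Nat.zero_le _) ⟨i, mem_univ i, hq.lw_pos⟩

lemma Thru.lw_pos {T : PTree} {p : ℝ²} (h : T.Thru τ p) : 0 < T.lw := by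
  obtain ⟨q, s, -, hq, -⟩ := h
  exact hq.lw_pos

lemma vecR_smul_int (n : ℤ) (v : ℤ²) : vecR (n • v) = (n : ℝ) • vecR v := by ext <;> simp [vecR]

lemma vecR_nsmul (n : ℕ) (v : ℤ²) : vecR (n • v) = (n : ℝ) • vecR v := by ext <;> simp [vecR]

lemma eq_of_two_lines {v w : ℤ²} (h : det2 v w ≠ 0) {q q' p p' : ℝ²} {s s' t t' : ℝ}
    (h1 : p = q + s • vecR v) (h2 : p' = q + s' • vecR v) (h3 : p = q' + t • vecR w)
    (h4 : p' = q' + t' • vecR w) : p = p' := by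
  have hd : (v.1 : ℝ) * w.2 - v.2 * w.1 ≠ 0 := by
    have : ((det2 v w : ℤ) : ℝ) ≠ 0 := mod_cast h
    simpa [det2] using this
  have e1 : p.1 - p'.1 = (s - s') * v.1 := by rw [h1, h2]; simp [vecR]; ring
  have e2 : p.2 - p'.2 = (s - s') * v.2 := by rw [h1, h2]; simp [vecR]; ring
  have e3 : p.1 - p'.1 = (t - t') * w.1 := by rw [h3, h4]; simp [vecR]; ring
  have e4 : p.2 - p'.2 = (t - t') * w.2 := by rw [h3, h4]; simp [vecR]; ring
  have e5 : (s - s') * ((v.1 : ℝ) * w.2 - v.2 * w.1) = 0 := by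
    linear_combination (-(w.2 : ℝ)) * e1 + (w.1 : ℝ) * e2 + (w.2 : ℝ) * e3 - (w.1 : ℝ) * e4
  have e6 : s - s' = 0 := (mul_eq_zero.1 e5).resolve_right hd
  rw [e6, zero_mul, sub_eq_zero] at e1 e2
  exact Prod.ext e1 e2

lemma At.unique : ∀ {T : PTree} {p p' : ℝ²}, T.At τ p → T.At τ p' → p = p'
  | leg _ _ _, _, _, h, h' => h.1.trans h'.1.symm
  | node k ts, p, p', h, h' => by
    obtain ⟨-, h1, i, j, hij⟩ := h
    obtain ⟨-, h1', -⟩ := h'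
    obtain ⟨q, s, -, hq, e⟩ := h1 i
    obtain ⟨q', s', -, hq', e'⟩ := h1' i
    obtain ⟨r, t, -, hr, f⟩ := h1 j
    obtain ⟨r', t', -, hr', f'⟩ := h1' j
    rw [← hq.unique hq'] at e'
    rw [← hr.unique hr'] at f'
    exact eq_of_two_lines hij e e' f f'

end PTree

/-- The height above the parabola through the vertices of the unfolding. -/
def height (p : ℝ²) : ℝ := p.2 + 3 * p.1 * (p.1 - 1) / 2

/-- The differential of the height. -/
def dheight (p : ℝ²) : ℝ² := (3 * (p.1 - 1 / 2), 1)

lemma height_add (p : ℝ²) (s : ℝ) (v : ℤ²) : height (p + s • vecR v) =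
    height p + s * alpha (dheight p) v + 3 / 2 * (s * v.1) ^ 2 := by
  simp only [height, dheight, alpha, vecR, fst_add, snd_add, smul_fst, smul_snd,
    smul_eq_mul]
  ring

lemma alpha_dheight_add (p : ℝ²) (s : ℝ) (v : ℤ²) : alpha (dheight (p + s • vecR v)) v =
    alpha (dheight p) v + 3 * s * (v.1 : ℝ) ^ 2 := by
  simp only [dheight, alpha, vecR, fst_add, smul_fst, smul_eq_mul]
  ring

lemma alpha_sum {ι : Type} (α : ℝ²) (s : Finset ι) (v : ι → ℤ²) :
    alpha α σ(v,s) = ∑ i ∈ s, alpha α (v i) := by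
  simp only [alpha, fst_sum, snd_sum, Int.cast_sum, mul_sum,
    sum_add_distrib]

lemma height_edgeLine (n : ℤ) (x : ℝ) :
    height (x, edgeLine n x) = 3 / 2 * ((x - n - 1 / 2) ^ 2 - 1 / 4) := by
  simp only [height, edgeLine]; ring

lemma height_nonneg_of_two_lines {p : ℝ²} {n n' : ℤ} (hn : n ≠ n')
    (h : p = (p.1, edgeLine n p.1)) (h' : p = (p.1, edgeLine n' p.1)) : 0 ≤ height p := by
  have e4 : edgeLine n p.1 = edgeLine n' p.1 := congrArg Prod.snd (h.symm.trans h')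
  have e5 : p.1 = ((n : ℝ) + n' + 1) / 2 := by
    simp only [edgeLine] at e4
    refine mul_left_cancel₀ (sub_ne_zero.2 (mod_cast hn.symm) : (n' : ℝ) - n ≠ 0) ?_
    linarith
  rw [h, height_edgeLine, e5]
  have h6 : (1 : ℤ) ≤ (n' - n) ^ 2 := sq_pos_of_ne_zero (sub_ne_zero.2 hn.symm)
  have h5 : (1 : ℝ) ≤ ((n' : ℝ) - n) ^ 2 := mod_cast h6
  nlinarith

namespace PTree

variable {τ : ZMod 3 → ℝ}

lemma height_singPt (hτ : Interior τ) (n : ℤ) : height (singPt τ n) < 0 := by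
  rw [singPt, height_edgeLine]
  have := hτ (n : ZMod 3)
  nlinarith [this.1, this.2]

lemma Thru.leg_snd {n : ℤ} {ε : ℤˣ} {w : ℕ} {p : ℝ²} (h : (leg n ε w).Thru τ p) :
    p = (p.1, edgeLine n p.1) := by
  obtain ⟨q, s, -, ⟨rfl, -⟩, rfl⟩ := h
  refine Prod.ext rfl ?_
  simp [singPt, edgeLine, vec, vecR]
  ring

lemma Thru.leg_facts (hτ : Interior τ) {n : ℤ} {ε : ℤˣ} {w : ℕ} {p : ℝ²} (h : (leg n ε w).Thru τ p)
    (hp : 0 ≤ height p) : alpha (dheight p) (leg n ε w).vec = 3 * w * |p.1 - n - 1 / 2| ∧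
      1 / 2 ≤ |p.1 - n - 1 / 2| := by
  rw [h.leg_snd, height_edgeLine] at hp
  have h1 : 1 / 2 ≤ |p.1 - n - 1 / 2| := by
    rw [← abs_of_pos (by norm_num : (0 : ℝ) < 1 / 2)]
    exact sq_le_sq.1 (by linarith)
  refine ⟨?_, h1⟩
  obtain ⟨q, s, hs, ⟨rfl, hw⟩, hpq⟩ := h
  have hn := hτ (n : ZMod 3)
  have hp1 : p.1 = n + τ n + s * (w * (ε : ℤ)) := by rw [hpq]; simp [singPt, vec, vecR]
  have hsw : 0 < s * (w : ℝ) := mul_pos hs (mod_cast hw)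
  simp only [alpha, dheight, vec, smul_fst, smul_snd, smul_eq_mul]
  push_cast
  rcases Int.units_eq_one_or ε with rfl | rfl
  · have : 0 < p.1 - n - 1 / 2 := by
      rcases abs_cases (p.1 - n - 1 / 2) with h2 | h2
      · linarith
      · simp at hp1; nlinarith [hn.1]
    rw [abs_of_pos this]; simp; ring
  · have : p.1 - n - 1 / 2 < 0 := by
      rcases abs_cases (p.1 - n - 1 / 2) with h2 | h2
      · simp at hp1; nlinarith [hn.2]
      · linarith
    rw [abs_of_neg this]; simp; ring

lemma Thru.leg_alpha_ge (hτ : Interior τ) {n : ℤ} {ε : ℤˣ} {w : ℕ} {p : ℝ²}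
    (h : (leg n ε w).Thru τ p) (hp : 0 ≤ height p) :
    3 / 2 * ((leg n ε w).lw : ℝ) ≤ alpha (dheight p) (leg n ε w).vec := by
  have h3 := h.leg_facts hτ hp
  rw [h3.1, lw]
  nlinarith [h3.2, (Nat.cast_nonneg w : (0 : ℝ) ≤ w)]

lemma alpha_node_ge {k : ℕ} {ts : Fin k → PTree} {p : ℝ²}
    (h : ∀ i, 3 / 2 * ((ts i).lw : ℝ) ≤ alpha (dheight p) (ts i).vec) :
    3 / 2 * ((node k ts).lw : ℝ) ≤ alpha (dheight p) (node k ts).vec := by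
  rw [vec, lw, alpha_sum, Nat.cast_sum, mul_sum]
  exact sum_le_sum fun i _ => h i

lemma At.node_facts (hτ : Interior τ) : ∀ {k : ℕ} {ts : Fin k → PTree} {p : ℝ²}, (node k ts).At τ p →
    0 ≤ height p ∧ ∀ i, 3 / 2 * ((ts i).lw : ℝ) ≤ alpha (dheight p) (ts i).vec := by
  have main : ∀ T : PTree, ∀ p, (∀ k ts, T = node k ts → T.At τ p →
      0 ≤ height p ∧ ∀ i, 3 / 2 * ((ts i).lw : ℝ) ≤ alpha (dheight p) (ts i).vec) := by
    intro T
    induction T with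
    | leg => rintro p k ts ⟨⟩
    | node k ts ih =>
      intro p k' ts' he hT
      cases he
      obtain ⟨hk, h1, i, j, hij⟩ := hT
      have hnode : ∀ i, (∀ k' ts', ts i = node k' ts' →
          0 < height p ∧ 3 / 2 * ((ts i).lw : ℝ) ≤ alpha (dheight p) (ts i).vec) := by
        intro i k' ts' he
        obtain ⟨q, s, hs, hq, rfl⟩ := h1 i
        have h2 := ih i q k' ts' he hq
        have h3 : 3 / 2 * ((ts i).lw : ℝ) ≤ alpha (dheight q) (ts i).vec := by
          rw [he]; exact alpha_node_ge h2.2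
        have h4 : 0 < ((ts i).lw : ℝ) := mod_cast hq.lw_pos
        rw [height_add, alpha_dheight_add]
        constructor
        · have : 0 < s * alpha (dheight q) (ts i).vec := mul_pos hs (by linarith)
          have := sq_nonneg (s * ((ts i).vec.1 : ℝ))
          linarith [h2.1]
        · have := mul_nonneg (mul_nonneg (by norm_num : (0 : ℝ) ≤ 3) hs.le)
            (sq_nonneg ((ts i).vec.1 : ℝ))
          linarith
      have hh : 0 ≤ height p := by
        rcases hi : ts i with ⟨n, ε, w⟩ | ⟨k', ts'⟩
        · rcases hj : ts j with ⟨n', ε', w'⟩ | ⟨k', ts'⟩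
          · have h2 := h1 i
            have h3 := h1 j
            rw [hi] at h2 hij
            rw [hj] at h3 hij
            have e2 := Thru.leg_snd (ε := ε) (w := w) h2
            have e3 := Thru.leg_snd (ε := ε') (w := w') h3
            have hne : n ≠ n' := by
              rintro rfl
              refine hij ?_
              simp only [det2, vec, smul_fst, smul_snd, smul_eq_mul]; ring
            exact height_nonneg_of_two_lines hne e2 e3
          · exact (hnode j _ _ hj).1.le
        · exact (hnode i _ _ hi).1.le
      refine ⟨hh, fun i => ?_⟩
      rcases hi : ts i with ⟨n, ε, w⟩ | ⟨k', ts'⟩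
      · have h2 := h1 i
        rw [hi] at h2
        exact Thru.leg_alpha_ge hτ h2 hh
      · rw [← hi]; exact (hnode i _ _ hi).2
  intro k ts p h
  exact main _ p k ts rfl h

lemma At.alpha_ge (hτ : Interior τ) {k : ℕ} {ts : Fin k → PTree} {p : ℝ²} (h : (node k ts).At τ p) :
    3 / 2 * ((node k ts).lw : ℝ) ≤ alpha (dheight p) (node k ts).vec :=
  alpha_node_ge (h.node_facts hτ).2

lemma Thru.node_height_pos (hτ : Interior τ) {k : ℕ} {ts : Fin k → PTree} {p : ℝ²} (h : (node k ts).Thru τ p) :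
    0 < height p := by
  obtain ⟨q, s, hs, hq, rfl⟩ := h
  have h1 := hq.alpha_ge hτ
  have h2 : 0 < ((node k ts).lw : ℝ) := mod_cast hq.lw_pos
  have h3 : 0 < s * alpha (dheight q) (node k ts).vec := mul_pos hs (by linarith)
  rw [height_add]
  linarith [(hq.node_facts hτ).1, sq_nonneg (s * ((node k ts).vec.1 : ℝ))]

lemma Thru.alpha_ge (hτ : Interior τ) {T : PTree} {p : ℝ²} (h : T.Thru τ p) (hp : 0 ≤ height p) :
    3 / 2 * (T.lw : ℝ) ≤ alpha (dheight p) T.vec := by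
  cases T with
  | leg n ε w => exact h.leg_alpha_ge hτ hp
  | node k ts =>
    obtain ⟨q, s, hs, hq, rfl⟩ := h
    have h1 := hq.alpha_ge hτ
    rw [alpha_dheight_add]
    have := mul_nonneg (mul_nonneg (by norm_num : (0 : ℝ) ≤ 3) hs.le)
      (sq_nonneg ((node k ts).vec.1 : ℝ))
    linarith

lemma Thru.alpha_pos (hτ : Interior τ) {T : PTree} {p : ℝ²} (h : T.Thru τ p) (hp : 0 ≤ height p) :
    0 < alpha (dheight p) T.vec := by
  have := h.alpha_ge hτ hp
  have h2 : 0 < (T.lw : ℝ) := mod_cast h.lw_pos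
  linarith

/-- The legs are close to every point of the outgoing edge, in terms of the weight of the legs. -/
lemma Thru.legs_bound_lw (hτ : Interior τ) {c : ℝ} (hc : 0 < c) :
    ∀ {T : PTree} {p : ℝ²}, T.Thru τ p → height p ≤ 3 / 2 * c ^ 2 → ∀ n ∈ T.legs,
      |(n : ℝ) + 1 / 2 - p.1| ≤ 1 / 2 + T.lw * c := by
  intro T
  induction T with
  | leg n ε w =>
    intro p h hp m hm
    obtain rfl : m = n := hm
    have hw : 1 ≤ (w : ℝ) := mod_cast h.lw_pos
    rw [h.leg_snd, height_edgeLine] at hp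
    have h1 : (p.1 - m - 1 / 2) ^ 2 ≤ (1 / 2 + c) ^ 2 := by nlinarith
    have h2 := abs_le.1 (abs_le_of_sq_le_sq h1 (by positivity))
    rw [show (m : ℝ) + 1 / 2 - p.1 = -(p.1 - m - 1 / 2) by ring, abs_neg, lw, abs_le]
    constructor <;> nlinarith [h2.1, h2.2]
  | node k ts ih =>
    intro p h hp m hm
    obtain ⟨i, hi⟩ := mem_iUnion.1 hm
    obtain ⟨q, s, hs, hq, rfl⟩ := h
    have h1 := hq.alpha_ge hτ
    have hlw : 0 < ((node k ts).lw : ℝ) := mod_cast hq.lw_pos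
    have h2 : 0 < s * alpha (dheight q) (node k ts).vec := mul_pos hs (by linarith)
    rw [height_add] at hp
    have h3 := (hq.node_facts hτ).1
    have h4 : (s * ((node k ts).vec.1 : ℝ)) ^ 2 ≤ c ^ 2 := by nlinarith
    have h5 := abs_le.1 (abs_le_of_sq_le_sq h4 hc.le)
    have h6 := ih i (hq.2.1 i) (by nlinarith [sq_nonneg (s * ((node k ts).vec.1 : ℝ))]) m hi
    have h7 : ((ts i).lw : ℝ) + 1 ≤ ((node k ts).lw : ℝ) := by
      have : (ts i).lw + 1 ≤ ∑ i, (ts i).lw := by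
        have hk := hq.1
        obtain ⟨j, hj⟩ : ∃ j : Fin k, j ≠ i := by
          by_cases h0 : i = ⟨0, by omega⟩
          · exact ⟨⟨1, by omega⟩, by rw [h0]; simp [Fin.ext_iff]⟩
          · exact ⟨⟨0, by omega⟩, Ne.symm h0⟩
        rw [← add_sum_erase _ _ (mem_univ i)]
        have := single_le_sum (f := fun j => (ts j).lw) (fun _ _ => Nat.zero_le _)
          (mem_erase.2 ⟨hj, mem_univ j⟩)
        have := (hq.2.1 j)
        have := Thru.lw_pos this
        omega
      exact_mod_cast this
    have h8 : (q + s • vecR (node k ts).vec).1 = q.1 + s * (node k ts).vec.1 := by simp [vecR]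
    rw [h8]
    rw [abs_le] at h6 ⊢
    constructor <;> nlinarith [h6.1, h6.2, h5.1, h5.2]

/-- The legs are close to every point of the outgoing edge, in terms of the direction of the
outgoing edge. -/
lemma At.legs_bound_alpha (hτ : Interior τ) : ∀ {k : ℕ} {ts : Fin k → PTree}
    {p : ℝ²}, (node k ts).At τ p → ∀ n ∈ (node k ts).legs,
      3 * |(n : ℝ) + 1 / 2 - p.1| ≤ alpha (dheight p) (node k ts).vec := by
  have main : ∀ T : PTree, ∀ p, T.Thru τ p → 0 ≤ height p → ∀ n ∈ T.legs,
      3 * |(n : ℝ) + 1 / 2 - p.1| ≤ alpha (dheight p) T.vec := by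
    intro T
    induction T with
    | leg n ε w =>
      intro p h hp m hm
      obtain rfl : m = n := hm
      have hw : 1 ≤ (w : ℝ) := mod_cast h.lw_pos
      have h3 := Thru.leg_facts hτ h hp
      rw [h3.1, show (m : ℝ) + 1 / 2 - p.1 = -(p.1 - m - 1 / 2) by ring, abs_neg]
      nlinarith [h3.2]
    | node k ts ih =>
      intro p h hp m hm
      obtain ⟨i, hi⟩ := mem_iUnion.1 hm
      obtain ⟨q, s, hs, hq, rfl⟩ := h
      have h1 := ih i q (hq.2.1 i) (hq.node_facts hτ).1 m hi
      have h2 : alpha (dheight q) (ts i).vec ≤ alpha (dheight q) (node k ts).vec := by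
        rw [vec, alpha_sum]
        exact single_le_sum (f := fun i => alpha (dheight q) (ts i).vec)
          (fun i _ => (Thru.alpha_pos hτ (hq.2.1 i) (hq.node_facts hτ).1).le) (mem_univ i)
      have h8 : (q + s • vecR (node k ts).vec).1 = q.1 + s * (node k ts).vec.1 := by simp [vecR]
      rw [alpha_dheight_add, h8]
      set a := (node k ts).vec.1
      have h9 : |(a : ℝ)| ≤ (a : ℝ) ^ 2 := by
        have : |a| ≤ a ^ 2 := by
          rw [← sq_abs]
          rcases eq_or_ne a 0 with h | h
          · simp [h]
          · nlinarith [Int.one_le_abs h]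
        exact_mod_cast this
      have h10 : |(m : ℝ) + 1 / 2 - (q.1 + s * a)| ≤ |(m : ℝ) + 1 / 2 - q.1| + s * |(a : ℝ)| := by
        rw [← sub_sub, ← abs_of_pos hs, ← abs_mul, abs_of_pos hs]
        exact abs_sub _ _
      nlinarith
  intro k ts p h n hn
  obtain ⟨i, hi⟩ := mem_iUnion.1 hn
  refine (main _ p (h.2.1 i) (h.node_facts hτ).1 n hi).trans ?_
  rw [vec, alpha_sum]
  exact single_le_sum (f := fun i => alpha (dheight p) (ts i).vec)
    (fun i _ => (Thru.alpha_pos hτ (h.2.1 i) (h.node_facts hτ).1).le) (mem_univ i)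

/-- Trees all of whose vertices have at least two incoming edges, and whose legs have positive
weight. -/
def Proper : PTree → Prop
  | leg _ _ w => 0 < w
  | node k ts => 2 ≤ k ∧ ∀ i, (ts i).Proper

lemma At.proper : ∀ {T : PTree} {p : ℝ²}, T.At τ p → T.Proper
  | leg _ _ _, _, h => h.2
  | node k ts, p, h => ⟨h.1, fun i => by
    obtain ⟨q, s, -, hq, -⟩ := h.2.1 i
    exact hq.proper⟩

lemma Proper.lw_pos : ∀ {T : PTree}, T.Proper → 0 < T.lw
  | leg _ _ _, h => h
  | node k ts, h => by
    have i : Fin k := ⟨0, by have := h.1; omega⟩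
    exact sum_pos' (fun i _ => Nat.zero_le _) ⟨i, mem_univ i, (h.2 i).lw_pos⟩

lemma finite_proper (s : Set ℤ) (hs : s.Finite) (K : ℕ) :
    {T : PTree | T.Proper ∧ T.lw ≤ K ∧ T.legs ⊆ s}.Finite := by
  induction K using Nat.strong_induction_on with
  | _ K ih =>
    have h1 : (⋃ n ∈ s, ⋃ ε : ℤˣ, ⋃ w ∈ Set.Iic K, {leg n ε w}).Finite :=
      hs.biUnion fun n _ => finite_iUnion fun ε => (finite_Iic K).biUnion fun w _ =>
        finite_singleton _
    have h2 : (⋃ k ∈ Set.Iic K, ⋃ K' ∈ Set.Iio K, node k '' {ts | ∀ i, ts i ∈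
        {T : PTree | T.Proper ∧ T.lw ≤ K' ∧ T.legs ⊆ s}}).Finite :=
      (finite_Iic K).biUnion fun k _ => (finite_Iio K).biUnion fun K' hK' =>
        Finite.image _ (Finite.pi' fun _ => ih K' hK')
    refine (h1.union h2).subset ?_
    rintro T ⟨hT, hlw, hleg⟩
    cases T with
    | leg n ε w =>
      left
      simp only [mem_iUnion]
      exact ⟨n, hleg rfl, ε, w, hlw, rfl⟩
    | node k ts =>
      right
      obtain ⟨hk, hts⟩ := hT
      have hsum : ∑ i, (ts i).lw ≤ K := hlw
      have hk1 : k ≤ K := by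
        have : ∑ i : Fin k, 1 ≤ ∑ i, (ts i).lw := sum_le_sum fun i _ => (hts i).lw_pos
        simp at this
        omega
      have hlt : ∀ i, (ts i).lw < K := by
        intro i
        obtain ⟨j, hj⟩ : ∃ j : Fin k, j ≠ i := by
          by_cases h0 : i = ⟨0, by omega⟩
          · exact ⟨⟨1, by omega⟩, by rw [h0]; simp [Fin.ext_iff]⟩
          · exact ⟨⟨0, by omega⟩, Ne.symm h0⟩
        rw [← add_sum_erase _ _ (mem_univ i)] at hsum
        have := single_le_sum (f := fun j => (ts j).lw) (fun _ _ => Nat.zero_le _)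
          (mem_erase.2 ⟨hj, mem_univ j⟩)
        have := (hts j).lw_pos
        omega
      simp only [mem_iUnion]
      refine ⟨k, hk1, K - 1, by simp only [Set.mem_Iio]; omega, ts, fun i => ⟨hts i, ?_, ?_⟩, rfl⟩
      · have := hlt i; omega
      · exact fun n hn => hleg (mem_iUnion.2 ⟨i, hn⟩)

lemma finite_int_near (x c : ℝ) : {n : ℤ | |(n : ℝ) + 1 / 2 - x| ≤ c}.Finite := by
  refine (finite_Icc ⌊x - c - 1⌋ ⌈x + c + 1⌉).subset fun n hn => ?_
  have hn' := abs_le.1 (show |(n : ℝ) + 1 / 2 - x| ≤ c from hn)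
  constructor
  · exact_mod_cast (Int.floor_le (x - c - 1)).trans (by linarith : x - c - 1 ≤ (n : ℝ))
  · exact_mod_cast (by linarith : (n : ℝ) ≤ x + c + 1).trans (Int.le_ceil _)

lemma finite_legs : ∀ T : PTree, T.legs.Finite
  | leg n _ _ => finite_singleton n
  | node _ ts => finite_iUnion fun i => (ts i).finite_legs

lemma finite_thru (hτ : Interior τ) (p : ℝ²) (K : ℕ) :
    {T : PTree | T.Thru τ p ∧ T.lw ≤ K}.Finite := by
  set c := |height p| + 1
  have hc : 0 < c := by positivity
  have hcp : height p ≤ 3 / 2 * c ^ 2 := by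
    have h1 := le_abs_self (height p)
    have h2 := abs_nonneg (height p)
    simp only [c]; nlinarith
  refine (finite_proper _ (finite_int_near p.1 (1 / 2 + K * c)) K).subset ?_
  rintro T ⟨hT, hK⟩
  obtain ⟨q, s, hs, hq, hpq⟩ := id hT
  refine ⟨hq.proper, hK, fun n hn => (hT.legs_bound_lw hτ hc hcp n hn).trans ?_⟩
  have : (T.lw : ℝ) ≤ K := mod_cast hK
  nlinarith

lemma finite_at (hτ : Interior τ) (p : ℝ²) (K : ℕ) :
    {T : PTree | T.At τ p ∧ T.lw ≤ K}.Finite := by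
  refine (finite_proper ({⌊p.1⌋} ∪ ⋃ T ∈ {T : PTree | T.Thru τ p ∧ T.lw ≤ K}, T.legs) ?_ K).subset ?_
  · refine (finite_singleton _).union ((finite_thru hτ p K).biUnion fun T _ => T.finite_legs)
  · rintro T ⟨hT, hK⟩
    refine ⟨hT.proper, hK, ?_⟩
    cases T with
    | leg n ε w =>
      intro m hm
      left
      obtain rfl : m = n := hm
      obtain ⟨rfl, hw⟩ := hT
      have := hτ m
      simp only [singPt, mem_singleton_iff]
      symm
      rw [Int.floor_eq_iff]
      constructor <;> linarith [this.1, this.2]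
    | node k ts =>
      intro n hn
      right
      obtain ⟨i, hi⟩ := mem_iUnion.1 hn
      exact mem_biUnion (x := ts i) ⟨hT.2.1 i, (single_le_sum (f := fun i => (ts i).lw)
        (fun _ _ => Nat.zero_le _) (mem_univ i)).trans hK⟩ hi

lemma three_dvd_vec_snd : ∀ T : PTree, (3 : ℤ) ∣ T.vec.2
  | leg n ε w => ⟨w * ε * -n, by simp only [vec, smul_snd, smul_eq_mul]; ring⟩
  | node k ts => by
    rw [vec, snd_sum]
    exact dvd_sum fun i _ => (ts i).three_dvd_vec_snd

end PTree

end

section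

open Finset Finsupp PTree Ray Prod Set

lemma finsum_mem_eq_sum_filter' {X M : Type*} [AddCommMonoid M] {f : X → M} {A : Set X} (F : Finset X)
    (h : ∀ x ∈ A, f x ≠ 0 → x ∈ F) [DecidablePred (· ∈ A)] :
    ∑ᶠ x ∈ A, f x = ∑ x ∈ F with x ∈ A, f x := by
  refine finsum_mem_eq_sum_of_inter_support_eq _ ?_
  ext x
  simp only [mem_inter_iff, Function.mem_support, coe_filter]
  constructor
  · rintro ⟨h1, h2⟩; exact ⟨⟨h x h1 h2, h1⟩, h2⟩
  · rintro ⟨⟨_, h1⟩, h2⟩; exact ⟨h1, h2⟩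

lemma finsum_mem_group {X Y V : Type*} {f : X → V →₀ ℂ} (b : X → Y) (A : Set X)
    (key : X → V) (c : X → ℂ) (hf : ∀ x, f x = single (key x) (c x)) (P : Y → V → Prop)
    [∀ y, DecidablePred (P y)]
    (h1 : {x | x ∈ A ∧ P (b x) (key x) ∧ f x ≠ 0}.Finite)
    (h2 : ∀ y, {x | x ∈ A ∧ b x = y ∧ f x ≠ 0}.Finite) :
    ∑ᶠ x ∈ {x | x ∈ A ∧ P (b x) (key x)}, f x =
      ∑ᶠ y, (∑ᶠ x ∈ {x | x ∈ A ∧ b x = y}, f x).filter (P y) := by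
  classical
  have h3 : ∀ y, (∑ᶠ x ∈ {x | x ∈ A ∧ b x = y}, f x).filter (P y) =
      ∑ x ∈ h1.toFinset with b x = y, f x := by
    intro y
    rw [finsum_mem_eq_sum_filter' (h2 y).toFinset (fun x hx hx' => by
      rw [Finite.mem_toFinset]; exact ⟨hx.1, hx.2, hx'⟩)]
    rw [show ∀ g : V →₀ ℂ, g.filter (P y) = filterAddHom (P y) g from fun _ => rfl, map_sum]
    have h4 : ∀ x, filterAddHom (P y) (f x) = if P y (key x) then f x else 0 := by
      intro x
      rw [show ∀ g : V →₀ ℂ, filterAddHom (P y) g = g.filter (P y) from fun _ => rfl, hf]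
      split_ifs with h
      · exact filter_single_of_pos _ h
      · exact filter_single_of_neg _ h
    simp only [h4]
    rw [← sum_filter]
    refine sum_congr ?_ fun _ _ => rfl
    ext x
    simp only [mem_filter, Finite.mem_toFinset]
    constructor
    · rintro ⟨⟨⟨h5, h6, h7⟩, -⟩, h8⟩
      subst h6
      exact ⟨⟨h5, h8, h7⟩, rfl⟩
    · rintro ⟨⟨h5, h6, h7⟩, rfl⟩
      exact ⟨⟨⟨h5, rfl, h7⟩, h5, rfl⟩, h6⟩
  simp only [h3]
  rw [finsum_eq_sum_of_support_subset (s := h1.toFinset.image b)]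
  · rw [sum_fiberwise_of_maps_to (g := b) fun x hx => mem_image_of_mem _ hx]
    rw [finsum_mem_eq_sum_filter' h1.toFinset (fun x hx hx' => by
      rw [Finite.mem_toFinset]; exact ⟨hx.1, hx.2, hx'⟩)]
    refine sum_congr ?_ fun _ _ => rfl
    refine filter_true_of_mem fun x hx => ?_
    rw [Finite.mem_toFinset] at hx
    exact ⟨hx.1, hx.2.1⟩
  · intro y hy
    obtain ⟨x, hx, -⟩ := exists_ne_zero_of_sum_ne_zero hy
    rw [mem_filter] at hx
    exact mem_coe.2 (mem_image.2 ⟨x, hx⟩)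

/-- The logarithm of the function of a ray, in a given degree. -/
def Ray.log (d : Ray) (j : ℕ) : ℤ² →₀ ℂ := single (d.logVec j) (d.logCoeff j)

lemma Ray.log_eq_zero {d : Ray} {j : ℕ} (h : ¬ (d.ord ∣ j ∧ 0 < j)) : d.log j = 0 := by
  rw [log, logCoeff]
  by_cases hd : d.ord ∣ j
  · have : j = 0 := by by_contra h0; exact h ⟨hd, Nat.pos_of_ne_zero h0⟩
    subst this
    simp
  · simp [hd]

lemma Ray.logVec_eq (d : Ray) (j : ℕ) : d.logVec j = (j / d.ord) • d.expo := by
  rw [logVec, expo]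
  ext <;> simp <;> ring

lemma rayLog_one (d : Ray) (j : ℕ) : rayLog (d, 1) j = d.log j := by simp [rayLog, log]

lemma rayLog_neg_one (d : Ray) (j : ℕ) : rayLog (d, -1) j = -d.log j := by simp [rayLog, log]

/-- The logarithm of the product of the functions of the rays with base `q`, in a given degree. -/
def baseLog (S : Set Ray) (q : ℝ²) (j : ℕ) : ℤ² →₀ ℂ :=
  ∑ᶠ d ∈ {d | d ∈ S ∧ d.base = q}, d.log j

/-- The corresponding sum over trees. -/
def treeLog (τ : ZMod 3 → ℝ) (q : ℝ²) (j : ℕ) : ℤ² →₀ ℂ :=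
  ∑ᶠ T ∈ {T : PTree | T.At τ q ∧ T.lw = j}, single T.vec (T.wtT : ℂ)

/-- The logarithm of the product of the functions of the rays through `p` but not based
at `p`, in a given degree. -/
def thruLog (S : Set Ray) (p : ℝ²) (j : ℕ) : ℤ² →₀ ℂ :=
  ∑ᶠ d ∈ {d | d ∈ S ∧ p ∈ d.support ∧ p ≠ d.base}, d.log j

/-- The relation between a diagram and the trees, up to order `k`. -/
structure Good (τ : ZMod 3 → ℝ) (k : ℕ) (S : Set Ray) : Prop where
  wt_pos : ∀ d ∈ S, 0 < d.wt
  prim : ∀ d ∈ S, IsPrim d.dir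
  ord_pos : ∀ d ∈ S, 0 < d.ord
  ord_le : ∀ d ∈ S, d.ord ≤ k + 1
  ord_le' : ∀ d ∈ S, d.base ∉ singSet τ → d.ord ≤ k
  tree : ∀ d ∈ S, ∃ (T : PTree) (i : ℕ), 0 < i ∧ T.At τ d.base ∧ d.expo = i • T.vec ∧
    d.ord = i * T.lw
  inj : ∀ d ∈ S, ∀ d' ∈ S, d.base = d'.base → d.expo = d'.expo → d.ord = d'.ord → d = d'
  log : ∀ q j, (q ∈ singSet τ ∨ j ≤ k) → baseLog S q j = treeLog τ q j

lemma eq_of_prim {m m' : ℤ²} {a b : ℕ} (hm : IsPrim m) (hm' : IsPrim m') (ha : 0 < a)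
    (h : (a : ℤ) • m = (b : ℤ) • m') : a = b ∧ m = m' := by
  have h1 : a * m.1 = b * m'.1 := congrArg fst h
  have h2 : a * m.2 = b * m'.2 := congrArg snd h
  have hab : a = b := by
    have h3 := congrArg₂ Int.gcd h1 h2
    rw [Int.gcd_mul_left, Int.gcd_mul_left, hm, hm'] at h3
    simpa using h3
  subst hab
  have ha' : (a : ℤ) ≠ 0 := mod_cast ha.ne'
  exact ⟨rfl, Prod.ext (mul_left_cancel₀ ha' h1) (mul_left_cancel₀ ha' h2)⟩

lemma exists_prim {v : ℤ²} (hv : v ≠ 0) :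
    ∃ (a : ℕ) (m : ℤ²), 0 < a ∧ IsPrim m ∧ v = (a : ℤ) • m := by
  have h0 : 0 < Int.gcd v.1 v.2 := by
    rw [Nat.pos_iff_ne_zero]
    intro h
    rw [Int.gcd_eq_zero_iff] at h
    exact hv (Prod.ext h.1 h.2)
  refine ⟨Int.gcd v.1 v.2, (v.1 / Int.gcd v.1 v.2, v.2 / Int.gcd v.1 v.2), h0,
    Int.gcd_ediv_gcd_ediv_gcd h0, ?_⟩
  refine Prod.ext ?_ ?_
  · exact (Int.mul_ediv_cancel' (Int.gcd_dvd_left ..)).symm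
  · exact (Int.mul_ediv_cancel' (Int.gcd_dvd_right ..)).symm

/-- The point `p` lies on the open ray from `q` in the direction `v`. -/
def OnRay (p q : ℝ²) (v : ℤ²) : Prop := ∃ s : ℝ, 0 < s ∧ p = q + s • vecR v

lemma onRay_nsmul {p q : ℝ²} {v : ℤ²} {i : ℕ} (hi : 0 < i) :
    OnRay p q (i • v) ↔ OnRay p q v := by
  have hi' : (0 : ℝ) < i := mod_cast hi
  constructor
  · rintro ⟨s, hs, rfl⟩
    exact ⟨s * i, mul_pos hs hi', by rw [vecR_nsmul, smul_smul]⟩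
  · rintro ⟨s, hs, rfl⟩
    exact ⟨s / i, div_pos hs hi', by rw [vecR_nsmul, smul_smul, div_mul_cancel₀ _ hi'.ne']⟩

lemma PTree.thru_iff {τ : ZMod 3 → ℝ} {T : PTree} {p : ℝ²} :
    T.Thru τ p ↔ ∃ q, T.At τ q ∧ OnRay p q T.vec :=
  ⟨fun ⟨q, s, hs, hq, h⟩ => ⟨q, hq, s, hs, h⟩, fun ⟨q, hq, s, hs, h⟩ => ⟨q, s, hs, hq, h⟩⟩

lemma vecR_ne_zero {v : ℤ²} (hv : v ≠ 0) : vecR v ≠ 0 := by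
  intro h
  apply hv
  have h1 := congrArg fst h
  have h2 := congrArg snd h
  simp only [vecR, fst_zero, snd_zero, Int.cast_eq_zero] at h1 h2
  exact Prod.ext h1 h2

lemma IsPrim.ne_zero {m : ℤ²} (hm : IsPrim m) : m ≠ 0 := by
  rintro rfl
  simp [IsPrim] at hm

lemma Ray.onRay_iff {d : Ray} (hd : IsPrim d.dir) (hw : 0 < d.wt) {p : ℝ²} :
    OnRay p d.base d.expo ↔ p ∈ d.support ∧ p ≠ d.base := by
  have h1 : d.expo = d.wt • d.dir := by rw [expo, Nat.cast_smul_eq_nsmul]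
  rw [h1, onRay_nsmul hw]
  constructor
  · rintro ⟨s, hs, rfl⟩
    refine ⟨⟨s, hs.le, rfl⟩, fun h => ?_⟩
    rw [add_eq_left, smul_eq_zero] at h
    exact h.elim hs.ne' (vecR_ne_zero hd.ne_zero)
  · rintro ⟨⟨s, hs, rfl⟩, h⟩
    refine ⟨s, lt_of_le_of_ne hs ?_, rfl⟩
    rintro rfl
    simp at h

section Good

variable {τ : ZMod 3 → ℝ} {k : ℕ} {S : Set Ray}

lemma Good.finite_of_trees (hS : Good τ k S) (A : Set Ray) (hA : A ⊆ S) (N : ℕ)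
    (F : Set PTree) (hF : F.Finite) (h : ∀ d ∈ A, d.ord ≤ N ∧ ∀ T : PTree, T.At τ d.base → 
      T.lw ≤ N → (∃ i : ℕ, 0 < i ∧ d.expo = i • T.vec) → T ∈ F) : A.Finite := by
  classical
  choose! b hb using fun (T : PTree) (hT : ∃ q, T.At τ q) => hT
  have hfin : (⋃ T ∈ F, ⋃ i ∈ Set.Iic N, ⋃ o ∈ Set.Iic N, {((b T, i • T.vec, o) : (ℝ²) × (ℤ²) × ℕ)}).Finite :=
    hF.biUnion fun T _ => (finite_Iic N).biUnion fun i _ => (finite_Iic N).biUnion fun o _ =>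
      finite_singleton _
  refine Finite.of_finite_image (f := fun d : Ray => (d.base, d.expo, d.ord)) (hfin.subset ?_) ?_
  · rintro _ ⟨d, hd, rfl⟩
    obtain ⟨T, i, hi, hT, h1, h2⟩ := hS.tree d (hA hd)
    obtain ⟨h3, h4⟩ := h d hd
    have hlw := hT.lw_pos
    have h5 : T.lw ≤ N := (Nat.le_mul_of_pos_left _ hi).trans (h2 ▸ h3)
    have h6 : i ≤ N := (Nat.le_mul_of_pos_right _ hlw).trans (h2 ▸ h3)
    simp only [mem_iUnion]
    refine ⟨T, h4 T hT h5 ⟨i, hi, h1⟩, i, h6, d.ord, h3, ?_⟩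
    rw [mem_singleton_iff, h1, hT.unique (hb T ⟨_, hT⟩)]
  · intro d hd d' hd' he
    simp only [Prod.mk.injEq] at he
    exact hS.inj d (hA hd) d' (hA hd') he.1 he.2.1 he.2.2

lemma Good.finite_base (hτ : Interior τ) (hS : Good τ k S) (q : ℝ²) (N : ℕ) :
    {d | d ∈ S ∧ d.base = q ∧ d.ord ≤ N}.Finite :=
  hS.finite_of_trees _ (fun _ hd => hd.1) N _ (finite_at hτ q N) fun _ hd =>
    ⟨hd.2.2, fun _ hT hN _ => ⟨hd.2.1 ▸ hT, hN⟩⟩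

lemma Good.finite_support (hτ : Interior τ) (hS : Good τ k S) (p : ℝ²)
    (N : ℕ) : {d | d ∈ S ∧ p ∈ d.support ∧ d.ord ≤ N}.Finite := by
  refine hS.finite_of_trees _ (fun _ hd => hd.1) N _
    ((finite_at hτ p N).union (finite_thru hτ p N)) fun d hd =>
    ⟨hd.2.2, fun T hT hN hi => ?_⟩
  obtain ⟨i, hi, he⟩ := hi
  by_cases h : p = d.base
  · left
    exact ⟨h ▸ hT, hN⟩
  · right
    refine ⟨thru_iff.2 ⟨d.base, hT, ?_⟩, hN⟩
    rw [← onRay_nsmul hi, ← he]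
    exact (onRay_iff (hS.prim d hd.1) (hS.wt_pos d hd.1)).2 ⟨hd.2.1, h⟩

lemma Ray.log_ne_zero {d : Ray} {j : ℕ} (h : d.log j ≠ 0) : d.ord ∣ j ∧ 0 < j := by
  by_contra h'
  exact h (log_eq_zero h')

lemma Ray.ord_le_of_log {d : Ray} {j : ℕ} (h : d.log j ≠ 0) : d.ord ≤ j :=
  Nat.le_of_dvd (log_ne_zero h).2 (log_ne_zero h).1

lemma Good.thruLog_eq (hτ : Interior τ) (hS : Good τ k S) (p : ℝ²) {j : ℕ}
    (hj : j ≤ k) : thruLog S p j =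
      ∑ᶠ T ∈ {T : PTree | T.Thru τ p ∧ T.lw = j}, single T.vec (T.wtT : ℂ) := by
  classical
  have e1 : thruLog S p j = ∑ᶠ d ∈ {d | d ∈ S ∧ OnRay p d.base (d.logVec j)}, d.log j := by
    rw [thruLog, finsum_mem_eq_sum_filter' (hS.finite_support hτ p j).toFinset,
      finsum_mem_eq_sum_filter' (hS.finite_support hτ p j).toFinset]
    · refine sum_congr_of_eq_on_inter ?_ ?_ fun _ _ _ => rfl
      all_goals
        intro d hd hd'
        by_contra h0
        have h1 := log_ne_zero h0
        rw [mem_filter] at hd hd'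
        refine hd' ⟨hd.1, ?_⟩
        have h2 := hd.2.1
        have h3 : OnRay p d.base (d.logVec j) ↔ p ∈ d.support ∧ p ≠ d.base := by
          rw [logVec_eq, onRay_nsmul (Nat.div_pos (Nat.le_of_dvd h1.2 h1.1) (hS.ord_pos d h2)),
            onRay_iff (hS.prim d h2) (hS.wt_pos d h2)]
        first
        | exact ⟨h2, h3.2 hd.2.2⟩
        | exact ⟨h2, h3.1 hd.2.2⟩
    · rintro d ⟨h2, h3⟩ h0
      have h1 := log_ne_zero h0
      rw [Finite.mem_toFinset]
      rw [logVec_eq, onRay_nsmul (Nat.div_pos (Nat.le_of_dvd h1.2 h1.1) (hS.ord_pos d h2)),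
            onRay_iff (hS.prim d h2) (hS.wt_pos d h2)] at h3
      exact ⟨h2, h3.1, ord_le_of_log h0⟩
    · rintro d ⟨h2, h3⟩ h0
      rw [Finite.mem_toFinset]
      exact ⟨h2, h3.1, ord_le_of_log h0⟩
  choose! b hb using fun (T : PTree) (hT : ∃ q, T.At τ q) => hT
  have e2 : {T : PTree | T.Thru τ p ∧ T.lw = j} =
      {T | T ∈ {T : PTree | (∃ q, T.At τ q) ∧ T.lw = j} ∧ OnRay p (b T) T.vec} := by
    ext T
    simp only [thru_iff]
    constructor
    · rintro ⟨⟨q, hq, h1⟩, h2⟩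
      exact ⟨⟨⟨q, hq⟩, h2⟩, (hb T ⟨q, hq⟩).unique hq ▸ h1⟩
    · rintro ⟨⟨h1, h2⟩, h3⟩
      exact ⟨⟨b T, hb T h1, h3⟩, h2⟩
  rw [e1, e2, finsum_mem_group (f := fun d : Ray => d.log j) (fun d : Ray => d.base) S (fun d => d.logVec j) (fun d => d.logCoeff j)
    (fun d => rfl) (fun q v => OnRay p q v), finsum_mem_group (f := fun T : PTree => single T.vec (T.wtT : ℂ)) b {T : PTree | (∃ q, T.At τ q) ∧ T.lw = j}
    vec (fun T => (T.wtT : ℂ)) (fun d => rfl) (fun q v => OnRay p q v)]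
  · congr 1
    funext q
    congr 1
    have h1 := hS.log q j (.inr hj)
    rw [baseLog, treeLog] at h1
    rw [h1]
    have h2 : {T : PTree | T.At τ q ∧ T.lw = j} =
        {T | T ∈ {T : PTree | (∃ q, T.At τ q) ∧ T.lw = j} ∧ b T = q} := by
      ext T
      simp only [mem_ofPred_eq]
      constructor
      · rintro ⟨h1, h2⟩
        exact ⟨⟨⟨q, h1⟩, h2⟩, (hb T ⟨q, h1⟩).unique h1⟩
      · rintro ⟨⟨h3, h2⟩, rfl⟩
        exact ⟨hb T h3, h2⟩
    rw [h2]
  · refine (finite_thru hτ p j).subset ?_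
    rintro T ⟨⟨h1, h2⟩, h3, -⟩
    exact ⟨thru_iff.2 ⟨b T, hb T h1, h3⟩, h2.le⟩
  · intro q
    refine (finite_at hτ q j).subset ?_
    rintro T ⟨⟨h1, h2⟩, rfl, -⟩
    exact ⟨hb T h1, h2.le⟩
  · refine (hS.finite_support hτ p j).subset ?_
    rintro d ⟨h2, h3, h0⟩
    have h1 := log_ne_zero h0
    rw [logVec_eq, onRay_nsmul (Nat.div_pos (Nat.le_of_dvd h1.2 h1.1) (hS.ord_pos d h2)),
            onRay_iff (hS.prim d h2) (hS.wt_pos d h2)] at h3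
    exact ⟨h2, h3.1, ord_le_of_log h0⟩
  · intro q
    refine (hS.finite_base hτ q j).subset ?_
    rintro d ⟨h1, h2, h0⟩
    exact ⟨h1, h2, ord_le_of_log h0⟩

end Good

end

section

open Finset PTree

section

variable {τ : ZMod 3 → ℝ} {k : ℕ} {S : Set Ray}

lemma exists_alpha (hτ : Interior τ) {p : ℝ²} (hp : p ∉ singSet τ) :
    ∃ α, (∀ T : PTree, T.Thru τ p → 0 < alpha α T.vec) ∧
      ∀ T : PTree, T.At τ p → 0 < alpha α T.vec := by
  by_cases hh : 0 ≤ height p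
  · refine ⟨dheight p, fun T hT => hT.alpha_pos hτ hh, fun T hT => ?_⟩
    cases T with
    | leg n ε w => exact absurd ⟨n, hT.1.symm⟩ hp
    | node k ts =>
      have := hT.alpha_ge hτ
      have h2 : 0 < ((node k ts).lw : ℝ) := by exact_mod_cast hT.lw_pos
      linarith
  · have hat : ∀ T : PTree, ¬ T.At τ p := by
      intro T hT
      cases T with
      | leg n ε w => exact hp ⟨n, hT.1.symm⟩
      | node k ts => exact hh (hT.node_facts hτ).1
    by_cases hT : ∃ T : PTree, T.Thru τ p
    · obtain ⟨T, hT⟩ := hT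
      cases T with
      | node k ts => exact absurd (hT.node_height_pos hτ).le hh
      | leg n ε w =>
        refine ⟨vecR ((ε : ℤ) • (1, -3 * n)), fun T' hT' => ?_, fun T hT => absurd hT (hat T)⟩
        cases T' with
        | node k ts => exact absurd (hT'.node_height_pos hτ).le hh
        | leg n' ε' w' =>
          have hn : n = n' := by
            by_contra hne
            exact hh (height_nonneg_of_two_lines hne hT.leg_snd hT'.leg_snd)
          subst hn
          obtain ⟨q, s, hs, ⟨rfl, hw⟩, h1⟩ := hT
          obtain ⟨q, s', hs', ⟨rfl, hw'⟩, h2⟩ := hT'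
          have hwr : (0 : ℝ) < w := mod_cast hw
          have hwr' : (0 : ℝ) < w' := mod_cast hw'
          have h3 := congrArg Prod.fst (h1.symm.trans h2)
          simp only [vec, vecR, Prod.fst_add, Prod.smul_fst, smul_eq_mul] at h3
          push_cast at h3
          have h4 := mul_pos hs hwr
          have h5 := mul_pos hs' hwr'
          have he : ε' = ε := by
            rcases Int.units_eq_one_or ε with rfl | rfl <;>
            rcases Int.units_eq_one_or ε' with rfl | rfl <;> first | rfl | (simp at h3; nlinarith)
          subst he
          have h6 : (((ε' : ℤ) : ℝ)) * (ε' : ℤ) = 1 := by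
            rcases Int.units_eq_one_or ε' with rfl | rfl <;> simp
          simp only [alpha, vec, vecR, Prod.smul_fst, Prod.smul_snd, smul_eq_mul]
          push_cast
          have : ((ε' : ℤ) : ℝ) * 1 * ((w' : ℝ) * (ε' : ℤ) * 1) +
              (ε' : ℤ) * (-3 * (n : ℝ)) * (w' * (ε' : ℤ) * (-3 * n)) =
              w' * (((ε' : ℤ) : ℝ) * (ε' : ℤ)) * (1 + 9 * (n : ℝ) ^ 2) := by ring
          rw [this, h6]
          positivity
    · exact ⟨0, fun T h => absurd ⟨T, h⟩ hT, fun T h => absurd h (hat T)⟩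

/-- The trees through `p` of bounded leg weight. -/
abbrev ThruTree (τ : ZMod 3 → ℝ) (p : ℝ²) (M : ℕ) : Type :=
  {T : PTree // T ∈ {T : PTree | T.Thru τ p ∧ T.lw ≤ M}}

lemma inSum_thruTree {p : ℝ²} {M : ℕ} [Fintype (ThruTree τ p M)] {j : ℕ} (hj : j ≤ M) :
    inSum (fun T : ThruTree τ p M => T.1.vec) (fun T => T.1.lw) (fun T => (T.1.wtT : ℂ)) j =
      ∑ᶠ T ∈ {T : PTree | T.Thru τ p ∧ T.lw = j}, Finsupp.single T.vec (T.wtT : ℂ) := by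
  classical
  rw [inSum, ← sum_filter]
  rw [finsum_mem_eq_of_bijOn (s := {T : PTree | T.Thru τ p ∧ T.lw = j})
    (t := ((univ.filter fun T : ThruTree τ p M => T.1.lw = j).map
      ⟨Subtype.val, Subtype.val_injective⟩ : Finset PTree)) (e := id)
      (g := fun T => Finsupp.single T.vec (T.wtT : ℂ)), finsum_mem_coe_finset, sum_map]
  · rfl
  · have : {T : PTree | T.Thru τ p ∧ T.lw = j} = ↑((univ.filter fun T : ThruTree τ p M =>
      T.1.lw = j).map ⟨Subtype.val, Subtype.val_injective⟩ : Finset PTree) := by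
      ext T
      simp only [coe_map, Set.mem_image, coe_filter, mem_univ,
        true_and, Function.Embedding.coeFn_mk]
      constructor
      · rintro ⟨h1, h2⟩
        exact ⟨⟨T, h1, h2.trans_le hj⟩, h2, rfl⟩
      · rintro ⟨⟨T, h1, h2⟩, h3, rfl⟩
        exact ⟨h1, h3⟩
    rw [← this]
    exact Set.bijOn_id _
  · intro _ _; rfl

lemma outTerm_one {κ : Type} [Fintype κ] [DecidableEq κ] {vec : κ → ℤ²} {lw : κ → ℕ} {w : κ → ℂ}
    (hv : ∀ T, vec T ≠ 0) (j : ℕ) : outTerm vec lw w 1 j = inSum vec lw w j := by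
  rw [outTerm, inSum, Nat.factorial_one, Nat.cast_one, inv_one, one_smul]
  rw [← (Equiv.funUnique (Fin 1) κ).symm.sum_comp]
  refine sum_congr rfl fun T _ => ?_
  have : Nm univ (vec ∘ ((Equiv.funUnique (Fin 1) κ).symm T)) = 1 := by
    rw [univ_unique, Nm_singleton]
    exact hv T
  rw [this]
  simp [Equiv.funUnique]

lemma outSum_eq {α : ℝ²} {p : ℝ²} (hp : p ∉ singSet τ) {M : ℕ}
    [Fintype (ThruTree τ p M)] [DecidableEq (ThruTree τ p M)] (hM : 0 < M)
    (hα : ∀ T : PTree, T.Thru τ p → 0 < alpha α T.vec) {j : ℕ} (hj : j ≤ M) :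
    outSum (fun T : ThruTree τ p M => T.1.vec) (fun T => T.1.lw) (fun T => (T.1.wtT : ℂ)) M j =
      inSum (fun T : ThruTree τ p M => T.1.vec) (fun T => T.1.lw) (fun T => (T.1.wtT : ℂ)) j +
        treeLog τ p j := by
  classical
  have hv : ∀ T : ThruTree τ p M, T.1.vec ≠ 0 := by
    intro T h
    have := hα _ T.2.1
    rw [h] at this
    simp [alpha] at this
  have hsub : ({1} : Finset ℕ) ⊆ Icc 1 M := by simp; omega
  rw [outSum, ← sum_sdiff hsub, sum_singleton, outTerm_one hv, add_comm]
  congr 1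
  simp only [outTerm, smul_sum]
  rw [sum_sigma']
  let G : Finset (Σ n : ℕ, Fin n → ThruTree τ p M) :=
    ((Icc 1 M \ {1}).sigma fun _ => univ).filter fun x =>
      ∑ i, (x.2 i).1.lw = j ∧ ∃ a b, det2 (x.2 a).1.vec (x.2 b).1.vec ≠ 0
  rw [← sum_subset (filter_subset _ _ : G ⊆ _)]
  · rw [treeLog, ← finsum_mem_coe_finset]
    refine finsum_mem_eq_of_bijOn (fun x => node x.1 fun i => (x.2 i).1) ⟨?_, ?_, ?_⟩ ?_
    · rintro ⟨n, ts⟩ hx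
      simp only [coe_filter, Set.mem_ofPred_eq, mem_sigma, mem_sdiff,
        mem_Icc, mem_singleton] at hx
      obtain ⟨⟨⟨⟨h1, h2⟩, h3⟩, -⟩, h4, h5⟩ := hx
      have h6 : 2 ≤ n := by change 1 ≤ n at h1; change ¬ n = 1 at h3; omega
      exact ⟨at_node.2 ⟨h6, fun i => (ts i).2.1, h5⟩, h4⟩
    · rintro ⟨n, ts⟩ _ ⟨n', ts'⟩ _ h
      simp only [node.injEq] at h
      obtain ⟨rfl, h⟩ := h
      congr 1
      funext i
      exact Subtype.ext (congrFun (eq_of_heq h) i)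
    · rintro T ⟨hT, hlw⟩
      cases T with
      | leg n ε w => exact absurd ⟨n, hT.1.symm⟩ hp
      | node n ts =>
        obtain ⟨h1, h2, h3⟩ := at_node.1 hT
        have hsum : ∑ i, (ts i).lw = j := hlw
        refine ⟨⟨n, fun i => ⟨ts i, h2 i, ?_⟩⟩, ?_, rfl⟩
        · exact (single_le_sum (f := fun i => (ts i).lw)
            (fun _ _ => Nat.zero_le _) (mem_univ i)).trans (hsum.trans_le hj)
        · simp only [coe_filter, Set.mem_ofPred_eq, mem_sigma, mem_sdiff,
            mem_Icc, mem_singleton]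
          have : ∑ i : Fin n, 1 ≤ ∑ i, (ts i).lw := sum_le_sum fun i _ => (h2 i).lw_pos
          simp at this
          exact ⟨⟨⟨⟨by omega, by omega⟩, by omega⟩, mem_univ _⟩, hsum, h3⟩
    · rintro ⟨n, ts⟩ hx
      simp only [coe_filter, Set.mem_ofPred_eq] at hx
      rw [if_pos hx.2.1, Finsupp.smul_single]
      congr 1
      simp only [wtT, smul_eq_mul]
      push_cast
      rw [Function.comp_def]
      ring
  · rintro ⟨n, ts⟩ hx hx'
    simp only [mem_sigma, mem_sdiff, mem_Icc, mem_singleton] at hx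
    dsimp only
    split_ifs with h
    · have h3 : ∀ a b, det2 (ts a).1.vec (ts b).1.vec = 0 := by
        by_contra! h4
        refine hx' ?_
        simp only [mem_filter, mem_sigma, mem_sdiff,
            mem_Icc, mem_singleton]
        exact ⟨hx, h, h4⟩
      rw [Nm_eq_zero (u := (fun T : ThruTree τ p M => T.1.vec) ∘ ts)
        (by rw [card_univ, Fintype.card_fin]; omega) fun i _ j _ => h3 i j]
      simp
    · simp

end

end

section

open PowerSeries List

lemma list_sum_eq_finsum {β M : Type} [AddCommMonoid M] {l : List β} (hl : l.Nodup)
    {A : Set β} (hA : ∀ d, d ∈ l ↔ d ∈ A) (f : β → M) : (l.map f).sum = ∑ᶠ d ∈ A, f d := by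
  classical
  have : A = ↑l.toFinset := by ext d; simp [← hA]
  rw [this, finsum_mem_coe_finset, sum_toFinset f hl]

section

variable {τ : ZMod 3 → ℝ} {k : ℕ} {S : Set Ray}

lemma Ray.base_mem_support (d : Ray) : d.base ∈ d.support := ⟨0, le_rfl, by simp⟩

lemma baseLog_add_thruLog {p : ℝ²} (h : {d | d ∈ S ∧ p ∈ d.support}.Finite) (j : ℕ) :
    ∑ᶠ d ∈ {d | d ∈ S ∧ p ∈ d.support}, d.log j = baseLog S p j + thruLog S p j := by
  have e : {d | d ∈ S ∧ p ∈ d.support} = {d | d ∈ S ∧ d.base = p} ∪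
      {d | d ∈ S ∧ p ∈ d.support ∧ p ≠ d.base} := by
    ext d
    simp only [Set.mem_union]
    constructor
    · rintro ⟨h1, h2⟩
      by_cases h3 : d.base = p
      · exact .inl ⟨h1, h3⟩
      · exact .inr ⟨h1, h2, Ne.symm h3⟩
    · rintro (⟨h1, rfl⟩ | ⟨h1, h2, -⟩)
      · exact ⟨h1, d.base_mem_support⟩
      · exact ⟨h1, h2⟩
  have h1 := h
  rw [e, Set.finite_union] at h1
  rw [e, finsum_mem_union _ h1.1 h1.2]
  · rfl
  · rw [Set.disjoint_left]
    rintro d ⟨-, h2⟩ ⟨-, -, h3⟩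
    exact h3 h2.symm

lemma nodup_filter_fst {l : List (Ray × ℤˣ)} (hl : l.Nodup) (u : ℤˣ) :
    ((l.filter fun x => x.2 = u).map Prod.fst).Nodup := by
  refine Nodup.map_on ?_ (hl.filter _)
  rintro ⟨d, u1⟩ h1 ⟨d', u2⟩ h2 rfl
  simp only [mem_filter, decide_eq_true_eq] at h1 h2
  rw [h1.2, h2.2]

lemma sum_rayLog_one {p : ℝ²} {l : List (Ray × ℤˣ)} (hl : IsLoopOrder S p l)
    (h : {d | d ∈ S ∧ p ∈ d.support}.Finite) (j : ℕ) :
    ((l.filter fun x => x.2 = 1).map fun x => rayLog x j).sum = baseLog S p j + thruLog S p j := by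
  rw [← baseLog_add_thruLog h, ← list_sum_eq_finsum (nodup_filter_fst hl.1 1), map_map]
  · congr 1
    refine map_congr_left fun x hx => ?_
    obtain ⟨d, u⟩ := x
    simp only [mem_filter, decide_eq_true_eq] at hx
    obtain ⟨-, rfl⟩ := hx
    exact rayLog_one d j
  · intro d
    rw [mem_map]
    constructor
    · rintro ⟨x, hx, rfl⟩
      rw [mem_filter, hl.2.1] at hx
      exact ⟨hx.1.1, hx.1.2.1⟩
    · rintro ⟨h1, h2⟩
      exact ⟨(d, 1), mem_filter.2 ⟨(hl.2.1 _).2 ⟨h1, h2, .inl rfl⟩, by simp⟩, rfl⟩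

lemma sum_rayLog_neg_one {p : ℝ²} {l : List (Ray × ℤˣ)} (hl : IsLoopOrder S p l) (j : ℕ) :
    ((l.filter fun x => x.2 = -1).map fun x => rayLog x j).sum = -thruLog S p j := by
  have h1 : thruLog S p j = (((l.filter fun x => x.2 = -1).map Prod.fst).map fun d => d.log j).sum := by
    rw [thruLog, ← list_sum_eq_finsum (nodup_filter_fst hl.1 (-1))]
    intro d
    rw [mem_map]
    constructor
    · rintro ⟨x, hx, rfl⟩
      rw [mem_filter, hl.2.1, decide_eq_true_eq] at hx
      refine ⟨hx.1.1, hx.1.2.1, ?_⟩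
      rcases hx.1.2.2 with h3 | h3
      · rw [hx.2] at h3
        exact absurd h3 (by decide)
      · exact h3.2
    · rintro ⟨h1, h2, h3⟩
      exact ⟨(d, -1), mem_filter.2 ⟨(hl.2.1 _).2 ⟨h1, h2, .inr ⟨rfl, h3⟩⟩, by simp⟩, rfl⟩
  rw [h1, map_map, sum_neg, map_map]
  congr 1
  refine map_congr_left fun x hx => ?_
  obtain ⟨d, u⟩ := x
  simp only [mem_filter, decide_eq_true_eq] at hx
  obtain ⟨-, rfl⟩ := hx
  exact rayLog_neg_one d j

lemma sum_rayLog {p : ℝ²} {l : List (Ray × ℤˣ)} (hl : IsLoopOrder S p l)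
    (h : {d | d ∈ S ∧ p ∈ d.support}.Finite) (j : ℕ) :
    (l.map fun x => rayLog x j).sum = baseLog S p j := by
  have h1 := sum_rayLog_one hl h j
  have h2 := sum_rayLog_neg_one hl j
  have h3 : ∀ l : List (Ray × ℤˣ), (l.map fun x => rayLog x j).sum =
      ((l.filter fun x => x.2 = 1).map fun x => rayLog x j).sum +
        ((l.filter fun x => x.2 = -1).map fun x => rayLog x j).sum := by
    intro l
    induction l with
    | nil => simp
    | cons x l ih =>
      rw [map_cons, sum_cons, ih, filter_cons, filter_cons]
      rcases Int.units_eq_one_or x.2 with h | h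
      · rw [if_pos (by simpa using h), if_neg (by rw [h]; decide), map_cons, sum_cons]
        abel
      · rw [if_neg (by rw [h]; decide), if_pos (by simpa using h), map_cons, sum_cons]
        abel
  rw [h3, h1, h2]
  abel

lemma Good.finite_support' (hτ : Interior τ) (hS : Good τ k S) (p : ℝ²) :
    {d | d ∈ S ∧ p ∈ d.support}.Finite :=
  (hS.finite_support hτ p (k + 1)).subset fun d hd => ⟨hd.1, hd.2, hS.ord_le d hd.1⟩

lemma exists_loopOrder {p : ℝ²} (h : {d | d ∈ S ∧ p ∈ d.support}.Finite) :
    ∃ l, IsLoopOrder S p l := by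
  classical
  have hf : (halfRays S p).Finite := by
    refine (h.prod (Set.finite_univ (α := ℤˣ))).subset ?_
    rintro ⟨d, u⟩ ⟨h1, h2, -⟩
    exact ⟨⟨h1, h2⟩, trivial⟩
  let r : Ray × ℤˣ → Ray × ℤˣ → Bool := fun x y => angle (halfDir x) ≤ angle (halfDir y)
  refine ⟨hf.toFinset.toList.mergeSort r, ?_, ?_, ?_⟩
  · exact (mergeSort_perm _ _).nodup_iff.2 (Finset.nodup_toList _)
  · intro x
    rw [(mergeSort_perm _ _).mem_iff]
    simp
  · have := pairwise_mergeSort (le := r) (fun a b c h1 h2 => by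
      simp only [r, decide_eq_true_eq] at h1 h2 ⊢; exact h1.trans h2)
      (fun a b => by simp only [r, Bool.or_eq_true, decide_eq_true_eq]; exact le_total _ _)
      hf.toFinset.toList
    exact this.imp fun h => by simpa [r] using h

lemma Good.coeff_loop (hτ : Interior τ) (hS : Good τ k S) {p : ℝ²}
    (hp : p ∉ singSet τ) {l : List (Ray × ℤˣ)} (hl : IsLoopOrder S p l) :
    coeff (k + 1) (l.map crossSeries).reverse.prod =
      opOf (baseLog S p (k + 1) - treeLog τ p (k + 1)) := by
  classical
  have hfin := hS.finite_support' hτ p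
  obtain ⟨α, hα, hα'⟩ := exists_alpha hτ hp
  have : Fintype (ThruTree τ p (k + 1)) := (PTree.finite_thru hτ p (k + 1)).fintype
  have hmem : ∀ x ∈ l, x.1 ∈ S ∧ p ∈ x.1.support := fun x hx => by
    have := (hl.2.1 x).1 hx
    exact ⟨this.1, this.2.1⟩
  have key := coeff_loop_eq (M := k + 1) (α := α) (vec := fun T : ThruTree τ p (k + 1) => T.1.vec)
    (lw := fun T => T.1.lw) (w := fun T => (T.1.wtT : ℂ)) (fun T => T.2.1.lw_pos)
    (fun T => hα _ T.2.1) hl.2.2 (fun x hx => hS.ord_pos _ (hmem x hx).1)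
    (fun x hx => hS.wt_pos _ (hmem x hx).1) ?_ ?_ ?_
  · rw [key, sum_rayLog hl hfin, outSum_eq hp (Nat.succ_pos k) hα le_rfl]
    congr 1
    abel
  · intro x hx
    obtain ⟨T, i, hi, hT, h1, -⟩ := hS.tree _ (hmem x hx).1
    have h2 : 0 < alpha α T.vec := by
      by_cases h : p = x.1.base
      · exact hα' T (h ▸ hT)
      · refine hα T (PTree.thru_iff.2 ⟨_, hT, ?_⟩)
        rw [← onRay_nsmul hi, ← h1]
        exact (Ray.onRay_iff (hS.prim _ (hmem x hx).1) (hS.wt_pos _ (hmem x hx).1)).2 ⟨(hmem x hx).2, h⟩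
    have hsm : ∀ (i : ℕ) (v : ℤ²), alpha α (i • v) = i * alpha α v := by
      intro i v
      rw [← Nat.cast_smul_eq_nsmul ℤ]
      simp only [alpha, Prod.smul_fst, Prod.smul_snd, smul_eq_mul]
      push_cast
      ring
    have h3 : 0 < alpha α x.1.expo := by rw [h1, hsm]; exact mul_pos (mod_cast hi) h2
    rw [Ray.expo, Nat.cast_smul_eq_nsmul ℤ, hsm] at h3
    exact pos_of_mul_pos_right h3 (Nat.cast_nonneg _)
  · intro j hj
    rw [sum_rayLog_neg_one hl, inSum_thruTree hj.le, hS.thruLog_eq hτ p (Nat.lt_succ_iff.1 hj)]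
  · intro j hj
    rw [sum_rayLog_one hl hfin, outSum_eq hp (Nat.succ_pos k) hα hj.le, inSum_thruTree hj.le,
      hS.thruLog_eq hτ p (Nat.lt_succ_iff.1 hj), hS.log p j (.inr (Nat.lt_succ_iff.1 hj)), add_comm]

lemma opOf_apply_single (f : ℤ² →₀ ℂ) (q v : ℤ²) :
    (opOf f (AddMonoidAlgebra.single q 1)).coeff (q + v) = ((det2 v q : ℤ) : ℂ) * f v := by
  induction f using Finsupp.induction_linear with
  | zero => simp
  | add f g hf hg => 
    rw [map_add opOf, LinearMap.add_apply, AddMonoidAlgebra.coeff_add, Finsupp.add_apply, hf, hg,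
      Finsupp.add_apply, mul_add]
  | single u c =>
    rw [opOf_single, LinearMap.smul_apply, derOp_single, AddMonoidAlgebra.coeff_smul,
      Finsupp.smul_apply, AddMonoidAlgebra.coeff_single, Finsupp.single_apply, Finsupp.single_apply]
    by_cases h : u = v
    · subst h
      rw [if_pos (by abel), if_pos rfl, smul_eq_mul]
      ring
    · rw [if_neg, if_neg h, smul_zero, mul_zero]
      intro h'
      apply h
      rw [add_comm q v] at h'
      exact add_right_cancel h'

lemma Good.newRay_iff (hτ : Interior τ) (hS : Good τ k S) {d : Ray}
    (hp : d.base ∉ singSet τ) (hprim : IsPrim d.dir) :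
    (∃ l, IsLoopOrder S d.base l ∧ ∀ q : ℤ²,
      (coeff (k + 1)
        (loopAut l (monomial 0 (AddMonoidAlgebra.single q 1)))).coeff (q + d.expo)
      = -((det2 d.dir q : ℤ) : ℂ) * d.coeff) ↔
    d.coeff = d.wt * (treeLog τ d.base (k + 1) - baseLog S d.base (k + 1)) d.expo := by
  have hdet : ∀ q, ((det2 d.expo q : ℤ) : ℂ) = d.wt * ((det2 d.dir q : ℤ) : ℂ) := by
    intro q
    rw [Ray.expo]
    simp only [det2, Prod.smul_fst, Prod.smul_snd, smul_eq_mul]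
    push_cast
    ring
  constructor
  · rintro ⟨l, hl, h⟩
    obtain ⟨q, hq⟩ : ∃ q, det2 d.dir q ≠ 0 := by
      by_contra! h0
      have h1 := h0 (0, 1)
      have h2 := h0 (1, 0)
      simp only [det2] at h1 h2
      exact hprim.ne_zero (Prod.ext (by simpa using h1) (by simpa using h2))
    have h1 := h q
    rw [coeff_loopAut, hS.coeff_loop hτ hp hl, opOf_apply_single, hdet] at h1
    have hq' : ((det2 d.dir q : ℤ) : ℂ) ≠ 0 := mod_cast hq
    rw [Finsupp.sub_apply] at h1 ⊢
    apply mul_left_cancel₀ hq'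
    linear_combination h1
  · intro h
    obtain ⟨l, hl⟩ := exists_loopOrder (hS.finite_support' hτ d.base)
    refine ⟨l, hl, fun q => ?_⟩
    rw [coeff_loopAut, hS.coeff_loop hτ hp hl, opOf_apply_single, hdet]
    rw [Finsupp.sub_apply] at h ⊢
    rw [h]
    ring

end

end

section

open Finsupp PTree Ray Set

section

variable {τ : ZMod 3 → ℝ} {k : ℕ} {S : Set Ray}

lemma singPt_injective (hτ : Interior τ) : Function.Injective (singPt τ) := by
  intro n n' h
  have h1 : (n : ℝ) + τ n = n' + τ n' := congrArg Prod.fst h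
  have h2 : ∀ n : ℤ, ⌊(n : ℝ) + τ n⌋ = n := by
    intro n
    have := hτ n
    rw [Int.floor_eq_iff]
    constructor <;> linarith [this.1, this.2]
  rw [← h2 n, ← h2 n', h1]

lemma PTree.at_singPt (hτ : Interior τ) {T : PTree} {n : ℤ}
    (h : T.At τ (singPt τ n)) : ∃ ε w, 0 < w ∧ T = leg n ε w := by
  cases T with
  | leg n' ε w =>
    obtain rfl := singPt_injective hτ h.1
    exact ⟨ε, w, h.2, rfl⟩
  | node k ts =>
    have h1 := (h.node_facts hτ).1
    have h2 := height_singPt hτ n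
    linarith

lemma treeLog_zero (q : ℝ²) : treeLog τ q 0 = 0 := by
  rw [treeLog]
  have : {T : PTree | T.At τ q ∧ T.lw = 0} = ∅ := by
    ext T
    simp only [mem_ofPred_eq, mem_empty_iff_false, iff_false, not_and]
    intro h h'
    exact h.lw_pos.ne' h'
  rw [this, finsum_mem_empty]

lemma baseLog_zero (q : ℝ²) : baseLog S q 0 = 0 := by
  rw [baseLog]
  refine (finsum_mem_congr rfl fun d _ => ?_).trans (finsum_mem_zero _)
  exact log_eq_zero (by simp)

lemma initial_dir_ne (n : ℤ) : ((1, -3 * n) : ℤ²) ≠ (-1, 3 * n) := by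
  intro h
  have := congrArg Prod.fst h
  simp at this

lemma baseLog_initial (hτ : Interior τ) (n : ℤ) (j : ℕ) :
    baseLog (initialDiagram τ) (singPt τ n) j = treeLog τ (singPt τ n) j := by
  rcases Nat.eq_zero_or_pos j with rfl | hj
  · rw [treeLog_zero, baseLog_zero]
  have e1 : {d | d ∈ initialDiagram τ ∧ d.base = singPt τ n} =
      {⟨singPt τ n, (1, -3 * n), 1, 1, 1⟩, ⟨singPt τ n, (-1, 3 * n), 1, 1, 1⟩} := by
    ext d
    simp only [initialDiagram, mem_insert_iff, mem_singleton_iff]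
    constructor
    · rintro ⟨⟨n', h1, h2, h3, h4, h5⟩, h6⟩
      obtain rfl := singPt_injective hτ (h1.symm.trans h6)
      rcases h2 with h2 | h2
      · left; exact Ray.ext h1 h2 h3 h4 h5
      · right; exact Ray.ext h1 h2 h3 h4 h5
    · rintro (rfl | rfl)
      · exact ⟨⟨n, rfl, .inl rfl, rfl, rfl, rfl⟩, rfl⟩
      · exact ⟨⟨n, rfl, .inr rfl, rfl, rfl, rfl⟩, rfl⟩
  have e2 : {T : PTree | T.At τ (singPt τ n) ∧ T.lw = j} = {leg n 1 j, leg n (-1) j} := by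
    ext T
    simp only [mem_insert_iff, mem_singleton_iff]
    constructor
    · rintro ⟨h1, h2⟩
      obtain ⟨ε, w, hw, rfl⟩ := at_singPt hτ h1
      obtain rfl : w = j := h2
      rcases Int.units_eq_one_or ε with rfl | rfl
      · exact .inl rfl
      · exact .inr rfl
    · rintro (rfl | rfl)
      · exact ⟨⟨rfl, hj⟩, rfl⟩
      · exact ⟨⟨rfl, hj⟩, rfl⟩
  rw [baseLog, treeLog, e1, e2, finsum_mem_pair, finsum_mem_pair]
  · congr 1
    · simp only [log, logVec, logCoeff, vec, wtT, Nat.div_one, one_mul]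
      rw [if_pos (one_dvd _)]
      congr 1
      · simp
      · push_cast; ring
    · simp only [log, logVec, logCoeff, vec, wtT, Nat.div_one, one_mul]
      rw [if_pos (one_dvd _)]
      congr 1
      · simp
      · push_cast; ring
  · intro h
    simp at h
  · intro h
    exact initial_dir_ne n (congrArg dir h)

lemma isPrim_one (b : ℤ) : IsPrim (1, b) := by simp [IsPrim]

lemma isPrim_neg_one (b : ℤ) : IsPrim (-1, b) := by simp [IsPrim]

lemma good_initial (hτ : Interior τ) : Good τ 0 (initialDiagram τ) where
  wt_pos := by rintro d ⟨n, h1, h2, h3, h4, h5⟩; omega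
  prim := by
    rintro d ⟨n, h1, h2 | h2, h3, h4, h5⟩
    · rw [h2]; exact isPrim_one _
    · rw [h2]; exact isPrim_neg_one _
  ord_pos := by rintro d ⟨n, h1, h2, h3, h4, h5⟩; omega
  ord_le := by rintro d ⟨n, h1, h2, h3, h4, h5⟩; omega
  ord_le' := by rintro d ⟨n, h1, h2, h3, h4, h5⟩ h; exact absurd ⟨n, h1.symm⟩ h
  tree := by
    rintro d ⟨n, h1, h2 | h2, h3, h4, h5⟩
    · refine ⟨leg n 1 1, 1, one_pos, ⟨h1, one_pos⟩, ?_, by rw [h4]; rfl⟩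
      rw [expo, h2, h3]; simp [vec]
    · refine ⟨leg n (-1) 1, 1, one_pos, ⟨h1, one_pos⟩, ?_, by rw [h4]; rfl⟩
      rw [expo, h2, h3]; simp [vec]
  inj := by
    rintro d ⟨n, h1, h2, h3, h4, h5⟩ d' ⟨n', h1', h2', h3', h4', h5'⟩ hb he -
    have : d.dir = d'.dir := by
      rw [expo, expo, h3, h3'] at he
      simpa using he
    exact Ray.ext hb this (h3.trans h3'.symm) (h4.trans h4'.symm) (h5.trans h5'.symm)
  log := by
    rintro q j (⟨n, rfl⟩ | hj)
    · exact baseLog_initial hτ n j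
    · obtain rfl : j = 0 := by omega
      rw [treeLog_zero, baseLog_zero]

lemma exists_of_finsum_apply_ne_zero {X V : Type*} {f : X → V →₀ ℂ} {A : Set X} {v : V}
    (h : (∑ᶠ x ∈ A, f x) v ≠ 0) : ∃ x ∈ A, f x v ≠ 0 := by
  by_contra! h0
  refine h (finsum_mem_induction (p := fun g : V →₀ ℂ => g v = 0) rfl ?_ fun x hx => h0 x hx)
  intro a b ha hb
  rw [Finsupp.add_apply, ha, hb, add_zero]

lemma treeLog_ne_zero {q : ℝ²} {j : ℕ} {v : ℤ²} (h : treeLog τ q j v ≠ 0) :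
    ∃ T : PTree, T.At τ q ∧ T.lw = j ∧ T.vec = v := by
  obtain ⟨T, hT, h1⟩ := exists_of_finsum_apply_ne_zero h
  exact ⟨T, hT.1, hT.2, by by_contra h2; exact h1 (single_eq_of_ne' h2)⟩

lemma Good.baseLog_ne_zero (hS : Good τ k S) {q : ℝ²} {j : ℕ} {v : ℤ²}
    (h : baseLog S q j v ≠ 0) :
    ∃ (T : PTree) (i : ℕ), 0 < i ∧ T.At τ q ∧ v = i • T.vec ∧ j = i * T.lw := by
  obtain ⟨d, hd, h1⟩ := exists_of_finsum_apply_ne_zero h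
  have h2 : d.log j ≠ 0 := by intro h0; rw [h0] at h1; exact h1 rfl
  have h3 := log_ne_zero h2
  obtain ⟨T, i, hi, hT, h4, h5⟩ := hS.tree d hd.1
  have h6 : d.logVec j = v := by by_contra h2; exact h1 (single_eq_of_ne' h2)
  refine ⟨T, j / d.ord * i, Nat.mul_pos (Nat.div_pos (Nat.le_of_dvd h3.2 h3.1) (hS.ord_pos d hd.1)) hi,
    hd.2 ▸ hT, ?_, ?_⟩
  · rw [← h6, logVec_eq, h4, smul_smul]
  · rw [mul_assoc, ← h5, Nat.div_mul_cancel h3.1]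

lemma Ray.log_self {d : Ray} (hd : 0 < d.ord) :
    d.log d.ord = single d.expo (d.coeff / d.wt) := by
  rw [log, logVec_eq, logCoeff, if_pos dvd_rfl, Nat.div_self hd]
  simp

lemma PTree.At.vec_ne_zero (hτ : Interior τ) {T : PTree} {p : ℝ²}
    (h : T.At τ p) (hp : p ∉ singSet τ) : T.vec ≠ 0 := by
  obtain ⟨α, -, hα⟩ := exists_alpha hτ hp
  intro h0
  have := hα T h
  rw [h0] at this
  simp [alpha] at this

lemma Good.step (hτ : Interior τ) (hS : Good τ k S) :
    Good τ (k + 1) (scatterStep (singSet τ) k S) := by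
  set f : ℝ² → ℤ² →₀ ℂ := fun p => treeLog τ p (k + 1) - baseLog S p (k + 1) with hf
  set N : Set Ray := {d | d.base ∉ singSet τ ∧ IsPrim d.dir ∧ 0 < d.wt ∧ d.ord = k + 1 ∧
    d.coeff ≠ 0 ∧ d.coeff = d.wt * f d.base d.expo} with hN
  have hstep : scatterStep (singSet τ) k S = S ∪ N := by
    rw [scatterStep]
    congr 1
    ext d
    simp only [hN, mem_ofPred_eq]
    constructor
    · rintro ⟨h1, h2, h3, h4, h5, h6⟩
      exact ⟨h1, h2, h3, h4, h5, (hS.newRay_iff hτ h1 h2).1 h6⟩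
    · rintro ⟨h1, h2, h3, h4, h5, h6⟩
      exact ⟨h1, h2, h3, h4, h5, (hS.newRay_iff hτ h1 h2).2 h6⟩
  have hfs : ∀ p v, f p v ≠ 0 → ∃ (T : PTree) (i : ℕ), 0 < i ∧ T.At τ p ∧ v = i • T.vec ∧
      k + 1 = i * T.lw := by
    intro p v h
    by_cases h1 : treeLog τ p (k + 1) v = 0
    · refine hS.baseLog_ne_zero (v := v) fun h2 => h ?_
      rw [hf, Finsupp.sub_apply, h1, h2, sub_zero]
    · obtain ⟨T, h2, h3, h4⟩ := treeLog_ne_zero h1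
      exact ⟨T, 1, one_pos, h2, by rw [one_smul, h4], by rw [one_mul, h3]⟩
  have hNf : ∀ d ∈ N, f d.base d.expo ≠ 0 := by
    rintro d ⟨h1, h2, h3, h4, h5, h6⟩ h0
    rw [h0, mul_zero] at h6
    exact h5 h6
  have hNinj : ∀ d ∈ N, ∀ d' ∈ N, d.base = d'.base → d.expo = d'.expo → d = d' := by
    rintro d ⟨h1, h2, h3, h4, h5, h6⟩ d' ⟨h1', h2', h3', h4', h5', h6'⟩ hb he
    obtain ⟨h7, h8⟩ := eq_of_prim h2 h2' h3 he
    refine Ray.ext hb h8 h7 (h4.trans h4'.symm) ?_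
    rw [h6, h6', h7, hb, he]
  rw [hstep]
  refine ⟨?_, ?_, ?_, ?_, ?_, ?_, ?_, ?_⟩
  · rintro d (h | h)
    · exact hS.wt_pos d h
    · exact h.2.2.1
  · rintro d (h | h)
    · exact hS.prim d h
    · exact h.2.1
  · rintro d (h | h)
    · exact hS.ord_pos d h
    · have := h.2.2.2.1; omega
  · rintro d (h | h)
    · have := hS.ord_le d h; omega
    · have := h.2.2.2.1; omega
  · rintro d (h | h) hb
    · have := hS.ord_le' d h hb; omega
    · have := h.2.2.2.1; omega
  · rintro d (h | h)
    · exact hS.tree d h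
    · obtain ⟨T, i, hi, h1, h2, h3⟩ := hfs _ _ (hNf d h)
      exact ⟨T, i, hi, h1, h2, h.2.2.2.1.trans h3⟩
  · rintro d (h | h) d' (h' | h') hb he ho
    · exact hS.inj d h d' h' hb he ho
    · have h1 := hS.ord_le' d h (hb ▸ h'.1)
      have h2 := h'.2.2.2.1
      omega
    · have h1 := hS.ord_le' d' h' (hb ▸ h.1)
      have h2 := h.2.2.2.1
      omega
    · exact hNinj d h d' h' hb he
  · intro q j hj
    have hsame : (q ∈ singSet τ ∨ j ≤ k) → baseLog (S ∪ N) q j = baseLog S q j := by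
      intro h
      refine finsum_mem_inter_support_eq' _ _ _ fun d hd => ?_
      have hd' : d.log j ≠ 0 := hd
      constructor
      · rintro ⟨h1 | h1, h2⟩
        · exact ⟨h1, h2⟩
        · rcases h with h | h
          · exact absurd (h2 ▸ h) h1.1
          · have h3 := ord_le_of_log hd'
            have h4 := h1.2.2.2.1
            omega
      · rintro ⟨h1, h2⟩
        exact ⟨Or.inl h1, h2⟩
    by_cases h : q ∈ singSet τ ∨ j ≤ k
    · rw [hsame h, hS.log q j h]
    · rw [not_or] at h
      obtain ⟨hq, hjk⟩ := h
      obtain rfl : j = k + 1 := by have := hj.resolve_left hq; omega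
      have e1 : {d | d ∈ S ∪ N ∧ d.base = q} = {d | d ∈ S ∧ d.base = q} ∪ {d | d ∈ N ∧ d.base = q} := by
        ext d
        simp only [mem_ofPred_eq, mem_union, or_and_right]
      have hbij : BijOn expo {d | d ∈ N ∧ d.base = q} ↑(f q).support := by
        refine ⟨?_, ?_, ?_⟩
        · rintro d ⟨hd, rfl⟩
          exact mem_support_iff.2 (hNf d hd)
        · rintro d ⟨hd, h1⟩ d' ⟨hd', h1'⟩ he
          exact hNinj d hd d' hd' (h1.trans h1'.symm) he
        · intro v hv
          have hv' := mem_support_iff.1 hv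
          obtain ⟨T, i, hi, h1, h2, h3⟩ := hfs _ _ hv'
          have hv0 : v ≠ 0 := by
            rw [h2]
            exact smul_ne_zero hi.ne' (h1.vec_ne_zero hτ hq)
          obtain ⟨a, m, ha, hm, rfl⟩ := exists_prim hv0
          refine ⟨⟨q, m, a, k + 1, a * f q ((a : ℤ) • m)⟩, ⟨⟨hq, hm, ha, rfl, ?_, rfl⟩, rfl⟩, rfl⟩
          exact mul_ne_zero (by exact_mod_cast ha.ne') hv'
      have hfin : {d | d ∈ N ∧ d.base = q}.Finite := 
        hbij.finite_iff_finite.2 (Finset.finite_toSet _)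
      have hfinS : {d | d ∈ S ∧ d.base = q}.Finite :=
        (hS.finite_base hτ q (k + 1)).subset fun d hd => ⟨hd.1, hd.2, hS.ord_le d hd.1⟩
      rw [baseLog, e1, finsum_mem_union _ hfinS hfin]
      · have e2 : ∑ᶠ d ∈ {d | d ∈ N ∧ d.base = q}, d.log (k + 1) = f q := by
          rw [finsum_mem_eq_of_bijOn (g := fun v => single v (f q v)) _ hbij,
            finsum_mem_coe_finset]
          · exact sum_single (f q)
          · rintro d ⟨⟨h1, h2, h3, h4, h5, h6⟩, rfl⟩
            rw [← h4, log_self (by omega), h6, mul_div_cancel_left₀]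
            exact_mod_cast h3.ne'
        rw [e2]
        change baseLog S q (k + 1) + (treeLog τ q (k + 1) - baseLog S q (k + 1)) = _
        abel
      · rw [disjoint_left]
        rintro d ⟨h1, h2⟩ ⟨h3, -⟩
        have h4 := hS.ord_le' d h1 h3.1
        have h5 := h3.2.2.2.1
        omega

lemma good_diagram (hτ : Interior τ) : ∀ k, Good τ k (diagram τ k)
  | 0 => good_initial hτ
  | k + 1 => (good_diagram hτ k).step hτ

lemma diagram_mono {k k' : ℕ} (h : k ≤ k') : diagram τ k ⊆ diagram τ k' := by
  induction k', h using Nat.le_induction with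
  | base => exact subset_rfl
  | succ k' _ ih => exact ih.trans subset_union_left

lemma mem_diagram_of_ord_le {d : Ray} (hd : d ∈ diagramInfty τ) {k : ℕ} (hk : d.ord ≤ k) :
    d ∈ diagram τ k := by
  obtain ⟨k', hk'⟩ := mem_iUnion.1 hd
  induction k' with
  | zero => exact diagram_mono (Nat.zero_le _) hk'
  | succ k' ih =>
    rcases hk' with h | h
    · exact ih h
    · by_cases hkk : k' + 1 ≤ k
      · exact diagram_mono hkk (.inr h)
      · have := h.2.2.2.1
        omega

lemma diagram_subset (k : ℕ) : diagram τ k ⊆ diagramInfty τ := subset_iUnion _ k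

lemma good_of_mem (hτ : Interior τ) {d : Ray} (hd : d ∈ diagramInfty τ) :
    d ∈ diagram τ d.ord ∧ Good τ d.ord (diagram τ d.ord) :=
  ⟨mem_diagram_of_ord_le hd le_rfl, good_diagram hτ _⟩

lemma baseLog_diagramInfty (hτ : Interior τ) (q : ℝ²) (j : ℕ) :
    baseLog (diagramInfty τ) q j = treeLog τ q j := by
  rw [← (good_diagram hτ j).log q j (.inr le_rfl)]
  refine finsum_mem_inter_support_eq' _ _ _ fun d hd => ?_
  have hd' : d.log j ≠ 0 := hd
  exact ⟨fun h => ⟨mem_diagram_of_ord_le h.1 (ord_le_of_log hd'), h.2⟩,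
    fun h => ⟨diagram_subset j h.1, h.2⟩⟩

end

end

section

open Finset PowerSeries

section Log

variable {A : Type} [CommRing A] [Algebra ℚ A]

lemma mul_derivative_logOf {f : PowerSeries A} (hf : constantCoeff f = 1) :
    f * derivative A (logOf f) = derivative A f := by
  have hs : HasSubst (f - 1) := HasSubst.of_constantCoeff_zero' (by
    rw [map_sub, map_one, hf, sub_self])
  have h1 : (1 + X) * derivative A (log A) = 1 := by
    rw [deriv_log]
    ext n
    rw [add_mul, one_mul, map_add, coeff_mk, coeff_one]
    cases n with
    | zero => simp
    | succ n =>
      rw [coeff_succ_X_mul, coeff_mk, ← map_add]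
      simp [pow_succ]
  have h2 : f * (derivative A (log A)).subst (f - 1) = 1 := by
    have h3 := congrArg (substAlgHom hs) h1
    rw [map_mul, map_add, map_one, substAlgHom_X, coe_substAlgHom,
      add_sub_cancel] at h3
    exact h3
  rw [logOf_eq, derivative_subst hs, ← mul_assoc, h2, one_mul, map_sub,
    Derivation.map_one_eq_zero, sub_zero]

lemma mul_theta_logOf {f : PowerSeries A} (hf : constantCoeff f = 1) :
    f * theta A (logOf f) = theta A f := by
  rw [theta, Derivation.smul_apply, Derivation.smul_apply, smul_eq_mul, smul_eq_mul,
    mul_left_comm, mul_derivative_logOf hf]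

lemma isUnit_of_constantCoeff_one {f : PowerSeries A} (hf : constantCoeff f = 1) :
    IsUnit f := isUnit_iff_constantCoeff.2 (hf ▸ isUnit_one)

lemma eq_logOf {f g : PowerSeries A} (hf : constantCoeff f = 1)
    (hg : constantCoeff g = 0) (h : f * theta A g = theta A f) :
    g = logOf f := by
  have h1 : theta A g = theta A (logOf f) :=
    (isUnit_of_constantCoeff_one hf).mul_left_cancel (h.trans (mul_theta_logOf hf).symm)
  ext n
  cases n with
  | zero =>
    rw [coeff_zero_eq_constantCoeff_apply, coeff_zero_eq_constantCoeff_apply,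
      hg, constantCoeff_logOf hf]
  | succ n =>
    have h2 := congrArg (coeff (n + 1)) h1
    rw [coeff_theta, coeff_theta] at h2
    have hu : IsUnit (((n + 1 : ℕ)) : A) := by
      rw [show (((n + 1 : ℕ)) : A) = algebraMap ℚ A ((n + 1 : ℕ) : ℚ) by simp]
      exact (IsUnit.mk0 _ (by positivity)).map _
    exact hu.mul_left_cancel h2

lemma theta_rescale (r : A) (f : PowerSeries A) :
    theta A (rescale r f) = rescale r (theta A f) := by
  ext n
  rw [coeff_theta, coeff_rescale, coeff_rescale, coeff_theta]
  ring

lemma logOf_rescale (r : A) {f : PowerSeries A} (hf : constantCoeff f = 1) :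
    logOf (rescale r f) = rescale r (logOf f) := by
  have hc : ∀ g : PowerSeries A, constantCoeff (rescale r g) =
      constantCoeff g := by
    intro g
    rw [← coeff_zero_eq_constantCoeff_apply, coeff_rescale]
    simp
  symm
  refine eq_logOf ?_ ?_ ?_
  · rw [hc, hf]
  · rw [hc, constantCoeff_logOf hf]
  · rw [theta_rescale, ← map_mul, mul_theta_logOf hf, theta_rescale]

lemma logOf_map {A' : Type} [CommRing A'] [Algebra ℚ A'] (φ : A →+* A') {f : PowerSeries A}
    (hf : constantCoeff f = 1) :
    logOf (map φ f) = map φ (logOf f) := by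
  symm
  refine eq_logOf ?_ ?_ ?_
  · rw [← coeff_zero_eq_constantCoeff_apply, coeff_map,
      coeff_zero_eq_constantCoeff_apply, hf, map_one]
  · rw [← coeff_zero_eq_constantCoeff_apply, coeff_map,
      coeff_zero_eq_constantCoeff_apply, constantCoeff_logOf hf, map_zero]
  · rw [theta_map, ← map_mul, mul_theta_logOf hf, theta_map]

lemma prod_mul_theta_sum {β : Type} (F : Finset β) (f g : β → PowerSeries A)
    (h : ∀ b ∈ F, f b * theta A (g b) = theta A (f b)) :
    (∏ b ∈ F, f b) * theta A σ(g,F) = theta A (∏ b ∈ F, f b) := by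
  classical
  induction F using Finset.induction_on with
  | empty => simp
  | insert b F hb ih =>
    rw [prod_insert hb, sum_insert hb, map_add, Derivation.leibniz, smul_eq_mul,
      smul_eq_mul, ← ih fun c hc => h c (mem_insert_of_mem hc),
      ← h b (mem_insert_self _ _)]
    ring

end Log

section RayProd

variable {S : Set Ray}

lemma one_add_monomial (d : Ray) : (1 + C d.coeff * X ^ d.wt : PowerSeries ℂ) =
    1 + monomial d.wt d.coeff := by
  congr 1
  ext n
  rw [coeff_C_mul, coeff_X_pow, coeff_monomial]
  split_ifs <;> simp

lemma coeff_prod_of_le {β : Type} {F G : Finset β} {o : β → ℕ} {c : β → ℂ} (hGF : G ⊆ F) {n : ℕ}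
    (h : ∀ b ∈ F, b ∉ G → n < o b) :
    coeff n (∏ b ∈ F, (1 + monomial (o b) (c b))) =
      coeff n (∏ b ∈ G, (1 + monomial (o b) (c b))) := by
  classical
  rw [← prod_sdiff hGF]
  have h1 : X ^ (n + 1) ∣
      (∏ b ∈ F \ G, (1 + monomial (o b) (c b))) - (1 : PowerSeries ℂ) := by
    have : ∀ E : Finset β, E ⊆ F \ G → X ^ (n + 1) ∣
      (∏ b ∈ E, (1 + monomial (o b) (c b))) - (1 : PowerSeries ℂ) := by
      intro E
      induction E using Finset.induction_on with
      | empty => intro _; simp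
      | insert b E hb ih =>
        intro hE
        rw [prod_insert hb, add_mul, one_mul, add_sub_right_comm]
        refine dvd_add (ih fun x hx => hE (mem_insert_of_mem hx)) (Dvd.dvd.mul_right ?_ _)
        have hb' := mem_sdiff.1 (hE (mem_insert_self b E))
        have hn := h b hb'.1 hb'.2
        rw [X_pow_dvd_iff]
        intro m hm
        rw [coeff_monomial, if_neg (by omega)]
    exact this _ subset_rfl
  have h2 : ∏ b ∈ F \ G, (1 + monomial (o b) (c b)) =
    (∏ b ∈ F \ G, (1 + monomial (o b) (c b)) - 1) + (1 : PowerSeries ℂ) := by ring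
  rw [h2, add_mul, one_mul, map_add]
  have h3 := (X_pow_dvd_iff.1 (Dvd.dvd.mul_right h1
    (∏ b ∈ G, (1 + monomial (o b) (c b))))) n (Nat.lt_succ_self n)
  rw [h3, zero_add]

/-- The sum of the logarithms of the functions of the rays. -/
def rayLogSeries (S : Set Ray) : PowerSeries ℂ :=
  mk fun n => ∑ᶠ d ∈ {d | d ∈ S ∧ d.wt ≤ n}, coeff n (logMono d.wt d.coeff)

lemma constantCoeff_rayProd (hw : ∀ d ∈ S, 0 < d.wt) :
    constantCoeff (rayProd S) = 1 := by
  rw [← coeff_zero_eq_constantCoeff_apply, rayProd, coeff_mk]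
  have : {d | d ∈ S ∧ d.wt ≤ 0} = ∅ := by
    ext d
    simp only [Set.mem_ofPred_eq, Set.mem_empty_iff_false, iff_false, not_and]
    intro h; have := hw d h; omega
  rw [this, finprod_mem_empty]
  simp

lemma coeff_logMono_of_lt {o n : ℕ} (c : ℂ) (h : n < o) : coeff n (logMono o c) = 0 := by
  rw [logMono, coeff_mk]
  split_ifs with h1
  · rw [Nat.div_eq_of_lt h]; simp
  · rfl

lemma logOf_rayProd (hw : ∀ d ∈ S, 0 < d.wt) (hfin : ∀ N, {d | d ∈ S ∧ d.wt ≤ N}.Finite) :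
    logOf (rayProd S) = rayLogSeries S := by
  classical
  set P : ℕ → PowerSeries ℂ := fun N => ∏ d ∈ (hfin N).toFinset, (1 + monomial d.wt d.coeff)
    with hP
  set L : ℕ → PowerSeries ℂ := fun N => ∑ d ∈ (hfin N).toFinset, logMono d.wt d.coeff with hL
  have hsub : ∀ {n N : ℕ}, n ≤ N → (hfin n).toFinset ⊆ (hfin N).toFinset := by
    intro n N h d hd
    simp only [Set.Finite.mem_toFinset] at hd ⊢
    exact ⟨hd.1, hd.2.trans h⟩
  have hlt : ∀ {n N : ℕ}, ∀ d ∈ (hfin N).toFinset, d ∉ (hfin n).toFinset → n < d.wt := by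
    intro n N d hd hd'
    simp only [Set.Finite.mem_toFinset] at hd hd'
    by_contra h
    exact hd' ⟨hd.1, by omega⟩
  have hPc : ∀ n N, n ≤ N → coeff n (rayProd S) = coeff n (P N) := by
    intro n N h
    rw [rayProd, coeff_mk, hP, coeff_prod_of_le (hsub h) hlt,
      finprod_mem_eq_finite_toFinset_prod _ (hfin n)]
    simp only [one_add_monomial]
  have hLc : ∀ n N, n ≤ N → coeff n (rayLogSeries S) = coeff n (L N) := by
    intro n N h
    rw [rayLogSeries, coeff_mk, hL, map_sum,
      finsum_mem_eq_finite_toFinset_sum _ (hfin n)]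
    refine sum_subset (hsub h) fun d hd hd' => ?_
    exact coeff_logMono_of_lt _ (hlt d hd hd')
  symm
  refine eq_logOf (constantCoeff_rayProd hw) ?_ ?_
  · rw [← coeff_zero_eq_constantCoeff_apply, hLc 0 0 le_rfl, hL, map_sum]
    refine sum_eq_zero fun d hd => coeff_logMono_of_lt _ (hw d ?_)
    simp only [Set.Finite.mem_toFinset] at hd
    exact hd.1
  · ext n
    have h1 : P n * theta ℂ (L n) = theta ℂ (P n) := prod_mul_theta_sum _ _ _ fun d hd => by
      simp only [Set.Finite.mem_toFinset] at hd
      exact mul_theta_logMono (hw d hd.1) _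
    have h2 := congrArg (coeff n) h1
    rw [coeff_mul, coeff_theta] at h2 ⊢
    rw [hPc n n le_rfl, ← h2]
    refine sum_congr rfl fun ij hij => ?_
    rw [HasAntidiagonal.mem_antidiagonal] at hij
    rw [coeff_theta, coeff_theta, hPc ij.1 n (by omega), hLc ij.2 n (by omega)]

end RayProd

end

section

open Finset PowerSeries Nat

section

variable {τ : ZMod 3 → ℝ}

lemma finsum_mem_apply {X V : Type*} {f : X → V →₀ ℂ} {A : Set X} (F : Finset X)
    (h : ∀ x ∈ A, f x ≠ 0 → x ∈ F) (v : V) [DecidablePred (· ∈ A)] :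
    (∑ᶠ x ∈ A, f x) v = ∑ x ∈ F with x ∈ A, f x v := by
  rw [finsum_mem_eq_sum_filter' F h, Finsupp.finsetSum_apply]

/-- The trees that start in `Q` with outgoing edge of direction `v`. -/
def treesIn (τ : ZMod 3 → ℝ) (Q : Set ℝ²) (v : ℤ²) : Set PTree :=
  {T | (∃ q ∈ Q, T.At τ q) ∧ T.vec = v}

/-- The rays of the limit diagram with base in `Q` and direction `m`. -/
def raysIn (τ : ZMod 3 → ℝ) (Q : Set ℝ²) (m : ℤ²) : Set Ray :=
  {d | d ∈ diagramInfty τ ∧ d.base ∈ Q ∧ d.dir = m}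

lemma PTree.exists_wt {m : ℤ²} (hm : IsPrim m) {v : ℤ²} {w i : ℕ} (hw : 0 < w)
    (h : (w : ℤ) • m = i • v) : ∃ w' : ℕ, 0 < w' ∧ w = i * w' ∧ v = (w' : ℤ) • m := by
  have hv : v ≠ 0 := by
    rintro rfl
    rw [smul_zero, smul_eq_zero] at h
    exact h.elim (mod_cast hw.ne') hm.ne_zero
  obtain ⟨a, m', ha, hm', rfl⟩ := exists_prim hv
  rw [← cast_smul_eq_nsmul ℤ, smul_smul, ← cast_mul] at h
  obtain ⟨h1, rfl⟩ := eq_of_prim hm hm' hw h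
  exact ⟨a, ha, h1, rfl⟩

lemma finite_raysIn (hτ : Interior τ) {Q : Set ℝ²} {m : ℤ²}
    (hm : IsPrim m) (hfin : ∀ w : ℕ, (treesIn τ Q ((w : ℤ) • m)).Finite) (N : ℕ) :
    {d | d ∈ raysIn τ Q m ∧ d.wt ≤ N}.Finite := by
  classical
  have hF : (⋃ w ∈ Set.Iic N, treesIn τ Q ((w : ℤ) • m)).Finite :=
    (Set.finite_Iic N).biUnion fun w _ => hfin w
  have key : ∀ d ∈ raysIn τ Q m, d.wt ≤ N → ∃ T ∈ hF.toFinset, ∃ i ≤ N, T.At τ d.base ∧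
      d.ord = i * T.lw := by
    rintro d ⟨hd, hq, rfl⟩ hN
    obtain ⟨hd', hg⟩ := good_of_mem hτ hd
    obtain ⟨T, i, hi, hT, h1, h2⟩ := hg.tree d hd'
    obtain ⟨w', hw', h3, h4⟩ := PTree.exists_wt (hg.prim d hd') (hg.wt_pos d hd') h1
    have h5 : w' ≤ d.wt := h3 ▸ Nat.le_mul_of_pos_left _ hi
    have h6 : i ≤ d.wt := h3 ▸ Nat.le_mul_of_pos_right _ hw'
    refine ⟨T, ?_, i, h6.trans hN, hT, h2⟩
    rw [Set.Finite.mem_toFinset, Set.mem_iUnion₂]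
    exact ⟨w', h5.trans hN, ⟨_, hq, hT⟩, h4⟩
  set J := N * ∑ T ∈ hF.toFinset, T.lw
  choose! b hb using fun (T : PTree) (hT : ∃ q, T.At τ q) => hT
  have hsub : {d | d ∈ raysIn τ Q m ∧ d.wt ≤ N} ⊆
      ⋃ q ∈ (hF.toFinset.image b : Finset ℝ²), {d | d ∈ diagram τ J ∧ d.base = q ∧ d.ord ≤ J} := by
    rintro d ⟨hd, hN⟩
    obtain ⟨T, hT, i, hi, h1, h2⟩ := key d hd hN
    have h3 : d.ord ≤ J := by
      rw [h2]
      exact Nat.mul_le_mul hi (single_le_sum (f := PTree.lw) (fun _ _ => Nat.zero_le _) hT)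
    rw [Set.mem_iUnion₂]
    exact ⟨b T, mem_image_of_mem _ hT, mem_diagram_of_ord_le hd.1 h3,
      h1.unique (hb T ⟨_, h1⟩), h3⟩
  refine Set.Finite.subset ?_ hsub
  exact (finite_toSet _).biUnion fun q _ => (good_diagram hτ J).finite_base hτ q J

lemma Ray.coeff_logMono (d : Ray) (hm : IsPrim d.dir) (ho : 0 < d.ord) (hw : 0 < d.wt) {w J : ℕ}
    (hw0 : 0 < w) (hJ : w * d.ord < J) : PowerSeries.coeff w (logMono d.wt d.coeff) =
      w * ∑ j ∈ range J, d.log j ((w : ℤ) • d.dir) := by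
  have hlog : ∀ j, d.log j ((w : ℤ) • d.dir) ≠ 0 → d.ord ∣ j ∧ d.wt * (j / d.ord) = w := by
    intro j h
    refine ⟨(Ray.log_ne_zero fun h0 => h (by rw [h0]; rfl)).1, ?_⟩
    have h1 : d.logVec j = (w : ℤ) • d.dir := by by_contra h2; exact h (Finsupp.single_eq_of_ne' h2)
    rw [Ray.logVec, ← cast_smul_eq_nsmul ℤ] at h1
    exact (eq_of_prim hm hm hw0 h1.symm).1.symm
  rw [logMono, PowerSeries.coeff_mk]
  split_ifs with h
  · obtain ⟨i, rfl⟩ := h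
    have hi : 0 < i := Nat.pos_of_mul_pos_left hw0
    rw [sum_eq_single (d.ord * i)]
    · rw [Ray.log, Ray.logVec, Ray.logCoeff, if_pos (dvd_mul_right _ _), Nat.mul_div_cancel_left _ ho,
        Nat.mul_div_cancel_left _ hw, ← Nat.cast_smul_eq_nsmul ℤ, Finsupp.single_eq_same, smul_eq_mul]
      have h1 : (i : ℂ) ≠ 0 := mod_cast hi.ne'
      have h2 : (d.wt : ℂ) ≠ 0 := mod_cast hw.ne'
      push_cast
      field_simp
    · intro j _ hj
      by_contra h0
      obtain ⟨⟨i', rfl⟩, h1⟩ := hlog j h0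
      rw [Nat.mul_div_cancel_left _ ho] at h1
      exact hj (by rw [Nat.eq_of_mul_eq_mul_left hw h1])
    · intro h1
      refine absurd (mem_range.2 (lt_of_le_of_lt ?_ hJ)) h1
      calc d.ord * i = i * d.ord := mul_comm _ _
        _ ≤ d.wt * i * d.ord := Nat.mul_le_mul_right _ (Nat.le_mul_of_pos_left _ hw)
  · rw [sum_eq_zero, mul_zero]
    intro j _
    by_contra h0
    exact h ⟨_, (hlog j h0).2.symm⟩

lemma coeff_rayLogSeries (hτ : Interior τ) {Q : Set ℝ²} {m : ℤ²}
    (hm : IsPrim m) (hfin : ∀ w : ℕ, (treesIn τ Q ((w : ℤ) • m)).Finite) {w : ℕ} (hw : 0 < w) :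
    coeff w (rayLogSeries (raysIn τ Q m)) =
      w * ∑ᶠ T ∈ treesIn τ Q ((w : ℤ) • m), (T.wtT : ℂ) := by
  classical
  set F := (finite_raysIn hτ hm hfin w).toFinset with hF
  set G := (hfin w).toFinset with hG
  have hmemF : ∀ {d}, d ∈ F ↔ d ∈ raysIn τ Q m ∧ d.wt ≤ w := fun {d} => by
    rw [hF, Set.Finite.mem_toFinset]; rfl
  have hmemG : ∀ {T}, T ∈ G ↔ T ∈ treesIn τ Q ((w : ℤ) • m) := fun {d} => by
    rw [hG, Set.Finite.mem_toFinset]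
  choose! b hb using fun (T : PTree) (hT : ∃ q, T.At τ q) => hT
  set J := w * ∑ d ∈ F, d.ord + ∑ T ∈ G, T.lw + 1
  set R : Finset ℝ² := F.image Ray.base ∪ G.image b
  have hbG : ∀ T ∈ G, T.At τ (b T) ∧ b T ∈ Q := by
    intro T hT
    obtain ⟨⟨q, hq, h1⟩, -⟩ := hmemG.1 hT
    have h2 := hb T ⟨q, h1⟩
    exact ⟨h2, h1.unique h2 ▸ hq⟩
  have hRQ : ∀ q ∈ R, q ∈ Q := by
    intro q hq
    rcases mem_union.1 hq with h | h
    · obtain ⟨d, hd, rfl⟩ := mem_image.1 h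
      exact (hmemF.1 hd).1.2.1
    · obtain ⟨T, hT, rfl⟩ := mem_image.1 h
      exact (hbG T hT).2
  have hA : ∀ q ∈ R, ∀ j, baseLog (diagramInfty τ) q j ((w : ℤ) • m) =
      ∑ d ∈ F with d.base = q, d.log j ((w : ℤ) • m) := by
    intro q hq j
    rw [baseLog, finsum_mem_apply (((good_diagram hτ j).finite_base hτ q j).toFinset ∪ F)]
    · symm
      refine sum_subset ?_ ?_
      · intro d hd
        rw [mem_filter] at hd
        rw [mem_filter, mem_union]
        exact ⟨.inr hd.1, (hmemF.1 hd.1).1.1, hd.2⟩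
      · intro d hd hd'
        by_contra h0
        rw [mem_filter] at hd
        obtain ⟨-, h1, h2⟩ := hd
        obtain ⟨hd1, hg⟩ := good_of_mem hτ h1
        have h3 : d.logVec j = (w : ℤ) • m := by
          by_contra h2; exact h0 (Finsupp.single_eq_of_ne' h2)
        have h4 := Ray.log_ne_zero (d := d) (j := j) fun h => h0 (by rw [h]; rfl)
        rw [Ray.logVec, ← cast_smul_eq_nsmul ℤ] at h3
        obtain ⟨h5, h6⟩ := eq_of_prim hm (hg.prim d hd1) hw h3.symm
        refine hd' (mem_filter.2 ⟨hmemF.2 ⟨⟨h1, h2 ▸ hRQ q hq, h6.symm⟩, ?_⟩, h2⟩)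
        rw [h5]
        exact Nat.le_mul_of_pos_right _ (Nat.div_pos (Nat.le_of_dvd h4.2 h4.1) (hg.ord_pos d hd1))
    · rintro d ⟨h1, h2⟩ h3
      have h4 := Ray.ord_le_of_log h3
      rw [mem_union, Set.Finite.mem_toFinset]
      exact .inl ⟨mem_diagram_of_ord_le h1 h4, h2, h4⟩
  have hB : ∀ q ∈ R, ∀ j, treeLog τ q j ((w : ℤ) • m) =
      ∑ T ∈ G with b T = q, if T.lw = j then (T.wtT : ℂ) else 0 := by
    intro q hq j
    rw [treeLog, finsum_mem_apply ((PTree.finite_at hτ q j).toFinset ∪ G), ← sum_filter,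
      filter_filter]
    · have hz : ∀ T ∈ G, (Finsupp.single T.vec (T.wtT : ℂ)) ((w : ℤ) • m) = T.wtT := by
        intro T hT
        rw [(hmemG.1 hT).2, Finsupp.single_eq_same]
      symm
      rw [← sum_congr rfl fun T hT => hz T (mem_filter.1 hT).1]
      refine sum_subset ?_ ?_
      · intro T hT
        rw [mem_filter] at hT
        rw [mem_filter, mem_union]
        exact ⟨.inr hT.1, hT.2.1 ▸ (hbG T hT.1).1, hT.2.2⟩
      · intro T hT hT'
        by_contra h0
        rw [mem_filter] at hT
        obtain ⟨-, h1, h2⟩ := hT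
        have h3 : T.vec = (w : ℤ) • m := by by_contra h2; exact h0 (Finsupp.single_eq_of_ne' h2)
        exact hT' (mem_filter.2 ⟨hmemG.2 ⟨⟨q, hRQ q hq, h1⟩, h3⟩, (hb T ⟨q, h1⟩).unique h1, h2⟩)
    · rintro T ⟨h1, h2⟩ -
      rw [mem_union, Set.Finite.mem_toFinset]
      exact .inl ⟨h1, h2.le⟩
  have hlhs : coeff w (rayLogSeries (raysIn τ Q m)) =
      w * ∑ d ∈ F, ∑ j ∈ range J, d.log j ((w : ℤ) • m) := by
    rw [rayLogSeries, coeff_mk,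
      finsum_mem_eq_finite_toFinset_sum _ (finite_raysIn hτ hm hfin w), mul_sum]
    refine sum_congr rfl fun d hd => ?_
    have hd' := hmemF.1 hd
    obtain ⟨hd1, hg⟩ := good_of_mem hτ hd'.1.1
    have h2 : w * d.ord < J := by
      have := single_le_sum (f := Ray.ord) (fun _ _ => zero_le _) hd
      have := mul_le_mul_left w this
      simp only [J]
      omega
    have h1 := d.coeff_logMono (hg.prim d hd1) (hg.ord_pos d hd1) (hg.wt_pos d hd1) hw h2
    rw [hd'.1.2.2] at h1
    exact h1
  rw [hlhs]
  congr 1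
  rw [finsum_mem_eq_finite_toFinset_sum _ (hfin w)]
  rw [← sum_fiberwise_of_maps_to (t := R) (g := Ray.base) fun d hd =>
      mem_union_left _ (mem_image_of_mem _ hd),
    ← sum_fiberwise_of_maps_to (t := R) (g := b) fun d hd =>
      mem_union_right _ (mem_image_of_mem _ hd)]
  refine sum_congr rfl fun q hq => ?_
  rw [sum_comm]
  calc ∑ j ∈ range J, ∑ d ∈ F with d.base = q, d.log j ((w : ℤ) • m)
      = ∑ j ∈ range J, ∑ T ∈ G with b T = q, if T.lw = j then (T.wtT : ℂ) else 0 :=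
        sum_congr rfl fun j _ => by rw [← hA q hq, baseLog_diagramInfty hτ, hB q hq]
    _ = ∑ T ∈ G with b T = q, (T.wtT : ℂ) := by
        rw [sum_comm]
        refine sum_congr rfl fun T hT => ?_
        rw [sum_ite_eq, if_pos]
        have := single_le_sum (f := PTree.lw) (fun _ _ => zero_le _)
          (mem_filter.1 hT).1
        rw [mem_range]
        omega

lemma coeff_zero_rayLogSeries {S : Set Ray} (hw : ∀ d ∈ S, 0 < d.wt) :
    coeff 0 (rayLogSeries S) = 0 := by
  rw [rayLogSeries, coeff_mk]
  refine (finsum_mem_congr rfl fun d hd => ?_).trans (finsum_mem_zero _)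
  exact coeff_logMono_of_lt _ (hw d hd.1)

lemma raysIn_wt_pos (hτ : Interior τ) {Q : Set ℝ²} {m : ℤ²} :
    ∀ d ∈ raysIn τ Q m, 0 < d.wt := fun d hd =>
  (good_of_mem hτ hd.1).2.wt_pos d (good_of_mem hτ hd.1).1

/-- The logarithm of the product of the functions of rays is the sum over the trees. -/
lemma logOf_raysIn (hτ : Interior τ) {Q : Set ℝ²} {m : ℤ²}
    (hm : IsPrim m) (hfin : ∀ w : ℕ, (treesIn τ Q ((w : ℤ) • m)).Finite) :
    logOf (rayProd (raysIn τ Q m)) =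
      mk fun w => w * ∑ᶠ T ∈ treesIn τ Q ((w : ℤ) • m), (T.wtT : ℂ) := by
  rw [logOf_rayProd (raysIn_wt_pos hτ) (finite_raysIn hτ hm hfin)]
  ext w
  rw [coeff_mk]
  rcases Nat.eq_zero_or_pos w with rfl | hw
  · rw [coeff_zero_rayLogSeries (raysIn_wt_pos hτ)]; simp
  · exact coeff_rayLogSeries hτ hm hfin hw

end

end

/-- The powers of the deck transformation. -/
def deckPow (k : ℤ) (q : ℝ²) : ℝ² :=
  (q.1 + 3 * k, q.2 - 9 * k * q.1 - (27 * (k : ℝ) ^ 2 - 9 * k) / 2)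

/-- The linear parts of the deck transformations. -/
def shear (k : ℤ) : ℤ² →+ ℤ² where
  toFun v := (v.1, v.2 - 9 * k * v.1)
  map_zero' := by simp
  map_add' u v := by ext <;> simp; ring

lemma deckPow_one (q : ℝ²) : deckPow 1 q = deck q := by ext <;> simp [deckPow, deck]; ring

lemma deckPow_zero (q : ℝ²) : deckPow 0 q = q := by ext <;> simp [deckPow]

lemma deckPow_add (k l : ℤ) (q : ℝ²) : deckPow (k + l) q = deckPow k (deckPow l q) := by
  ext <;> simp only [deckPow] <;> push_cast <;> ring

lemma deckPow_neg (k : ℤ) (q : ℝ²) : deckPow (-k) (deckPow k q) = q := by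
  rw [← deckPow_add, neg_add_cancel, deckPow_zero]

lemma deckPow_line (k : ℤ) (q : ℝ²) (r : ℝ) (m : ℤ²) :
    deckPow k (q + r • vecR m) = deckPow k q + r • vecR (shear k m) := by
  ext <;> simp [deckPow, vecR, shear] <;> ring

lemma alpha_deckPow (k : ℤ) (q : ℝ²) (v : ℤ²) :
    alpha (dheight (deckPow k q)) (shear k v) = alpha (dheight q) v := by
  simp [alpha, dheight, deckPow, shear]; ring

lemma det2_shear (k : ℤ) (u v : ℤ²) : det2 (shear k u) (shear k v) = det2 u v := by
  simp [det2, shear]; ring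

lemma shear_neg (k : ℤ) (v : ℤ²) : shear (-k) (shear k v) = v := by ext <;> simp [shear]

lemma IsPrim.shear {m : ℤ²} (hm : IsPrim m) (k : ℤ) : IsPrim (shear k m) := by
  rw [IsPrim, ← Int.isCoprime_iff_gcd_eq_one] at hm ⊢
  have := hm.add_mul_left_right (-(9 * k))
  convert! this using 1
  simp [Scat.shear]; ring

lemma singPt_deckPow (τ : ZMod 3 → ℝ) (n k : ℤ) :
    singPt τ (n + 3 * k) = deckPow k (singPt τ n) := by
  have : ((n + 3 * k : ℤ) : ZMod 3) = (n : ZMod 3) := by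
    push_cast
    rw [show (3 : ZMod 3) = 0 from rfl]; ring
  rw [singPt, singPt, this]
  ext <;> simp [deckPow, edgeLine] <;> ring

/-- Deck transformations of trees. -/
def PTree.shift (k : ℤ) : PTree → PTree
  | leg n ε w => leg (n + 3 * k) ε w
  | node j ts => node j fun i => (ts i).shift k

lemma PTree.vec_shift (k : ℤ) : ∀ T : PTree, (T.shift k).vec = Scat.shear k T.vec
  | leg n ε w => by
    simp only [shift, vec, Scat.shear]
    ext <;> simp; ring
  | node j ts => by
    rw [shift, vec, vec, map_sum]
    exact Finset.sum_congr rfl fun i _ => (ts i).vec_shift k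

lemma PTree.At.shift {τ : ZMod 3 → ℝ} (k : ℤ) : ∀ {T : PTree} {p : ℝ²}, T.At τ p →
    (T.shift k).At τ (deckPow k p)
  | leg _ _ _, _, h => ⟨by rw [h.1, singPt_deckPow], h.2⟩
  | node j ts, p, h => by
    obtain ⟨h1, h2, a, b, h3⟩ := h
    refine ⟨h1, fun i => ?_, a, b, ?_⟩
    · obtain ⟨q, s, hs, hq, rfl⟩ := h2 i
      exact ⟨_, s, hs, hq.shift k, by rw [deckPow_line, vec_shift]⟩
    · rwa [vec_shift, vec_shift, det2_shear]

lemma edgeLine_sub (m n : ℤ) (x : ℝ) :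
    edgeLine m x - edgeLine n x = 3 * (m - n) * ((m + n + 1) / 2 - x) := by
  simp only [edgeLine]; ring

lemma edgeLine_le {n : ℤ} {x : ℝ} (h1 : n ≤ x) (h2 : x ≤ n + 1) (m : ℤ) :
    edgeLine n x ≤ edgeLine m x := by
  rw [← sub_nonneg, edgeLine_sub]
  rcases lt_trichotomy m n with h | rfl | h
  · have : (m : ℝ) + 1 ≤ n := mod_cast h
    nlinarith
  · simp
  · have : (n : ℝ) + 1 ≤ m := mod_cast h
    nlinarith

lemma mem_outer_of_le {n : ℤ} {q : ℝ²} (h : edgeLine n q.1 ≤ q.2) : q ∈ outer := by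
  have h1 : ∀ ε : ℝ, 0 < ε → q + (0, ε) ∈ unfoldingᶜ := fun ε hε hu => by
    have := hu n
    simp only [Prod.fst_add, Prod.snd_add, add_zero] at this
    linarith
  have h2 : Filter.Tendsto (fun ε : ℝ => q + (0, ε)) (𝓝[>] 0) (𝓝 q) := by
    have : Continuous fun ε : ℝ => q + (0, ε) := by fun_prop
    have h3 := this.tendsto 0
    rw [show q + ((0 : ℝ), (0 : ℝ)) = q from add_zero q] at h3
    exact h3.mono_left nhdsWithin_le_nhds
  exact mem_closure_of_tendsto h2 (by filter_upwards [self_mem_nhdsWithin] with ε hε using h1 ε hε)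

lemma notMem_outer {n : ℤ} {q : ℝ²} (h1 : (n : ℝ) - 1 < q.1) (h2 : q.1 < n + 1)
    (h3 : q.2 < edgeLine (n - 1) q.1) (h4 : q.2 < edgeLine n q.1) : q ∉ outer := by
  set U : Set ℝ² := {q | (n : ℝ) - 1 < q.1 ∧ q.1 < n + 1 ∧ q.2 < edgeLine (n - 1) q.1 ∧
    q.2 < edgeLine n q.1}
  have hc : ∀ n : ℤ, Continuous fun q : ℝ² => edgeLine n q.1 := fun n => by
    unfold edgeLine; fun_prop
  have hU : IsOpen U := by
    refine (isOpen_lt continuous_const continuous_fst).inter ((isOpen_lt continuous_fst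
      continuous_const).inter ((isOpen_lt continuous_snd (hc _)).inter (isOpen_lt continuous_snd (hc _))))
  have hd : Disjoint U unfoldingᶜ := by
    rw [Set.disjoint_compl_right_iff_subset]
    rintro x ⟨a, b, c, d⟩ m
    by_cases hx : x.1 ≤ n
    · refine c.le.trans (edgeLine_le ?_ ?_ m) <;> push_cast <;> linarith
    · exact d.le.trans (edgeLine_le (not_le.1 hx).le b.le m)
  exact fun h => Set.disjoint_left.1 (hd.closure_right hU) ⟨h1, h2, h3, h4⟩ h

lemma mem_outer {q : ℝ²} : q ∈ outer ↔ ∃ n : ℤ, edgeLine n q.1 ≤ q.2 := by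
  refine ⟨fun h => ?_, fun ⟨n, hn⟩ => mem_outer_of_le hn⟩
  by_contra! h0
  have h1 := Int.floor_le q.1
  have h2 := Int.lt_floor_add_one q.1
  exact notMem_outer (n := ⌊q.1⌋) (by linarith) h2 (h0 _) (h0 _) h

lemma mem_interior_outer {q : ℝ²} {n : ℤ} (h : edgeLine n q.1 < q.2) : q ∈ interior outer :=
  mem_interior.2 ⟨{q | edgeLine n q.1 < q.2}, fun _ hx => mem_outer_of_le (le_of_lt hx),
    isOpen_lt (by unfold edgeLine; fun_prop) continuous_snd, h⟩

lemma mem_outer_of_height {q : ℝ²} (h : 0 ≤ height q) : q ∈ outer := by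
  refine mem_outer_of_le (n := ⌊q.1⌋) ?_
  have h1 := height_edgeLine ⌊q.1⌋ q.1
  simp only [height] at h h1
  have h2 := Int.floor_le q.1
  have h3 := Int.lt_floor_add_one q.1
  nlinarith

lemma deckPow_mem_outer (k : ℤ) {q : ℝ²} (h : q ∈ outer) : deckPow k q ∈ outer := by
  obtain ⟨n, hn⟩ := mem_outer.1 h
  refine mem_outer_of_le (n := n + 3 * k) ?_
  simp only [edgeLine, deckPow] at hn ⊢
  push_cast
  nlinarith

lemma edge_pt (n : ℤ) (s : ℝ) : (1 - s) • vtx n + s • vtx (n + 1) = (n + s, edgeLine n (n + s)) := by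
  ext <;> simp [vtx, edgeLine] <;> ring

lemma edge_pt_deckPow (n k : ℤ) (s : ℝ) :
    ((((n + 3 * k : ℤ) : ℝ) + s, edgeLine (n + 3 * k) (((n + 3 * k : ℤ) : ℝ) + s)) : ℝ²) =
      deckPow k (n + s, edgeLine n (n + s)) := by ext <;> simp [deckPow, edgeLine] <;> ring

lemma exists_eq_add_of_cast_eq {n n' : ℤ} (h : (n : ZMod 3) = n') : ∃ k, n' = n + 3 * k := by
  obtain ⟨k, hk⟩ := (ZMod.intCast_eq_intCast_iff_dvd_sub n n' 3).1 h
  exact ⟨k, by push_cast at hk; linarith⟩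

lemma edgeBary_inj {n n' : ℤ} {s s' : ℝ} (h : edgeBary (n : ZMod 3) s = edgeBary (n' : ZMod 3) s') :
    ∃ k, ((n' + s', edgeLine n' (n' + s')) : ℝ²) = deckPow k (n + s, edgeLine n (n + s)) := by
  have h0 : ∀ i : ZMod 3, i + 1 ≠ i ∧ i + 1 + 1 ≠ i ∧ i + 1 + 1 ≠ i + 1 := by decide
  have key : ∀ {n n' : ℤ} {s s' : ℝ}, edgeBary (n : ZMod 3) s = edgeBary (n' : ZMod 3) s' →
      (n' : ZMod 3) = n + 1 →
      ∃ k, ((n' + s', edgeLine n' (n' + s')) : ℝ²) = deckPow k (n + s, edgeLine n (n + s)) := by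
    intro n n' s s' h h1
    obtain ⟨k, rfl⟩ := exists_eq_add_of_cast_eq (n := n + 1) (n' := n') (by push_cast; exact h1.symm)
    rw [h1] at h
    have h2 := congrFun h (n : ZMod 3)
    have h3 := congrFun h (n + 1 + 1 : ZMod 3)
    simp only [edgeBary, Pi.add_apply, Pi.single_apply, (h0 _).1.symm, (h0 _).2.1,
      (h0 _).2.1.symm, (h0 _).1, if_true, if_false] at h2 h3
    obtain rfl : s = 1 := by linarith
    obtain rfl : s' = 0 := by linarith
    refine ⟨k, ?_⟩
    rw [edge_pt_deckPow (n + 1) k 0]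
    congr 1
    ext <;> simp [edgeLine]; ring
  have h1 : (n' : ZMod 3) = n ∨ (n' : ZMod 3) = n + 1 ∨ (n : ZMod 3) = n' + 1 := by
    generalize (n' : ZMod 3) = a; generalize (n : ZMod 3) = b; decide +revert
  rcases h1 with h1 | h1 | h1
  · obtain ⟨k, rfl⟩ := exists_eq_add_of_cast_eq h1.symm
    rw [h1] at h
    have h2 := congrFun h (n : ZMod 3)
    simp [edgeBary, (h0 _).1.symm] at h2
    subst h2
    exact ⟨k, edge_pt_deckPow n k _⟩
  · exact key h h1
  · obtain ⟨k, hk⟩ := key h.symm h1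
    exact ⟨-k, by rw [hk, deckPow_neg]⟩

/-- An invariant that separates the points of the affine manifold. -/
def fiberB : B → Set ℝ² :=
  Quot.lift (Sum.elim (fun q => {r | ∃ k, r = deckPow k q.1})
    fun l => {r | ∃ (n : ℤ) (s : ℝ), l.1 = edgeBary n s ∧ r = (n + s, edgeLine n (n + s))}) (by
    rintro _ _ (⟨q, r, h⟩ | ⟨n, s, hs, q, l, hq, hl⟩)
    · ext x
      simp only [Sum.elim_inl, h, ← deckPow_one, ← deckPow_add]
      exact ⟨fun ⟨k, hk⟩ => ⟨k - 1, by rw [hk, sub_add_cancel]⟩, fun ⟨k, hk⟩ => ⟨k + 1, hk⟩⟩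
    · ext x
      simp only [Sum.elim_inl, Sum.elim_inr, hq, hl, edge_pt]
      constructor
      · rintro ⟨k, rfl⟩
        refine ⟨n + 3 * k, s, ?_, (edge_pt_deckPow n k s).symm⟩
        congr 1
        push_cast
        rw [show (3 : ZMod 3) = 0 from rfl]; ring
      · rintro ⟨n', s', h1, rfl⟩
        exact edgeBary_inj h1)

lemma ofOuter_eq_iff {q r : outer} : ofOuter q = ofOuter r ↔ ∃ k, r.1 = deckPow k q.1 := by
  constructor
  · intro h
    have h1 : r.1 ∈ fiberB (ofOuter r) := ⟨0, (deckPow_zero _).symm⟩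
    rw [← h] at h1
    exact h1
  · rintro ⟨k, hk⟩
    have hstep : ∀ k : ℤ, ofOuter ⟨_, deckPow_mem_outer (k + 1) q.2⟩ = ofOuter ⟨_, deckPow_mem_outer k q.2⟩ := by
      intro k
      refine (Quot.sound (Glue.shift _ _ ?_)).symm
      change deckPow (k + 1) q.1 = deck (deckPow k q.1)
      rw [add_comm, deckPow_add, deckPow_one]
    have h1 : ∀ k : ℤ, ofOuter ⟨_, deckPow_mem_outer k q.2⟩ = ofOuter q := by
      intro k
      induction k with
      | zero => congr 1; exact Subtype.ext (deckPow_zero _)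
      | succ k ih => rw [hstep, ih]
      | pred k ih => 
        have := hstep (-(k : ℤ) - 1)
        simp only [sub_add_cancel] at this
        rw [← this, ih]
    rw [← h1 k]
    congr 1
    exact Subtype.ext hk.symm

lemma ofOuter_ne_ofTri {q : outer} {l : stdSimplex ℝ (ZMod 3)} (hl : ∀ i, 0 < l.1 i) :
    ofOuter q ≠ ofTri l := by
  intro h
  have h1 : q.1 ∈ fiberB (ofOuter q) := ⟨0, (deckPow_zero _).symm⟩
  rw [h] at h1
  obtain ⟨n, s, h2, -⟩ := h1
  have h3 := hl (n + 1 + 1)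
  have h0 : ∀ i : ZMod 3, i + 1 + 1 ≠ i ∧ i + 1 + 1 ≠ i + 1 := by decide
  rw [h2] at h3
  simp [edgeBary, h0] at h3

lemma ofTri_edgeBary {n : ℤ} {s : ℝ} (hs : s ∈ Set.Icc (0 : ℝ) 1) {l : stdSimplex ℝ (ZMod 3)}
    (hl : l.1 = edgeBary n s) :
    ofTri l = ofOuter ⟨(n + s, edgeLine n (n + s)), mem_outer_of_le (n := n) le_rfl⟩ :=
  (Quot.sound (Glue.edge n s hs _ l (edge_pt n s).symm hl)).symm

section

open Finset Prod

section Shear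

variable {ι : Type} {u : ι → ℤ²} {c : ι → ℝ}

lemma det2_vecR_shear (k : ℤ) (v : ℤ²) (P : ℝ²) :
    det2 (vecR (shear k v)) (P.1, P.2 - 9 * k * P.1) = det2 (vecR v) P := by
  simp [det2, vecR, shear]; ring

lemma CTree.vec_shear (k : ℤ) : ∀ T : CTree ι, T.vec (shear k ∘ u) = shear k (T.vec u)
  | .leaf _ => rfl
  | .node l r => by rw [vec, vec, l.vec_shear, r.vec_shear, map_add]

lemma CTree.mult_shear (k : ℤ) : ∀ T : CTree ι, T.mult (shear k ∘ u) = T.mult u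
  | .leaf _ => rfl
  | .node l r => by rw [mult, mult, l.mult_shear, r.mult_shear, vec_shear, vec_shear, det2_shear]

lemma CTree.Through.shear (k : ℤ) : ∀ {T : CTree ι} {P : ℝ²}, T.Through u c P →
    T.Through (Scat.shear k ∘ u) c (P.1, P.2 - 9 * k * P.1)
  | .leaf i, P, h => (det2_vecR_shear k _ P).trans h
  | .node l r, P, ⟨h, Q, s, h1, h2, h3, h4⟩ => by
    refine ⟨by rwa [vec_shear, vec_shear, det2_shear], _, s, h1.shear k, h2.shear k, h3, ?_⟩
    rw [vec_shear, vec_shear, ← map_add, h4]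
    ext <;> simp [vecR, Scat.shear]; ring

lemma shear_neg_comp (k : ℤ) : shear (-k) ∘ (shear k ∘ u) = u := funext fun _ => shear_neg k _

lemma curveCount_shear (k : ℤ) (I : Finset ι) : curveCount I (shear k ∘ u) c = curveCount I u c := by
  have : ∀ T : CTree ι, (∃ P, T.Through (shear k ∘ u) c P) ↔ ∃ P, T.Through u c P := fun T =>
    ⟨fun ⟨P, hP⟩ => ⟨_, shear_neg_comp (u := u) k ▸ hP.shear (-k)⟩, fun ⟨P, hP⟩ => ⟨_, hP.shear k⟩⟩
  simp only [curveCount, this, CTree.mult_shear]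

lemma GenericDispl.shear (k : ℤ) {I : Finset ι} (h : GenericDispl I u c) :
    GenericDispl I (Scat.shear k ∘ u) c := by
  have hs : ∀ J : Finset ι, ∑ i ∈ J, (Scat.shear k ∘ u) i = Scat.shear k σ(u,J) := fun J =>
    (map_sum _ _ _).symm
  have hP : ∀ v P, det2 (vecR (Scat.shear k v)) P = det2 (vecR v) (P.1, P.2 + 9 * k * P.1) := by
    intro v P
    simpa using det2_vecR_shear k v (P.1, P.2 + 9 * k * P.1)
  intro J K L hJ hK hL h1 h2 h3 h4 h5 h6 h7 P h8 h9
  simp only [hs, hP, det2_shear] at h7 h8 h9 ⊢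
  exact h J K L hJ hK hL h1 h2 h3 h4 h5 h6 h7 _ h8 h9

lemma Nm_shear (k : ℤ) (I : Finset ι) : Nm I (shear k ∘ u) = Nm I u := by
  unfold Nm
  congr 1
  ext N
  simp only [curveCount_shear]
  exact ⟨fun ⟨c, h, h'⟩ => ⟨c, shear_neg_comp (u := u) k ▸ h.shear (-k), h'⟩,
    fun ⟨c, h, h'⟩ => ⟨c, h.shear k, h'⟩⟩

end Shear

/-- The point of the affine manifold below a point of the region above the unfolding. -/
def outPt (q : ℝ²) : B := by
  classical
  exact if h : q ∈ outer then ofOuter ⟨q, h⟩ else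
    ofOuter ⟨(0, edgeLine 0 0), mem_outer_of_le (n := 0) le_rfl⟩

lemma outPt_eq {q : ℝ²} (h : q ∈ outer) : outPt q = ofOuter ⟨q, h⟩ := dif_pos h

lemma outPt_eq_iff {q r : ℝ²} (hq : q ∈ outer) (hr : r ∈ outer) :
    outPt q = outPt r ↔ ∃ k, r = deckPow k q := by rw [outPt_eq hq, outPt_eq hr, ofOuter_eq_iff]

lemma outPt_deckPow (k : ℤ) {q : ℝ²} (hq : q ∈ outer) : outPt (deckPow k q) = outPt q :=
  ((outPt_eq_iff hq (deckPow_mem_outer k hq)).2 ⟨k, rfl⟩).symm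

lemma affine_match {x y : ℝ²} {m m' : ℤ²} {a b : ℝ} (hab : a < b)
    (h : ∀ r ∈ Set.Ioo a b, ∃ k, y + r • vecR m' = deckPow k (x + r • vecR m)) :
    ∃ k, m' = shear k m ∧ y = deckPow k x := by
  have hD : 0 < |(m'.1 : ℝ) - m.1| + 1 := by positivity
  set η : ℝ := min ((b - a) / 4) (1 / (|(m'.1 : ℝ) - m.1| + 1))
  have hη : 0 < η := lt_min (by linarith) (by positivity)
  have hη1 : η ≤ (b - a) / 4 := min_le_left _ _
  have hη2 : |(m'.1 : ℝ) - m.1| * η < 1 := by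
    have : η ≤ 1 / (|(m'.1 : ℝ) - m.1| + 1) := min_le_right _ _
    rw [le_div_iff₀ hD] at this
    nlinarith
  obtain ⟨k, hk⟩ := h ((a + b) / 2) ⟨by linarith, by linarith⟩
  obtain ⟨k', hk'⟩ := h ((a + b) / 2 + η) ⟨by linarith, by linarith⟩
  have e1 := congrArg fst hk
  have e2 := congrArg snd hk
  have e1' := congrArg fst hk'
  have e2' := congrArg snd hk'
  simp only [deckPow, vecR, fst_add, snd_add, smul_fst, smul_snd,
    smul_eq_mul] at e1 e2 e1' e2'
  have hd : ((m'.1 : ℝ) - m.1) * η = 3 * ((k' : ℝ) - k) := by linarith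
  have hkk : k' = k := by
    have h1 : |3 * ((k' : ℝ) - k)| < 1 := by rw [← hd, abs_mul, abs_of_pos hη]; exact hη2
    have h2 : |3 * (k' - k)| < 1 := mod_cast h1
    have := abs_lt.1 h2
    omega
  subst hkk
  have hm1 : (m'.1 : ℝ) - m.1 = 0 := by
    have : ((m'.1 : ℝ) - m.1) * η = 0 := by rw [hd]; ring
    exact (mul_eq_zero.1 this).resolve_right hη.ne'
  have hm2 : (m'.2 : ℝ) - (m.2 - 9 * k' * m.1) = 0 := by
    have : ((m'.2 : ℝ) - (m.2 - 9 * k' * m.1)) * η = 0 := by linarith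
    exact (mul_eq_zero.1 this).resolve_right hη.ne'
  have h1 : m' = shear k' m := by
    refine Prod.ext ?_ ?_
    · exact_mod_cast sub_eq_zero.1 hm1
    · exact_mod_cast sub_eq_zero.1 hm2
  refine ⟨k', h1, ?_⟩
  rw [deckPow_line, h1] at hk
  exact add_right_cancel hk

variable {τ : ZMod 3 → ℝ}

lemma chart_outer {κ : Set ((ℝ²) × B)} (hκ : κ ∈ charts τ) {y z : ℝ²} (hz : z ∈ outer)
    (h : (y, outPt z) ∈ κ) : ∃ k, y = deckPow k z := by
  rw [outPt_eq hz] at h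
  have key : ∀ hy : y ∈ outer, ofOuter ⟨z, hz⟩ = ofOuter ⟨y, hy⟩ → ∃ k, y = deckPow k z :=
    fun hy h => ofOuter_eq_iff.1 h
  rcases hκ with (rfl | rfl) | ⟨n, rfl⟩
  · obtain ⟨hy, -, h⟩ := h
    exact key hy h
  · obtain ⟨l, hl, -, h⟩ := h
    exact absurd h (ofOuter_ne_ofTri hl)
  · rcases h with ⟨hy, -, -, h⟩ | ⟨l, hl, -, h⟩
    · exact key hy h
    · exact absurd h (ofOuter_ne_ofTri hl)

lemma star_notMem_outer {n : ℤ} {l : stdSimplex ℝ (ZMod 3)} (hl : ∀ i, 0 < l.1 i) :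
    l.1 ((n - 1 : ℤ) : ZMod 3) • vtx (n - 1) + l.1 ((n : ℤ) : ZMod 3) • vtx n
      + l.1 ((n + 1 : ℤ) : ZMod 3) • vtx (n + 1) ∉ outer := by
  have h1 := hl ((n - 1 : ℤ) : ZMod 3)
  have h2 := hl ((n : ℤ) : ZMod 3)
  have h3 := hl ((n + 1 : ℤ) : ZMod 3)
  have h4 : l.1 ((n - 1 : ℤ) : ZMod 3) + l.1 ((n : ℤ) : ZMod 3) + l.1 ((n + 1 : ℤ) : ZMod 3) = 1 := by
    rw [← l.2.2]
    push_cast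
    generalize (n : ZMod 3) = i
    have : (univ : Finset (ZMod 3)) = {i - 1, i, i + 1} := by decide +revert
    rw [this, sum_insert, sum_insert, sum_singleton, add_assoc] <;> decide +revert
  generalize l.1 ((n - 1 : ℤ) : ZMod 3) = a at *
  generalize l.1 ((n : ℤ) : ZMod 3) = b at *
  generalize l.1 ((n + 1 : ℤ) : ZMod 3) = c at *
  obtain rfl : b = 1 - a - c := by linarith
  apply notMem_outer (n := n) <;> simp [vtx, edgeLine] <;> nlinarith

lemma chart_continue {κ : Set ((ℝ²) × B)} (hκ : κ ∈ charts τ) {y y' z : ℝ²} {b : B}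
    (hz : z ∈ outer) (h : (y', outPt z) ∈ κ) (hy : y ∈ outer) (hb : (y, b) ∈ κ) : b = outPt y := by
  rw [outPt_eq hz] at h
  rw [outPt_eq hy]
  rcases hκ with (rfl | rfl) | ⟨n, rfl⟩
  · exact hb.2.2
  · obtain ⟨l, hl, -, h⟩ := h
    exact absurd h (ofOuter_ne_ofTri hl)
  · rcases hb with ⟨_, -, -, h⟩ | ⟨l, hl, h, -⟩
    · exact h
    · simp only at h
      exact absurd (h ▸ hy) (star_notMem_outer hl)

lemma germ_chart {κ : Set ((ℝ²) × B)} (hκ : κ ∈ charts τ) {x y : ℝ²} {m m' : ℤ²}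
    {f : ℝ → B} {a b : ℝ} (hab : a < b) (hx : ∀ r ∈ Set.Ioo a b, x + r • vecR m ∈ outer)
    (h : ∀ r ∈ Set.Ioo a b, f r = outPt (x + r • vecR m))
    (h' : ∀ r ∈ Set.Ioo a b, (y + r • vecR m', f r) ∈ κ) : ∃ k, m' = shear k m ∧ y = deckPow k x :=
  affine_match hab fun r hr => chart_outer hκ (hx r hr) (h r hr ▸ h' r hr)

lemma eventually_iff {P : ℝ → Prop} {s : Set ℝ} {a : ℝ} :
    (∀ᶠ r in 𝓝[s] a, P r) ↔ ∃ ε > 0, ∀ r, |r - a| < ε → r ∈ s → P r := by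
  rw [eventually_nhdsWithin_iff, Metric.eventually_nhds_iff]
  rfl

/-- The edge `e` is the image of the ray or segment that starts at `x` with velocity `m`. -/
def CurveData.Lift (C : CurveData) (e : Fin C.nE) (x : ℝ²) (m : ℤ²) : Prop :=
  ∀ r ∈ C.dom e, x + r • vecR m ∈ outer ∧ C.path e r = outPt (x + r • vecR m)

lemma CurveData.Lift.deckPow {C : CurveData} {e : Fin C.nE} {x : ℝ²} {m : ℤ²}
    (h : C.Lift e x m) (k : ℤ) : C.Lift e (Scat.deckPow k x) (shear k m) := fun r hr => by
  rw [← deckPow_line]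
  exact ⟨deckPow_mem_outer k (h r hr).1, by rw [outPt_deckPow k (h r hr).1, (h r hr).2]⟩

namespace TropicalCurve

variable (C : TropicalCurve τ) {e : Fin C.nE} {x : ℝ²} {m : ℤ²}

lemma mem_dom {r : ℝ} : r ∈ C.dom e ↔ 0 ≤ r ∧ (C.head e = none ∨ r ≤ C.len e) := by
  rw [CurveData.dom]
  split_ifs with h <;> simp [h]

lemma exists_pos_dom (e : Fin C.nE) : ∃ δ > 0, ∀ r, 0 ≤ r → r < δ → r ∈ C.dom e :=
  ⟨C.len e, C.len_pos e, fun _ h1 h2 => C.mem_dom.2 ⟨h1, .inr h2.le⟩⟩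

lemma lift_unique {x' : ℝ²} {m' : ℤ²} (h : C.Lift e x m) (h' : C.Lift e x' m') :
    ∃ k, m' = shear k m ∧ x' = deckPow k x := by
  obtain ⟨δ, hδ, hd⟩ := C.exists_pos_dom e
  refine affine_match hδ fun r hr => (outPt_eq_iff (h r (hd r hr.1.le hr.2)).1
    (h' r (hd r hr.1.le hr.2)).1).1 ?_
  rw [← (h r (hd r hr.1.le hr.2)).2, (h' r (hd r hr.1.le hr.2)).2]

lemma lift_extend (hout : ∀ r : ℝ, 0 ≤ r → x + r • vecR m ∈ outer)
    (h : ∀ᶠ r in 𝓝[≥] (0 : ℝ), C.path e r = outPt (x + r • vecR m)) :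
    ∀ r, 0 ≤ r → (C.head e = none ∨ r < C.len e) → C.path e r = outPt (x + r • vecR m) := by
  obtain ⟨δ, hδ, hg⟩ := eventually_iff.1 h
  by_contra! hbad
  set S : Set ℝ := {r | 0 ≤ r ∧ (C.head e = none ∨ r < C.len e) ∧ C.path e r ≠ outPt (x + r • vecR m)}
    with hS
  have hne : S.Nonempty := hbad
  have hbd : BddBelow S := ⟨0, fun r hr => hr.1⟩
  have hge : ∀ r ∈ S, δ ≤ r := fun r hr => by
    by_contra! h0
    exact hr.2.2 (hg r (by rwa [sub_zero, abs_of_nonneg hr.1]) hr.1)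
  have h0 : δ ≤ sInf S := le_csInf hne hge
  have hlt : C.head e = none ∨ sInf S < C.len e := by
    obtain ⟨r, hr⟩ := hne
    exact hr.2.1.imp_right fun h => (csInf_le hbd hr).trans_lt h
  obtain ⟨κ, hκ, q, m', -, hev⟩ := C.affine e (sInf S) (by linarith) hlt
  rw [← nhdsWithin_univ] at hev
  obtain ⟨ε, hε, hch⟩ := eventually_iff.1 hev
  have hgood : ∀ r ∈ Set.Ioo (sInf S - min δ ε) (sInf S), C.path e r = outPt (x + r • vecR m) := by
    intro r hr
    have h1 : 0 ≤ r := by linarith [hr.1, min_le_left δ ε]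
    by_contra h2
    exact absurd (csInf_le hbd (show r ∈ S from ⟨h1, hlt.imp_right fun h => hr.2.trans h, h2⟩))
      (not_le.2 hr.2)
  have hη : 0 < min δ ε := lt_min hδ hε
  have hch' : ∀ r, |r - sInf S| < ε → ((q - sInf S • vecR m') + r • vecR m', C.path e r) ∈ κ := by
    intro r hr
    rw [show q - sInf S • vecR m' + r • vecR m' = q + (r - sInf S) • vecR m' by module]
    exact hch r hr trivial
  have hin : ∀ r ∈ Set.Ioo (sInf S - min δ ε) (sInf S), |r - sInf S| < ε := by
    intro r hr
    rw [abs_lt]; constructor <;> linarith [hr.1, hr.2, min_le_right δ ε]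
  have hpos : ∀ r ∈ Set.Ioo (sInf S - min δ ε) (sInf S), 0 ≤ r := fun r hr => by
    linarith [hr.1, min_le_left δ ε]
  have hab : sInf S - min δ ε < sInf S := by linarith
  obtain ⟨k, rfl, hk⟩ := germ_chart hκ hab (fun r hr => hout r (hpos r hr)) hgood
    fun r hr => hch' r (hin r hr)
  obtain ⟨r, hrS, hr⟩ := exists_lt_of_csInf_lt hne (by linarith : sInf S < sInf S + ε)
  have h1 := csInf_le hbd hrS
  have h2 := hch' r (by rw [abs_of_nonneg (by linarith)]; linarith)
  obtain ⟨r', hr'⟩ : (Set.Ioo (sInf S - min δ ε) (sInf S)).Nonempty := Set.nonempty_Ioo.2 hab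
  have h3 := hch' r' (hin r' hr')
  rw [hgood r' hr'] at h3
  rw [hk, ← deckPow_line] at h2
  have h4 := chart_continue hκ (hout r' (hpos r' hr')) h3 (deckPow_mem_outer k (hout r hrS.1)) h2
  rw [outPt_deckPow k (hout r hrS.1)] at h4
  exact hrS.2.2 h4

/-- The lift of an edge matches every chart at its head. -/
lemma lift_head {v : Fin C.nV} {κ : Set ((ℝ²) × B)} {y : ℝ²} {vel : Fin C.nE → ℤ²}
    (hf : C.IsFrame τ v κ y vel) (he : C.head e = some v)
    (hout : ∀ r : ℝ, 0 ≤ r → r ≤ C.len e → x + r • vecR m ∈ outer)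
    (h : ∀ r, 0 ≤ r → r < C.len e → C.path e r = outPt (x + r • vecR m)) :
    ∃ k, vel e = shear k m ∧ y = deckPow k (x + C.len e • vecR m) ∧
      C.path e (C.len e) = outPt (x + C.len e • vecR m) ∧ 
      ∃ y' z, z ∈ outer ∧ (y', outPt z) ∈ κ := by
  obtain ⟨hκ, -, h2, -⟩ := hf
  obtain ⟨-, h3⟩ := h2 e (by simp [CurveData.inE, he])
  obtain ⟨ε, hε, h4⟩ := eventually_iff.1 h3
  have hl := C.len_pos e
  set a := max 0 (C.len e - ε)
  have ha : a < C.len e := max_lt hl (by linarith)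
  have ha0 : ∀ r ∈ Set.Ioo a (C.len e), 0 ≤ r := fun r hr => (le_max_left _ _).trans hr.1.le
  have h5 : ∀ r, a < r → r ≤ C.len e →
      (y - C.len e • vecR (vel e) + r • vecR (vel e), C.path e r) ∈ κ := by
    intro r h1 h2
    have h6 := (le_max_right 0 (C.len e - ε)).trans_lt h1
    have := h4 r (by rw [abs_of_nonpos (by linarith)]; linarith) h2
    rwa [sub_smul, ← add_sub_assoc, add_sub_right_comm] at this
  obtain ⟨k, h6, h7⟩ := germ_chart hκ ha (fun r hr => hout r (ha0 r hr) hr.2.le)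
    (fun r hr => h r (ha0 r hr) hr.2) fun r hr => h5 r hr.1 hr.2.le
  have hy : y = deckPow k (x + C.len e • vecR m) := by rw [deckPow_line, ← h7, ← h6, sub_add_cancel]
  obtain ⟨r, hr⟩ := Set.nonempty_Ioo.2 ha
  have h8 := h5 r hr.1 hr.2.le
  rw [h r (ha0 r hr) hr.2] at h8
  refine ⟨k, h6, hy, ?_, _, _, hout r (ha0 r hr) hr.2.le, h8⟩
  have h9 := h5 _ ha le_rfl
  rw [sub_add_cancel] at h9
  have h10 := hout _ hl.le le_rfl
  rw [chart_continue hκ (hout r (ha0 r hr) hr.2.le) h8 (hy ▸ deckPow_mem_outer k h10) h9, hy,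
    outPt_deckPow k h10]

end TropicalCurve

end

section

open Finset PTree

namespace TropicalCurve

variable {τ : ZMod 3 → ℝ} (C : TropicalCurve τ) {e : Fin C.nE} {v : Fin C.nV} {x : ℝ²} {m : ℤ²}

lemma mem_inE : e ∈ C.inE v ↔ C.head e = some v := by simp [CurveData.inE]

lemma inE_nonempty (v : Fin C.nV) : (C.inE v).Nonempty :=
  card_pos.1 (by have := C.valency v; omega)

lemma lift_of_germ (hout : ∀ r : ℝ, 0 ≤ r → x + r • vecR m ∈ outer)
    (h : ∀ᶠ r in 𝓝[≥] (0 : ℝ), C.path e r = outPt (x + r • vecR m)) : C.Lift e x m := by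
  intro r hr
  rw [C.mem_dom] at hr
  refine ⟨hout r hr.1, ?_⟩
  have h1 := C.lift_extend hout h
  rcases hr.2 with h2 | h2
  · exact h1 r hr.1 (.inl h2)
  · rcases h2.lt_or_eq with h2 | rfl
    · exact h1 r hr.1 (.inr h2)
    · cases hv : C.head e with
      | none => exact h1 _ hr.1 (.inl hv)
      | some v =>
        obtain ⟨κ, y, vel, hf⟩ := C.balanced v
        obtain ⟨k, -, -, h3, -⟩ := C.lift_head hf hv (fun r hr _ => hout r hr)
          fun r hr hr' => h1 r hr (.inr hr')
        exact h3

lemma match_head (hl : C.Lift e x m) {κ : Set ((ℝ²) × B)} {y : ℝ²}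
    {vel : Fin C.nE → ℤ²} (hf : C.IsFrame τ v κ y vel) (he : C.head e = some v) :
    ∃ k, vel e = shear k m ∧ y = deckPow k (x + C.len e • vecR m) ∧
      ∃ y' z, z ∈ outer ∧ (y', outPt z) ∈ κ := by
  obtain ⟨k, h1, h2, -, h3⟩ := C.lift_head hf he
    (fun r hr hr' => (hl r (C.mem_dom.2 ⟨hr, .inr hr'⟩)).1)
    fun r hr hr' => (hl r (C.mem_dom.2 ⟨hr, .inr hr'.le⟩)).2
  exact ⟨k, h1, h2, h3⟩

lemma vertexMult_eq {m : Fin C.nE → ℤ²}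
    (hin : ∀ e ∈ C.inE v, ∃ q, C.Lift e q (m e) ∧ x = q + C.len e • vecR (m e))
    (hα : ∀ e ∈ C.inE v, 0 < alpha (dheight x) ((C.wt e : ℤ) • m e)) :
    C.vertexMult τ v = Nm (C.inE v) fun e => (C.wt e : ℤ) • m e := by
  set u : Fin C.nE → ℤ² := fun e => (C.wt e : ℤ) • m e with hu
  have key : ∀ κ q vel, C.IsFrame τ v κ q vel → ∀ c : Fin C.nE → ℝ,
      GenericDispl (C.inE v) (fun e => (C.wt e : ℤ) • vel e) c →
      curveCount (C.inE v) (fun e => (C.wt e : ℤ) • vel e) c = Nm (C.inE v) u := by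
    intro κ y vel hf c hc
    have h1 : ∀ e ∈ C.inE v, ∃ k, vel e = shear k (m e) ∧ y = deckPow k x := by
      intro e he
      obtain ⟨q, hl, hx⟩ := hin e he
      obtain ⟨k, h2, h3, -⟩ := C.match_head hl hf (C.mem_inE.1 he)
      exact ⟨k, h2, hx ▸ h3⟩
    obtain ⟨e₀, he₀⟩ := C.inE_nonempty v
    obtain ⟨k, -, hy⟩ := h1 e₀ he₀
    have h2 : ∀ e ∈ C.inE v, (C.wt e : ℤ) • vel e = shear k (u e) := by
      intro e he
      obtain ⟨k', h3, h4⟩ := h1 e he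
      have h5 := congrArg Prod.fst (hy.symm.trans h4)
      simp only [deckPow] at h5
      obtain rfl : k = k' := by
        have : (k : ℝ) = k' := by linarith
        exact_mod_cast this
      rw [h3, hu, map_zsmul]
    have h3 : ∀ e ∈ C.inE v, 0 < alpha (dheight y) ((C.wt e : ℤ) • vel e) := by
      intro e he
      rw [h2 e he, hy, alpha_deckPow]
      exact hα e he
    rw [curveCount_eq_Nm h3 hc, Nm_congr h3 (u' := shear k ∘ u) h2, Nm_shear]
  obtain ⟨κ, y, vel, hf⟩ := C.balanced v
  obtain ⟨c, hc⟩ := exists_genericDispl (C.inE v) (fun e => (C.wt e : ℤ) • vel e)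
  have hS : {N | ∃ κ q vel, C.IsFrame τ v κ q vel ∧ ∃ c : Fin C.nE → ℝ,
      GenericDispl (C.inE v) (fun e => (C.wt e : ℤ) • vel e) c ∧
      N = curveCount (C.inE v) (fun e => (C.wt e : ℤ) • vel e) c} = {Nm (C.inE v) u} := by
    ext N
    simp only [Set.mem_singleton_iff]
    constructor
    · rintro ⟨κ, q, vel, hf, c, hc, rfl⟩
      exact key κ q vel hf c hc
    · rintro rfl
      exact ⟨κ, y, vel, hf, c, hc, (key κ y vel hf c hc).symm⟩
  rw [CurveData.vertexMult, hS, csInf_singleton]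

lemma exists_det2_ne_zero (hv : C.vertexMult τ v ≠ 0) {κ : Set ((ℝ²) × B)} {y : ℝ²}
    {vel : Fin C.nE → ℤ²} (hf : C.IsFrame τ v κ y vel) : ∃ a ∈ C.inE v, ∃ b ∈ C.inE v,
      det2 ((C.wt a : ℤ) • vel a) ((C.wt b : ℤ) • vel b) ≠ 0 := by
  by_contra! h
  obtain ⟨c, hc⟩ := exists_genericDispl (C.inE v) (fun e => (C.wt e : ℤ) • vel e)
  exact hv (Nat.sInf_eq_zero.2 (.inl ⟨κ, y, vel, hf, c, hc,
    (curveCount_eq_zero (u := fun e => (C.wt e : ℤ) • vel e) (C.valency v) h c).symm⟩))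

lemma outE_eq (he : C.tail e = some v) : C.outE v = {e} := by
  ext a
  simp only [CurveData.outE, mem_filter, mem_univ, true_and, mem_singleton]
  exact ⟨fun h => (C.tail_unique v).unique h he, fun h => h ▸ he⟩

lemma smul_vecR_div {w : ℕ} (hw : 0 < w) (s : ℝ) (m : ℤ²) :
    s • vecR m = (s / w) • vecR ((w : ℤ) • m) := by
  have : (w : ℝ) ≠ 0 := mod_cast hw.ne'
  rw [vecR_smul_int, smul_smul, Int.cast_natCast, div_mul_cancel₀ _ this]

lemma exists_leg_lift (he : C.tail e = none) : ∃ (n : ℤ) (ε : ℤˣ),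
    C.Lift e (singPt τ n) ((ε : ℤ) • (1, -3 * n)) := by
  obtain ⟨i, ε, h⟩ := C.start e he
  obtain ⟨n, rfl⟩ := ZMod.intCast_surjective i
  have hpt : ∀ r : ℝ, singPt τ n + r • vecR ((ε : ℤ) • (1, -3 * n)) =
      (n + (τ n + (ε : ℤ) * r), edgeLine n (n + (τ n + (ε : ℤ) * r))) := by
    intro r
    ext <;> simp [singPt, vecR, edgeLine] <;> ring
  refine ⟨n, ε, C.lift_of_germ (fun r _ => ?_) ?_⟩
  · rw [hpt]; exact mem_outer_of_le (n := n) le_rfl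
  · filter_upwards [h] with r hr
    obtain ⟨l, hl, hp⟩ := hr
    have h0 : ∀ i : ZMod 3, i + 1 ≠ i := by decide
    have h1 := l.2.1 (n : ZMod 3)
    have h2 := l.2.1 (n + 1 : ZMod 3)
    rw [hl] at h1 h2
    simp [edgeBary, h0, (h0 _).symm] at h1 h2
    rw [hp, ofTri_edgeBary ⟨h2, h1⟩ hl, hpt, outPt_eq]

instance : Nonempty PTree := ⟨leg 0 1 0⟩

/-- Compatible lifts of the edges that come into the vertex `v`, which lies at `x`. -/
def Behind (v : Fin C.nV) (x : ℝ²) (u : ℤ²) (P : Fin C.nE → (ℝ²) × (ℤ²)) : Prop :=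
  (∀ e ∈ C.inE v, IsPrim (P e).2 ∧ C.Lift e (P e).1 (P e).2 ∧
    x = (P e).1 + C.len e • vecR (P e).2 ∧ 0 < alpha (dheight x) ((C.wt e : ℤ) • (P e).2)) ∧
  u = ∑ e ∈ C.inE v, (C.wt e : ℤ) • (P e).2

/-- The edge `e` lifts to `x + ℝ≥0 m`, where the tree `T` describes what is behind it. -/
def HasTree (e : Fin C.nE) (T : PTree) (x : ℝ²) (m : ℤ²) : Prop :=
  T.At τ x ∧ IsPrim m ∧ T.vec = (C.wt e : ℤ) • m ∧ C.Lift e x m ∧ ∀ v, C.tail e = some v →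
    ∃ P : Fin C.nE → (ℝ²) × (ℤ²), C.Behind v x ((C.wt e : ℤ) • m) P

lemma exists_hasTree (hτ : Interior τ) (hC : ∀ v, C.vertexMult τ v ≠ 0)
    (e : Fin C.nE) : ∃ (T : PTree) (x : ℝ²) (m : ℤ²), C.HasTree e T x m := by
  obtain ⟨rk, hrk⟩ := C.acyclic
  have hleg : ∀ e, C.tail e = none → ∃ (T : PTree) (x : ℝ²) (m : ℤ²), C.HasTree e T x m := by
    intro e he
    obtain ⟨n, ε, hl⟩ := C.exists_leg_lift he
    refine ⟨leg n ε (C.wt e), _, _, ⟨rfl, C.wt_pos e⟩, ?_, ?_, hl, fun v hv => by simp [he] at hv⟩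
    · rcases Int.units_eq_one_or ε with rfl | rfl <;> simp [IsPrim]
    · rw [vec, smul_smul]
  have hnode : ∀ n v, rk v = n → ∀ e, C.tail e = some v →
      ∃ (T : PTree) (x : ℝ²) (m : ℤ²), C.HasTree e T x m := by
    intro n
    induction n using Nat.strong_induction_on with
    | _ n ih =>
      rintro v rfl e he
      obtain ⟨κ, y, vel, hf⟩ := C.balanced v
      have hin : ∀ e' ∈ C.inE v, ∃ T : PTree, T.Thru τ y ∧ T.vec = (C.wt e' : ℤ) • vel e' ∧
          (∃ y' z, z ∈ outer ∧ (y', outPt z) ∈ κ) ∧ ∃ x', IsPrim (vel e') ∧ C.Lift e' x' (vel e') ∧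
            y = x' + C.len e' • vecR (vel e') := by
        intro e' he'
        obtain ⟨T, x, m, h1, h2, h3, h4, -⟩ : ∃ (T : PTree) (x : ℝ²) (m : ℤ²),
            C.HasTree e' T x m := by
          cases hw : C.tail e' with
          | none => exact hleg e' hw
          | some w => exact ih (rk w) (hrk e' w v hw (C.mem_inE.1 he')) w rfl e' hw
        obtain ⟨k, h5, h6, h7⟩ := C.match_head h4 hf (C.mem_inE.1 he')
        have h8 : (T.shift k).vec = (C.wt e' : ℤ) • vel e' := by
          rw [vec_shift, h3, h5, map_zsmul]
        rw [deckPow_line, ← h5] at h6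
        refine ⟨T.shift k, ⟨_, C.len e' / C.wt e', ?_, h1.shift k, ?_⟩, h8, h7, _,
          h5 ▸ h2.shear k, h5 ▸ h4.deckPow k, h6⟩
        · exact div_pos (C.len_pos e') (mod_cast C.wt_pos e')
        · rw [h8, ← smul_vecR_div (C.wt_pos e'), h6]
      choose! T hT using hin
      set σ := (C.inE v).equivFin.symm
      have hmem : ∀ i, (σ i : Fin C.nE) ∈ C.inE v := fun i => (σ i).2
      set N := node _ fun i => T (σ i) with hN
      have hvec : N.vec = (C.wt e : ℤ) • vel e := by
        have h1 := hf.2.2.2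
        rw [C.outE_eq he, sum_singleton] at h1
        rw [← h1, hN, vec, ← sum_coe_sort (C.inE v), ← Equiv.sum_comp σ]
        exact sum_congr rfl fun i _ => (hT _ (hmem i)).2.1
      have hat : N.At τ y := by
        obtain ⟨a, ha, b, hb, hab⟩ := C.exists_det2_ne_zero (hC v) hf
        refine at_node.2 ⟨C.valency v, fun i => (hT _ (hmem i)).1, σ.symm ⟨a, ha⟩,
          σ.symm ⟨b, hb⟩, ?_⟩
        rw [Equiv.apply_symm_apply, Equiv.apply_symm_apply, (hT a ha).2.1, (hT b hb).2.1]
        exact hab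
      have hpos : 0 < alpha (dheight y) (vel e) := by
        have h1 := hat.alpha_ge hτ
        have h2 : (0 : ℝ) < N.lw := mod_cast hat.lw_pos
        rw [← hN, hvec] at h1
        have h3 : alpha (dheight y) ((C.wt e : ℤ) • vel e) = C.wt e * alpha (dheight y) (vel e) := by
          simp [alpha]; ring
        rw [h3] at h1
        exact pos_of_mul_pos_right (by linarith) (Nat.cast_nonneg _)
      obtain ⟨hy, hch⟩ := hat.node_facts hτ
      have hout : ∀ r : ℝ, 0 ≤ r → y + r • vecR (vel e) ∈ outer := by
        intro r hr
        refine mem_outer_of_height ?_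
        rw [height_add]
        have := mul_nonneg hr hpos.le
        have := sq_nonneg (r * ((vel e).1 : ℝ))
        linarith
      obtain ⟨h1, h2⟩ := hf.2.1 e (by rw [C.outE_eq he]; exact mem_singleton_self e)
      have hbeh : ∀ e' ∈ C.inE v, ∃ x', IsPrim (vel e') ∧ C.Lift e' x' (vel e') ∧
          y = x' + C.len e' • vecR (vel e') ∧ 0 < alpha (dheight y) ((C.wt e' : ℤ) • vel e') := by
        intro e' he'
        obtain ⟨hthru, h3, -, x', h4, h5, h6⟩ := hT e' he'
        refine ⟨x', h4, h5, h6, ?_⟩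
        have h7 := hch (σ.symm ⟨e', he'⟩)
        obtain ⟨_, _, _, h8, _⟩ := hthru
        have h9 : (0 : ℝ) < (T e').lw := mod_cast h8.lw_pos
        simp only [Equiv.apply_symm_apply, h3] at h7
        linarith
      choose! x' hx' using hbeh
      refine ⟨N, y, vel e, hat, h1, hvec, C.lift_of_germ hout ?_, fun v' hv' =>
        ⟨fun e' => (x' e', vel e'), ?_⟩⟩
      · obtain ⟨e', he'⟩ := C.inE_nonempty v
        obtain ⟨-, -, ⟨y', z, hz, hyz⟩, -⟩ := hT e' he'
        filter_upwards [h2, self_mem_nhdsWithin] with r hr hr0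
        exact chart_continue hf.1 hz hyz (hout r hr0) hr
      · obtain rfl : v = v' := Option.some.inj (he.symm.trans hv')
        have h3 := hf.2.2.2
        rw [C.outE_eq he, sum_singleton] at h3
        exact ⟨hx', h3.symm⟩
  cases he : C.tail e with
  | none => exact hleg e he
  | some v => exact hnode _ v rfl e he

lemma leg_lift (he : C.tail e = none) (h : C.Lift e x m) :
    ∃ (n : ℤ) (ε : ℤˣ), x = singPt τ n ∧ m = (ε : ℤ) • (1, -3 * n) := by
  obtain ⟨n, ε, h1⟩ := C.exists_leg_lift he
  obtain ⟨k, rfl, rfl⟩ := C.lift_unique h1 h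
  refine ⟨n + 3 * k, ε, (singPt_deckPow τ n k).symm, ?_⟩
  ext <;> simp [shear]; ring

lemma exists_behind (hτ : Interior τ) (hC : ∀ v, C.vertexMult τ v ≠ 0)
    (he : C.tail e = some v) (h : C.Lift e x m) : ∃ P, C.Behind v x ((C.wt e : ℤ) • m) P := by
  obtain ⟨T, y, m', -, -, -, h1, h2⟩ := C.exists_hasTree hτ hC e
  obtain ⟨k, rfl, rfl⟩ := C.lift_unique h1 h
  obtain ⟨P, h3, h4⟩ := h2 v he
  refine ⟨fun e' => (deckPow k (P e').1, shear k (P e').2), fun e' he' => ?_, ?_⟩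
  · obtain ⟨h5, h6, h7, h8⟩ := h3 e' he'
    exact ⟨h5.shear k, h6.deckPow k, by dsimp only; rw [h7, deckPow_line],
      by rwa [← map_zsmul, alpha_deckPow]⟩
  · simp_rw [← map_zsmul, h4, map_sum]

end TropicalCurve

end

section

open Finset PTree

lemma PTree.node_congr {k k' : ℕ} {ts : Fin k → PTree} {ts' : Fin k' → PTree} (h : k = k')
    (h' : ∀ (i : Fin k) (i' : Fin k'), i.val = i'.val → ts i = ts' i') : node k ts = node k' ts' := by
  subst h
  rw [show ts = ts' from funext fun i => h' i i rfl]

lemma PTree.node_inj {k k' : ℕ} {ts : Fin k → PTree} {ts' : Fin k' → PTree}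
    (h : node k ts = node k' ts') : k = k' ∧ ∀ (i : Fin k) (i' : Fin k'), i.val = i'.val → ts i = ts' i' := by
  cases h
  exact ⟨rfl, fun i i' h => by rw [Fin.ext h]⟩

lemma exists_eq_rec {α β : Type} {r : α → α → Prop} (hr : WellFounded r)
    (F : ∀ a, (∀ b, r b a → β) → β) : ∃ f : α → β, ∀ a, f a = F a fun b _ => f b :=
  ⟨hr.fix F, hr.fix_eq F⟩

namespace TropicalCurve

variable {τ : ZMod 3 → ℝ} (C : TropicalCurve τ) {e : Fin C.nE} {v : Fin C.nV} {x : ℝ²} {m : ℤ²}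

/-- The edge `a` leads to the tail of the edge `b`. -/
def Child (a b : Fin C.nE) : Prop := ∃ v, C.head a = some v ∧ C.tail b = some v

lemma exists_child_lt : ∃ ρ : Fin C.nE → ℕ, ∀ a b, C.Child a b → ρ a < ρ b := by
  obtain ⟨rk, hrk⟩ := C.acyclic
  refine ⟨fun e => (C.tail e).elim 0 fun v => rk v + 1, ?_⟩
  rintro a b ⟨v, ha, hb⟩
  cases h : C.tail a with
  | none => simp [h, hb]
  | some w => simpa [h, hb] using hrk a w v h ha

lemma child_wf : WellFounded C.Child := by
  obtain ⟨ρ, hρ⟩ := C.exists_child_lt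
  exact Subrelation.wf (hρ _ _) (measure ρ).wf

lemma parent_wf : WellFounded fun a b => C.Child b a := by
  obtain ⟨ρ, hρ⟩ := C.exists_child_lt
  refine Subrelation.wf (fun {a b} h => ?_) (measure fun e => ∑ e, ρ e - ρ e).wf
  have h1 := hρ _ _ h
  have h2 := single_le_sum (fun e _ => Nat.zero_le (ρ e)) (mem_univ a)
  show ∑ e, ρ e - ρ a < ∑ e, ρ e - ρ b
  omega

lemma exists_tail (v : Fin C.nV) : ∃ e, C.tail e = some v := (C.tail_unique v).exists

/-- Induction from the unbounded leg. -/
lemma root_induction {P : Fin C.nE → Prop} (h0 : ∀ e, C.head e = none → P e)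
    (h1 : ∀ e v, C.tail e = some v → P e → ∀ e' ∈ C.inE v, P e') (e : Fin C.nE) : P e :=
  C.parent_wf.induction e fun a ih => by
    cases h : C.head a with
    | none => exact h0 a h
    | some v =>
      obtain ⟨b, hb⟩ := C.exists_tail v
      exact h1 b v hb (ih b ⟨v, h, hb⟩) a (C.mem_inE.2 h)

/-- Induction towards the unbounded leg. -/
lemma leaf_induction {P : Fin C.nE → Prop} (h0 : ∀ e, C.tail e = none → P e)
    (h1 : ∀ e v, C.tail e = some v → (∀ e' ∈ C.inE v, P e') → P e) (e : Fin C.nE) : P e :=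
  C.child_wf.induction e fun a ih => by
    cases h : C.tail a with
    | none => exact h0 a h
    | some v => exact h1 a v h fun e' he' => ih e' ⟨v, C.mem_inE.1 he', h⟩

/-- Orderings of the edges coming into the vertices. -/
abbrev Ordering : Type := ∀ v, Fin (C.inE v).card ≃ C.inE v

/-- A development of the curve in the plane, with the trees that describe what is behind its edges. -/
structure IsMarked (o : C.Ordering) (pt : Fin C.nE → ℝ²) (dir : Fin C.nE → ℤ²)
    (tr : Fin C.nE → PTree) : Prop where
  lift : ∀ e, C.Lift e (pt e) (dir e)
  prim : ∀ e, IsPrim (dir e)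
  realized : ∀ e, (tr e).At τ (pt e)
  vec : ∀ e, (tr e).vec = (C.wt e : ℤ) • dir e
  leg : ∀ e, C.tail e = none → ∃ n ε, tr e = leg n ε (C.wt e)
  node : ∀ e v, C.tail e = some v → tr e = .node _ fun i => tr (o v i)
  glue : ∀ e v, C.tail e = some v → ∀ e' ∈ C.inE v, pt e = pt e' + C.len e' • vecR (dir e')

variable {C} {o : C.Ordering} {pt pt' : Fin C.nE → ℝ²} {dir dir' : Fin C.nE → ℤ²}
  {tr tr' : Fin C.nE → PTree}

lemma IsMarked.alpha_pos (hτ : Interior τ) (h : C.IsMarked o pt dir tr)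
    (he : C.tail e = some v) : ∀ e' ∈ C.inE v, 0 < alpha (dheight (pt e)) ((C.wt e' : ℤ) • dir e') := by
  intro e' he'
  have h1 := h.realized e
  rw [h.node e v he] at h1
  have h2 := (h1.node_facts hτ).2 ((o v).symm ⟨e', he'⟩)
  have h3 : (0 : ℝ) < (tr e').lw := mod_cast (h.realized e').lw_pos
  simp only [Equiv.apply_symm_apply, h.vec] at h2
  linarith

lemma IsMarked.vertexMult_eq (hτ : Interior τ) (h : C.IsMarked o pt dir tr)
    (he : C.tail e = some v) :
    C.vertexMult τ v = Nm univ fun i => (tr (o v i)).vec := by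
  have hα := h.alpha_pos hτ he
  rw [C.vertexMult_eq (x := pt e) (fun e' he' => ⟨_, h.lift e', h.glue e v he e' he'⟩) hα]
  have h1 : C.inE v = univ.image fun i => (o v i : Fin C.nE) := by
    ext a
    simp only [mem_image, mem_univ, true_and]
    exact ⟨fun ha => ⟨(o v).symm ⟨a, ha⟩, by simp⟩, by rintro ⟨i, rfl⟩; exact (o v i).2⟩
  have h2 := Nm_image (α := dheight (pt e)) (I := univ) (f := fun i => (o v i : Fin C.nE))
    (u := fun e => (C.wt e : ℤ) • dir e)
    (Subtype.val_injective.comp (o v).injective).injOn fun i _ => hα _ (o v i).2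
  rw [← h1] at h2
  rw [h2]
  congr 1
  exact funext fun i => (h.vec _).symm

/-- The weights of the trees of a marked curve. -/
lemma IsMarked.wtT_node (hτ : Interior τ) (h : C.IsMarked o pt dir tr)
    (he : C.tail e = some v) : (tr e).wtT =
      C.vertexMult τ v / ((C.inE v).card.factorial : ℚ) * ∏ e' ∈ C.inE v, (tr e').wtT := by
  rw [h.node e v he, wtT, ← h.vertexMult_eq hτ he, ← prod_coe_sort (C.inE v),
    ← Equiv.prod_comp (o v)]

lemma exists_isMarked (hτ : Interior τ) (hC : ∀ v, C.vertexMult τ v ≠ 0)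
    (hm : IsPrim m) (hl : ∀ e, C.head e = none → C.Lift e x m) (o : C.Ordering) :
    ∃ pt dir tr, C.IsMarked o pt dir tr ∧ ∀ e, C.head e = none → pt e = x ∧ dir e = m := by
  have hback : ∀ v (e : Fin C.nE) (Q : (ℝ²) × (ℤ²)), ∃ P, C.tail e = some v →
      C.Lift e Q.1 Q.2 → C.Behind v Q.1 ((C.wt e : ℤ) • Q.2) P := by
    intro v e Q
    by_cases h : C.tail e = some v ∧ C.Lift e Q.1 Q.2
    · obtain ⟨P, hP⟩ := C.exists_behind hτ hC h.1 h.2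
      exact ⟨P, fun _ _ => hP⟩
    · exact ⟨fun _ => Q, fun h1 h2 => absurd ⟨h1, h2⟩ h⟩
  choose f hf using hback
  choose par hpar using C.exists_tail
  obtain ⟨PD, hPD⟩ := exists_eq_rec C.parent_wf fun e g => match h : C.head e with
    | none => (x, m)
    | some v => f v (par v) (g (par v) ⟨v, h, hpar v⟩) e
  have hPD0 : ∀ e, C.head e = none → PD e = (x, m) := by
    intro e he
    rw [hPD]
    split
    · rfl
    · rename_i w hw; exact absurd (he.symm.trans hw) nofun
  have hPD1 : ∀ e v, C.tail e = some v → ∀ e' ∈ C.inE v, PD e' = f v e (PD e) e' := by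
    intro e v he e' he'
    rw [C.mem_inE] at he'
    rw [(C.tail_unique v).unique he (hpar v), hPD e']
    split
    · rename_i hw; exact absurd (he'.symm.trans hw) nofun
    · rename_i w hw
      obtain rfl : v = w := Option.some.inj (he'.symm.trans hw)
      rfl
  have hgood : ∀ e, IsPrim (PD e).2 ∧ C.Lift e (PD e).1 (PD e).2 := by
    refine C.root_induction (fun e he => ?_) fun e v he h e' he' => ?_
    · rw [hPD0 e he]; exact ⟨hm, hl e he⟩
    · rw [hPD1 e v he e' he']
      have := (hf v e (PD e) he h.2).1 e' he'
      exact ⟨this.1, this.2.1⟩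
  have hbeh : ∀ e v, C.tail e = some v → C.Behind v (PD e).1 ((C.wt e : ℤ) • (PD e).2) PD := by
    intro e v he
    obtain ⟨h1, h2⟩ := hf v e (PD e) he (hgood e).2
    refine ⟨fun e' he' => ?_, ?_⟩
    · rw [hPD1 e v he e' he']
      exact h1 e' he'
    · rw [h2]
      exact sum_congr rfl fun e' he' => by rw [hPD1 e v he e' he']
  have hleg : ∀ e, ∃ (n : ℤ) (ε : ℤˣ), C.tail e = none →
      (PD e).1 = singPt τ n ∧ (PD e).2 = (ε : ℤ) • (1, -3 * n) := by
    intro e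
    by_cases he : C.tail e = none
    · obtain ⟨n, ε, h⟩ := C.leg_lift he (hgood e).2
      exact ⟨n, ε, fun _ => h⟩
    · exact ⟨0, 1, fun h => absurd h he⟩
  choose n ε hleg using hleg
  obtain ⟨tr, htr⟩ := exists_eq_rec C.child_wf fun e (g : ∀ b, C.Child b e → PTree) =>
    match h : C.tail e with
    | none => leg (n e) (ε e) (C.wt e)
    | some v => .node _ fun i => g (o v i) ⟨v, C.mem_inE.1 (o v i).2, h⟩
  have htr0 : ∀ e, C.tail e = none → tr e = leg (n e) (ε e) (C.wt e) := by
    intro e he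
    rw [htr]
    split
    · rfl
    · rename_i w hw; exact absurd (he.symm.trans hw) nofun
  have htr1 : ∀ e v, C.tail e = some v → tr e = .node _ fun i => tr (o v i) := by
    intro e v he
    rw [htr]
    split
    · rename_i hw; exact absurd (he.symm.trans hw) nofun
    · rename_i w hw
      obtain rfl : v = w := Option.some.inj (he.symm.trans hw)
      rfl
  have hat : ∀ e, (tr e).At τ (PD e).1 ∧ (tr e).vec = (C.wt e : ℤ) • (PD e).2 := by
    refine C.leaf_induction (fun e he => ?_) fun e v he ih => ?_
    · rw [htr0 e he, (hleg e he).1, (hleg e he).2, vec, smul_smul]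
      exact ⟨⟨rfl, C.wt_pos e⟩, rfl⟩
    · rw [htr1 e v he]
      have h2 : ∀ i, (tr (o v i)).vec = (C.wt (o v i) : ℤ) • (PD (o v i)).2 := fun i =>
        (ih _ (o v i).2).2
      constructor
      · refine at_node.2 ⟨C.valency v, fun i => ⟨(PD (o v i)).1, C.len (o v i) / C.wt (o v i),
          div_pos (C.len_pos _) (mod_cast C.wt_pos _), (ih _ (o v i).2).1, ?_⟩, ?_⟩
        · rw [h2, ← smul_vecR_div (C.wt_pos _), ((hbeh e v he).1 _ (o v i).2).2.2.1]
        · have h3 : Nm (C.inE v) (fun e => (C.wt e : ℤ) • (PD e).2) ≠ 0 := by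
            rw [← C.vertexMult_eq (x := (PD e).1) (fun e' he' => ⟨_, (hgood e').2,
              ((hbeh e v he).1 e' he').2.2.1⟩) fun e' he' => ((hbeh e v he).1 e' he').2.2.2]
            exact hC v
          have h4 := mt (Nm_eq_zero (C.valency v)) h3
          push Not at h4
          obtain ⟨a, ha, b, hb, hab⟩ := h4
          refine ⟨(o v).symm ⟨a, ha⟩, (o v).symm ⟨b, hb⟩, ?_⟩
          rw [h2, h2]
          simpa only [Equiv.apply_symm_apply] using hab
      · rw [(hbeh e v he).2, vec, ← sum_coe_sort (C.inE v), ← Equiv.sum_comp (o v)]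
        exact sum_congr rfl fun i _ => h2 i
  exact ⟨fun e => (PD e).1, fun e => (PD e).2, tr, ⟨fun e => (hgood e).2, fun e => (hgood e).1,
    fun e => (hat e).1, fun e => (hat e).2, fun e he => ⟨_, _, htr0 e he⟩, htr1,
    fun e v he e' he' => ((hbeh e v he).1 e' he').2.2.1⟩, fun e he => by simp [hPD0 e he]⟩

end TropicalCurve

end

section

open Finset Option

namespace TropicalCurve

variable {τ : ZMod 3 → ℝ} {C D : TropicalCurve τ} {e : Fin C.nE} {v : Fin C.nV} {x : ℝ²}
  {m : ℤ²} {o : C.Ordering} {pt : Fin C.nE → ℝ²} {dir : Fin C.nE → ℤ²}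
  {tr : Fin C.nE → PTree} {o' : D.Ordering} {pt' : Fin D.nE → ℝ²} {dir' : Fin D.nE → ℤ²}
  {tr' : Fin D.nE → PTree}

lemma IsMarked.unique (hτ : Interior τ) {pt' : Fin C.nE → ℝ²}
    {dir' : Fin C.nE → ℤ²} {tr' : Fin C.nE → PTree} (h : C.IsMarked o pt dir tr)
    (h' : C.IsMarked o pt' dir' tr') (h0 : ∀ e, C.head e = none → pt e = pt' e) : tr = tr' := by
  have hk : ∀ {k : ℤ} {q : ℝ²}, deckPow k q = q → k = 0 := fun {k q} hq => by
    have h6 := congrArg Prod.fst hq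
    simp only [deckPow] at h6
    have : (k : ℝ) = 0 := by linarith
    exact_mod_cast this
  have h1 : ∀ e, pt e = pt' e := by
    refine C.root_induction h0 fun e v he ih e' he' => ?_
    obtain ⟨k, h3, h4⟩ := C.lift_unique (h.lift e') (h'.lift e')
    have h5 := h.glue e v he e' he'
    rw [ih, h'.glue e v he e' he', h3, h4, ← deckPow_line] at h5
    obtain rfl := hk h5
    rw [h4, deckPow_zero]
  have h2 : ∀ e, dir e = dir' e := fun e => by
    obtain ⟨k, h3, h4⟩ := C.lift_unique (h.lift e) (h'.lift e)
    rw [← h1 e] at h4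
    obtain rfl := hk h4.symm
    rw [h3]; ext <;> simp [shear]
  refine funext fun e => C.leaf_induction (P := fun e => tr e = tr' e) (fun e he => ?_)
    (fun e v he ih => ?_) e
  · obtain ⟨n, ε, h3⟩ := h.leg e he
    obtain ⟨n', ε', h3'⟩ := h'.leg e he
    have h4 := h.realized e
    have h4' := h'.realized e
    rw [h3] at h4; rw [h3'] at h4'
    obtain rfl := singPt_injective hτ (h4.1.symm.trans ((h1 e).trans h4'.1))
    have h5 := congrArg Prod.fst ((h.vec e).trans ((h2 e ▸ rfl : _ = _).trans (h'.vec e).symm))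
    have h6 : (C.wt e : ℤ) ≠ 0 := mod_cast (C.wt_pos e).ne'
    rw [h3, h3'] at h5
    simp only [PTree.vec, Prod.smul_fst, smul_eq_mul, mul_one, mul_eq_mul_left_iff, h6, or_false] at h5
    rw [h3, h3', Units.ext h5]
  · rw [h.node e v he, h'.node e v he]
    exact PTree.node_congr rfl fun i i' hi => by rw [Fin.ext hi]; exact ih _ (o v i').2

lemma prod_edges_head (g : Fin C.nE → ℚ) (he : C.head e = none) :
    ∏ a, g a = g e * ∏ v, ∏ a ∈ C.inE v, g a := by
  rw [← prod_fiberwise univ C.head g, Fintype.prod_option]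
  congr 1
  have : univ.filter (fun a => C.head a = none) = {e} := by
    ext a
    simp only [mem_filter, mem_univ, true_and, mem_singleton]
    exact ⟨fun h => C.root.unique h he, fun h => h ▸ he⟩
  rw [this, prod_singleton]

lemma prod_edges_tail (g : Fin C.nE → ℚ) {out : Fin C.nV → Fin C.nE}
    (ho : ∀ v, C.tail (out v) = some v) :
    ∏ a, g a = (∏ a ∈ univ.filter (fun a => C.tail a = none), g a) * ∏ v, g (out v) := by
  rw [← prod_fiberwise univ C.tail g, Fintype.prod_option]
  congr 1
  refine prod_congr rfl fun v _ => ?_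
  rw [show univ.filter (fun a => C.tail a = some v) = {out v} from C.outE_eq (ho v),
    prod_singleton]

lemma IsMarked.wtT_ne_zero (hτ : Interior τ) (h : C.IsMarked o pt dir tr)
    (hC : ∀ v, C.vertexMult τ v ≠ 0) (e : Fin C.nE) : (tr e).wtT ≠ 0 := by
  refine C.leaf_induction (P := fun e => (tr e).wtT ≠ 0) (fun e he => ?_) (fun e v he ih => ?_) e
  · obtain ⟨n, ε, h1⟩ := h.leg e he
    rw [h1, PTree.wtT]
    have : (C.wt e : ℚ) ≠ 0 := mod_cast (C.wt_pos e).ne'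
    positivity
  · rw [h.wtT_node hτ he]
    exact mul_ne_zero (div_ne_zero (mod_cast hC v) (by positivity)) (prod_ne_zero_iff.2 ih)

lemma IsMarked.vertexMult_ne_zero (hτ : Interior τ) (h : C.IsMarked o pt dir tr)
    (h0 : ∀ e, C.head e = none → (tr e).wtT ≠ 0) (v : Fin C.nV) : C.vertexMult τ v ≠ 0 := by
  have h1 : ∀ e, (tr e).wtT ≠ 0 := by
    refine C.root_induction h0 fun e v he ih e' he' => ?_
    rw [h.wtT_node hτ he] at ih
    exact prod_ne_zero_iff.1 (right_ne_zero_of_mul ih) e' he'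
  obtain ⟨e, he⟩ := C.exists_tail v
  have := h1 e
  rw [h.wtT_node hτ he] at this
  intro h2
  simp [h2] at this

lemma IsMarked.wtT_root (hτ : Interior τ) (h : C.IsMarked o pt dir tr)
    (hC : ∀ v, C.vertexMult τ v ≠ 0) (he : C.head e = none) :
    (tr e).wtT * ∏ v, ((C.inE v).card.factorial : ℚ) = (∏ v, (C.vertexMult τ v : ℚ)) *
      ∏ e ∈ univ.filter (fun e => C.tail e = none),
        (-1) ^ (C.wt e + 1) / (C.wt e : ℚ) ^ 2 := by
  choose out ho using C.exists_tail
  have h1 := prod_edges_tail (fun e => (tr e).wtT) ho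
  rw [prod_edges_head _ he] at h1
  simp only [h.wtT_node hτ (ho _), prod_mul_distrib, prod_div_distrib] at h1
  have h2 : ∏ v, ∏ a ∈ C.inE v, (tr a).wtT ≠ 0 := prod_ne_zero_iff.2 fun v _ =>
    prod_ne_zero_iff.2 fun e _ => h.wtT_ne_zero hτ hC e
  have h3 : ∏ v, ((C.inE v).card.factorial : ℚ) ≠ 0 := prod_ne_zero_iff.2 fun v _ => by positivity
  rw [← mul_assoc] at h1
  have h4 := mul_right_cancel₀ h2 h1
  rw [h4, mul_assoc, div_mul_cancel₀ _ h3, mul_comm]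
  congr 1
  refine prod_congr rfl fun e he => ?_
  obtain ⟨n, ε, h5⟩ := h.leg e (by simpa using he)
  rw [h5, PTree.wtT]

/-- The bijections `f` and `g` form an isomorphism. -/
def IsIso (C D : TropicalCurve τ) (f : Fin C.nV ≃ Fin D.nV) (g : Fin C.nE ≃ Fin D.nE) : Prop :=
  ∀ e, D.tail (g e) = (C.tail e).map f ∧ D.head (g e) = (C.head e).map f ∧
    D.wt (g e) = C.wt e ∧ D.dom (g e) = C.dom e ∧ Set.EqOn (D.path (g e)) (C.path e) (C.dom e)

/-- The isomorphism respects the orderings. -/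
def Compat (o : C.Ordering) (o' : D.Ordering) (f : Fin C.nV ≃ Fin D.nV) (g : Fin C.nE ≃ Fin D.nE) :
    Prop :=
  ∀ v i i', i.val = i'.val → (o' (f v) i' : Fin D.nE) = g (o v i)

/-- The edges are reached in the same way from the unbounded legs. -/
inductive Cor (o : C.Ordering) (o' : D.Ordering) : Fin C.nE → Fin D.nE → Prop
  | root {e e'} : C.head e = none → D.head e' = none → Cor o o' e e'
  | step {e e' v v' i i'} : Cor o o' e e' → C.tail e = some v → D.tail e' = some v' →
      i.val = i'.val → Cor o o' (o v i) (o' v' i')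

lemma Cor.symm {a : Fin C.nE} {b : Fin D.nE} (h : Cor o o' a b) : Cor o' o b a := by
  induction h with
  | root h1 h2 => exact .root h2 h1
  | step _ h1 h2 h3 ih => exact .step ih h2 h1 h3.symm

lemma Cor.cases' {a : Fin C.nE} {b : Fin D.nE} (h : Cor o o' a b) :
    (C.head a = none ∧ D.head b = none) ∨ ∃ e e' v v' i i', Cor o o' e e' ∧ C.tail e = some v ∧
      D.tail e' = some v' ∧ i.val = i'.val ∧ a = o v i ∧ b = o' v' i' := by
  cases h with
  | root h1 h2 => exact .inl ⟨h1, h2⟩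
  | step h1 h2 h3 h4 => exact .inr ⟨_, _, _, _, _, _, h1, h2, h3, h4, rfl, rfl⟩

lemma head_ordering (o : C.Ordering) (v i) : C.head (o v i) = some v := C.mem_inE.1 (o v i).2

lemma Cor.functional {a : Fin C.nE} {b b' : Fin D.nE} (h : Cor o o' a b) (h' : Cor o o' a b') :
    b = b' := by
  induction h generalizing b' with
  | root h1 h2 =>
    rcases h'.cases' with ⟨-, h3⟩ | ⟨e, e', v, v', i, i', -, -, -, -, rfl, -⟩
    · exact D.root.unique h2 h3
    · simp [head_ordering] at h1
  | @step e e' v v' i i' _ h1 h2 h3 ih =>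
    rcases h'.cases' with ⟨h4, -⟩ | ⟨a, a', w, w', j, j', h4, h5, h6, h7, h8, rfl⟩
    · simp [head_ordering] at h4
    · have h9 := congrArg C.head h8
      rw [head_ordering, head_ordering, some.injEq] at h9
      subst h9
      obtain rfl := (C.tail_unique v).unique h1 h5
      obtain rfl := ih h4
      obtain rfl : v' = w' := some.inj (h2.symm.trans h6)
      obtain rfl : i = j := (o v).injective (Subtype.ext h8)
      rw [Fin.ext (h3.symm.trans h7)]

lemma IsMarked.tail_iff (h : C.IsMarked o pt dir tr) (h' : D.IsMarked o' pt' dir' tr')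
    {a : Fin C.nE} {b : Fin D.nE} (hab : tr a = tr' b) (hv : C.tail a = some v) :
    ∃ v', D.tail b = some v' ∧ ∀ i, ∃ i', i.val = i'.val ∧ tr (o v i) = tr' (o' v' i') := by
  rw [h.node a v hv] at hab
  cases hb : D.tail b with
  | none =>
    obtain ⟨n, ε, h1⟩ := h'.leg b hb
    rw [h1] at hab
    cases hab
  | some v' =>
    rw [h'.node b v' hb] at hab
    obtain ⟨h1, h2⟩ := PTree.node_inj hab
    exact ⟨v', rfl, fun i => ⟨Fin.cast h1 i, rfl, h2 i _ rfl⟩⟩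

lemma IsMarked.cor_tree (h : C.IsMarked o pt dir tr) (h' : D.IsMarked o' pt' dir' tr')
    (h0 : ∀ e e', C.head e = none → D.head e' = none → tr e = tr' e') {a : Fin C.nE} {b : Fin D.nE}
    (hab : Cor o o' a b) : tr a = tr' b := by
  induction hab with
  | root h1 h2 => exact h0 _ _ h1 h2
  | @step e e' v v' i i' _ h1 h2 h3 ih =>
    obtain ⟨w, h4, h5⟩ := h.tail_iff h' ih h1
    obtain rfl : v' = w := some.inj (h2.symm.trans h4)
    obtain ⟨j, h6, h7⟩ := h5 i
    rw [h7, Fin.ext (h3.symm.trans h6)]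

lemma IsMarked.cor_total (h : C.IsMarked o pt dir tr) (h' : D.IsMarked o' pt' dir' tr')
    (h0 : ∀ e e', C.head e = none → D.head e' = none → tr e = tr' e') (a : Fin C.nE) :
    ∃ b, Cor o o' a b := by
  refine C.root_induction (P := fun a => ∃ b, Cor o o' a b) (fun e he => ?_)
    (fun e v he ⟨b, hb⟩ e' he' => ?_) a
  · obtain ⟨r, hr, -⟩ := D.root
    exact ⟨r, .root he hr⟩
  · obtain ⟨v', h1, h2⟩ := h.tail_iff h' (h.cor_tree h' h0 hb) he
    obtain ⟨i', h3, -⟩ := h2 ((o v).symm ⟨e', he'⟩)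
    have := Cor.step hb he h1 h3
    rw [Equiv.apply_symm_apply] at this
    exact ⟨_, this⟩

lemma IsMarked.exists_iso (h : C.IsMarked o pt dir tr) (h' : D.IsMarked o' pt' dir' tr')
    (h0 : ∀ e e', C.head e = none → D.head e' = none → tr e = tr' e') :
    ∃ f g, IsIso C D f g ∧ Compat o o' f g := by
  choose g hg using h.cor_total h' h0
  choose g' hg' using h'.cor_total h fun e e' h1 h2 => (h0 e' e h2 h1).symm
  have ht : ∀ e, tr e = tr' (g e) := fun e => h.cor_tree h' h0 (hg e)
  let G : Fin C.nE ≃ Fin D.nE := ⟨g, g', fun e => (hg' (g e)).functional (hg e).symm,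
    fun e => (hg (g' e)).functional (hg' e).symm⟩
  have ht' : ∀ e, tr' e = tr (g' e) := fun e => by rw [ht]; exact congrArg tr' (G.right_inv e).symm
  choose out ho using C.exists_tail
  choose out' ho' using D.exists_tail
  choose f hf using fun v => h.tail_iff h' (ht (out v)) (ho v)
  choose f' hf' using fun v => h'.tail_iff h (ht' (out' v)) (ho' v)
  have hff : ∀ e v, C.tail e = some v → D.tail (g e) = some (f v) := fun e v he => by
    rw [(C.tail_unique v).unique he (ho v)]; exact (hf v).1
  have hff' : ∀ e v, D.tail e = some v → C.tail (g' e) = some (f' v) := fun e v he => by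
    rw [(D.tail_unique v).unique he (ho' v)]; exact (hf' v).1
  let F : Fin C.nV ≃ Fin D.nV := ⟨f, f',
    fun v => by
      have h1 := hff' _ _ (hff _ _ (ho v))
      rw [show g' (g (out v)) = out v from G.left_inv _, ho v] at h1
      exact (some.inj h1).symm,
    fun v => by
      have h1 := hff _ _ (hff' _ _ (ho' v))
      rw [show g (g' (out' v)) = out' v from G.right_inv _, ho' v] at h1
      exact (some.inj h1).symm⟩
  have hdir : ∀ e, C.wt e = D.wt (g e) ∧ dir e = dir' (g e) := fun e =>
    eq_of_prim (h.prim e) (h'.prim _) (C.wt_pos e) (by rw [← h.vec, ← h'.vec, ht])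
  have hpt : ∀ e, pt e = pt' (g e) := fun e => (h.realized e).unique (ht e ▸ h'.realized (g e))
  have hcor : ∀ e v i i', C.tail e = some v → i.val = i'.val → (o' (f v) i' : Fin D.nE) = g (o v i) :=
    fun e v i i' he hi => (Cor.step (hg e) he (hff e v he) hi).functional (hg _)
  refine ⟨F, G, fun e => ?_, fun v i i' hi => hcor _ v i i' (ho v) hi⟩
  have hhead : D.head (g e) = (C.head e).map f ∧ D.dom (g e) = C.dom e := by
    rcases (hg e).cases' with ⟨h1, h2⟩ | ⟨a, a', v, v', i, i', h1, h2, h3, h4, h5, h6⟩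
    · simp [CurveData.dom, h1, h2]
    · obtain rfl := h1.functional (hg a)
      obtain rfl : f v = v' := some.inj ((hff a v h2).symm.trans h3)
      have h7 : C.head e = some v := by rw [h5, head_ordering]
      have h8 : D.head (g e) = some (f v) := by rw [h6, head_ordering]
      have h9 := h'.glue (g a) (f v) h3 (g e) (D.mem_inE.2 h8)
      rw [← hpt, ← hpt, h.glue a v h2 e (C.mem_inE.2 h7), ← (hdir e).2] at h9
      have h10 := smul_left_injective ℝ (vecR_ne_zero (h.prim e).ne_zero) (add_left_cancel h9)
      simp [CurveData.dom, h7, h8, h10]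
  refine ⟨?_, hhead.1, (hdir e).1.symm, hhead.2, fun r hr => ?_⟩
  · cases he : C.tail e with
    | some v => exact hff e v he
    | none =>
      cases he' : D.tail (g e) with
      | none => rfl
      | some v' =>
        have h1 := hff' _ _ he'
        rw [show g' (g e) = e from G.left_inv _, he] at h1
        cases h1
  · rw [(h.lift e r hr).2, hpt, (hdir e).2]
    exact (h'.lift (g e) r (hhead.2.symm ▸ hr)).2

variable {f : Fin C.nV ≃ Fin D.nV} {g : Fin C.nE ≃ Fin D.nE}

lemma IsIso.mem_inE_iff (h : IsIso C D f g) (v e) : e ∈ C.inE v ↔ g e ∈ D.inE (f v) := by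
  rw [mem_inE, mem_inE, (h e).2.1]
  cases C.head e <;> simp

lemma IsIso.card_inE (h : IsIso C D f g) (v) : (C.inE v).card = (D.inE (f v)).card :=
  card_equiv g (h.mem_inE_iff v)

lemma IsIso.exists_compat (h : IsIso C D f g) (o : C.Ordering) : ∃ o' : D.Ordering, Compat o o' f g := by
  have h1 : ∀ v e, e ∈ C.inE (f.symm v) ↔ g e ∈ D.inE v := fun v e => by
    rw [h.mem_inE_iff, f.apply_symm_apply]
  have h2 : ∀ v, (D.inE v).card = (C.inE (f.symm v)).card := fun v =>
    (card_equiv g (h1 v)).symm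
  refine ⟨fun v => (finCongr (h2 v)).trans ((o (f.symm v)).trans (g.subtypeEquiv (h1 v))),
    fun v i i' hi => ?_⟩
  have h3 : ∀ w (_ : w = v) (j : Fin (C.inE w).card), j.val = i.val → (o w j : Fin C.nE) = o v i := by
    rintro w rfl j hj
    rw [Fin.ext hj]
  exact congrArg g (h3 _ (f.symm_apply_apply v) _ hi.symm)

lemma IsIso.isMarked (h : IsIso C D f g)
    (hc : Compat o o' f g) (hM : C.IsMarked o pt dir tr) :
    D.IsMarked o' (pt ∘ g.symm) (dir ∘ g.symm) (tr ∘ g.symm) := by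
  have key : ∀ {P : Fin D.nE → Prop}, (∀ e, P (g e)) → ∀ e, P e := fun h e =>
    g.apply_symm_apply e ▸ h (g.symm e)
  have htail : ∀ e v, D.tail (g e) = some v → ∃ w, C.tail e = some w ∧ f w = v := fun e v he => by
    rw [(h e).1, map_eq_some_iff] at he
    exact he
  refine ⟨key fun e => ?_, key fun e => ?_, key fun e => ?_, key fun e => ?_, key fun e he => ?_,
    key fun e v he => ?_, key fun e v he => key fun e' he' => ?_⟩ <;>
    simp only [Function.comp_apply, Equiv.symm_apply_apply]
  · intro r hr
    rw [(h e).2.2.2.1] at hr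
    rw [(h e).2.2.2.2 hr]
    exact hM.lift e r hr
  · exact hM.prim e
  · exact hM.realized e
  · rw [(h e).2.2.1]; exact hM.vec e
  · rw [(h e).2.2.1]
    rw [(h e).1, map_eq_none_iff] at he
    exact hM.leg e he
  · obtain ⟨w, h1, rfl⟩ := htail e v he
    rw [hM.node e w h1]
    refine PTree.node_congr (h.card_inE w) fun i i' hi => ?_
    rw [hc w i i' hi, Equiv.symm_apply_apply]
  · obtain ⟨w, h1, rfl⟩ := htail e v he
    rw [mem_inE, (h e').2.1, map_eq_some_iff] at he'
    obtain ⟨w', h2, h3⟩ := he'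
    obtain rfl := f.injective h3
    rw [hM.glue e w' h1 e' (C.mem_inE.2 h2)]
    have h4 := (h e').2.2.2.1
    rw [CurveData.dom, CurveData.dom, (h e').2.1, h2, if_neg (by simp), if_neg (by simp)] at h4
    have h5 : D.len (g e') = C.len e' := le_antisymm
      (h4 ▸ Set.right_mem_Icc.2 (D.len_pos _).le : D.len (g e') ∈ Set.Icc 0 (C.len e')).2
      (h4.symm ▸ Set.right_mem_Icc.2 (C.len_pos _).le : C.len e' ∈ Set.Icc 0 (D.len (g e'))).2
    rw [h5]

end TropicalCurve

end

section

open Finset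

namespace TropicalCurve

variable {τ : ZMod 3 → ℝ} {C D : TropicalCurve τ} {e : Fin C.nE} {x y : ℝ²} {m m' : ℤ²}

/-- The trees that describe the curve, when the unbounded leg is developed to `x + ℝ≥0 m`. -/
def trees (C : TropicalCurve τ) (x : ℝ²) (m : ℤ²) : Set PTree :=
  {T | ∃ o pt dir tr, C.IsMarked o pt dir tr ∧
    ∀ e, C.head e = none → pt e = x ∧ dir e = m ∧ tr e = T}

lemma Compat.edge_eq {f f' : Fin C.nV ≃ Fin D.nV} {g g' : Fin C.nE ≃ Fin D.nE} {o : C.Ordering}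
    {o' : D.Ordering} (hi : IsIso C D f g) (hi' : IsIso C D f' g') (h : Compat o o' f g)
    (h' : Compat o o' f' g') : f = f' ∧ g = g' := by
  have h1 : ∀ e, g e = g' e := by
    refine C.root_induction (fun e he => ?_) fun e v he ih e' he' => ?_
    · exact D.root.unique (by rw [(hi e).2.1, he]; rfl) (by rw [(hi' e).2.1, he]; rfl)
    · have h2 := (hi e).1
      rw [ih, (hi' e).1, he] at h2
      have h3 : f' v = f v := Option.some.inj h2
      obtain ⟨i, hi⟩ := (o v).surjective ⟨e', he'⟩
      have h4 : ∀ w (_ : w = f v), ∀ j : Fin (D.inE w).card, j.val = i.val →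
          (o' w j : Fin D.nE) = g (o v i) := by
        rintro _ rfl j hj
        exact h v i j hj.symm
      have h6 := h' v i (Fin.cast (hi'.card_inE v) i) rfl
      rw [h4 _ h3 _ rfl, hi] at h6
      exact h6
  refine ⟨Equiv.ext fun v => ?_, Equiv.ext h1⟩
  obtain ⟨e, he⟩ := C.exists_tail v
  have h2 := (hi e).1
  rw [h1, (hi' e).1, he] at h2
  exact (Option.some.inj h2).symm

lemma trees_weight (hτ : Interior τ) (hC : ∀ v, C.vertexMult τ v ≠ 0)
    (hm : IsPrim m) (hl : ∀ e, C.head e = none → C.Lift e x m) :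
    (C.trees x m).Finite ∧ (C.trees x m).Nonempty ∧ ∑ᶠ T ∈ C.trees x m, T.wtT = C.mult τ := by
  classical
  obtain ⟨r, hr, -⟩ := C.root
  choose pt dir tr hM h0 using C.exists_isMarked hτ hC hm hl
  have hroot : ∀ e, C.head e = none → e = r := fun e he => C.root.unique he hr
  set t : C.Ordering → PTree := fun o => tr o r with ht
  have ht_eq : ∀ {o pt' dir' tr'}, C.IsMarked o pt' dir' tr' → pt' r = x → tr' r = t o := by
    intro o pt' dir' tr' h h1
    rw [h.unique hτ (hM o) fun e he => by rw [hroot e he, h1, (h0 o r hr).1]]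
  have htrees : C.trees x m = Set.range t := by
    ext T
    constructor
    · rintro ⟨o, pt', dir', tr', h1, h2⟩
      exact ⟨o, by rw [← ht_eq h1 (h2 r hr).1, (h2 r hr).2.2]⟩
    · rintro ⟨o, rfl⟩
      refine ⟨o, _, _, _, hM o, fun e he => ?_⟩
      rw [hroot e he]
      exact ⟨(h0 o r hr).1, (h0 o r hr).2, rfl⟩
  have hfib : ∀ o₀, (univ.filter fun o => t o = t o₀).card = Nat.card C.autSet := by
    intro o₀
    have h1 : ∀ a : C.autSet, ∃ o : {o // t o = t o₀}, Compat o₀ o.1 a.1.1 a.1.2 := by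
      rintro ⟨⟨f, g⟩, h⟩
      obtain ⟨o, ho⟩ := IsIso.exists_compat h o₀
      have h2 := IsIso.isMarked h ho (hM o₀)
      have h3 : g r = r := hroot _ (by rw [(h r).2.1, hr]; rfl)
      have h4 : g.symm r = r := by rw [Equiv.symm_apply_eq, h3]
      refine ⟨⟨o, ?_⟩, ho⟩
      rw [← ht_eq h2 (by simp [h4, (h0 o₀ r hr).1]), Function.comp_apply, h4]
    choose Φ hΦ using h1
    rw [← Fintype.card_subtype, ← Nat.card_eq_fintype_card]
    refine (Nat.card_eq_of_bijective Φ ⟨fun a b hab => ?_, fun ⟨o, ho⟩ => ?_⟩).symm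
    · have h2 := hΦ b
      rw [← hab] at h2
      obtain ⟨h3, h4⟩ := (hΦ a).edge_eq a.2 b.2 h2
      exact Subtype.ext (Prod.ext h3 h4)
    · obtain ⟨f, g, h2, h3⟩ := (hM o₀).exists_iso (hM o) fun e e' he he' => by
        rw [hroot e he, hroot e' he']; exact ho.symm
      refine ⟨⟨(f, g), h2⟩, Subtype.ext ?_⟩
      have h4 := hΦ ⟨(f, g), h2⟩
      refine funext fun v => Equiv.ext fun i => Subtype.ext ?_
      obtain ⟨w, rfl⟩ := f.surjective v
      have h5 := h2.card_inE w
      rw [h4 w (Fin.cast h5.symm i) i rfl, h3 w (Fin.cast h5.symm i) i rfl]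
  have hcard : (Fintype.card C.Ordering : ℚ) = ∏ v, ((C.inE v).card.factorial : ℚ) := by
    rw [Fintype.card_pi]
    push_cast
    exact prod_congr rfl fun v _ => by
      rw [Fintype.card_equiv (C.inE v).equivFin.symm, Fintype.card_fin]
  have hfac : ∏ v, ((C.inE v).card.factorial : ℚ) ≠ 0 := prod_ne_zero_iff.2 fun v _ => by positivity
  refine ⟨htrees ▸ Set.finite_range t,
    htrees ▸ ⟨_, fun v => (C.inE v).equivFin.symm, rfl⟩, ?_⟩
  have hcoe : C.trees x m = ((univ.image t : Finset PTree) : Set PTree) := by simp [htrees]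
  rw [hcoe, finsum_mem_coe_finset]
  have hsum := sum_comp (s := univ) (fun T : PTree => T.wtT) t
  have hA : ∀ T ∈ univ.image t, (univ.filter fun o => t o = T).card • T.wtT =
      (Nat.card C.autSet : ℚ) * T.wtT := by
    intro T hT
    obtain ⟨o₀, -, rfl⟩ := mem_image.1 hT
    rw [hfib, nsmul_eq_mul]
  rw [sum_congr rfl hA, ← mul_sum] at hsum
  have hconst := sum_congr (s₁ := (univ : Finset C.Ordering)) rfl fun o _ => (hM o).wtT_root hτ hC hr
  rw [← sum_mul, sum_const, card_univ, nsmul_eq_mul, hcard, mul_comm] at hconst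
  have h1 := mul_left_cancel₀ hfac hconst
  rw [hsum] at h1
  have h2 : (Nat.card C.autSet : ℚ) ≠ 0 := by
    have : Nat.card C.autSet ≠ 0 := by
      let o₀ : C.Ordering := fun v => (C.inE v).equivFin.symm
      rw [← hfib o₀]
      exact card_ne_zero.2 ⟨o₀, by simp⟩
    exact_mod_cast this
  rw [CurveData.mult, mul_assoc, ← h1, one_div, inv_mul_cancel_left₀ h2]

lemma vertexMult_ne_zero_of_mult (h : C.mult τ ≠ 0) (v : Fin C.nV) : C.vertexMult τ v ≠ 0 := by
  have h1 := prod_ne_zero_iff.1 (right_ne_zero_of_mul (left_ne_zero_of_mul h)) v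
    (mem_univ v)
  exact_mod_cast h1

lemma trees_vertexMult {T : PTree} (hτ : Interior τ) (h : T ∈ C.trees x m)
    (hT : T.wtT ≠ 0) (v : Fin C.nV) : C.vertexMult τ v ≠ 0 := by
  obtain ⟨o, pt, dir, tr, h1, h2⟩ := h
  exact h1.vertexMult_ne_zero hτ (fun e he => (h2 e he).2.2 ▸ hT) v

lemma trees_realized {T : PTree} (h : T ∈ C.trees x m) (he : C.head e = none) :
    T.At τ x ∧ T.vec = (C.wt e : ℤ) • m ∧ C.Lift e x m ∧ IsPrim m := by
  obtain ⟨o, pt, dir, tr, h1, h2⟩ := h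
  obtain ⟨rfl, rfl, rfl⟩ := h2 e he
  exact ⟨h1.realized e, h1.vec e, h1.lift e, h1.prim e⟩

lemma iso_of_trees {T : PTree} (h : T ∈ C.trees x m) (h' : T ∈ D.trees y m') :
    C.toCurveData.Iso D.toCurveData := by
  obtain ⟨o, pt, dir, tr, h1, h2⟩ := h
  obtain ⟨o', pt', dir', tr', h1', h2'⟩ := h'
  obtain ⟨f, g, h3, -⟩ := h1.exists_iso h1' fun e e' he he' => by
    rw [(h2 e he).2.2, (h2' e' he').2.2]
  exact ⟨f, g, h3⟩

lemma trees_of_iso {T : PTree} (h : C.toCurveData.Iso D.toCurveData) (hT : T ∈ C.trees x m) :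
    T ∈ D.trees x m := by
  obtain ⟨f, g, h⟩ := h
  obtain ⟨o, pt, dir, tr, h1, h2⟩ := hT
  obtain ⟨o', ho'⟩ := IsIso.exists_compat h o
  refine ⟨o', _, _, _, IsIso.isMarked h ho' h1, fun e he => ?_⟩
  obtain ⟨e, rfl⟩ := g.surjective e
  rw [(h e).2.1, Option.map_eq_none_iff] at he
  simpa using h2 e he

end TropicalCurve

end

section

open Finset

variable {τ : ZMod 3 → ℝ}

lemma exists_chart (hτ : Interior τ) {q : ℝ²} (hq : q ∈ outer)
    (hs : q ∉ singSet τ) : ∃ κ ∈ charts τ, ∀ᶠ z in 𝓝 q, z ∈ outer → (z, outPt z) ∈ κ := by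
  set n := ⌊q.1⌋ with hn
  have h1 := Int.floor_le q.1
  have h2 := Int.lt_floor_add_one q.1
  have hsing : ∀ k : ℤ, (k : ℝ) < (singPt τ k).1 ∧ (singPt τ k).1 < k + 1 := fun k => by
    have := hτ k
    constructor <;> simp only [singPt] <;> linarith [this.1, this.2]
  have hstar : ∀ k : ℤ, (singPt τ (k - 1)).1 < q.1 → q.1 < (singPt τ k).1 →
      ∃ κ ∈ charts τ, ∀ᶠ z in 𝓝 q, z ∈ outer → (z, outPt z) ∈ κ := fun k h3 h4 => by
    refine ⟨starChart τ k, .inr ⟨k, rfl⟩, ?_⟩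
    filter_upwards [continuous_fst.continuousAt.eventually (lt_mem_nhds h3),
      continuous_fst.continuousAt.eventually (gt_mem_nhds h4)] with z h5 h6 hz
    exact .inl ⟨hz, h5, h6, outPt_eq hz⟩
  obtain ⟨k, hk⟩ := mem_outer.1 hq
  rcases ((edgeLine_le h1 h2.le k).trans hk).lt_or_eq with h3 | h3
  · refine ⟨outerChart, .inl (.inl rfl), ?_⟩
    filter_upwards [isOpen_interior.mem_nhds (mem_interior_outer h3)] with z hz hz'
    exact ⟨hz', hz, outPt_eq hz'⟩
  · rcases lt_trichotomy q.1 (singPt τ n).1 with h4 | h4 | h4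
    · refine hstar n ?_ h4
      have := (hsing (n - 1)).2
      push_cast at this
      linarith
    · refine absurd ⟨n, Prod.ext h4.symm ?_⟩ hs
      rw [← h3, ← hn, h4]; rfl
    · refine hstar (n + 1) (by rwa [add_sub_cancel_right]) ?_
      have := (hsing (n + 1)).1
      push_cast at this
      linarith

namespace PTree

lemma At.node_notMem (hτ : Interior τ) {k : ℕ} {ts : Fin k → PTree} {p : ℝ²}
    (h : (node k ts).At τ p) : p ∉ singSet τ := by
  rintro ⟨n, rfl⟩
  have h1 := (h.node_facts hτ).1
  have h2 := height_singPt hτ n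
  linarith

lemma Thru.notMem (hτ : Interior τ) : ∀ {T : PTree} {p : ℝ²}, T.Thru τ p →
    p ∉ singSet τ
  | node k ts, p, h => by
    rintro ⟨n, rfl⟩
    have h1 := h.node_height_pos hτ
    have h2 := height_singPt hτ n
    linarith
  | leg n ε w, p, h => by
    rintro ⟨n', rfl⟩
    have h1 : (singPt τ n').2 = edgeLine n (singPt τ n').1 := congrArg Prod.snd h.leg_snd
    obtain ⟨q, s, hs, ⟨rfl, hw⟩, h2⟩ := h
    have h3 := hτ n'
    have h4 := edgeLine_sub n' n (singPt τ n').1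
    rw [← h1, show edgeLine n' (singPt τ n').1 = (singPt τ n').2 from rfl, sub_self] at h4
    simp only [singPt] at h4
    have h5 : n' = n := by
      by_contra h5
      have h6 : (n' : ℝ) - n ≠ 0 := sub_ne_zero.2 (mod_cast h5)
      have h7 : ((n' : ℝ) + n + 1) / 2 - (n' + τ n') = 0 :=
        (mul_eq_zero.1 h4.symm).resolve_left (by positivity)
      have h8 : (n : ℝ) < n' + 1 := by linarith [h3.2]
      have h9 : (n' : ℝ) < n + 1 := by linarith [h3.1]
      have h10 : n < n' + 1 := mod_cast h8
      have h11 : n' < n + 1 := mod_cast h9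
      omega
    subst h5
    have h6 : s * ((w : ℝ) * ((ε : ℤ) : ℝ)) = 0 := by
      have := congrArg Prod.fst h2
      simpa [singPt, vec, vecR] using this
    rcases Int.units_eq_one_or ε with rfl | rfl <;> simp [hs.ne', hw.ne'] at h6

lemma Thru.mem_outer (hτ : Interior τ) : ∀ {T : PTree} {p : ℝ²},
    T.Thru τ p → p ∈ outer
  | node _ _, _, h => mem_outer_of_height (h.node_height_pos hτ).le
  | leg n _ _, _, h => mem_outer_of_le (n := n) (congrArg Prod.snd h.leg_snd).ge

lemma At.mem_outer (hτ : Interior τ) : ∀ {T : PTree} {p : ℝ²},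
    T.At τ p → p ∈ outer
  | node _ _, _, h => mem_outer_of_height (h.node_facts hτ).1
  | leg n _ _, _, h => mem_outer_of_le (n := n) (by rw [h.1]; rfl)

lemma At.vec_ne_zero' (hτ : Interior τ) : ∀ {T : PTree} {p : ℝ²},
    T.At τ p → T.vec ≠ 0
  | node _ _, _, h => h.vec_ne_zero hτ (h.node_notMem hτ)
  | leg _ _ w, _, h => fun h0 => by simpa [vec, h.2.ne'] using congrArg Prod.fst h0

end PTree

lemma edgeBary_mem {i : ZMod 3} {s : ℝ} (hs : s ∈ Set.Icc (0 : ℝ) 1) :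
    edgeBary i s ∈ stdSimplex ℝ (ZMod 3) := by
  refine ⟨fun j => add_nonneg ?_ ?_, ?_⟩
  · rw [Pi.single_apply]; split_ifs <;> linarith [hs.2]
  · rw [Pi.single_apply]; split_ifs <;> linarith [hs.1]
  · simp [edgeBary, sum_add_distrib]

/-- The tropical curve with a given development. -/
lemma exists_curve_of_development (hτ : Interior τ) (D : CurveData)
    {pt : Fin D.nE → ℝ²} {dir : Fin D.nE → ℤ²} {tr : Fin D.nE → PTree}
    (hpath : ∀ e r, D.path e r = outPt (pt e + r • vecR (dir e))) (hV : 0 < D.nV)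
    (hwt : ∀ e, 0 < D.wt e) (hlen : ∀ e, 0 < D.len e) (hroot : ∃! e, D.head e = none)
    (htail : ∀ v, ∃! e, D.tail e = some v)
    (hrk : ∃ rk : Fin D.nV → ℕ, ∀ e v w, D.tail e = some v → D.head e = some w → rk v < rk w)
    (hprim : ∀ e, IsPrim (dir e)) (hat : ∀ e, (tr e).At τ (pt e))
    (hvec : ∀ e, (tr e).vec = (D.wt e : ℤ) • dir e)
    (hleg : ∀ e, D.tail e = none → ∃ n ε, tr e = PTree.leg n ε (D.wt e))
    (o : ∀ v, Fin (D.inE v).card ≃ D.inE v)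
    (hnode : ∀ e v, D.tail e = some v → tr e = .node _ fun i => tr (o v i))
    (hglue : ∀ e v, D.tail e = some v → ∀ e' ∈ D.inE v, pt e = pt e' + D.len e' • vecR (dir e')) :
    ∃ C : TropicalCurve τ, ∀ e, D.head e = none → tr e ∈ C.trees (pt e) (dir e) := by
  have hthru : ∀ e (r : ℝ), 0 < r → (tr e).Thru τ (pt e + r • vecR (dir e)) := fun e r hr =>
    ⟨pt e, r / D.wt e, div_pos hr (mod_cast hwt e), hat e, by
      rw [hvec, ← TropicalCurve.smul_vecR_div (hwt e)]⟩
  have hout : ∀ e (r : ℝ), 0 ≤ r → pt e + r • vecR (dir e) ∈ outer := fun e r hr => by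
    rcases hr.lt_or_eq with h | rfl
    · exact (hthru e r h).mem_outer hτ
    · rw [zero_smul, add_zero]; exact (hat e).mem_outer hτ
  have hcont : ∀ e (s : ℝ), Filter.Tendsto (fun r : ℝ => pt e + r • vecR (dir e)) (𝓝 s)
      (𝓝 (pt e + s • vecR (dir e))) := fun e s => Continuous.tendsto (by fun_prop) s
  let C : TropicalCurve τ :=
    { D with
      nV_pos := hV
      wt_pos := hwt
      len_pos := hlen
      root := hroot
      tail_unique := htail
      acyclic := hrk
      valency := fun v => by
        obtain ⟨e, he, -⟩ := htail v
        have := hat e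
        rw [hnode e v he] at this
        exact this.1
      start := fun e he => by
        obtain ⟨n, ε, h⟩ := hleg e he
        have h1 := hat e
        have h2 := hvec e
        rw [h] at h1 h2
        have h3 : dir e = (ε : ℤ) • (1, -3 * n) := by
          have h0 : (D.wt e : ℤ) ≠ 0 := mod_cast (hwt e).ne'
          rw [PTree.vec, ← smul_smul] at h2
          exact (smul_right_injective _ h0 h2).symm
        refine ⟨n, ε, ?_⟩
        have h4 : Filter.Tendsto (fun s : ℝ => τ n + ((ε : ℤ) : ℝ) * s) (𝓝 0) (𝓝 (τ n)) := by
          have : Continuous fun s : ℝ => τ n + ((ε : ℤ) : ℝ) * s := by fun_prop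
          simpa using this.tendsto 0
        filter_upwards [(h4.eventually (Icc_mem_nhds (hτ n).1 (hτ n).2)).filter_mono
          nhdsWithin_le_nhds] with s hs
        refine ⟨⟨_, edgeBary_mem hs⟩, rfl, ?_⟩
        rw [ofTri_edgeBary hs rfl, ← outPt_eq, hpath, h1.1, h3]
        congr 1
        ext <;> simp [singPt, vecR, edgeLine] <;> ring
      affine := fun e s hs _ => by
        obtain ⟨κ, hκ, h⟩ := exists_chart hτ (hout e s hs.le) ((hthru e s hs).notMem hτ)
        refine ⟨κ, hκ, pt e + s • vecR (dir e), dir e, hprim e, ?_⟩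
        filter_upwards [(hcont e s).eventually h, lt_mem_nhds hs] with r hr hr0
        rw [add_assoc, ← add_smul, add_sub_cancel, hpath]
        exact hr (hout e r hr0.le)
      balanced := fun v => by
        obtain ⟨e, he, hu⟩ := htail v
        have h0 := hat e
        rw [hnode e v he] at h0
        obtain ⟨κ, hκ, h⟩ := exists_chart hτ (h0.mem_outer hτ) (h0.node_notMem hτ)
        have hoe : D.outE v = {e} := by
          ext a
          simp only [CurveData.outE, mem_filter, mem_univ, true_and,
            mem_singleton]
          exact ⟨hu a, fun h => h ▸ he⟩
        refine ⟨κ, pt e, dir, hκ, ?_, fun a ha => ⟨hprim a, ?_⟩, ?_⟩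
        · rw [hoe]
          rintro a ha
          obtain rfl := mem_singleton.1 ha
          refine ⟨hprim a, ?_⟩
          have h1 := hcont a 0
          rw [zero_smul, add_zero] at h1
          filter_upwards [(h1.eventually h).filter_mono nhdsWithin_le_nhds,
            self_mem_nhdsWithin] with r hr hr0
          rw [hpath]
          exact hr (hout a r hr0)
        · have h1 := hcont a (D.len a)
          rw [← hglue e v he a ha] at h1
          filter_upwards [(h1.eventually h).filter_mono nhdsWithin_le_nhds,
            (lt_mem_nhds (hlen a)).filter_mono nhdsWithin_le_nhds] with r hr hr0
          rw [hpath, hglue e v he a ha, add_assoc, ← add_smul, add_sub_cancel]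
          exact hr (hout a r hr0.le)
        · rw [hoe, sum_singleton, ← hvec, hnode e v he, PTree.vec,
            ← sum_coe_sort (D.inE v), ← Equiv.sum_comp (o v)]
          exact sum_congr rfl fun i _ => (hvec _).symm }
  refine ⟨C, fun e he => ⟨o, pt, dir, tr, ⟨fun e r hr => ?_, hprim, hat, hvec, hleg, hnode, hglue⟩,
    fun e' he' => ?_⟩⟩
  · have hr0 := (C.mem_dom.1 hr).1
    exact ⟨hout e r hr0, hpath e r⟩
  · obtain rfl := hroot.unique he' he
    exact ⟨rfl, rfl, rfl⟩

end

section

open Finset PTree Option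

namespace PTree

/-- The subtrees just behind the root vertex. -/
def child : PTree → ℕ → Option PTree
  | leg _ _ _, _ => none
  | node k ts, i => if h : i < k then some (ts ⟨i, h⟩) else none

lemma child_eq {S S' : PTree} {i : ℕ} : S.child i = some S' ↔
    ∃ k ts, S = node k ts ∧ ∃ j : Fin k, j.val = i ∧ S' = ts j := by
  cases S with
  | leg => simp [child]
  | node k ts =>
    simp only [child, dite_none_right_eq_some, some.injEq]
    constructor
    · rintro ⟨h, rfl⟩
      exact ⟨k, ts, rfl, ⟨i, h⟩, rfl, rfl⟩
    · rintro ⟨_, _, h, j, rfl, rfl⟩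
      cases h
      exact ⟨j.2, rfl⟩

/-- The subtree at an address. -/
def sub (T : PTree) : List ℕ → Option PTree
  | [] => some T
  | i :: l => (T.sub l).bind fun S => S.child i

lemma sub_append (T : PTree) (i : ℕ) : ∀ l, T.sub (l ++ [i]) = (T.child i).bind fun S => S.sub l
  | [] => by simp [sub]
  | j :: l => by
    rw [List.cons_append, sub, sub_append T i l, bind_assoc]
    rfl

lemma finite_sub (T : PTree) : {l | ∃ S, T.sub l = some S}.Finite := by
  have hsplit : ∀ T : PTree, {l | ∃ S, T.sub l = some S} ⊆
      {[]} ∪ {l | ∃ l' i S, l = l' ++ [i] ∧ T.child i = some S ∧ ∃ S', S.sub l' = some S'} := by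
    rintro T l ⟨S, hS⟩
    rcases List.eq_nil_or_concat l with rfl | ⟨l', i, rfl⟩
    · exact .inl rfl
    · rw [List.concat_eq_append] at hS ⊢
      rw [sub_append, bind_eq_some_iff] at hS
      obtain ⟨S', h1, h2⟩ := hS
      exact .inr ⟨l', i, S', rfl, h1, S, h2⟩
  induction T with
  | leg n ε w =>
    refine (Set.finite_singleton []).subset ((hsplit _).trans ?_)
    rintro l (h | ⟨l', i, S, -, h, -⟩)
    · exact h
    · cases h
  | node k ts ih =>
    refine ((Set.finite_singleton []).union (Set.finite_iUnion fun j : Fin k =>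
      (ih j).image (· ++ [j.val]))).subset ((hsplit _).trans (Set.union_subset_union_right _ ?_))
    rintro l ⟨l', i, S, rfl, h, h'⟩
    obtain ⟨_, _, h1, j, rfl, rfl⟩ := child_eq.1 h
    cases h1
    exact Set.mem_iUnion.2 ⟨j, l', h', rfl⟩

lemma sub_cons {T S : PTree} {i : ℕ} {l : List ℕ} : T.sub (i :: l) = some S ↔
    ∃ k ts, T.sub l = some (node k ts) ∧ ∃ j : Fin k, j.val = i ∧ S = ts j := by
  rw [sub, bind_eq_some_iff]
  constructor
  · rintro ⟨S', h1, h2⟩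
    obtain ⟨k, ts, rfl, h3⟩ := child_eq.1 h2
    exact ⟨k, ts, h1, h3⟩
  · rintro ⟨k, ts, h1, h3⟩
    exact ⟨_, h1, child_eq.2 ⟨k, ts, rfl, h3⟩⟩

lemma At.sub {τ : ZMod 3 → ℝ} {T : PTree} {p : ℝ²} (h : T.At τ p) :
    ∀ {l : List ℕ} {S : PTree}, T.sub l = some S → ∃ q, S.At τ q
  | [], S, hS => ⟨p, some.inj hS ▸ h⟩
  | i :: l, S, hS => by
    obtain ⟨k, ts, h1, j, -, rfl⟩ := sub_cons.1 hS
    obtain ⟨q, hq⟩ := h.sub h1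
    obtain ⟨q', -, -, h2, -⟩ := (at_node.1 hq).2.1 j
    exact ⟨q', h2⟩

end PTree

lemma exists_option {α : Type} (P : α → Prop) (hP : ∀ a b, P a → P b → a = b) :
    ∃ x : Option α, ∀ a, x = some a ↔ P a := by
  by_cases h : ∃ a, P a
  · obtain ⟨a, ha⟩ := h
    exact ⟨some a, fun b => ⟨fun h => some.inj h ▸ ha, fun hb => by rw [hP a b ha hb]⟩⟩
  · exact ⟨none, fun b => ⟨nofun, fun hb => absurd ⟨b, hb⟩ h⟩⟩

/-- Every tree that is realized in the plane describes a tropical curve. -/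
lemma exists_curve {τ : ZMod 3 → ℝ} (hτ : Interior τ) {k : ℕ}
    {ts : Fin k → PTree} {p : ℝ²} (hT : (node k ts).At τ p) {m : ℤ²} (hm : IsPrim m)
    {w : ℕ} (hw : (node k ts).vec = (w : ℤ) • m) :
    ∃ C : TropicalCurve τ, ∀ e, C.head e = none → node k ts ∈ C.trees p m := by
  set T := node k ts
  have hfin : Finite {l // ∃ S, T.sub l = some S} := T.finite_sub
  have hfin' : Finite {l // ∃ k ts, T.sub l = some (.node k ts)} :=
    (T.finite_sub.subset (t := {l | ∃ k ts, T.sub l = some (.node k ts)})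
      fun l ⟨k, ts, h⟩ => ⟨_, h⟩).to_subtype
  obtain ⟨nE, ⟨a⟩⟩ := Finite.exists_equiv_fin {l // ∃ S, T.sub l = some S}
  obtain ⟨nV, ⟨b⟩⟩ := Finite.exists_equiv_fin {l // ∃ k ts, T.sub l = some (.node k ts)}
  set A : Fin nE → List ℕ := fun e => (a.symm e).1 with hA
  set B : Fin nV → List ℕ := fun v => (b.symm v).1 with hB
  have hAinj : ∀ e e', A e = A e' → e = e' := fun e e' h => a.symm.injective (Subtype.ext h)
  have hBinj : ∀ v v', B v = B v' → v = v' := fun e e' h => b.symm.injective (Subtype.ext h)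
  have hAsurj : ∀ l S, T.sub l = some S → ∃ e, A e = l := fun l S h =>
    ⟨a ⟨l, S, h⟩, by rw [hA]; simp⟩
  have hBsurj : ∀ l k ts, T.sub l = some (.node k ts) → ∃ v, B v = l := fun l k ts h =>
    ⟨b ⟨l, k, ts, h⟩, by rw [hB]; simp⟩
  choose tr htr using fun e => (a.symm e).2
  choose kk tt htt using fun v => (b.symm v).2
  change ∀ e, T.sub (A e) = some (tr e) at htr
  change ∀ v, T.sub (B v) = some (.node (kk v) (tt v)) at htt
  choose pt hat using fun e => hT.sub (htr e)
  choose wt dir hwt hprim hvec using fun e => exists_prim ((hat e).vec_ne_zero' hτ)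
  choose tail htail using fun e => exists_option (fun v => A e = B v) fun v v' h h' =>
    hBinj _ _ (h.symm.trans h')
  choose head hhead using fun e => exists_option (fun v => ∃ i, A e = i :: B v)
    fun v v' ⟨i, h⟩ ⟨i', h'⟩ => hBinj _ _ (List.cons.inj (h.symm.trans h')).2
  have htrv : ∀ e v, tail e = some v → tr e = .node (kk v) (tt v) := fun e v he => by
    have h1 := htr e
    rw [(htail e v).1 he, htt] at h1
    exact (some.inj h1).symm
  have hφ : ∀ v (j : Fin (kk v)), ∃ e, A e = j.val :: B v := fun v j =>
    hAsurj _ _ (sub_cons.2 ⟨_, _, htt v, j, rfl, rfl⟩)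
  choose φ hφ using hφ
  have hφtr : ∀ v j, tr (φ v j) = tt v j := fun v j => by
    have h1 := htr (φ v j)
    rw [hφ, sub_cons.2 ⟨_, _, htt v, j, rfl, rfl⟩] at h1
    exact (some.inj h1).symm
  have hheadφ : ∀ e v, head e = some v ↔ ∃ j, e = φ v j := fun e v => by
    rw [hhead]
    constructor
    · rintro ⟨i, h⟩
      have h1 := htr e
      rw [h, sub_cons] at h1
      obtain ⟨k', ts', h2, j, rfl, -⟩ := h1
      obtain ⟨rfl, -⟩ := node_inj (some.inj ((htt v).symm.trans h2))
      exact ⟨j, hAinj _ _ (h.trans (hφ v j).symm)⟩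
    · rintro ⟨j, rfl⟩
      exact ⟨j, hφ v j⟩
  have hlen : ∀ e, ∃ s : ℝ, 0 < s ∧ ∀ f v, tail f = some v → head e = some v →
      pt f = pt e + s • vecR (dir e) := by
    intro e
    by_cases h : ∃ f v, tail f = some v ∧ head e = some v
    · obtain ⟨f, v, h1, h2⟩ := h
      obtain ⟨j, rfl⟩ := (hheadφ e v).1 h2
      have h3 := hat f
      rw [htrv f v h1] at h3
      obtain ⟨q, s, hs, h4, h5⟩ := (at_node.1 h3).2.1 j
      refine ⟨s * wt (φ v j), mul_pos hs (mod_cast hwt _), fun f' v' h1' h2' => ?_⟩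
      obtain rfl : v = v' := some.inj (h2.symm.trans h2')
      obtain rfl := hAinj f f' (((htail f v).1 h1).trans ((htail f' v).1 h1').symm)
      rw [← hφtr] at h4 h5
      rw [h5, hvec, h4.unique (hat _), vecR_smul_int, smul_smul, Int.cast_natCast]
    · exact ⟨1, one_pos, fun f v h1 h2 => absurd ⟨f, v, h1, h2⟩ h⟩
  choose len hlen hglue using hlen
  let D : CurveData :=
    { nV := nV, nE := nE, tail := tail, head := head, wt := wt, len := len
      path := fun e r => outPt (pt e + r • vecR (dir e)) }
  have hroot : ∀ e, head e = none ↔ A e = [] := by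
    intro e
    constructor
    · intro h
      cases hl : A e with
      | nil => rfl
      | cons i l =>
        have h1 := htr e
        rw [hl, sub_cons] at h1
        obtain ⟨k', ts', h2, -⟩ := h1
        obtain ⟨v, hv⟩ := hBsurj _ _ _ h2
        have h3 := (hhead e v).2 ⟨i, by rw [hl, hv]⟩
        rw [h] at h3
        cases h3
    · intro h
      cases h1 : head e with
      | none => rfl
      | some v =>
        obtain ⟨i, h2⟩ := (hhead e v).1 h1
        rw [h] at h2
        cases h2
  have hinE : ∀ v, D.inE v = univ.image (φ v) := fun v => by
    ext e
    simp only [CurveData.inE, mem_filter, mem_univ, true_and, mem_image]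
    exact (hheadφ e v).trans (exists_congr fun _ => eq_comm)
  have hφinj : ∀ v, Function.Injective (φ v) := fun v j j' h => by
    have h1 := hφ v j
    rw [h, hφ] at h1
    exact (Fin.ext (List.cons.inj h1).1).symm
  have hcard : ∀ v, (D.inE v).card = kk v := fun v => by
    rw [hinE, card_image_of_injective _ (hφinj v), card_fin]
  have hmem : ∀ v j, φ v j ∈ D.inE v := fun v j => by
    rw [hinE]; exact mem_image_of_mem _ (mem_univ _)
  let o : ∀ v, Fin (D.inE v).card ≃ D.inE v := fun v =>
    Equiv.ofBijective (fun i => ⟨φ v (Fin.cast (hcard v) i), hmem v _⟩) ⟨fun i j h =>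
      Fin.cast_injective _ (hφinj v (congrArg Subtype.val h)), fun ⟨e, he⟩ => by
      rw [hinE] at he
      obtain ⟨j, -, rfl⟩ := mem_image.1 he
      exact ⟨Fin.cast (hcard v).symm j, rfl⟩⟩
  obtain ⟨r, hr⟩ := hAsurj [] T rfl
  obtain ⟨v₀, -⟩ := hBsurj [] k ts rfl
  have htrr : ∀ e, head e = none → tr e = T := fun e he => by
    have h1 := htr e
    rw [(hroot e).1 he] at h1
    exact (some.inj h1).symm
  obtain ⟨C, hC⟩ := exists_curve_of_development hτ D (pt := pt) (dir := dir) (tr := tr)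
    (fun _ _ => rfl) v₀.pos hwt hlen
    ⟨r, (hroot r).2 hr, fun e he => hAinj _ _ (((hroot e).1 he).trans hr.symm)⟩
    (fun v => by
      obtain ⟨e, he⟩ := hAsurj _ _ (htt v)
      exact ⟨e, (htail e v).2 he, fun e' he' => hAinj _ _ (((htail e' v).1 he').trans he.symm)⟩)
    ⟨fun v => ∑ u, (B u).length - (B v).length, fun e v u h1 h2 => by
      obtain ⟨i, h3⟩ := (hhead e u).1 h2
      rw [(htail e v).1 h1] at h3
      have h4 := congrArg List.length h3
      have h5 := single_le_sum (fun u _ => Nat.zero_le (B u).length) (mem_univ v)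
      rw [List.length_cons] at h4
      show ∑ u, (B u).length - (B v).length < ∑ u, (B u).length - (B u).length
      omega⟩
    hprim hat hvec
    (fun e he => by
      cases h : tr e with
      | node k' ts' =>
        have h1 := htr e
        rw [h] at h1
        obtain ⟨v, hv⟩ := hBsurj _ _ _ h1
        exact absurd (he.symm.trans ((htail e v).2 hv.symm)) nofun
      | leg n ε w' =>
        have h1 := hvec e
        rw [h, vec, ← smul_smul] at h1
        have h2 : IsPrim ((ε : ℤ) • ((1, -3 * n) : ℤ²)) := by
          rcases Int.units_eq_one_or ε with rfl | rfl <;> simp [IsPrim]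
        show ∃ n' ε', leg n ε w' = leg n' ε' (wt e)
        rw [(eq_of_prim (hprim e) h2 (hwt e) h1.symm).1]
        exact ⟨n, ε, rfl⟩)
    o
    (fun e v he => by
      rw [htrv e v he]
      exact node_congr (hcard v).symm fun i i' hi => by
        rw [← hφtr]
        exact congrArg (fun j => tr (φ v j)) (Fin.ext hi))
    (fun e v he e' he' => hglue e' e v he (by simpa [CurveData.inE] using he'))
  refine ⟨C, fun e he => ?_⟩
  have h1 := hC r ((hroot r).2 hr)
  rw [htrr r ((hroot r).2 hr)] at h1
  have h2 : pt r = p := (hat r).unique (htrr r ((hroot r).2 hr) ▸ hT)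
  have h3 : dir r = m := by
    have := hvec r
    rw [htrr r ((hroot r).2 hr), hw] at this
    exact (eq_of_prim (hprim r) hm (hwt r) this.symm).2
  rwa [h2, h3] at h1

end

section

open PTree

variable {τ : ZMod 3 → ℝ}

lemma finsum_mem_mul_ratCast {α : Type} {s : Set α} {f : α → ℚ} (h : {x | x ∈ s ∧ f x ≠ 0}.Finite)
    (a : ℂ) : ∑ᶠ x ∈ s, a * (f x : ℂ) = a * ((∑ᶠ x ∈ s, f x : ℚ) : ℂ) :=
  (((AddMonoidHom.mulLeft a).comp (Rat.castHom ℂ).toAddMonoidHom).map_finsum_mem' (s := s) (f := f)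
    h).symm

/-- The correspondence between tropical curves and the trees that describe them. -/
lemma curves_eq_trees (hτ : Interior τ) {Q : Set ℝ²} {m : ℤ²}
    (hm : IsPrim m) {w : ℕ} {𝒞 : Set (CurveClass τ)} (hfin : (treesIn τ Q ((w : ℤ) • m)).Finite)
    (hleg : ∀ T ∈ treesIn τ Q ((w : ℤ) • m), ∃ k ts, T = .node k ts)
    (h1 : ∀ C : TropicalCurve τ, C.cls ∈ 𝒞 → (∀ v, C.vertexMult τ v ≠ 0) →
      ∃ x ∈ Q, ∃ e, C.head e = none ∧ C.wt e = w ∧ C.Lift e x m)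
    (h2 : ∀ (C : TropicalCurve τ) e, ∀ x ∈ Q, C.head e = none → C.wt e = w → C.Lift e x m → C.cls ∈ 𝒞)
    (h3 : ∀ x ∈ Q, ∀ k, deckPow k x ∈ Q → deckPow k x = x) :
    {c | c ∈ 𝒞 ∧ c.mult ≠ 0}.Finite ∧ ∀ a : ℂ, ∑ᶠ c ∈ 𝒞, a * (c.mult : ℂ) =
      a * ∑ᶠ T ∈ treesIn τ Q ((w : ℤ) • m), (T.wtT : ℂ) := by
  have hcls : ∀ c : CurveClass τ, TropicalCurve.cls (Quotient.out c) = c := Quotient.out_eq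
  set R : Set (CurveClass τ) :=
    {c | c ∈ 𝒞 ∧ ∀ v, (Quotient.out c).vertexMult τ v ≠ 0} with hR
  have hmult : {c | c ∈ 𝒞 ∧ c.mult ≠ 0} ⊆ R := fun c hc =>
    ⟨hc.1, TropicalCurve.vertexMult_ne_zero_of_mult hc.2⟩
  choose! x hx e he hwt hlift using fun (c : CurveClass τ) (hc : c ∈ R) =>
    h1 (Quotient.out c) ((hcls c).symm ▸ hc.1) hc.2
  set F : CurveClass τ → Set PTree := fun c => TropicalCurve.trees (Quotient.out c) (x c) m
  have hF : ∀ c ∈ R, (F c).Finite ∧ (F c).Nonempty ∧ ∑ᶠ T ∈ F c, T.wtT = c.mult := fun c hc =>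
    TropicalCurve.trees_weight hτ hc.2 hm fun e' he' => by
      rw [(Quotient.out c).root.unique he' (he c hc)]
      exact hlift c hc
  have hFsub : ∀ c ∈ R, F c ⊆ treesIn τ Q ((w : ℤ) • m) := fun c hc T hT => by
    obtain ⟨h4, h5, -⟩ := TropicalCurve.trees_realized hT (he c hc)
    exact ⟨⟨_, hx c hc, h4⟩, by rw [h5, hwt c hc]⟩
  have hdisj : ∀ c ∈ R, ∀ c' ∈ R, ∀ T, T ∈ F c → T ∈ F c' → c = c' := fun c _ c' _ T h4 h5 => by
    rw [← hcls c, ← hcls c']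
    exact Quotient.sound (TropicalCurve.iso_of_trees h4 h5)
  have hcover : ∀ T ∈ treesIn τ Q ((w : ℤ) • m), T.wtT ≠ 0 → ∃ c ∈ R, T ∈ F c := by
    intro T hT hT0
    obtain ⟨k, ts, rfl⟩ := hleg T hT
    obtain ⟨⟨q, hq, h4⟩, h5⟩ := hT
    obtain ⟨C, hC⟩ := exists_curve hτ h4 hm h5
    have hiso : C.toCurveData.Iso (Quotient.out C.cls).toCurveData :=
      Quotient.exact (s := curveSetoid τ) (hcls C.cls).symm
    obtain ⟨r, hr, -⟩ := C.root
    have h6 := TropicalCurve.trees_of_iso hiso (hC r hr)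
    obtain ⟨-, h7, h8, -⟩ := TropicalCurve.trees_realized (hC r hr) hr
    have h9 := (eq_of_prim hm hm (C.wt_pos r) (h7.symm.trans h5)).1
    have hc : C.cls ∈ R := ⟨h2 C r q hq hr h9 h8, TropicalCurve.trees_vertexMult hτ h6 hT0⟩
    obtain ⟨-, -, h10, -⟩ := TropicalCurve.trees_realized h6 (he _ hc)
    obtain ⟨j, -, h11⟩ := TropicalCurve.lift_unique _ h10 (hlift _ hc)
    have h12 := h3 q hq j (h11 ▸ hx _ hc)
    refine ⟨_, hc, ?_⟩
    rwa [h12.symm.trans h11.symm] at h6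
  have hRfin : R.Finite := by
    choose! t ht using fun c (hc : c ∈ R) => (hF c hc).2.1
    exact Set.Finite.of_injOn (fun c hc => hFsub c hc (ht c hc))
      (fun c hc c' hc' h => hdisj c hc c' hc' _ (ht c hc) (h ▸ ht c' hc')) hfin
  refine ⟨hRfin.subset hmult, fun a => ?_⟩
  have h4 : ∑ᶠ c ∈ 𝒞, c.mult = ∑ᶠ T ∈ treesIn τ Q ((w : ℤ) • m), T.wtT := by
    rw [finsum_mem_inter_support_eq' _ 𝒞 R fun c hc => ⟨fun h => hmult ⟨h, hc⟩, fun h => h.1⟩,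
      ← finsum_mem_congr rfl fun c hc => (hF c hc).2.2, ← finsum_mem_biUnion
      (fun c hc c' hc' hne => Set.disjoint_left.2 fun T h h' => hne (hdisj c hc c' hc' T h h')) hRfin
      fun c hc => (hF c hc).1]
    refine finsum_mem_inter_support_eq' _ _ _ fun T hT => ?_
    rw [Set.mem_iUnion₂]
    exact ⟨fun ⟨c, hc, h⟩ => hFsub c hc h, fun h => by
      obtain ⟨c, hc, h⟩ := hcover T h hT
      exact ⟨c, hc, h⟩⟩
  have h5 := finsum_mem_mul_ratCast (s := treesIn τ Q ((w : ℤ) • m)) (f := wtT)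
    (hfin.subset fun T h => h.1) 1
  simp only [one_mul] at h5
  rw [finsum_mem_mul_ratCast (hRfin.subset hmult) a, h4, h5]

namespace TropicalCurve

lemma exists_lift (C : TropicalCurve τ) (hτ : Interior τ)
    (hC : ∀ v, C.vertexMult τ v ≠ 0) {e : Fin C.nE} {p : ℝ²} {m : ℤ²} {a b : ℝ} (hab : a < b)
    (hd : ∀ r ∈ Set.Ioo a b, r ∈ C.dom e)
    (h : ∀ r ∈ Set.Ioo a b, ∃ h : p + r • vecR m ∈ outer, C.path e r = ofOuter ⟨_, h⟩) :
    C.Lift e p m := by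
  obtain ⟨-, x', m', -, -, -, hl, -⟩ := C.exists_hasTree hτ hC e
  obtain ⟨k, rfl, rfl⟩ := affine_match (x := x') (y := p) (m := m') (m' := m) hab fun r hr => by
    obtain ⟨h1, h2⟩ := h r hr
    refine (outPt_eq_iff (hl r (hd r hr)).1 h1).1 ?_
    rw [← (hl r (hd r hr)).2, h2, outPt_eq]
  exact hl.deckPow k

end TropicalCurve

lemma exists_iso_of_cls {C C' : TropicalCurve τ} (h : C'.cls = C.cls) :
    ∃ f g, TropicalCurve.IsIso C' C f g :=
  Quotient.exact (s := curveSetoid τ) h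

lemma curvesAt (hτ : Interior τ) {p : ℝ²} (hp : p ∉ singSet τ) {m : ℤ²}
    (hm : IsPrim m) (w : ℕ) : (treesIn τ {p} ((w : ℤ) • m)).Finite ∧
      {c | c ∈ tropCurvesAt τ p m w ∧ c.mult ≠ 0}.Finite ∧
      ∀ a : ℂ, ∑ᶠ c ∈ tropCurvesAt τ p m w, a * (c.mult : ℂ) =
        a * ∑ᶠ T ∈ treesIn τ {p} ((w : ℤ) • m), (T.wtT : ℂ) := by
  have hleg : ∀ T ∈ treesIn τ {p} ((w : ℤ) • m), ∃ k ts, T = .node k ts := by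
    rintro (⟨n, ε, w'⟩ | ⟨k, ts⟩) ⟨⟨q, rfl, h⟩, -⟩
    · exact absurd ⟨n, h.1.symm⟩ hp
    · exact ⟨k, ts, rfl⟩
  have hfin : (treesIn τ {p} ((w : ℤ) • m)).Finite := by
    refine (finite_at hτ p ⌈alpha (dheight p) ((w : ℤ) • m)⌉₊).subset fun T hT => ?_
    obtain ⟨k, ts, rfl⟩ := hleg T hT
    obtain ⟨⟨q, rfl, h⟩, h1⟩ := hT
    refine ⟨h, ?_⟩
    have h2 := h.alpha_ge hτ
    rw [h1] at h2
    have h3 := Nat.le_ceil (alpha (dheight q) ((w : ℤ) • m))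
    have h4 : (0 : ℝ) ≤ ((node k ts).lw : ℝ) := Nat.cast_nonneg _
    have h5 : ((node k ts).lw : ℝ) ≤ (⌈alpha (dheight q) ((w : ℤ) • m)⌉₊ : ℝ) := by linarith
    exact_mod_cast h5
  refine ⟨hfin, curves_eq_trees hτ hm hfin hleg (fun C hC hv => ⟨p, rfl, ?_⟩) ?_ ?_⟩
  · obtain ⟨C', h1, e', h2, h3, h4⟩ := hC
    obtain ⟨f, g, hi⟩ := exists_iso_of_cls h1
    obtain ⟨i1, i2, i3, i4, i5⟩ := hi e'
    refine ⟨g e', by rw [i2, h2]; rfl, by rw [i3, h3], ?_⟩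
    obtain ⟨δ, hδ, hd⟩ := C.exists_pos_dom (g e')
    obtain ⟨ε, hε, h5⟩ := eventually_iff.1 h4
    refine C.exists_lift hτ hv (lt_min hδ hε)
      (fun r hr => hd r hr.1.le (hr.2.trans_le (min_le_left _ _))) fun r hr => ?_
    obtain ⟨h6, h7⟩ := h5 r (by rw [sub_zero, abs_of_pos hr.1]; exact hr.2.trans_le (min_le_right _ _))
      hr.1.le
    exact ⟨h6, (i5 (i4 ▸ hd r hr.1.le (hr.2.trans_le (min_le_left _ _)))).trans h7⟩
  · rintro C e x rfl he hw hl
    refine ⟨C, rfl, e, he, hw, ?_⟩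
    filter_upwards [self_mem_nhdsWithin] with r hr
    obtain ⟨h1, h2⟩ := hl r (C.mem_dom.2 ⟨hr, .inl he⟩)
    exact ⟨h1, h2.trans (outPt_eq h1)⟩
  · rintro x rfl k h
    exact h

/-- A fundamental domain for the deck transformations. -/
abbrev strip (x₀ : ℝ) : Set ℝ² := {q | q.1 ∈ Set.Ico x₀ (x₀ + 3)}

lemma curvesUp (hτ : Interior τ) (x₀ : ℝ) (w : ℕ) :
    (treesIn τ (strip x₀) ((w : ℤ) • (0, 1))).Finite ∧
    ∀ d, w = 3 * d → {c | c ∈ tropCurves τ d ∧ c.mult ≠ 0}.Finite ∧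
      ∀ a : ℂ, ∑ᶠ c ∈ tropCurves τ d, a * (c.mult : ℂ) =
        a * ∑ᶠ T ∈ treesIn τ (strip x₀) ((w : ℤ) • (0, 1)), (T.wtT : ℂ) := by
  have hvec : ∀ r : ℝ, r • vecR (0, 1) = (0, r) := fun r => by ext <;> simp [vecR]
  have hleg : ∀ T ∈ treesIn τ (strip x₀) ((w : ℤ) • (0, 1)),
      ∃ k ts, T = .node k ts := by
    rintro (⟨n, ε, w'⟩ | ⟨k, ts⟩) ⟨⟨q, -, h⟩, h1⟩
    · have h2 := congrArg Prod.fst h1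
      simp [vec, h.2.ne'] at h2
    · exact ⟨k, ts, rfl⟩
  have hfin : (treesIn τ (strip x₀) ((w : ℤ) • (0, 1))).Finite := by
    refine (finite_proper _ (finite_int_near x₀ (w + 3)) w).subset fun T hT => ?_
    obtain ⟨k, ts, rfl⟩ := hleg T hT
    obtain ⟨⟨q, hq, h⟩, h1⟩ := hT
    have h0 : alpha (dheight q) ((w : ℤ) • (0, 1)) = w := by simp [alpha, dheight]
    have h2 := h.alpha_ge hτ
    have h3 := h.legs_bound_alpha hτ
    rw [h1, h0] at h2 h3
    refine ⟨h.proper, ?_, fun n hn => ?_⟩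
    · have h4 : (0 : ℝ) ≤ ((node k ts).lw : ℝ) := Nat.cast_nonneg _
      have h5 : ((node k ts).lw : ℝ) ≤ w := by linarith
      exact_mod_cast h5
    · have h4 := h3 n hn
      have h5 := abs_nonneg ((n : ℝ) + 1 / 2 - q.1)
      have h6 := abs_le.1 (show |(n : ℝ) + 1 / 2 - q.1| ≤ w by linarith)
      have hq' : x₀ ≤ q.1 ∧ q.1 < x₀ + 3 := hq
      have hw : (0 : ℝ) ≤ w := Nat.cast_nonneg _
      show |(n : ℝ) + 1 / 2 - x₀| ≤ w + 3
      rw [abs_le]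
      constructor <;> linarith [hq'.1, hq'.2, h6.1, h6.2]
  refine ⟨hfin, fun d hd => curves_eq_trees hτ (by simp [IsPrim]) hfin hleg (fun C hC hv => ?_) ?_ ?_⟩
  · obtain ⟨C', h1, e', h2, h3, q, h4⟩ := hC
    obtain ⟨f, g, hi⟩ := exists_iso_of_cls h1
    obtain ⟨i1, i2, i3, i4, i5⟩ := hi e'
    have he : C.head (g e') = none := by rw [i2, h2]; rfl
    obtain ⟨b, hb⟩ := Filter.eventually_atTop.1 h4
    have hdom : ∀ r ∈ Set.Ioo (max 0 b) (max 0 b + 1), r ∈ C.dom (g e') := fun r hr =>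
      C.mem_dom.2 ⟨(le_max_left _ _).trans hr.1.le, .inl he⟩
    have hl : C.Lift (g e') q (0, 1) := C.exists_lift hτ hv (lt_add_one (max 0 b))
      hdom fun r hr => by
        obtain ⟨h6, h7⟩ := hb r ((le_max_right _ _).trans hr.1.le)
        rw [← hvec] at h6
        refine ⟨h6, (i5 (i4 ▸ hdom r hr)).trans (h7.trans ?_)⟩
        simp only [hvec]
    obtain ⟨j, hj, -⟩ := existsUnique_add_zsmul_mem_Ico (by norm_num : (0 : ℝ) < 3) q.1 x₀
    refine ⟨deckPow j q, ?_, g e', he, by rw [i3, h3, hd], ?_⟩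
    · rw [zsmul_eq_mul, mul_comm] at hj
      exact hj
    · have := hl.deckPow j
      rwa [show shear j (0, 1) = (0, 1) by ext <;> simp [shear]] at this
  · rintro C e x - he hw hl
    refine ⟨C, rfl, e, he, hw.trans hd, x, ?_⟩
    filter_upwards [Filter.eventually_ge_atTop 0] with r hr
    obtain ⟨h1, h2⟩ := hl r (C.mem_dom.2 ⟨hr, .inl he⟩)
    rw [hvec] at h1 h2
    exact ⟨h1, h2.trans (outPt_eq h1)⟩
  · intro x hx k hk
    have h1 : x.1 + 3 * k < x₀ + 3 := hk.2
    have h2 : x₀ ≤ x.1 + 3 * k := hk.1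
    have h3 : (k : ℝ) < 1 := by linarith [hx.1]
    have h4 : (-1 : ℝ) < k := by linarith [hx.2]
    have h5 : k < 1 := mod_cast h3
    have h6 : -1 < k := mod_cast h4
    obtain rfl : k = 0 := by omega
    exact deckPow_zero x

end

end

end Scat

open Scat

theorem proposition3 (τ : ZMod 3 → ℝ) (hτ : ∀ i, τ i ∈ Set.Ioo (0 : ℝ) 1) (x₀ : ℝ) :
    -- the product that defines `f_out` and the sums over tropical curves are finite in each degree
    (∀ N : ℕ, {r | r ∈ upwardRays τ x₀ ∧ r.wt ≤ N}.Finite) ∧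
    (∀ d : ℕ, 1 ≤ d → {c | c ∈ tropCurves τ d ∧ c.mult ≠ 0}.Finite) ∧
    -- the logarithm of `f_out` at `t = 1`
    PowerSeries.logOf (fOut τ x₀) =
      PowerSeries.mk (fun n => ∑ d ∈ Finset.Icc 1 n,
        if n = 3 * d then ∑ᶠ c ∈ tropCurves τ d, 3 * (d : ℂ) * (c.mult : ℂ) else 0) ∧
    -- the same with the variable `t` that records the order in `y`
    PowerSeries.logOf (PowerSeries.rescale (Polynomial.X : Polynomial ℂ)
        (PowerSeries.map Polynomial.C (fOut τ x₀))) =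
      PowerSeries.mk (fun n => ∑ d ∈ Finset.Icc 1 n,
        if n = 3 * d then
          Polynomial.C (∑ᶠ c ∈ tropCurves τ d, 3 * (d : ℂ) * (c.mult : ℂ)) *
            Polynomial.X ^ (3 * d)
        else 0) ∧
    -- the correspondence for the rays with given base and direction
    (∀ p ∉ singSet τ, ∀ m : ℤ × ℤ, IsPrim m →
      (∀ N : ℕ, {r | r ∈ raysAt τ p m ∧ r.wt ≤ N}.Finite) ∧
      (∀ w : ℕ, 1 ≤ w → {c | c ∈ tropCurvesAt τ p m w ∧ c.mult ≠ 0}.Finite) ∧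
      PowerSeries.logOf (rayProd (raysAt τ p m)) =
        PowerSeries.mk (fun w => ∑ᶠ c ∈ tropCurvesAt τ p m w, (w : ℂ) * (c.mult : ℂ))) := by
  have hprim : IsPrim (0, 1) := by simp [IsPrim]
  have hup : upwardRays τ x₀ = raysIn τ {q | q.1 ∈ Set.Ico x₀ (x₀ + 3)} (0, 1) := by
    ext d
    exact and_congr_right fun _ => and_comm
  have hfin := fun w => (curvesUp hτ x₀ w).1
  have hcoeff : ∀ n, PowerSeries.coeff n (PowerSeries.logOf (fOut τ x₀)) = ∑ d ∈ Finset.Icc 1 n,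
      if n = 3 * d then ∑ᶠ c ∈ tropCurves τ d, 3 * (d : ℂ) * (c.mult : ℂ) else 0 := by
    intro n
    rw [fOut, hup, logOf_raysIn hτ hprim hfin, PowerSeries.coeff_mk]
    by_cases h : ∃ d ∈ Finset.Icc 1 n, n = 3 * d
    · obtain ⟨d, hd, rfl⟩ := h
      rw [Finset.sum_eq_single_of_mem d hd fun d' _ hne => if_neg (by omega), if_pos rfl,
        ((curvesUp hτ x₀ (3 * d)).2 d rfl).2]
      push_cast
      rfl
    · rw [Finset.sum_eq_zero fun d hd => if_neg fun h' => h ⟨d, hd, h'⟩]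
      rcases Nat.eq_zero_or_pos n with rfl | hn
      · simp
      · rw [finsum_mem_congr (t := ∅) (g := fun _ => 0) (Set.eq_empty_iff_forall_notMem.2 ?_) nofun,
          finsum_mem_empty, mul_zero]
        rintro T ⟨-, hT⟩
        have h1 := T.three_dvd_vec_snd
        rw [hT] at h1
        have h2 : (3 : ℤ) ∣ n := by simpa using h1
        obtain ⟨d, rfl⟩ := Int.natCast_dvd_natCast.1 (by exact_mod_cast h2 : ((3 : ℕ) : ℤ) ∣ n)
        exact h ⟨d, Finset.mem_Icc.2 ⟨by omega, by omega⟩, rfl⟩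
  have hconst : PowerSeries.constantCoeff (fOut τ x₀) = 1 := by
    rw [fOut, hup]; exact constantCoeff_rayProd (raysIn_wt_pos hτ)
  refine ⟨fun N => ?_, fun d _ => ((curvesUp hτ x₀ (3 * d)).2 d rfl).1, ?_, ?_, fun p hp m hm => ?_⟩
  · rw [hup]; exact finite_raysIn hτ hprim hfin N
  · ext n
    rw [hcoeff, PowerSeries.coeff_mk]
  · rw [logOf_rescale _ (by simp [← PowerSeries.coeff_zero_eq_constantCoeff_apply, hconst]),
      logOf_map _ hconst]
    ext1 n
    rw [PowerSeries.coeff_rescale, PowerSeries.coeff_map, hcoeff, PowerSeries.coeff_mk, map_sum,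
      Finset.mul_sum]
    refine Finset.sum_congr rfl fun d _ => ?_
    split_ifs with h
    · rw [h, mul_comm]
    · simp
  · have hray : raysAt τ p m = raysIn τ {p} m := rfl
    have hfin' := fun w => (curvesAt hτ hp hm w).1
    refine ⟨fun N => hray ▸ finite_raysIn hτ hm hfin' N, fun w _ => (curvesAt hτ hp hm w).2.1, ?_⟩
    rw [hray, logOf_raysIn hτ hm hfin']
    ext w
    rw [PowerSeries.coeff_mk, PowerSeries.coeff_mk, (curvesAt hτ hp hm w).2.2]
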